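/- **Setting.** Let $\mathcal V$ be a braided monoidal category with braiding $\beta$ and unit object $\top$ which is monoidally complete: $\mathcal V$ is complete and, for every object $b$, the functors $b\otimes-$ and $-\otimes b$ preserve limits. An object $x$ of a monoidal category has a left dual ${}^*x$ if there are maps $\top\to x\otimes{}^*x$ and ${}^*x\otimes x\to\top$ satisfying the triangle identities. Assume that the full subcategory of $\mathcal V$ on the objects with left duals is essentially small. **Functors into $\mathcal V$.** A separable Frobenius functor $F$ between monoidal categories is a functor with a monoidal structure $\varphi_{a,b}\colon Fa\otimes Fb\to F(a\otimes b)$, $\varphi_0\colon\top\to F\top$ and a comonoidal structure $\psi_{a,b}\colon F(a\otimes b)\to Fa\otimes Fb$, $\psi_0\colon F\top\to\top$ such that (up to associativity) $(1\otimes\varphi_{b,c})(\psi_{a,b}\otimes1)=\psi_{a,b\otimes c}\varphi_{a\otimes b,c}$, $(\varphi_{a,b}\otimes1)(1\otimes\psi_{b,c})=\psi_{a\otimes b,c}\varphi_{a,b\otimes c}$ and $\varphi_{a,b}\psi_{a,b}=1$. It is strong if also $\psi_{a,b}\varphi_{a,b}=1$, $\varphi_0\psi_0=1$ and $\psi_0\varphi_0=1$.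 The objects of $\mathbf{sfmon}/\!\!/\mathcal V$ are the separable Frobenius functors $F\colon A\to\mathcal V$ of reconstruction type, that is, with $A$ an essentially small monoidal category and every $Fa$ having a left dual; a morphism from $F\colon A\to\mathcal V$ to $G\colon C\to\mathcal V$ is a separable Frobenius functor $H\colon A\to C$ with $GH=F$ as separable Frobenius functors. $\mathbf{strmon}/\!\!/\mathcal V$ is the subcategory of strong functors $F$ and strong $H$. $\mathbf{sfmon}^*/\!\!/\mathcal V$ and $\mathbf{strmon}^*/\!\!/\mathcal V$ are the full subcategories of those $F$ whose domain has left duals. **Weak bialgebras.** (Elements $h,k,\dots$ and Sweedler notation abbreviate maps of $\mathcal V$.) A weak bialgebra in $\mathcal V$ is an object $H$ with an algebra structure and a coalgebra structure such that $\Delta(hk)=\Delta(h)\Delta(k)$, where the product on $H\otimes H$ is formed with $\beta$, and $$1_1\otimes1_21'_1\otimes1'_2=1_1\otimes1_2\otimes1_3=1_1\otimes1'_11_2\otimes1'_2,\qquad \epsilon(ab_1)\epsilon(b_2c)=\epsilon(abc)=\epsilon(ab_2)\epsilon(b_1c),$$ where the crossings in the last expression on each side are $\beta^{-1}$. Its four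 canonical idempotents are $s(h)=1_1\epsilon(1_2h)$, $t(h)=\epsilon(1_1h)1_2$, $z(h)=\epsilon(h1_1)1_2$, $r(h)=1_1\epsilon(h1_2)$, with the crossings in $t$ and $r$ being $\beta$. A weak Hopf algebra is a weak bialgebra with a map $S\colon H\to H$ such that, for convolution $\star$, $S\star\mathrm{id}=r$, $\mathrm{id}\star S=t$ and $S\star\mathrm{id}\star S=S$. A weak morphism $f\colon H\to J$ of weak bialgebras is an algebra morphism which commutes with the four canonical idempotents and satisfies $\Delta(1)\cdot(f\otimes f)\Delta(h)=\Delta(f(h))=(f\otimes f)\Delta(h)\cdot\Delta(1)$ in $J\otimes J$. Write $\mathbf{wba}\,\mathcal V$ and $\mathbf{wha}\,\mathcal V$ for the categories of weak bialgebras and of weak Hopf algebras with weak morphisms of (underlying) weak bialgebras, and $\mathbf{ba}\,\mathcal V$, $\mathbf{ha}\,\mathcal V$ for the categories of bialgebras and of Hopf algebras with maps that strictly preserve the algebra and coalgebra structures. There are inclusions $\mathbf{ba}\,\mathcal V\to\mathbf{wba}\,\mathcal V$ and $\mathbf{ha}\,\mathcal V\to\mathbf{wha}\,\mathcal V$. **The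 Tannaka construction.** For $F$ in $\mathbf{sfmon}/\!\!/\mathcal V$, $\tan F=\int_{a\in A}Fa\otimes{}^*(Fa)$; its projections correspond to canonical actions $\tan F\otimes Fa\to Fa$, written $h\cdot x$. It is the weak bialgebra determined by $(hk)\cdot x=h\cdot(k\cdot x)$, $1\cdot x=x$, $\Delta(h)\cdot(x\otimes y)=\psi(h\cdot\varphi(x\otimes y))$ and $\epsilon(h)=\psi_0(h\cdot\varphi_0)$, where $H\otimes H$ acts on $Fa\otimes Fb$ by means of $\beta$. A morphism $H\colon F\to G$ is sent to the map $\tan G\to\tan F$ that corresponds to the canonical actions of $\tan G$ on $GHa=Fa$. **Representations.** For a weak bialgebra $H$, $\mathrm{mod}\,H$ is the forgetful functor $U\colon H\text{-}\mathrm{mod}\to\mathcal V$, where $H\text{-}\mathrm{mod}$ is the category of left $H$-modules whose underlying object has a left dual in $\mathcal V$. The tensor product of modules $a,b$ is a splitting of the idempotent $\nabla$ on $Ua\otimes Ub$ given by the action of $\Delta(1)$, with $H$ acting through $\Delta$; the unit object is a splitting of $t\colon H\to H$, with action induced by $t\circ\mu$; the binary structure maps of $U$ are those of the splittings of $\nabla$,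 and $\varphi_0$, $\psi_0$ are induced by the unit and the counit of $H$. A weak morphism $f\colon H\to J$ is sent to restriction of scalars $J\text{-}\mathrm{mod}\to H\text{-}\mathrm{mod}$, with the separable Frobenius structure that makes it a morphism over $\mathcal V$. **Proposition.** These constructions are well defined (for suitable choices of ends and splittings) and give functors $\tan\colon\mathbf{sfmon}/\!\!/\mathcal V\to(\mathbf{wba}\,\mathcal V)^{\mathrm{op}}$ and $\mathrm{mod}\colon(\mathbf{wba}\,\mathcal V)^{\mathrm{op}}\to\mathbf{sfmon}/\!\!/\mathcal V$ with $$\tan\dashv\mathrm{mod}.$$ The unit at $F$ sends $a$ to $Fa$ with the canonical action of $\tan F$, and the counit at $H$ is the map $H\to\tan U$ that corresponds to the actions of $H$ on its modules. Moreover there are adjunctions $$\mathbf{sfmon}^*/\!\!/\mathcal V\rightleftarrows(\mathbf{wha}\,\mathcal V)^{\mathrm{op}},\qquad \mathbf{strmon}/\!\!/\mathcal V\rightleftarrows(\mathbf{ba}\,\mathcal V)^{\mathrm{op}},\qquad \mathbf{strmon}^*/\!\!/\mathcal V\rightleftarrows(\mathbf{ha}\,\mathcal V)^{\mathrm{op}}$$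 (left adjoints from left to right), such that the four adjunctions form a commutative square: along the inclusion and forgetful functors $\mathbf{sfmon}^*/\!\!/\mathcal V\to\mathbf{sfmon}/\!\!/\mathcal V$ and $\mathbf{wha}\,\mathcal V\to\mathbf{wba}\,\mathcal V$; $\mathbf{strmon}/\!\!/\mathcal V\to\mathbf{sfmon}/\!\!/\mathcal V$ and $\mathbf{ba}\,\mathcal V\to\mathbf{wba}\,\mathcal V$; $\mathbf{strmon}^*/\!\!/\mathcal V\to\mathbf{strmon}/\!\!/\mathcal V$ and $\mathbf{ha}\,\mathcal V\to\mathbf{ba}\,\mathcal V$; $\mathbf{strmon}^*/\!\!/\mathcal V\to\mathbf{sfmon}^*/\!\!/\mathcal V$ and $\mathbf{ha}\,\mathcal V\to\mathbf{wha}\,\mathcal V$, both the left and the right adjoints commute and the units correspond; and the two squares formed by these inclusion and forgetful functors commute. -/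

import Mathlib

open CategoryTheory MonoidalCategory BraidedCategory Opposite Limits

universe v u v₁ u₁ v₂ u₂ v₃ u₃ v₄ u₄

noncomputable section

set_option linter.unusedSectionVars false

namespace Tannaka

/-! ### Weak bialgebras and weak Hopf algebras -/

section Algebra

open scoped MonObj ComonObj

variable {V : Type u} [Category.{v} V] [MonoidalCategory V] [BraidedCategory V]

/-- The product `x ⋆ y` of two maps into the tensor square of an algebra `M`
(`x₁y₁ ⊗ x₂y₂`, where `x₂` is braided past `y₁`). -/
def sqMul {X Y : V} (M : V) [MonObj M] (x : X ⟶ M ⊗ M) (y : Y ⟶ M ⊗ M) : X ⊗ Y ⟶ M ⊗ M :=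
  (x ⊗ₘ y) ≫ tensorμ M M M M ≫ (μ[M] ⊗ₘ μ[M])

/-- `(a ⊗ b) ⊗ (c ⊗ d) ↦ a ⊗ (m(b, c) ⊗ d)`. -/
def mulMiddle {M : V} (m : M ⊗ M ⟶ M) : (M ⊗ M) ⊗ (M ⊗ M) ⟶ M ⊗ (M ⊗ M) :=
  (α_ M M (M ⊗ M)).hom ≫ M ◁ ((α_ M M M).inv ≫ m ▷ M)

/-- `(a ⊗ b) ⊗ c ↦ (a ⊗ d(b)₁) ⊗ (d(b)₂ ⊗ c)`. -/
def comulMiddle {M : V} (d : M ⟶ M ⊗ M) : (M ⊗ M) ⊗ M ⟶ (M ⊗ M) ⊗ (M ⊗ M) :=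
  ((M ◁ d) ≫ (α_ M M M).inv) ▷ M ≫ (α_ (M ⊗ M) M M).hom

/-- A weak bialgebra in a braided monoidal category: an algebra and a coalgebra such that
`Δ(ab) = Δ(a)Δ(b)`,
`1₁ ⊗ 1₂1'₁ ⊗ 1'₂ = 1₁ ⊗ 1₂ ⊗ 1₃ = 1₁ ⊗ 1'₁1₂ ⊗ 1'₂` and
`ε(ab₁)ε(b₂c) = ε(abc) = ε(ab₂)ε(b₁c)`,
where the crossings in the last two lines are inverse to those in the first one. -/
class WeakBimonObj (M : V) extends MonObj M, ComonObj M where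
  mul_comul : μ[M] ≫ Δ[M] = (Δ[M] ⊗ₘ Δ[M]) ≫ tensorμ M M M M ≫ (μ[M] ⊗ₘ μ[M])
  weak_unit : (λ_ (𝟙_ V)).inv ≫ ((η[M] ≫ Δ[M]) ⊗ₘ (η[M] ≫ Δ[M])) ≫ mulMiddle μ[M] =
    η[M] ≫ Δ[M] ≫ M ◁ Δ[M]
  weak_unit' : (λ_ (𝟙_ V)).inv ≫ ((η[M] ≫ Δ[M]) ⊗ₘ (η[M] ≫ Δ[M])) ≫
      mulMiddle ((β_ M M).inv ≫ μ[M]) =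
    η[M] ≫ Δ[M] ≫ M ◁ Δ[M]
  weak_counit : comulMiddle Δ[M] ≫ ((μ[M] ≫ ε[M]) ⊗ₘ (μ[M] ≫ ε[M])) ≫ (λ_ (𝟙_ V)).hom =
    μ[M] ▷ M ≫ μ[M] ≫ ε[M]
  weak_counit' : comulMiddle (Δ[M] ≫ (β_ M M).inv) ≫
      ((μ[M] ≫ ε[M]) ⊗ₘ (μ[M] ≫ ε[M])) ≫ (λ_ (𝟙_ V)).hom =
    μ[M] ▷ M ≫ μ[M] ≫ ε[M]

section Idempotents

variable (M : V) [MonObj M] [ComonObj M]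

/-- The canonical idempotent `h ↦ 1₁ ε(1₂ h)`. -/
def idemS : M ⟶ M :=
  (λ_ M).inv ≫ (η[M] ≫ Δ[M]) ▷ M ≫ (α_ M M M).hom ≫ M ◁ (μ[M] ≫ ε[M]) ≫ (ρ_ M).hom

/-- The canonical idempotent `h ↦ ε(1₁ h) 1₂`. -/
def idemT : M ⟶ M :=
  (λ_ M).inv ≫ (η[M] ≫ Δ[M]) ▷ M ≫ (α_ M M M).hom ≫ M ◁ (β_ M M).hom ≫ (α_ M M M).inv ≫
    (μ[M] ≫ ε[M]) ▷ M ≫ (λ_ M).hom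

/-- The canonical idempotent `h ↦ ε(h 1₁) 1₂`. -/
def idemZ : M ⟶ M :=
  (ρ_ M).inv ≫ M ◁ (η[M] ≫ Δ[M]) ≫ (α_ M M M).inv ≫ (μ[M] ≫ ε[M]) ▷ M ≫ (λ_ M).hom

/-- The canonical idempotent `h ↦ 1₁ ε(h 1₂)`. -/
def idemR : M ⟶ M :=
  (ρ_ M).inv ≫ M ◁ (η[M] ≫ Δ[M]) ≫ (α_ M M M).inv ≫ (β_ M M).hom ▷ M ≫ (α_ M M M).hom ≫
    M ◁ (μ[M] ≫ ε[M]) ≫ (ρ_ M).hom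

variable {M} in
/-- The convolution product of two endomorphisms. -/
def convMul (f g : M ⟶ M) : M ⟶ M := Δ[M] ≫ (f ⊗ₘ g) ≫ μ[M]

end Idempotents

/-- A weak Hopf algebra: a weak bialgebra with an antipode `S` such that
`S ⋆ id = r`, `id ⋆ S = t` and `S ⋆ id ⋆ S = S`. -/
class WeakHopfObj (M : V) extends WeakBimonObj M where
  antipode : M ⟶ M
  antipode_conv_id : convMul antipode (𝟙 M) = idemR M
  id_conv_antipode : convMul (𝟙 M) antipode = idemT M
  antipode_conv_id_conv_antipode : convMul (convMul antipode (𝟙 M)) antipode = antipode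

/-- Weak morphisms of weak bialgebras: they preserve multiplication and unit, commute with the
four canonical idempotents, and `(f ⊗ f)Δ(h) ⋆ Δ(1) = Δ(f(h)) = Δ(1) ⋆ (f ⊗ f)Δ(h)`. -/
class IsWeakHom {M N : V} [WeakBimonObj M] [WeakBimonObj N] (f : M ⟶ N) : Prop
    extends IsMonHom f where
  idemS_comm : idemS M ≫ f = f ≫ idemS N
  idemT_comm : idemT M ≫ f = f ≫ idemT N
  idemZ_comm : idemZ M ≫ f = f ≫ idemZ N
  idemR_comm : idemR M ≫ f = f ≫ idemR N
  comul_left : f ≫ Δ[N] = (λ_ M).inv ≫ sqMul N (η[N] ≫ Δ[N]) (Δ[M] ≫ (f ⊗ₘ f))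
  comul_right : f ≫ Δ[N] = (ρ_ M).inv ≫ sqMul N (Δ[M] ≫ (f ⊗ₘ f)) (η[N] ≫ Δ[N])

lemma sqMul_natural_left {X X' Y : V} {M : V} [MonObj M] (g : X' ⟶ X) (x : X ⟶ M ⊗ M)
    (y : Y ⟶ M ⊗ M) : sqMul M (g ≫ x) y = g ▷ Y ≫ sqMul M x y := by
  simp [sqMul, MonoidalCategory.tensorHom_def]

lemma sqMul_natural_right {X Y' Y : V} {M : V} [MonObj M] (g : Y' ⟶ Y) (x : X ⟶ M ⊗ M)
    (y : Y ⟶ M ⊗ M) : sqMul M x (g ≫ y) = X ◁ g ≫ sqMul M x y := by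
  simp [sqMul, MonoidalCategory.tensorHom_def']

lemma sqMul_assoc {X Y Z : V} {M : V} [MonObj M] (x : X ⟶ M ⊗ M) (y : Y ⟶ M ⊗ M)
    (z : Z ⟶ M ⊗ M) :
    sqMul M (sqMul M x y) z = (α_ X Y Z).hom ≫ sqMul M x (sqMul M y z) := by
  have h := MonObj.mul_assoc (M ⊗ M)
  have e : ∀ {A B : V} (a : A ⟶ M ⊗ M) (b : B ⟶ M ⊗ M),
      sqMul M a b = (a ⊗ₘ b) ≫ μ[M ⊗ M] := by
    intro A B a b; simp [sqMul, MonObj.tensorObj.mul_def]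
  simp only [e]
  calc _ = ((x ⊗ₘ y) ⊗ₘ z) ≫ μ[M ⊗ M] ▷ (M ⊗ M) ≫ μ[M ⊗ M] := by
        rw [← tensorHom_id, tensorHom_comp_tensorHom_assoc, Category.comp_id]
    _ = (α_ X Y Z).hom ≫ (x ⊗ₘ (y ⊗ₘ z)) ≫ (M ⊗ M) ◁ μ[M ⊗ M] ≫ μ[M ⊗ M] := by
        rw [h, associator_naturality_assoc]
    _ = _ := by rw [← id_tensorHom, tensorHom_comp_tensorHom_assoc, Category.comp_id]

lemma sqMul_map {X Y : V} {M N : V} [MonObj M] [MonObj N] (f : M ⟶ N) [IsMonHom f]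
    (x : X ⟶ M ⊗ M) (y : Y ⟶ M ⊗ M) :
    sqMul M x y ≫ (f ⊗ₘ f) = sqMul N (x ≫ (f ⊗ₘ f)) (y ≫ (f ⊗ₘ f)) := by
  simp only [sqMul, Category.assoc]
  rw [← tensorHom_comp_tensorHom, Category.assoc, tensorμ_natural_assoc, tensorHom_comp_tensorHom,
    tensorHom_comp_tensorHom, IsMonHom.mul_hom]

lemma WeakBimonObj.sqMul_comul {X Y : V} {M : V} [WeakBimonObj M] (x : X ⟶ M) (y : Y ⟶ M) :
    sqMul M (x ≫ Δ[M]) (y ≫ Δ[M]) = (x ⊗ₘ y) ≫ μ[M] ≫ Δ[M] := by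
  rw [WeakBimonObj.mul_comul]
  rw [sqMul, ← tensorHom_comp_tensorHom, Category.assoc]

lemma WeakBimonObj.one_sqMul {M : V} [WeakBimonObj M] :
    (λ_ M).inv ≫ sqMul M (η[M] ≫ Δ[M]) Δ[M] = Δ[M] := by
  have := WeakBimonObj.sqMul_comul η[M] (𝟙 M)
  rw [Category.id_comp] at this
  rw [this]; simp

lemma WeakBimonObj.sqMul_one {M : V} [WeakBimonObj M] :
    (ρ_ M).inv ≫ sqMul M Δ[M] (η[M] ≫ Δ[M]) = Δ[M] := by
  have := WeakBimonObj.sqMul_comul (𝟙 M) η[M]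
  rw [Category.id_comp] at this
  rw [this]; simp

instance (M : V) [WeakBimonObj M] : IsWeakHom (𝟙 M) where
  idemS_comm := by simp
  idemT_comm := by simp
  idemZ_comm := by simp
  idemR_comm := by simp
  comul_left := by simpa using WeakBimonObj.one_sqMul.symm
  comul_right := by simpa using WeakBimonObj.sqMul_one.symm

instance {M N P : V} [WeakBimonObj M] [WeakBimonObj N] [WeakBimonObj P] (f : M ⟶ N) (g : N ⟶ P)
    [IsWeakHom f] [IsWeakHom g] : IsWeakHom (f ≫ g) where
  idemS_comm := by
    rw [← Category.assoc, IsWeakHom.idemS_comm, Category.assoc, IsWeakHom.idemS_comm,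
      Category.assoc]
  idemT_comm := by
    rw [← Category.assoc, IsWeakHom.idemT_comm, Category.assoc, IsWeakHom.idemT_comm,
      Category.assoc]
  idemZ_comm := by
    rw [← Category.assoc, IsWeakHom.idemZ_comm, Category.assoc, IsWeakHom.idemZ_comm,
      Category.assoc]
  idemR_comm := by
    rw [← Category.assoc, IsWeakHom.idemR_comm, Category.assoc, IsWeakHom.idemR_comm,
      Category.assoc]
  comul_left := by
    have h1 : η[P] ≫ Δ[P] =
        (λ_ (𝟙_ V)).inv ≫ sqMul P (η[P] ≫ Δ[P]) ((η[N] ≫ Δ[N]) ≫ (g ⊗ₘ g)) := by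
      have := η[N] ≫= IsWeakHom.comul_left (f := g)
      rw [IsMonHom.one_hom_assoc] at this
      conv_lhs => rw [this]
      rw [Category.assoc, sqMul_natural_right η[N], leftUnitor_inv_naturality_assoc]
    rw [Category.assoc, IsWeakHom.comul_left (f := g), leftUnitor_inv_naturality_assoc,
      ← sqMul_natural_right, ← Category.assoc f, IsWeakHom.comul_left (f := f), Category.assoc,
      sqMul_map, sqMul_natural_right]
    conv_rhs => rw [h1, sqMul_natural_left, sqMul_assoc]
    simp [tensorHom_comp_tensorHom]
  comul_right := by
    have h1 : η[P] ≫ Δ[P] =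
        (ρ_ (𝟙_ V)).inv ≫ sqMul P ((η[N] ≫ Δ[N]) ≫ (g ⊗ₘ g)) (η[P] ≫ Δ[P]) := by
      have := η[N] ≫= IsWeakHom.comul_right (f := g)
      rw [IsMonHom.one_hom_assoc] at this
      conv_lhs => rw [this]
      rw [Category.assoc, sqMul_natural_left η[N], rightUnitor_inv_naturality_assoc]
    rw [Category.assoc, IsWeakHom.comul_right (f := g), rightUnitor_inv_naturality_assoc,
      ← sqMul_natural_left, ← Category.assoc f, IsWeakHom.comul_right (f := f), Category.assoc,
      sqMul_map, sqMul_natural_left, sqMul_assoc]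
    conv_rhs => rw [h1, sqMul_natural_right]
    simp [tensorHom_comp_tensorHom]

lemma one_one_braiding_inv (M : V) [MonObj M] :
    (η[M] ⊗ₘ η[M]) ≫ (β_ M M).inv ≫ μ[M] = (λ_ (𝟙_ V)).hom ≫ η[M] := by
  rw [braiding_inv_naturality_assoc]
  have : (η[M] ⊗ₘ η[M]) ≫ μ[M] = (λ_ (𝟙_ V)).hom ≫ η[M] := by
    simp [MonoidalCategory.tensorHom_def']
  rw [this]
  simp [unitors_equal]

lemma mulMiddle_one {M : V} [MonObj M] (m : M ⊗ M ⟶ M)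
    (hm : (η[M] ⊗ₘ η[M]) ≫ m = (λ_ (𝟙_ V)).hom ≫ η[M]) :
    ((η[M] ⊗ₘ η[M]) ⊗ₘ (η[M] ⊗ₘ η[M])) ≫ mulMiddle m =
      ((λ_ (𝟙_ V)).hom ⊗ₘ 𝟙 _) ≫ (η[M] ⊗ₘ (η[M] ⊗ₘ η[M])) := by
  rw [mulMiddle, associator_naturality_assoc, ← id_tensorHom, tensorHom_comp_tensorHom,
    associator_inv_naturality_assoc, ← tensorHom_id, tensorHom_comp_tensorHom, hm]
  have : ((λ_ (𝟙_ V)).hom ≫ η[M] ⊗ₘ η[M] ≫ 𝟙 M) =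
      ((λ_ (𝟙_ V)).hom ⊗ₘ 𝟙 _) ≫ (η[M] ⊗ₘ η[M]) := by
    rw [tensorHom_comp_tensorHom, Category.id_comp, Category.comp_id]
  rw [this]
  have h2 : (η[M] ≫ 𝟙 M ⊗ₘ (α_ (𝟙_ V) (𝟙_ V) (𝟙_ V)).inv ≫
      ((λ_ (𝟙_ V)).hom ⊗ₘ 𝟙 (𝟙_ V)) ≫ (η[M] ⊗ₘ η[M])) =
      (𝟙_ V ◁ ((α_ (𝟙_ V) (𝟙_ V) (𝟙_ V)).inv ≫ ((λ_ (𝟙_ V)).hom ⊗ₘ 𝟙 (𝟙_ V)))) ≫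
      (η[M] ⊗ₘ (η[M] ⊗ₘ η[M])) := by
    simp only [← id_tensorHom, tensorHom_comp_tensorHom, Category.id_comp, Category.comp_id,
      Category.assoc]
  rw [h2, ← Category.assoc]
  congr 1
  monoidal

lemma bimon_weak_unit {M : V} [BimonObj M] (m : M ⊗ M ⟶ M)
    (hm : (η[M] ⊗ₘ η[M]) ≫ m = (λ_ (𝟙_ V)).hom ≫ η[M]) :
    (λ_ (𝟙_ V)).inv ≫ ((η[M] ≫ Δ[M]) ⊗ₘ (η[M] ≫ Δ[M])) ≫ mulMiddle m =
    η[M] ≫ Δ[M] ≫ M ◁ Δ[M] := by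
  rw [Bimon.one_comul_assoc]
  simp only [Bimon.one_comul]
  rw [← tensorHom_comp_tensorHom, Category.assoc, mulMiddle_one m hm, ← id_tensorHom,
    tensorHom_comp_tensorHom η[M] η[M], Bimon.one_comul, Category.comp_id]
  have : (η[M] ⊗ₘ (λ_ (𝟙_ V)).inv ≫ (η[M] ⊗ₘ η[M])) =
     (𝟙 _ ⊗ₘ (λ_ (𝟙_ V)).inv) ≫ (η[M] ⊗ₘ (η[M] ⊗ₘ η[M])) := by
    rw [tensorHom_comp_tensorHom, Category.id_comp]
  rw [this]
  simp only [← Category.assoc]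
  congr 1
  monoidal

lemma comulMiddle_counit {M : V} [ComonObj M] (d : M ⟶ M ⊗ M)
    (hd : d ≫ (ε[M] ⊗ₘ ε[M]) = ε[M] ≫ (λ_ (𝟙_ V)).inv) :
    comulMiddle d ≫ ((ε[M] ⊗ₘ ε[M]) ⊗ₘ (ε[M] ⊗ₘ ε[M])) =
      ((ε[M] ⊗ₘ ε[M]) ⊗ₘ ε[M]) ≫ (𝟙 _ ⊗ₘ (λ_ (𝟙_ V)).inv) := by
  rw [comulMiddle, Category.assoc, ← associator_naturality, ← tensorHom_id,
    tensorHom_comp_tensorHom_assoc, Category.assoc, ← associator_inv_naturality, Category.id_comp,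
    ← id_tensorHom, tensorHom_comp_tensorHom_assoc, hd, Category.id_comp]
  have h2 : ((ε[M] ⊗ₘ ε[M] ≫ (λ_ (𝟙_ V)).inv) ≫ (α_ (𝟙_ V) (𝟙_ V) (𝟙_ V)).inv ⊗ₘ ε[M]) =
      ((ε[M] ⊗ₘ ε[M]) ⊗ₘ ε[M]) ≫
      ((𝟙 _ ⊗ₘ (λ_ (𝟙_ V)).inv) ≫ (α_ (𝟙_ V) (𝟙_ V) (𝟙_ V)).inv) ▷ 𝟙_ V := by
    simp only [← tensorHom_id, tensorHom_comp_tensorHom, Category.comp_id,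
      tensorHom_comp_tensorHom_assoc]
  rw [h2, Category.assoc]
  congr 1
  monoidal

lemma counit_counit (M : V) [ComonObj M] :
    Δ[M] ≫ (ε[M] ⊗ₘ ε[M]) = ε[M] ≫ (λ_ (𝟙_ V)).inv := by
  simp [MonoidalCategory.tensorHom_def]

lemma counit_counit_braiding_inv (M : V) [ComonObj M] :
    (Δ[M] ≫ (β_ M M).inv) ≫ (ε[M] ⊗ₘ ε[M]) = ε[M] ≫ (λ_ (𝟙_ V)).inv := by
  rw [Category.assoc, ← braiding_inv_naturality, ← Category.assoc, counit_counit]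
  simp
  rw [unitors_inv_equal]

lemma bimon_weak_counit {M : V} [BimonObj M] (d : M ⟶ M ⊗ M)
    (hd : d ≫ (ε[M] ⊗ₘ ε[M]) = ε[M] ≫ (λ_ (𝟙_ V)).inv) :
    comulMiddle d ≫ ((μ[M] ≫ ε[M]) ⊗ₘ (μ[M] ≫ ε[M])) ≫ (λ_ (𝟙_ V)).hom =
    μ[M] ▷ M ≫ μ[M] ≫ ε[M] := by
  simp only [Bimon.mul_counit]
  rw [← tensorHom_comp_tensorHom, Category.assoc, reassoc_of% comulMiddle_counit d hd,
    ← tensorHom_id, tensorHom_comp_tensorHom_assoc μ[M], Bimon.mul_counit, Category.id_comp]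
  have : (((ε[M] ⊗ₘ ε[M]) ≫ (λ_ (𝟙_ V)).hom) ⊗ₘ ε[M]) =
     ((ε[M] ⊗ₘ ε[M]) ⊗ₘ ε[M]) ≫ ((λ_ (𝟙_ V)).hom ⊗ₘ 𝟙 _) := by
    rw [tensorHom_comp_tensorHom, Category.comp_id]
  rw [this, Category.assoc]
  congr 1
  monoidal

/-- A bialgebra is a weak bialgebra. -/
abbrev weakBimonObjOfBimonObj (M : V) [BimonObj M] : WeakBimonObj M where
  mul_comul := BimonObj.mul_comul M
  weak_unit := bimon_weak_unit _ (by simp [MonoidalCategory.tensorHom_def'])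
  weak_unit' := bimon_weak_unit _ (one_one_braiding_inv M)
  weak_counit := bimon_weak_counit _ (counit_counit M)
  weak_counit' := bimon_weak_counit _ (counit_counit_braiding_inv M)

lemma idemT_of_bimonObj (M : V) [BimonObj M] : idemT M = ε[M] ≫ η[M] := by
  rw [idemT, Bimon.one_comul, Bimon.mul_counit]
  have h1 : ((λ_ (𝟙_ V)).inv ≫ (η[M] ⊗ₘ η[M])) ▷ M ≫ (α_ M M M).hom ≫ M ◁ (β_ M M).hom ≫
      (α_ M M M).inv = (λ_ (𝟙_ V)).inv ▷ M ≫ (α_ _ _ _).hom ≫ 𝟙_ V ◁ (β_ (𝟙_ V) M).hom ≫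
        (α_ _ _ _).inv ≫ ((η[M] ⊗ₘ 𝟙 M) ⊗ₘ η[M]) := by
    rw [← associator_inv_naturality, ← id_tensorHom, ← id_tensorHom,
      tensorHom_comp_tensorHom_assoc, ← braiding_naturality, comp_whiskerRight,
      Category.assoc, ← tensorHom_id (η[M] ⊗ₘ η[M]), associator_naturality_assoc,
      tensorHom_comp_tensorHom_assoc, Category.id_comp, Category.comp_id]
  have h2 : ((η[M] ⊗ₘ 𝟙 M) ⊗ₘ η[M]) ≫ ((ε[M] ⊗ₘ ε[M]) ≫ (λ_ (𝟙_ V)).hom) ▷ M =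
      (𝟙_ V ◁ ε[M] ⊗ₘ η[M]) ≫ (λ_ (𝟙_ V)).hom ▷ M := by
    rw [← tensorHom_id, ← tensorHom_id, tensorHom_comp_tensorHom, tensorHom_comp_tensorHom,
      tensorHom_comp_tensorHom_assoc, BimonObj.one_counit, Category.id_comp, id_tensorHom]
  rw [reassoc_of% h1, reassoc_of% h2]
  simp only [braiding_tensorUnit_left, MonoidalCategory.tensorHom_def]
  monoidal

lemma idemR_of_bimonObj (M : V) [BimonObj M] : idemR M = ε[M] ≫ η[M] := by
  rw [idemR, Bimon.one_comul, Bimon.mul_counit]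
  have h1 : M ◁ ((λ_ (𝟙_ V)).inv ≫ (η[M] ⊗ₘ η[M])) ≫ (α_ M M M).inv ≫ (β_ M M).hom ▷ M ≫
      (α_ M M M).hom = M ◁ (λ_ (𝟙_ V)).inv ≫ (α_ _ _ _).inv ≫ (β_ M (𝟙_ V)).hom ▷ 𝟙_ V ≫
        (α_ _ _ _).hom ≫ (η[M] ⊗ₘ (𝟙 M ⊗ₘ η[M])) := by
    rw [← associator_naturality, ← tensorHom_id, ← tensorHom_id,
      tensorHom_comp_tensorHom_assoc, ← braiding_naturality, whiskerLeft_comp,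
      Category.assoc, ← id_tensorHom M (η[M] ⊗ₘ η[M]), associator_inv_naturality_assoc,
      tensorHom_comp_tensorHom_assoc, Category.id_comp, Category.comp_id]
  have h2 : (η[M] ⊗ₘ (𝟙 M ⊗ₘ η[M])) ≫ M ◁ ((ε[M] ⊗ₘ ε[M]) ≫ (λ_ (𝟙_ V)).hom) =
      (η[M] ⊗ₘ ε[M] ▷ 𝟙_ V) ≫ M ◁ (λ_ (𝟙_ V)).hom := by
    rw [← id_tensorHom, ← id_tensorHom, tensorHom_comp_tensorHom, tensorHom_comp_tensorHom,
      tensorHom_comp_tensorHom_assoc, BimonObj.one_counit, Category.id_comp, tensorHom_id]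
  rw [reassoc_of% h1, reassoc_of% h2]
  simp only [braiding_tensorUnit_right, MonoidalCategory.tensorHom_def']
  monoidal

section Strict

section

variable {M N : V} (f : M ⟶ N) (e : 𝟙_ V ⟶ M ⊗ M) (m : N ⊗ N ⟶ 𝟙_ V)

lemma strict_aux₁ : f ≫ (λ_ N).inv ≫ (e ≫ (f ⊗ₘ f)) ▷ N =
    (λ_ M).inv ≫ e ▷ M ≫ ((f ⊗ₘ f) ⊗ₘ f) := by
  rw [leftUnitor_inv_naturality_assoc, whisker_exchange, MonoidalCategory.tensorHom_def (f ⊗ₘ f) f]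
  simp

lemma strict_aux₂ : M ◁ ((f ⊗ₘ f) ≫ m) ≫ (ρ_ M).hom ≫ f =
    (f ⊗ₘ (f ⊗ₘ f)) ≫ N ◁ m ≫ (ρ_ N).hom := by
  rw [← rightUnitor_naturality, whisker_exchange_assoc, MonoidalCategory.tensorHom_def f (f ⊗ₘ f)]
  simp

lemma strict_aux₃ : f ≫ (ρ_ N).inv ≫ N ◁ (e ≫ (f ⊗ₘ f)) =
    (ρ_ M).inv ≫ M ◁ e ≫ (f ⊗ₘ (f ⊗ₘ f)) := by
  rw [rightUnitor_inv_naturality_assoc, ← whisker_exchange,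
    MonoidalCategory.tensorHom_def' f (f ⊗ₘ f)]
  simp

lemma strict_aux₄ : ((f ⊗ₘ f) ≫ m) ▷ M ≫ (λ_ M).hom ≫ f =
    ((f ⊗ₘ f) ⊗ₘ f) ≫ m ▷ N ≫ (λ_ N).hom := by
  rw [← leftUnitor_naturality, ← whisker_exchange_assoc, MonoidalCategory.tensorHom_def' (f ⊗ₘ f) f]
  simp

end

variable {M N : V} [WeakBimonObj M] [WeakBimonObj N] (f : M ⟶ N) [IsMonHom f] [IsComonHom f]

lemma strict_one_comul : η[N] ≫ Δ[N] = (η[M] ≫ Δ[M]) ≫ (f ⊗ₘ f) := by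
  rw [Category.assoc, ← IsComonHom.hom_comul, IsMonHom.one_hom_assoc]

lemma strict_mul_counit : μ[M] ≫ ε[M] = (f ⊗ₘ f) ≫ μ[N] ≫ ε[N] := by
  rw [← IsMonHom.mul_hom_assoc, IsComonHom.hom_counit f]

/-- A morphism that strictly preserves all the structure is a weak morphism. -/
lemma isWeakHom_of_strict : IsWeakHom f where
  idemS_comm := by
    simp only [idemS, Category.assoc]
    rw [strict_one_comul f, strict_mul_counit f, strict_aux₂, reassoc_of% strict_aux₁ f,
      associator_naturality_assoc]
  idemT_comm := by
    simp only [idemT, Category.assoc]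
    rw [strict_one_comul f, strict_mul_counit f, strict_aux₄, reassoc_of% strict_aux₁ f,
      associator_naturality_assoc, ← associator_inv_naturality_assoc]
    simp only [← id_tensorHom, tensorHom_comp_tensorHom_assoc, braiding_naturality,
      Category.id_comp, Category.comp_id]
  idemZ_comm := by
    simp only [idemZ, Category.assoc]
    rw [strict_one_comul f, strict_mul_counit f, strict_aux₄, reassoc_of% strict_aux₃ f,
      associator_inv_naturality_assoc]
  idemR_comm := by
    simp only [idemR, Category.assoc]
    rw [strict_one_comul f, strict_mul_counit f, strict_aux₂, reassoc_of% strict_aux₃ f,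
      associator_inv_naturality_assoc, ← associator_naturality_assoc]
    simp only [← tensorHom_id, tensorHom_comp_tensorHom_assoc, braiding_naturality,
      Category.id_comp, Category.comp_id]
  comul_left := by
    rw [← IsComonHom.hom_comul f, sqMul_natural_right, ← leftUnitor_inv_naturality_assoc,
      WeakBimonObj.one_sqMul]
  comul_right := by
    rw [← IsComonHom.hom_comul f, sqMul_natural_left, ← rightUnitor_inv_naturality_assoc,
      WeakBimonObj.sqMul_one]

end Strict

/-- A Hopf algebra is a weak Hopf algebra. -/
abbrev weakHopfObjOfHopfObj (M : V) [HopfObj M] : WeakHopfObj M where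
  toWeakBimonObj := weakBimonObjOfBimonObj M
  antipode := HopfObj.antipode
  antipode_conv_id := by
    rw [idemR_of_bimonObj, convMul, tensorHom_id, HopfObj.antipode_left]
  id_conv_antipode := by
    rw [idemT_of_bimonObj, convMul, id_tensorHom, HopfObj.antipode_right]
  antipode_conv_id_conv_antipode := by
    have : convMul (HopfObj.antipode (X := M)) (𝟙 M) = ε[M] ≫ η[M] := by
      rw [convMul, tensorHom_id, HopfObj.antipode_left]
    rw [this, convMul, MonoidalCategory.tensorHom_def]
    simp [← whisker_exchange_assoc]

variable (V)

/-- Bundled weak bialgebras in `V`. -/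
structure WBA where
  X : V
  [str : WeakBimonObj X]

/-- Bundled weak Hopf algebras in `V`. -/
structure WHA where
  X : V
  [str : WeakHopfObj X]

/-- Bundled bialgebras in `V`. -/
structure BA where
  X : V
  [str : BimonObj X]

/-- Bundled Hopf algebras in `V`. -/
structure HA where
  X : V
  [str : HopfObj X]

attribute [instance] WBA.str WHA.str BA.str HA.str

variable {V}

/-- Weak morphisms of weak bialgebras. -/
@[ext]
structure WBA.Hom (H J : WBA V) where
  hom : H.X ⟶ J.X
  [weak : IsWeakHom hom]

attribute [instance] WBA.Hom.weak

/-- Morphisms of bialgebras strictly preserve all the structure. -/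
@[ext]
structure BA.Hom (H J : BA V) where
  hom : H.X ⟶ J.X
  [strict : IsBimonHom hom]

attribute [instance] BA.Hom.strict

/-- The category `wba V`. -/
instance : Category (WBA V) where
  Hom := WBA.Hom
  id H := { hom := 𝟙 H.X }
  comp f g := { hom := f.hom ≫ g.hom }

/-- The category `ba V`. -/
instance : Category (BA V) where
  Hom := BA.Hom
  id H := { hom := 𝟙 H.X, strict := { } }
  comp f g := { hom := f.hom ≫ g.hom, strict := { } }

/-- The weak bialgebra underlying a weak Hopf algebra. -/
def WHA.toWBA (H : WHA V) : WBA V where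
  X := H.X

/-- The bialgebra underlying a Hopf algebra. -/
def HA.toBA (H : HA V) : BA V where
  X := H.X

/-- A bialgebra as a weak bialgebra. -/
def BA.toWBA (H : BA V) : WBA V where
  X := H.X
  str := weakBimonObjOfBimonObj H.X

/-- A Hopf algebra as a weak Hopf algebra. -/
def HA.toWHA (H : HA V) : WHA V where
  X := H.X
  str := weakHopfObjOfHopfObj H.X

/-- The category `wha V`: morphisms are the weak morphisms of the underlying weak bialgebras. -/
instance : Category (WHA V) :=
  inferInstanceAs (Category (InducedCategory (WBA V) WHA.toWBA))

/-- The category `ha V`: morphisms are the morphisms of the underlying bialgebras. -/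
instance : Category (HA V) :=
  inferInstanceAs (Category (InducedCategory (BA V) HA.toBA))

variable (V)

/-- The forgetful functor `wha V ⥤ wba V`. -/
def whaToWba : WHA V ⥤ WBA V := inducedFunctor WHA.toWBA

/-- The forgetful functor `ha V ⥤ ba V`. -/
def haToBa : HA V ⥤ BA V := inducedFunctor HA.toBA

/-- The inclusion `ba V ⥤ wba V`. -/
def baToWba : BA V ⥤ WBA V where
  obj H := H.toWBA
  map {H J} f :=
    letI := weakBimonObjOfBimonObj H.X
    letI := weakBimonObjOfBimonObj J.X
    { hom := f.hom
      weak := isWeakHom_of_strict f.hom }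

/-- The inclusion `ha V ⥤ wha V`. -/
def haToWha : HA V ⥤ WHA V where
  obj H := H.toWHA
  map f := ⟨(baToWba V).map ((haToBa V).map f)⟩

end Algebra

/-! ### Separable Frobenius monoidal functors -/

section Frobenius

open Functor.LaxMonoidal Functor.OplaxMonoidal

variable {A : Type u₁} [Category.{v₁} A] [MonoidalCategory A]
  {B : Type u₂} [Category.{v₂} B] [MonoidalCategory B]
  {C : Type u₃} [Category.{v₃} C] [MonoidalCategory C]

/-- A separable Frobenius monoidal structure on a functor: a monoidal structure `(ε, μ)` and a
comonoidal structure `(η, δ)` satisfying the two Frobenius axioms and `μ ∘ δ = 1`. -/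
class SepFrobenius (F : A ⥤ B) extends F.LaxMonoidal, F.OplaxMonoidal where
  frobenius_left : ∀ X Y Z : A,
    δ X Y ▷ F.obj Z ≫ (α_ (F.obj X) (F.obj Y) (F.obj Z)).hom ≫ F.obj X ◁ μ Y Z =
      μ (X ⊗ Y) Z ≫ F.map (α_ X Y Z).hom ≫ δ X (Y ⊗ Z)
  frobenius_right : ∀ X Y Z : A,
    F.obj X ◁ δ Y Z ≫ (α_ (F.obj X) (F.obj Y) (F.obj Z)).inv ≫ μ X Y ▷ F.obj Z =
      μ X (Y ⊗ Z) ≫ F.map (α_ X Y Z).inv ≫ δ (X ⊗ Y) Z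
  separable : ∀ X Y : A, δ X Y ≫ μ X Y = 𝟙 (F.obj (X ⊗ Y))

instance : SepFrobenius (𝟭 A) where
  frobenius_left _ _ _ := by simp
  frobenius_right _ _ _ := by simp
  separable _ _ := by simp

instance (F : A ⥤ B) (G : B ⥤ C) [SepFrobenius F] [SepFrobenius G] : SepFrobenius (F ⋙ G) where
  frobenius_left X Y Z := by
    have h := SepFrobenius.frobenius_left (F := G) (F.obj X) (F.obj Y) (F.obj Z)
    have h' := congrArg G.map (SepFrobenius.frobenius_left (F := F) X Y Z)
    simp only [Functor.map_comp] at h'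
    simp only [Functor.comp_obj, Functor.comp_map, comp_δ, comp_μ, comp_whiskerRight,
      MonoidalCategory.whiskerLeft_comp, Category.assoc]
    rw [reassoc_of% h, μ_natural_left_assoc, δ_natural_right, reassoc_of% h']
  frobenius_right X Y Z := by
    have h := SepFrobenius.frobenius_right (F := G) (F.obj X) (F.obj Y) (F.obj Z)
    have h' := congrArg G.map (SepFrobenius.frobenius_right (F := F) X Y Z)
    simp only [Functor.map_comp] at h'
    simp only [Functor.comp_obj, Functor.comp_map, comp_δ, comp_μ, comp_whiskerRight,
      MonoidalCategory.whiskerLeft_comp, Category.assoc]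
    rw [reassoc_of% h, μ_natural_right_assoc, δ_natural_left, reassoc_of% h']
  separable X Y := by
    have h := SepFrobenius.separable (F := G) (F.obj X) (F.obj Y)
    have h' := congrArg G.map (SepFrobenius.separable (F := F) X Y)
    simp only [Functor.map_comp] at h'
    simp only [Functor.comp_obj, comp_δ, comp_μ, Category.assoc]
    rw [reassoc_of% h, h', CategoryTheory.Functor.map_id]

variable (A B) in
/-- Bundled separable Frobenius monoidal functors. Two of them are equal when the functors and the
monoidal and comonoidal structures are. -/
structure SFFunctor where
  functor : A ⥤ B
  [sf : SepFrobenius functor]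

attribute [instance] SFFunctor.sf

namespace SFFunctor

variable (A) in
/-- The identity separable Frobenius functor. -/
abbrev id : SFFunctor A A where
  functor := 𝟭 A

/-- Composition of separable Frobenius functors. -/
abbrev comp (F : SFFunctor A B) (G : SFFunctor B C) : SFFunctor A C where
  functor := F.functor ⋙ G.functor

lemma mk_congr {F : A ⥤ B} {i j : SepFrobenius F}
    (hε : i.ε = j.ε) (hμ : i.μ = j.μ) (hη : i.η = j.η) (hδ : i.δ = j.δ) :
    SFFunctor.mk F (sf := i) = SFFunctor.mk F (sf := j) := by
  have h : i = j := by
    obtain ⟨⟩ := i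
    obtain ⟨⟩ := j
    congr 1
    · exact Functor.LaxMonoidal.ext hε hμ
    · exact Functor.OplaxMonoidal.ext hη hδ
  rw [h]

lemma id_comp (F : SFFunctor A B) : (id A).comp F = F := by
  obtain ⟨F⟩ := F
  refine mk_congr (F := F) (i := inferInstanceAs (SepFrobenius (𝟭 A ⋙ F))) (j := inferInstance) ?_ ?_ ?_ ?_
  · change ε F ≫ F.map (𝟙 _) = ε F
    simp
  · funext X Y
    change μ F X Y ≫ F.map (𝟙 _) = μ F X Y
    simp
  · change F.map (𝟙 _) ≫ η F = η F
    simp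
  · funext X Y
    change F.map (𝟙 _) ≫ δ F X Y = δ F X Y
    simp

lemma comp_id (F : SFFunctor A B) : F.comp (id B) = F := by
  obtain ⟨F⟩ := F
  refine mk_congr (F := F) (i := inferInstanceAs (SepFrobenius (F ⋙ 𝟭 B))) (j := inferInstance) ?_ ?_ ?_ ?_
  · exact Category.id_comp (ε F)
  · funext X Y
    exact Category.id_comp (μ F X Y)
  · exact Category.comp_id (η F)
  · funext X Y
    exact Category.comp_id (δ F X Y)

lemma comp_assoc {D : Type u₄} [Category.{v₄} D] [MonoidalCategory D] (F : SFFunctor A B)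
    (G : SFFunctor B C) (H : SFFunctor C D) : (F.comp G).comp H = F.comp (G.comp H) := by
  obtain ⟨F⟩ := F
  obtain ⟨G⟩ := G
  obtain ⟨H⟩ := H
  refine mk_congr (F := F ⋙ G ⋙ H) (i := inferInstanceAs (SepFrobenius ((F ⋙ G) ⋙ H)))
    (j := inferInstanceAs (SepFrobenius (F ⋙ G ⋙ H))) ?_ ?_ ?_ ?_
  · change ε H ≫ H.map (ε G ≫ G.map (ε F)) = (ε H ≫ H.map (ε G)) ≫ H.map (G.map (ε F))
    simp
  · funext X Y
    change μ H _ _ ≫ H.map (μ G _ _ ≫ G.map (μ F X Y)) =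
      (μ H _ _ ≫ H.map (μ G _ _)) ≫ H.map (G.map (μ F X Y))
    simp
  · change H.map (G.map (η F) ≫ η G) ≫ η H = H.map (G.map (η F)) ≫ H.map (η G) ≫ η H
    simp
  · funext X Y
    change H.map (G.map (δ F X Y) ≫ δ G _ _) ≫ δ H _ _ =
      H.map (G.map (δ F X Y)) ≫ H.map (δ G _ _) ≫ δ H _ _
    simp

end SFFunctor

/-- A separable Frobenius functor is strong when its structure maps are invertible, the inverse of
`μ` being `δ` and that of `ε` being `η`. -/
structure IsStrong (F : A ⥤ B) [SepFrobenius F] : Prop where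
  μ_δ : ∀ X Y : A, μ F X Y ≫ δ F X Y = 𝟙 (F.obj X ⊗ F.obj Y)
  ε_η : ε F ≫ η F = 𝟙 (𝟙_ B)
  η_ε : η F ≫ ε F = 𝟙 (F.obj (𝟙_ A))

variable (A) in
lemma IsStrong.id : IsStrong (𝟭 A) where
  μ_δ _ _ := by simp
  ε_η := by simp
  η_ε := by simp

lemma IsStrong.comp {F : A ⥤ B} {G : B ⥤ C} [SepFrobenius F] [SepFrobenius G]
    (hF : IsStrong F) (hG : IsStrong G) : IsStrong (F ⋙ G) where
  μ_δ _ _ := by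
    simp only [comp_δ, comp_μ, Category.assoc]
    rw [← G.map_comp_assoc, hF.μ_δ]
    simp [hG.μ_δ]
  ε_η := by
    simp only [comp_ε, comp_η, Category.assoc]
    rw [← G.map_comp_assoc, hF.ε_η]
    simp [hG.ε_η]
  η_ε := by
    simp only [comp_ε, comp_η, Category.assoc]
    rw [reassoc_of% hG.η_ε, ← G.map_comp, hF.η_ε]
    simp

end Frobenius

/-! ### Categories of functors into `V` -/

section Slice

variable (V : Type u) [Category.{v} V] [MonoidalCategory V]

/-- The objects `x` that have a left dual `*x`, with unit `⊤ ⟶ x ⊗ *x` and counit `*x ⊗ x ⟶ ⊤`.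
(Mathlib calls such a `*x` a right dual of `x`.) -/
def dualizable : ObjectProperty V := fun x => Nonempty (HasRightDual x)

/-- `V` is complete and tensoring with an object on either side is continuous. -/
class MonoidallyComplete : Prop where
  hasLimits : HasLimits V
  preservesLimits_tensorLeft : ∀ b : V, PreservesLimits (tensorLeft b)
  preservesLimits_tensorRight : ∀ b : V, PreservesLimits (tensorRight b)

/-- A separable Frobenius functor of reconstruction type into `V`: its domain is (essentially)
small and its values have left duals. -/
structure SFOver where
  A : Type (max u v)
  [cat : Category.{v} A]
  [mon : MonoidalCategory A]
  [small : EssentiallySmall.{v} A]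
  F : SFFunctor A V
  dual : ∀ a : A, dualizable V (F.functor.obj a)

attribute [instance] SFOver.cat SFOver.mon SFOver.small

variable {V}

namespace SFOver

/-- A morphism from `F : A ⥤ V` to `G : C ⥤ V` is a separable Frobenius functor `H : A ⥤ C`
with `G H = F` as separable Frobenius functors. -/
@[ext]
structure Hom (F G : SFOver V) where
  H : SFFunctor F.A G.A
  comm : H.comp G.F = F.F

/-- The category `sfmon ⫽ V`. -/
instance : Category (SFOver V) where
  Hom := Hom
  id F := ⟨SFFunctor.id F.A, SFFunctor.id_comp _⟩
  comp f g := ⟨f.H.comp g.H, by rw [SFFunctor.comp_assoc, g.comm, f.comm]⟩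
  id_comp _ := Hom.ext (SFFunctor.id_comp _)
  comp_id _ := Hom.ext (SFFunctor.comp_id _)
  assoc _ _ _ := Hom.ext (SFFunctor.comp_assoc _ _ _)

lemma Hom.obj_eq {F G : SFOver V} (f : F ⟶ G) (a : F.A) :
    G.F.functor.obj (f.H.functor.obj a) = F.F.functor.obj a := by
  conv_rhs => rw [← f.comm]
  rfl

variable (V) in
/-- The domain has left duals. -/
def domainHasDuals : ObjectProperty (SFOver V) := fun F => ∀ a : F.A, dualizable F.A a

end SFOver

variable (V) in
/-- The category `sfmon* ⫽ V`. -/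
abbrev SFOverStar := (SFOver.domainHasDuals V).FullSubcategory

variable (V) in
/-- Strong monoidal functors of reconstruction type into `V`. -/
structure StrOver where
  toSFOver : SFOver V
  strong : IsStrong toSFOver.F.functor

namespace StrOver

/-- Morphisms from `F` to `G` are the strong monoidal functors `H` with `G H = F`. -/
@[ext]
structure Hom (F G : StrOver V) where
  hom : F.toSFOver ⟶ G.toSFOver
  strong : IsStrong hom.H.functor

/-- The category `strmon ⫽ V`. -/
instance : Category (StrOver V) where
  Hom := Hom
  id F := ⟨𝟙 F.toSFOver, IsStrong.id _⟩
  comp f g := ⟨f.hom ≫ g.hom, f.strong.comp g.strong⟩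

variable (V) in
/-- The inclusion `strmon ⫽ V ⥤ sfmon ⫽ V`. -/
def incl : StrOver V ⥤ SFOver V where
  obj F := F.toSFOver
  map f := f.hom

variable (V) in
/-- The domain has left duals. -/
def domainHasDuals : ObjectProperty (StrOver V) := fun F => SFOver.domainHasDuals V F.toSFOver

end StrOver

variable (V) in
/-- The category `strmon* ⫽ V`. -/
abbrev StrOverStar := (StrOver.domainHasDuals V).FullSubcategory

variable (V) in
/-- The inclusion `strmon* ⫽ V ⥤ sfmon* ⫽ V`. -/
def StrOverStar.incl : StrOverStar V ⥤ SFOverStar V :=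
  (SFOver.domainHasDuals V).lift ((StrOver.domainHasDuals V).ι ⋙ StrOver.incl V)
    (fun F => F.property)

end Slice

/-! ### The Tannaka construction -/

section Tan

open Functor.LaxMonoidal Functor.OplaxMonoidal

variable {V : Type u} [Category.{v} V] [MonoidalCategory V]

instance (F : SFOver V) (a : F.A) : HasRightDual (F.F.functor.obj a) := (F.dual a).some

/-- The diagram `(b, a) ↦ Fa ⊗ *(Fb)`. -/
def SFOver.endDiagram (F : SFOver V) : F.Aᵒᵖ ⥤ F.A ⥤ V where
  obj b := F.F.functor ⋙ tensorRight ((F.F.functor.obj b.unop)ᘁ)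
  map g := { app := fun a => F.F.functor.obj a ◁ ((F.F.functor.map g.unop)ᘁ)
             naturality := fun _ _ h => (whisker_exchange _ _).symm }
  map_id b := by
    ext a
    simp
  map_comp g h := by
    ext a
    simp [comp_rightAdjointMate]

/-- The action of `H ⊗ H` on `a ⊗ b` obtained from actions of `H` on `a` and on `b`, by braiding the
second copy of `H` past `a`. -/
def act₂ [BraidedCategory V] {H a b : V} (x : H ⊗ a ⟶ a) (y : H ⊗ b ⟶ b) :
    (H ⊗ H) ⊗ (a ⊗ b) ⟶ a ⊗ b :=
  tensorμ H H a b ≫ (x ⊗ₘ y)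

/-- The action `T ⊗ Fa ⟶ Fa` obtained from `π : T ⟶ Fa ⊗ *(Fa)`. -/
def SFOver.act (F : SFOver V) {T : V} {a : F.A}
    (π : T ⟶ F.F.functor.obj a ⊗ (F.F.functor.obj a)ᘁ) :
    T ⊗ F.F.functor.obj a ⟶ F.F.functor.obj a :=
  π ▷ _ ≫ (α_ _ _ _).hom ≫ _ ◁ ε_ _ _ ≫ (ρ_ _).hom

/-- The data exhibiting a weak bialgebra `T` as the Tannaka object of `F`: the underlying object is
the end `∫ₐ Fa ⊗ *(Fa)` with projections `π`, and the structure maps have the discharged forms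
`(hk) · x = h · (k · x)`, `1 · x = x`,
`Δ(h) · (x ⊗ y) = δ(h · μ(x ⊗ y))` and `ε(h) = η(h · ε)`. -/
structure TannakaStructure [BraidedCategory V] (F : SFOver V) (T : WBA V) where
  π : ∀ a : F.A, T.X ⟶ F.F.functor.obj a ⊗ (F.F.functor.obj a)ᘁ
  dinatural : ∀ ⦃a b : F.A⦄ (f : a ⟶ b),
    π a ≫ F.F.functor.map f ▷ _ = π b ≫ _ ◁ ((F.F.functor.map f)ᘁ)
  isEnd : IsLimit (Wedge.mk (F := F.endDiagram) T.X π dinatural)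
  mul_act : ∀ a : F.A, MonObj.mul (X := T.X) ▷ F.F.functor.obj a ≫ F.act (π a) =
    (α_ _ _ _).hom ≫ T.X ◁ F.act (π a) ≫ F.act (π a)
  one_act : ∀ a : F.A, MonObj.one (X := T.X) ▷ F.F.functor.obj a ≫ F.act (π a) = (λ_ _).hom
  comul_act : ∀ a b : F.A,
    ComonObj.comul (X := T.X) ▷ (F.F.functor.obj a ⊗ F.F.functor.obj b) ≫
        act₂ (F.act (π a)) (F.act (π b)) =
      T.X ◁ μ F.F.functor a b ≫ F.act (π (a ⊗ b)) ≫ δ F.F.functor a b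
  counit_eq : ComonObj.counit (X := T.X) =
    (ρ_ T.X).inv ≫ T.X ◁ ε F.F.functor ≫ F.act (π (𝟙_ F.A)) ≫ η F.F.functor

variable (V) in
/-- The Tannaka functor `tan`. On a morphism `H : F ⟶ G` it is the map `tan G ⟶ tan F`
corresponding to the action of `tan G` on `F = G H`. -/
structure TannakaFunctor [BraidedCategory V] where
  functor : SFOver V ⥤ (WBA V)ᵒᵖ
  str : ∀ F : SFOver V, TannakaStructure F (functor.obj F).unop
  map_act : ∀ {F G : SFOver V} (f : F ⟶ G) (a : F.A),
    (functor.map f).unop.hom ▷ F.F.functor.obj a ≫ F.act ((str F).π a) =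
      (functor.obj G).unop.X ◁ eqToHom (SFOver.Hom.obj_eq f a).symm ≫
        G.act ((str G).π (f.H.functor.obj a)) ≫ eqToHom (SFOver.Hom.obj_eq f a)

end Tan

/-! ### Representations -/

section Rep

open Functor.LaxMonoidal Functor.OplaxMonoidal

variable {V : Type u} [Category.{v} V] [MonoidalCategory V] [BraidedCategory V]

/-- `H-mod`: the left `H`-modules whose underlying object has a left dual in `V`. -/
abbrev DMod (H : WBA V) := ((dualizable V).inverseImage (Mod.forget (D := V) H.X)).FullSubcategory

namespace DMod

/-- The forgetful functor `U : H-mod ⥤ V`. -/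
abbrev forget (H : WBA V) : DMod H ⥤ V :=
  ObjectProperty.ι ((dualizable V).inverseImage (Mod.forget (D := V) H.X)) ⋙ Mod.forget H.X

/-- The action of `H` on a module. -/
def act {H : WBA V} (a : DMod H) : H.X ⊗ (forget H).obj a ⟶ (forget H).obj a :=
  ModObj.smul (M := H.X) (X := a.obj.X)

/-- Restriction of scalars along a weak morphism. -/
abbrev restrict {H J : WBA V} (f : H ⟶ J) : DMod J ⥤ DMod H :=
  ObjectProperty.lift ((dualizable V).inverseImage (Mod.forget (D := V) H.X))
    (ObjectProperty.ι ((dualizable V).inverseImage (Mod.forget (D := V) J.X)) ⋙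
      letI : IsMonHom f.hom := f.weak.toIsMonHom
      Mod.comap (D := V) f.hom)
    (fun a => a.property)

/-- The idempotent `∇`, the action of `Δ(1)` on `a ⊗ b`. -/
def nabla {H : WBA V} (a b : DMod H) :
    (forget H).obj a ⊗ (forget H).obj b ⟶ (forget H).obj a ⊗ (forget H).obj b :=
  (λ_ _).inv ≫ (MonObj.one (X := H.X) ≫ ComonObj.comul) ▷ _ ≫ act₂ a.act b.act

end DMod

/-- The monoidal structure on `H-mod` and the separable Frobenius structure on `U : H-mod ⥤ V`,
for a choice of splittings of idempotents: `U(a ⊗ b)` is a splitting of `∇` on `Ua ⊗ Ub` via the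
binary structure maps of `U`, with `H` acting through `Δ`; the unit object is a splitting of the
idempotent `t` on `H`, with `H` acting by `t ∘ mul`, and the nullary structure maps of `U` are the
unit and the counit of `H`. -/
structure RepStructure (H : WBA V) where
  [mon : MonoidalCategory (DMod H)]
  [small : EssentiallySmall.{v} (DMod H)]
  [sf : SepFrobenius (DMod.forget H)]
  μ_δ : ∀ a b : DMod H, μ (DMod.forget H) a b ≫ δ (DMod.forget H) a b = DMod.nabla a b
  act_tensor : ∀ a b : DMod H, (a ⊗ b).act =
    H.X ◁ δ (DMod.forget H) a b ≫ ComonObj.comul ▷ _ ≫ act₂ a.act b.act ≫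
      μ (DMod.forget H) a b
  p : H.X ⟶ (DMod.forget H).obj (𝟙_ (DMod H))
  i : (DMod.forget H).obj (𝟙_ (DMod H)) ⟶ H.X
  i_p : i ≫ p = 𝟙 _
  p_i : p ≫ i = idemT H.X
  act_unit : (𝟙_ (DMod H)).act = H.X ◁ i ≫ MonObj.mul ≫ p
  ε_eq : ε (DMod.forget H) = MonObj.one (X := H.X) ≫ p
  η_eq : η (DMod.forget H) = i ≫ ComonObj.counit

/-- `U : H-mod ⥤ V` as an object of `sfmon ⫽ V`. -/
def RepStructure.toSFOver {H : WBA V} (R : RepStructure H) : SFOver V :=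
  letI := R.mon
  letI := R.sf
  { A := DMod H
    small := R.small
    F := ⟨DMod.forget H⟩
    dual := fun a => a.property }

variable (V) in
/-- The representation functor `mod`, sending `H` to `U : H-mod ⥤ V` and a weak morphism
`f : H ⟶ J` to the restriction functor `J-mod ⥤ H-mod` with its separable Frobenius structure, which
is determined by the requirement that the restriction is a morphism over `V`. -/
structure RepFunctor where
  rep : ∀ H : WBA V, RepStructure H
  restr : ∀ {H J : WBA V} (_ : H ⟶ J), (rep J).toSFOver ⟶ (rep H).toSFOver
  restr_functor : ∀ {H J : WBA V} (f : H ⟶ J), (restr f).H.functor = DMod.restrict f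
  restr_id : ∀ H : WBA V, restr (𝟙 H) = 𝟙 (rep H).toSFOver
  restr_comp : ∀ {H J K : WBA V} (f : H ⟶ J) (g : J ⟶ K), restr (f ≫ g) = restr g ≫ restr f

/-- The underlying functor of `mod`. -/
def RepFunctor.functor (M : RepFunctor V) : (WBA V)ᵒᵖ ⥤ SFOver V where
  obj H := (M.rep H.unop).toSFOver
  map f := M.restr f.unop
  map_id H := M.restr_id H.unop
  map_comp f g := M.restr_comp g.unop f.unop

/-! ### The adjunctions -/

/-- The unit of the adjunction sends `x` to `Fx` with the canonical action of `tan F`, and the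
counit is the map `H ⟶ tan U` whose discharged form at a module is the given action of `H`. -/
structure IsTannakaAdjunction {T : TannakaFunctor V} {M : RepFunctor V}
    (adj : T.functor ⊣ M.functor) : Prop where
  unit_act : ∀ (F : SFOver V) (a : F.A),
    DMod.act (H := (T.functor.obj F).unop) ((adj.unit.app F).H.functor.obj a) =
      (T.functor.obj F).unop.X ◁ eqToHom (SFOver.Hom.obj_eq (adj.unit.app F) a) ≫
        F.act ((T.str F).π a) ≫ eqToHom (SFOver.Hom.obj_eq (adj.unit.app F) a).symm
  counit_act : ∀ (H : WBA V) (a : DMod H),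
    (adj.counit.app (op H)).unop.hom ▷ (DMod.forget H).obj a ≫
      SFOver.act (M.functor.obj (op H)) (a := a) ((T.str (M.functor.obj (op H))).π a) = a.act

/-- The adjunction `L' ⊣ R'` is a restriction of `L ⊣ R` along `I` and `K`: both squares of functors
commute and the units correspond. -/
structure AdjRestricts {C : Type u₁} [Category.{v₁} C] {D : Type u₂} [Category.{v₂} D]
    {C' : Type u₃} [Category.{v₃} C'] {D' : Type u₄} [Category.{v₄} D']
    {L : C ⥤ D} {R : D ⥤ C} {L' : C' ⥤ D'} {R' : D' ⥤ C'} (adj' : L' ⊣ R') (adj : L ⊣ R)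
    (I : C' ⥤ C) (K : D' ⥤ D) : Prop where
  left : L' ⋙ K = I ⋙ L
  right : R' ⋙ I = K ⋙ R
  unit : ∀ X : C', I.map (adj'.unit.app X) = adj.unit.app (I.obj X) ≫
    eqToHom ((congrArg R.obj (Functor.congr_obj left X).symm).trans
      (Functor.congr_obj right (L'.obj X)).symm)

end Rep

end Tannaka

end

open Tannaka

noncomputable section

set_option linter.unusedSectionVars false
set_option linter.unusedSimpArgs false
namespace Tannaka

/-! ### A strict calculus of right-nested words

Every map `A₁ ⊗ ⋯ ⊗ Aₙ ⟶ B₁ ⊗ ⋯ ⊗ Bₖ` is replaced by the family of maps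
`A₁ ⊗ (⋯ ⊗ (Aₙ ⊗ Z)) ⟶ B₁ ⊗ (⋯ ⊗ (Bₖ ⊗ Z))`, natural in `Z`; in this form no associators or unitors
appear. The simp lemmas of this section normalise a composite by performing the operations to the
right first. -/

section Calculus

variable {V : Type u} [Category.{v} V] [MonoidalCategory V]

/-- Left whiskering, with its own simp normal form. -/
def lw (X : V) {Y Z : V} (f : Y ⟶ Z) : X ⊗ Y ⟶ X ⊗ Z := X ◁ f

notation:81 X:82 "◃" f:81 => lw X f

/-- The flattening of a map `A ⟶ B`. -/
def hat₁₁ {A B : V} (f : A ⟶ B) (Z : V) : A ⊗ Z ⟶ B ⊗ Z := f ▷ Z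

/-- The flattening of a map `A ⊗ B ⟶ C`. -/
def hat₂₁ {A B C : V} (f : A ⊗ B ⟶ C) (Z : V) : A ⊗ B ⊗ Z ⟶ C ⊗ Z :=
  (α_ A B Z).inv ≫ f ▷ Z

/-- The flattening of a map `C ⟶ A ⊗ B`. -/
def hat₁₂ {A B C : V} (f : C ⟶ A ⊗ B) (Z : V) : C ⊗ Z ⟶ A ⊗ B ⊗ Z :=
  f ▷ Z ≫ (α_ A B Z).hom

/-- The flattening of a map `⊤ ⟶ A`. -/
def hat₀₁ {A : V} (f : 𝟙_ V ⟶ A) (Z : V) : Z ⟶ A ⊗ Z := (λ_ Z).inv ≫ f ▷ Z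

/-- The flattening of a map `A ⟶ ⊤`. -/
def hat₁₀ {A : V} (f : A ⟶ 𝟙_ V) (Z : V) : A ⊗ Z ⟶ Z := f ▷ Z ≫ (λ_ Z).hom

/-- The flattening of a map `⊤ ⟶ A ⊗ B`. -/
def hat₀₂ {A B : V} (f : 𝟙_ V ⟶ A ⊗ B) (Z : V) : Z ⟶ A ⊗ B ⊗ Z :=
  (λ_ Z).inv ≫ f ▷ Z ≫ (α_ A B Z).hom

/-- The flattening of a map `A ⊗ B ⟶ ⊤`. -/
def hat₂₀ {A B : V} (f : A ⊗ B ⟶ 𝟙_ V) (Z : V) : A ⊗ B ⊗ Z ⟶ Z :=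
  (α_ A B Z).inv ≫ f ▷ Z ≫ (λ_ Z).hom

@[simp] lemma lw_id (X Y : V) : X ◃ 𝟙 Y = 𝟙 _ := whiskerLeft_id _ _

@[simp] lemma lw_comp (X : V) {Y Z W : V} (f : Y ⟶ Z) (g : Z ⟶ W) :
    X ◃ f ≫ X ◃ g = X ◃ (f ≫ g) := (MonoidalCategory.whiskerLeft_comp X f g).symm

@[simp] lemma lw_comp_assoc (X : V) {Y Z W U : V} (f : Y ⟶ Z) (g : Z ⟶ W) (h : X ⊗ W ⟶ U) :
    X ◃ f ≫ X ◃ g ≫ h = X ◃ (f ≫ g) ≫ h := by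
  rw [← Category.assoc, lw_comp]

section Naturality

variable {A B C : V} {Z Z' : V} (g : Z ⟶ Z')

@[simp] lemma hat₁₁_nat (f : A ⟶ B) : hat₁₁ f Z ≫ B ◃ g = A ◃ g ≫ hat₁₁ f Z' :=
  (whisker_exchange f g).symm

@[simp] lemma hat₁₁_nat_assoc (f : A ⟶ B) {W : V} (h : B ⊗ Z' ⟶ W) :
    hat₁₁ f Z ≫ B ◃ g ≫ h = A ◃ g ≫ hat₁₁ f Z' ≫ h := by
  rw [← Category.assoc, hat₁₁_nat, Category.assoc]

@[simp] lemma hat₂₁_nat (f : A ⊗ B ⟶ C) :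
    hat₂₁ f Z ≫ C ◃ g = A ◃ B ◃ g ≫ hat₂₁ f Z' := by
  simp [hat₂₁, lw, ← whisker_exchange]

@[simp] lemma hat₂₁_nat_assoc (f : A ⊗ B ⟶ C) {W : V} (h : C ⊗ Z' ⟶ W) :
    hat₂₁ f Z ≫ C ◃ g ≫ h = A ◃ B ◃ g ≫ hat₂₁ f Z' ≫ h := by
  rw [← Category.assoc, hat₂₁_nat, Category.assoc]

@[simp] lemma hat₁₂_nat (f : C ⟶ A ⊗ B) :
    hat₁₂ f Z ≫ A ◃ B ◃ g = C ◃ g ≫ hat₁₂ f Z' := by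
  simp [hat₁₂, lw, whisker_exchange_assoc]

@[simp] lemma hat₁₂_nat_assoc (f : C ⟶ A ⊗ B) {W : V} (h : A ⊗ B ⊗ Z' ⟶ W) :
    hat₁₂ f Z ≫ A ◃ B ◃ g ≫ h = C ◃ g ≫ hat₁₂ f Z' ≫ h := by
  rw [← Category.assoc, hat₁₂_nat, Category.assoc]

@[simp] lemma hat₁₂_nat_left (f : C ⟶ A ⊗ B) {Y : V} (r : B ⊗ Z' ⟶ Y) :
    hat₁₂ f Z ≫ A ◃ (B ◃ g ≫ r) = C ◃ g ≫ hat₁₂ f Z' ≫ A ◃ r := by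
  rw [← lw_comp, hat₁₂_nat_assoc]

@[simp] lemma hat₁₂_nat_left_assoc (f : C ⟶ A ⊗ B) {Y W : V} (r : B ⊗ Z' ⟶ Y)
    (h : A ⊗ Y ⟶ W) :
    hat₁₂ f Z ≫ A ◃ (B ◃ g ≫ r) ≫ h = C ◃ g ≫ hat₁₂ f Z' ≫ A ◃ r ≫ h := by
  rw [← lw_comp, Category.assoc, hat₁₂_nat_assoc]

@[simp] lemma hat₀₁_nat (f : 𝟙_ V ⟶ A) : hat₀₁ f Z ≫ A ◃ g = g ≫ hat₀₁ f Z' := by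
  simp [hat₀₁, lw, ← whisker_exchange]

@[simp] lemma hat₀₁_nat_assoc (f : 𝟙_ V ⟶ A) {W : V} (h : A ⊗ Z' ⟶ W) :
    hat₀₁ f Z ≫ A ◃ g ≫ h = g ≫ hat₀₁ f Z' ≫ h := by
  rw [← Category.assoc, hat₀₁_nat, Category.assoc]

@[simp] lemma hat₁₀_nat (f : A ⟶ 𝟙_ V) : hat₁₀ f Z ≫ g = A ◃ g ≫ hat₁₀ f Z' := by
  simp [hat₁₀, lw, whisker_exchange_assoc]

@[simp] lemma hat₀₂_nat (f : 𝟙_ V ⟶ A ⊗ B) : hat₀₂ f Z ≫ A ◃ B ◃ g = g ≫ hat₀₂ f Z' := by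
  simp only [hat₀₂, lw, Category.assoc]
  rw [← associator_naturality_right, ← whisker_exchange_assoc, leftUnitor_inv_naturality_assoc]

@[simp] lemma hat₀₂_nat_assoc (f : 𝟙_ V ⟶ A ⊗ B) {W : V} (h : A ⊗ B ⊗ Z' ⟶ W) :
    hat₀₂ f Z ≫ A ◃ B ◃ g ≫ h = g ≫ hat₀₂ f Z' ≫ h := by
  rw [← Category.assoc, hat₀₂_nat, Category.assoc]

@[simp] lemma hat₀₂_nat_left (f : 𝟙_ V ⟶ A ⊗ B) {Y : V} (r : B ⊗ Z' ⟶ Y) :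
    hat₀₂ f Z ≫ A ◃ (B ◃ g ≫ r) = g ≫ hat₀₂ f Z' ≫ A ◃ r := by
  rw [← lw_comp, hat₀₂_nat_assoc]

@[simp] lemma hat₀₂_nat_left_assoc (f : 𝟙_ V ⟶ A ⊗ B) {Y W : V} (r : B ⊗ Z' ⟶ Y)
    (h : A ⊗ Y ⟶ W) :
    hat₀₂ f Z ≫ A ◃ (B ◃ g ≫ r) ≫ h = g ≫ hat₀₂ f Z' ≫ A ◃ r ≫ h := by
  rw [← lw_comp, Category.assoc, hat₀₂_nat_assoc]

@[simp] lemma hat₂₀_nat (f : A ⊗ B ⟶ 𝟙_ V) : hat₂₀ f Z ≫ g = A ◃ B ◃ g ≫ hat₂₀ f Z' := by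
  simp only [hat₂₀, lw, Category.assoc]
  rw [associator_inv_naturality_right_assoc, whisker_exchange_assoc, leftUnitor_naturality]

end Naturality

section Composition

variable {A B C D : V} (Z : V)

@[simp] lemma hat₁₁_id : hat₁₁ (𝟙 A) Z = 𝟙 _ := id_whiskerRight _ _

lemma hat₁₁_comp (f : A ⟶ B) (g : B ⟶ C) : hat₁₁ (f ≫ g) Z = hat₁₁ f Z ≫ hat₁₁ g Z :=
  comp_whiskerRight _ _ _

lemma hat₂₁_comp (f : A ⊗ B ⟶ C) (g : C ⟶ D) :
    hat₂₁ (f ≫ g) Z = hat₂₁ f Z ≫ hat₁₁ g Z := by simp [hat₂₁, hat₁₁]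

lemma hat₁₂_comp (f : D ⟶ C) (g : C ⟶ A ⊗ B) :
    hat₁₂ (f ≫ g) Z = hat₁₁ f Z ≫ hat₁₂ g Z := by simp [hat₁₂, hat₁₁]

lemma hat₀₁_comp (f : 𝟙_ V ⟶ A) (g : A ⟶ B) :
    hat₀₁ (f ≫ g) Z = hat₀₁ f Z ≫ hat₁₁ g Z := by simp [hat₀₁, hat₁₁]

lemma hat₁₀_comp (f : A ⟶ B) (g : B ⟶ 𝟙_ V) :
    hat₁₀ (f ≫ g) Z = hat₁₁ f Z ≫ hat₁₀ g Z := by simp [hat₁₀, hat₁₁]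

lemma hat₀₂_comp (f : 𝟙_ V ⟶ C) (g : C ⟶ A ⊗ B) :
    hat₀₂ (f ≫ g) Z = hat₀₁ f Z ≫ hat₁₂ g Z := by simp [hat₀₂, hat₀₁, hat₁₂]

lemma hat₂₀_comp (f : A ⊗ B ⟶ C) (g : C ⟶ 𝟙_ V) :
    hat₂₀ (f ≫ g) Z = hat₂₁ f Z ≫ hat₁₀ g Z := by simp [hat₂₀, hat₂₁, hat₁₀]

lemma hat₁₁_mid (f : A ⟶ B ⊗ C) (g : B ⊗ C ⟶ D) :
    hat₁₁ (f ≫ g) Z = hat₁₂ f Z ≫ hat₂₁ g Z := by simp [hat₁₁, hat₁₂, hat₂₁]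

lemma hat₁₁_zero (f : A ⟶ 𝟙_ V) (g : 𝟙_ V ⟶ B) :
    hat₁₁ (f ≫ g) Z = hat₁₀ f Z ≫ hat₀₁ g Z := by simp [hat₁₁, hat₁₀, hat₀₁]

lemma hat₂₁_lw (f : B ⟶ C) (g : A ⊗ C ⟶ D) :
    hat₂₁ (A ◁ f ≫ g) Z = A ◃ hat₁₁ f Z ≫ hat₂₁ g Z := by simp [hat₂₁, hat₁₁, lw]

lemma hat₂₁_rw (f : A ⟶ C) (g : C ⊗ B ⟶ D) :
    hat₂₁ (f ▷ B ≫ g) Z = hat₁₁ f (B ⊗ Z) ≫ hat₂₁ g Z := by simp [hat₂₁, hat₁₁]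

lemma hat₁₂_lw (f : B ⟶ C) (g : D ⟶ A ⊗ B) :
    hat₁₂ (g ≫ A ◁ f) Z = hat₁₂ g Z ≫ A ◃ hat₁₁ f Z := by simp [hat₁₂, hat₁₁, lw]

lemma hat₁₂_rw (f : A ⟶ C) (g : D ⟶ A ⊗ B) :
    hat₁₂ (g ≫ f ▷ B) Z = hat₁₂ g Z ≫ hat₁₁ f (B ⊗ Z) := by simp [hat₁₂, hat₁₁]

lemma hat₁₁_congr {f g : A ⟶ B} (h : ∀ Z, hat₁₁ f Z = hat₁₁ g Z) : f = g := by
  have := h (𝟙_ V)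
  rw [hat₁₁, hat₁₁] at this
  rwa [← MonoidalCategory.whiskerRight_iff]

lemma hat₂₁_congr {f g : A ⊗ B ⟶ C} (h : ∀ Z, hat₂₁ f Z = hat₂₁ g Z) : f = g := by
  refine hat₁₁_congr fun Z => ?_
  have := h Z
  rwa [hat₂₁, hat₂₁, cancel_epi] at this

lemma hat₁₂_congr {f g : C ⟶ A ⊗ B} (h : ∀ Z, hat₁₂ f Z = hat₁₂ g Z) : f = g := by
  refine hat₁₁_congr fun Z => ?_
  have := h Z
  rwa [hat₁₂, hat₁₂, cancel_mono] at this

lemma hat₀₁_congr {f g : 𝟙_ V ⟶ A} (h : ∀ Z, hat₀₁ f Z = hat₀₁ g Z) : f = g := by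
  refine hat₁₁_congr fun Z => ?_
  have := h Z
  rwa [hat₀₁, hat₀₁, cancel_epi] at this

lemma hat₁₀_congr {f g : A ⟶ 𝟙_ V} (h : ∀ Z, hat₁₀ f Z = hat₁₀ g Z) : f = g := by
  refine hat₁₁_congr fun Z => ?_
  have := h Z
  rwa [hat₁₀, hat₁₀, cancel_mono] at this

lemma hat₀₂_congr {f g : 𝟙_ V ⟶ A ⊗ B} (h : ∀ Z, hat₀₂ f Z = hat₀₂ g Z) : f = g := by
  refine hat₁₁_congr fun Z => ?_
  have := h Z
  rwa [hat₀₂, hat₀₂, cancel_epi, cancel_mono] at this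

lemma hat₂₀_congr {f g : A ⊗ B ⟶ 𝟙_ V} (h : ∀ Z, hat₂₀ f Z = hat₂₀ g Z) : f = g := by
  refine hat₁₁_congr fun Z => ?_
  have := h Z
  rwa [hat₂₀, hat₂₀, cancel_epi, cancel_mono] at this

end Composition

section Braiding

variable [BraidedCategory V]

/-- The braiding of the first two letters. -/
def swap (A B Z : V) : A ⊗ B ⊗ Z ⟶ B ⊗ A ⊗ Z :=
  (α_ A B Z).inv ≫ (β_ A B).hom ▷ Z ≫ (α_ B A Z).hom

/-- The inverse of `swap A B Z`. -/
def swapInv (A B Z : V) : B ⊗ A ⊗ Z ⟶ A ⊗ B ⊗ Z :=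
  (α_ B A Z).inv ≫ (β_ A B).inv ▷ Z ≫ (α_ A B Z).hom

@[simp] lemma swap_swapInv (A B Z : V) : swap A B Z ≫ swapInv A B Z = 𝟙 _ := by
  simp [swap, swapInv]

@[simp] lemma swapInv_swap (A B Z : V) : swapInv A B Z ≫ swap A B Z = 𝟙 _ := by
  simp [swap, swapInv]

@[simp] lemma swap_swapInv_assoc (A B Z : V) {W : V} (h : A ⊗ B ⊗ Z ⟶ W) :
    swap A B Z ≫ swapInv A B Z ≫ h = h := by
  simp [← Category.assoc]

@[simp] lemma swapInv_swap_assoc (A B Z : V) {W : V} (h : B ⊗ A ⊗ Z ⟶ W) :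
    swapInv A B Z ≫ swap A B Z ≫ h = h := by
  simp [← Category.assoc]

section Naturality

variable {A B : V} {Z Z' : V} (g : Z ⟶ Z')

@[simp] lemma swap_nat : swap A B Z ≫ B ◃ A ◃ g = A ◃ B ◃ g ≫ swap A B Z' := by
  simp only [swap, lw, Category.assoc]
  rw [associator_inv_naturality_right_assoc, whisker_exchange_assoc, associator_naturality_right]

@[simp] lemma swap_nat_assoc {W : V} (h : B ⊗ A ⊗ Z' ⟶ W) :
    swap A B Z ≫ B ◃ A ◃ g ≫ h = A ◃ B ◃ g ≫ swap A B Z' ≫ h := by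
  rw [← Category.assoc, swap_nat, Category.assoc]

@[simp] lemma swap_nat_left {Y : V} (r : A ⊗ Z' ⟶ Y) :
    swap A B Z ≫ B ◃ (A ◃ g ≫ r) = A ◃ B ◃ g ≫ swap A B Z' ≫ B ◃ r := by
  rw [← lw_comp, swap_nat_assoc]

@[simp] lemma swap_nat_left_assoc {Y W : V} (r : A ⊗ Z' ⟶ Y) (h : B ⊗ Y ⟶ W) :
    swap A B Z ≫ B ◃ (A ◃ g ≫ r) ≫ h = A ◃ B ◃ g ≫ swap A B Z' ≫ B ◃ r ≫ h := by
  rw [← lw_comp, Category.assoc, swap_nat_assoc]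

@[simp] lemma swapInv_nat : swapInv A B Z ≫ A ◃ B ◃ g = B ◃ A ◃ g ≫ swapInv A B Z' := by
  simp only [swapInv, lw, Category.assoc]
  rw [associator_inv_naturality_right_assoc, whisker_exchange_assoc, associator_naturality_right]

@[simp] lemma swapInv_nat_assoc {W : V} (h : A ⊗ B ⊗ Z' ⟶ W) :
    swapInv A B Z ≫ A ◃ B ◃ g ≫ h = B ◃ A ◃ g ≫ swapInv A B Z' ≫ h := by
  rw [← Category.assoc, swapInv_nat, Category.assoc]

@[simp] lemma swapInv_nat_left {Y : V} (r : B ⊗ Z' ⟶ Y) :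
    swapInv A B Z ≫ A ◃ (B ◃ g ≫ r) = B ◃ A ◃ g ≫ swapInv A B Z' ≫ A ◃ r := by
  rw [← lw_comp, swapInv_nat_assoc]

@[simp] lemma swapInv_nat_left_assoc {Y W : V} (r : B ⊗ Z' ⟶ Y) (h : A ⊗ Y ⟶ W) :
    swapInv A B Z ≫ A ◃ (B ◃ g ≫ r) ≫ h = B ◃ A ◃ g ≫ swapInv A B Z' ≫ A ◃ r ≫ h := by
  rw [← lw_comp, Category.assoc, swapInv_nat_assoc]

end Naturality

section Crossing

variable {A B C : V} (X Z : V)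

lemma lw_hat₁₁_swap (f : A ⟶ B) :
    X ◃ hat₁₁ f Z ≫ swap X B Z = swap X A Z ≫ hat₁₁ f (X ⊗ Z) := by
  simp only [lw, hat₁₁, swap, associator_inv_naturality_middle_assoc, Category.assoc]
  rw [← comp_whiskerRight_assoc, braiding_naturality_right]
  simp

lemma hat₁₁_swap (f : A ⟶ B) :
    hat₁₁ f (X ⊗ Z) ≫ swap B X Z = swap A X Z ≫ X ◃ hat₁₁ f Z := by
  simp only [lw, hat₁₁, swap, associator_inv_naturality_left_assoc, Category.assoc]
  rw [← comp_whiskerRight_assoc, braiding_naturality_left]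
  simp

lemma swap_tensor_right (A B : V) : swap X (A ⊗ B) Z =
    X ◁ (α_ A B Z).hom ≫ swap X A (B ⊗ Z) ≫ A ◃ swap X B Z ≫ (α_ A B (X ⊗ Z)).inv := by
  simp only [swap, lw, braiding_tensor_right_hom, MonoidalCategory.whiskerLeft_comp]
  monoidal

lemma swap_tensor_left (A B : V) : swap (A ⊗ B) X Z =
    (α_ A B (X ⊗ Z)).hom ≫ A ◃ swap B X Z ≫ swap A X (B ⊗ Z) ≫ X ◁ (α_ A B Z).inv := by
  simp only [swap, lw, braiding_tensor_left_hom, MonoidalCategory.whiskerLeft_comp]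
  monoidal

lemma swap_unit_right : swap X (𝟙_ V) Z = X ◁ (λ_ Z).hom ≫ (λ_ (X ⊗ Z)).inv := by
  simp only [swap, braiding_tensorUnit_right]
  monoidal

lemma swap_unit_left : swap (𝟙_ V) X Z = (λ_ (X ⊗ Z)).hom ≫ X ◁ (λ_ Z).inv := by
  simp only [swap, braiding_tensorUnit_left]
  monoidal

lemma lw_hat₂₁_swap (f : A ⊗ B ⟶ C) :
    X ◃ hat₂₁ f Z ≫ swap X C Z =
      swap X A (B ⊗ Z) ≫ A ◃ swap X B Z ≫ hat₂₁ f (X ⊗ Z) := by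
  have h := lw_hat₁₁_swap X Z f
  rw [swap_tensor_right] at h
  simp only [lw, hat₂₁, hat₁₁, MonoidalCategory.whiskerLeft_comp, Category.assoc] at h ⊢
  rw [h]
  simp

lemma hat₂₁_swap (f : A ⊗ B ⟶ C) :
    hat₂₁ f (X ⊗ Z) ≫ swap C X Z =
      A ◃ swap B X Z ≫ swap A X (B ⊗ Z) ≫ X ◃ hat₂₁ f Z := by
  have h := hat₁₁_swap X Z f
  rw [swap_tensor_left] at h
  simp only [lw, hat₂₁, hat₁₁, MonoidalCategory.whiskerLeft_comp, Category.assoc] at h ⊢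
  rw [h]
  simp

lemma lw_hat₁₂_swap (f : C ⟶ A ⊗ B) :
    X ◃ hat₁₂ f Z ≫ swap X A (B ⊗ Z) ≫ A ◃ swap X B Z = swap X C Z ≫ hat₁₂ f (X ⊗ Z) := by
  have h := lw_hat₁₁_swap X Z f
  rw [swap_tensor_right] at h
  simp only [lw, hat₁₂, hat₁₁, MonoidalCategory.whiskerLeft_comp, Category.assoc] at h ⊢
  rw [← reassoc_of% h]
  simp

lemma hat₁₂_swap (f : C ⟶ A ⊗ B) :
    hat₁₂ f (X ⊗ Z) ≫ A ◃ swap B X Z ≫ swap A X (B ⊗ Z) = swap C X Z ≫ X ◃ hat₁₂ f Z := by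
  have h := hat₁₁_swap X Z f
  rw [swap_tensor_left] at h
  simp only [lw, hat₁₂, hat₁₁, MonoidalCategory.whiskerLeft_comp, Category.assoc] at h ⊢
  rw [← reassoc_of% h]
  simp

lemma lw_hat₀₁_swap (f : 𝟙_ V ⟶ A) : X ◃ hat₀₁ f Z ≫ swap X A Z = hat₀₁ f (X ⊗ Z) := by
  have h := lw_hat₁₁_swap X Z f
  rw [swap_unit_right] at h
  simp only [lw, hat₀₁, hat₁₁, MonoidalCategory.whiskerLeft_comp, Category.assoc] at h ⊢
  rw [h]
  simp

lemma hat₀₁_swap (f : 𝟙_ V ⟶ A) : hat₀₁ f (X ⊗ Z) ≫ swap A X Z = X ◃ hat₀₁ f Z := by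
  have h := hat₁₁_swap X Z f
  rw [swap_unit_left] at h
  simp only [lw, hat₀₁, hat₁₁, MonoidalCategory.whiskerLeft_comp, Category.assoc] at h ⊢
  rw [h]
  simp

lemma swap_hat₁₀ (f : A ⟶ 𝟙_ V) : swap X A Z ≫ hat₁₀ f (X ⊗ Z) = X ◃ hat₁₀ f Z := by
  have h := lw_hat₁₁_swap X Z f
  rw [swap_unit_right] at h
  simp only [lw, hat₁₀, hat₁₁, MonoidalCategory.whiskerLeft_comp, Category.assoc] at h ⊢
  rw [← reassoc_of% h]
  simp

lemma swap_lw_hat₁₀ (f : A ⟶ 𝟙_ V) : swap A X Z ≫ X ◃ hat₁₀ f Z = hat₁₀ f (X ⊗ Z) := by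
  have h := hat₁₁_swap X Z f
  rw [swap_unit_left] at h
  simp only [lw, hat₁₀, hat₁₁, MonoidalCategory.whiskerLeft_comp, Category.assoc] at h ⊢
  rw [← reassoc_of% h]
  simp

lemma lw_hat₀₂_swap (f : 𝟙_ V ⟶ A ⊗ B) :
    X ◃ hat₀₂ f Z ≫ swap X A (B ⊗ Z) ≫ A ◃ swap X B Z = hat₀₂ f (X ⊗ Z) := by
  have h := lw_hat₀₁_swap X Z f
  rw [swap_tensor_right] at h
  simp only [lw, hat₀₂, hat₀₁, MonoidalCategory.whiskerLeft_comp, Category.assoc] at h ⊢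
  rw [← reassoc_of% h]
  simp

lemma hat₀₂_swap (f : 𝟙_ V ⟶ A ⊗ B) :
    hat₀₂ f (X ⊗ Z) ≫ A ◃ swap B X Z ≫ swap A X (B ⊗ Z) = X ◃ hat₀₂ f Z := by
  have h := hat₀₁_swap X Z f
  rw [swap_tensor_left] at h
  simp only [lw, hat₀₂, hat₀₁, MonoidalCategory.whiskerLeft_comp, Category.assoc] at h ⊢
  rw [← reassoc_of% h]
  simp

lemma swap_swap_hat₂₀ (f : A ⊗ B ⟶ 𝟙_ V) :
    swap X A (B ⊗ Z) ≫ A ◃ swap X B Z ≫ hat₂₀ f (X ⊗ Z) = X ◃ hat₂₀ f Z := by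
  have h := swap_hat₁₀ X Z f
  rw [swap_tensor_right] at h
  simp only [lw, hat₂₀, hat₁₀, MonoidalCategory.whiskerLeft_comp, Category.assoc] at h ⊢
  rw [← h]
  simp

lemma swap_swap_lw_hat₂₀ (f : A ⊗ B ⟶ 𝟙_ V) :
    A ◃ swap B X Z ≫ swap A X (B ⊗ Z) ≫ X ◃ hat₂₀ f Z = hat₂₀ f (X ⊗ Z) := by
  have h := swap_lw_hat₁₀ X Z f
  rw [swap_tensor_left] at h
  simp only [lw, hat₂₀, hat₁₀, MonoidalCategory.whiskerLeft_comp, Category.assoc] at h ⊢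
  rw [← h]
  simp

lemma swap_yang_baxter (A B C Z : V) :
    swap A B (C ⊗ Z) ≫ B ◃ swap A C Z ≫ swap B C (A ⊗ Z) =
      A ◃ swap B C Z ≫ swap A C (B ⊗ Z) ≫ C ◃ swap A B Z := by
  have h := lw_hat₁₁_swap A Z (β_ B C).hom
  rw [swap_tensor_right, swap_tensor_right] at h
  simp only [lw, hat₁₁, swap, MonoidalCategory.whiskerLeft_comp, Category.assoc] at h ⊢
  have h' := A ◁ (α_ B C Z).inv ≫= h =≫ (α_ C B (A ⊗ Z)).hom
  simp only [Category.assoc, Iso.inv_hom_id, Category.comp_id] at h'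
  rw [h', whiskerLeft_inv_hom_assoc]

end Crossing

end Braiding

end Calculus

end Tannaka
namespace Tannaka

section WeakBialgebraCalculus

open scoped MonObj ComonObj

variable {V : Type u} [Category.{v} V] [MonoidalCategory V]

/-- The flattening of a map `A ⊗ B ⟶ C ⊗ D`. -/
def hat₂₂ {A B C D : V} (f : A ⊗ B ⟶ C ⊗ D) (Z : V) : A ⊗ B ⊗ Z ⟶ C ⊗ D ⊗ Z :=
  (α_ A B Z).inv ≫ f ▷ Z ≫ (α_ C D Z).hom

lemma hat₂₂_mid {A B C D E : V} (f : A ⊗ B ⟶ E) (g : E ⟶ C ⊗ D) (Z : V) :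
    hat₂₂ (f ≫ g) Z = hat₂₁ f Z ≫ hat₁₂ g Z := by
  simp [hat₂₂, hat₂₁, hat₁₂]

lemma hat₂₂_congr {A B C D : V} {f g : A ⊗ B ⟶ C ⊗ D} (h : ∀ Z, hat₂₂ f Z = hat₂₂ g Z) :
    f = g := by
  refine hat₁₁_congr fun Z => ?_
  have := h Z
  rwa [hat₂₂, hat₂₂, cancel_epi, cancel_mono] at this

/-- The flattening of a map `⊤ ⟶ A ⊗ (B ⊗ C)`. -/
def hat₀₃ {A B C : V} (f : 𝟙_ V ⟶ A ⊗ B ⊗ C) (Z : V) : Z ⟶ A ⊗ B ⊗ C ⊗ Z :=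
  (λ_ Z).inv ≫ f ▷ Z ≫ (α_ A (B ⊗ C) Z).hom ≫ A ◁ (α_ B C Z).hom

/-- The flattening of a map `(A ⊗ B) ⊗ C ⟶ ⊤`. -/
def hat₃₀ {A B C : V} (f : (A ⊗ B) ⊗ C ⟶ 𝟙_ V) (Z : V) : A ⊗ B ⊗ C ⊗ Z ⟶ Z :=
  (α_ A B (C ⊗ Z)).inv ≫ (α_ (A ⊗ B) C Z).inv ≫ f ▷ Z ≫ (λ_ Z).hom

/-- `hat₃₂` flattens a map `X ⊗ (A ⊗ B) ⟶ C ⊗ D`. -/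
def hat₃₂ {X A B C D : V} (f : X ⊗ (A ⊗ B) ⟶ C ⊗ D) (Z : V) : X ⊗ A ⊗ B ⊗ Z ⟶ C ⊗ D ⊗ Z :=
  X ◁ (α_ A B Z).inv ≫ (α_ X (A ⊗ B) Z).inv ≫ f ▷ Z ≫ (α_ C D Z).hom

lemma hat₃₂_congr {X A B C D : V} {f g : X ⊗ (A ⊗ B) ⟶ C ⊗ D}
    (h : ∀ Z, hat₃₂ f Z = hat₃₂ g Z) : f = g := by
  refine hat₁₁_congr fun Z => ?_
  have := h Z
  rwa [hat₃₂, hat₃₂, cancel_epi, cancel_epi, cancel_mono] at this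

lemma hat₃₀_congr {A B C : V} {f g : (A ⊗ B) ⊗ C ⟶ 𝟙_ V} (h : ∀ Z, hat₃₀ f Z = hat₃₀ g Z) :
    f = g := by
  refine hat₁₁_congr fun Z => ?_
  have := h Z
  rwa [hat₃₀, hat₃₀, cancel_epi, cancel_epi, cancel_mono] at this

section Mon

variable (H : V) [MonObj H] (Z : V)

@[simp] lemma hat_mul_assoc : hat₂₁ μ[H] (H ⊗ Z) ≫ hat₂₁ μ[H] Z = H ◃ hat₂₁ μ[H] Z ≫ hat₂₁ μ[H] Z := by
  have := congrArg (· ▷ Z) (MonObj.mul_assoc H)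
  simp only [comp_whiskerRight] at this
  simp only [hat₂₁, lw, MonoidalCategory.whiskerLeft_comp, Category.assoc]
  rw [associator_inv_naturality_left_assoc, this]
  simp

@[simp] lemma hat_one_mul : hat₀₁ η[H] (H ⊗ Z) ≫ hat₂₁ μ[H] Z = 𝟙 _ := by
  have := congrArg (· ▷ Z) (MonObj.one_mul H)
  simp only [comp_whiskerRight] at this
  simp only [hat₂₁, hat₀₁, Category.assoc]
  rw [associator_inv_naturality_left_assoc, this]
  simp

@[simp] lemma hat_mul_one : H ◃ hat₀₁ η[H] Z ≫ hat₂₁ μ[H] Z = 𝟙 _ := by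
  have := congrArg (· ▷ Z) (MonObj.mul_one H)
  simp only [comp_whiskerRight] at this
  simp only [hat₂₁, hat₀₁, lw, MonoidalCategory.whiskerLeft_comp, Category.assoc]
  rw [associator_inv_naturality_middle_assoc, this]
  simp

@[simp] lemma hat_mul_assoc_assoc {W : V} (g : H ⊗ Z ⟶ W) :
    hat₂₁ μ[H] (H ⊗ Z) ≫ hat₂₁ μ[H] Z ≫ g = H ◃ hat₂₁ μ[H] Z ≫ hat₂₁ μ[H] Z ≫ g := by
  rw [← Category.assoc, hat_mul_assoc, Category.assoc]

@[simp] lemma hat_one_mul_assoc {W : V} (g : H ⊗ Z ⟶ W) :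
    hat₀₁ η[H] (H ⊗ Z) ≫ hat₂₁ μ[H] Z ≫ g = g := by
  rw [← Category.assoc, hat_one_mul, Category.id_comp]

@[simp] lemma hat_mul_one_assoc {W : V} (g : H ⊗ Z ⟶ W) :
    H ◃ hat₀₁ η[H] Z ≫ hat₂₁ μ[H] Z ≫ g = g := by
  rw [← Category.assoc, hat_mul_one, Category.id_comp]

@[simp] lemma hat_mul_one_left {Y : V} (f : Y ⟶ Z) :
    H ◃ (f ≫ hat₀₁ η[H] Z) ≫ hat₂₁ μ[H] Z = H ◃ f := by
  rw [← lw_comp, Category.assoc, hat_mul_one, Category.comp_id]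

@[simp] lemma hat_mul_one_left_assoc {Y W : V} (f : Y ⟶ Z) (g : H ⊗ Z ⟶ W) :
    H ◃ (f ≫ hat₀₁ η[H] Z) ≫ hat₂₁ μ[H] Z ≫ g = H ◃ f ≫ g := by
  rw [← Category.assoc, hat_mul_one_left]

end Mon

section Comon

variable (H : V) [ComonObj H] (Z : V)

@[simp] lemma hat_comul_assoc :
    hat₁₂ Δ[H] Z ≫ hat₁₂ Δ[H] (H ⊗ Z) = hat₁₂ Δ[H] Z ≫ H ◃ hat₁₂ Δ[H] Z := by
  have := congrArg (· ▷ Z) (ComonObj.comul_assoc H)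
  simp only [comp_whiskerRight] at this
  simp only [hat₁₂, lw, MonoidalCategory.whiskerLeft_comp, Category.assoc]
  rw [← associator_naturality_middle_assoc, reassoc_of% this]
  simp

@[simp] lemma hat_counit_comul : hat₁₂ Δ[H] Z ≫ hat₁₀ ε[H] (H ⊗ Z) = 𝟙 _ := by
  have := congrArg (· ▷ Z) (ComonObj.counit_comul H)
  simp only [comp_whiskerRight] at this
  simp only [hat₁₂, hat₁₀, lw, MonoidalCategory.whiskerLeft_comp, Category.assoc]
  rw [← associator_naturality_left_assoc, reassoc_of% this]
  simp

@[simp] lemma hat_comul_counit : hat₁₂ Δ[H] Z ≫ H ◃ hat₁₀ ε[H] Z = 𝟙 _ := by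
  have := congrArg (· ▷ Z) (ComonObj.comul_counit H)
  simp only [comp_whiskerRight] at this
  simp only [hat₁₂, hat₁₀, lw, MonoidalCategory.whiskerLeft_comp, Category.assoc]
  rw [← associator_naturality_middle_assoc, reassoc_of% this]
  simp

@[simp] lemma hat_comul_assoc_assoc {W : V} (g : H ⊗ H ⊗ H ⊗ Z ⟶ W) :
    hat₁₂ Δ[H] Z ≫ hat₁₂ Δ[H] (H ⊗ Z) ≫ g = hat₁₂ Δ[H] Z ≫ H ◃ hat₁₂ Δ[H] Z ≫ g := by
  rw [← Category.assoc, hat_comul_assoc, Category.assoc]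

@[simp] lemma hat_comul_assoc_mid {Y : V} (f : H ⊗ Z ⟶ Y) :
    hat₁₂ Δ[H] Z ≫ H ◃ f ≫ hat₁₂ Δ[H] Y = hat₁₂ Δ[H] Z ≫ H ◃ (hat₁₂ Δ[H] Z ≫ H ◃ f) := by
  rw [← hat₁₂_nat, hat_comul_assoc_assoc, lw_comp]

@[simp] lemma hat_comul_assoc_mid_assoc {Y W : V} (f : H ⊗ Z ⟶ Y) (g : H ⊗ H ⊗ Y ⟶ W) :
    hat₁₂ Δ[H] Z ≫ H ◃ f ≫ hat₁₂ Δ[H] Y ≫ g =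
      hat₁₂ Δ[H] Z ≫ H ◃ (hat₁₂ Δ[H] Z ≫ H ◃ f) ≫ g := by
  rw [← hat₁₂_nat_assoc, hat_comul_assoc_assoc, lw_comp_assoc]

@[simp] lemma hat_comul_counit_assoc {W : V} (g : H ⊗ Z ⟶ W) :
    hat₁₂ Δ[H] Z ≫ H ◃ hat₁₀ ε[H] Z ≫ g = g := by
  rw [← Category.assoc, hat_comul_counit, Category.id_comp]

end Comon

variable [BraidedCategory V] (H : V)

lemma hat_act₂ (Z : V) {X a b : V} (f : X ⟶ H ⊗ H) (x : H ⊗ a ⟶ a) (y : H ⊗ b ⟶ b) :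
    hat₃₂ (f ▷ (a ⊗ b) ≫ act₂ x y) Z =
      hat₁₂ f (a ⊗ b ⊗ Z) ≫ H ◃ (swap H a (b ⊗ Z) ≫ a ◃ hat₂₁ y Z) ≫ hat₂₁ x (b ⊗ Z) := by
  simp only [hat₁₂, hat₂₁, hat₃₂, lw, swap, act₂, tensorμ, MonoidalCategory.tensorHom_def',
    MonoidalCategory.whiskerLeft_comp, comp_whiskerRight, Category.assoc]
  monoidal

section Flatten

variable [MonObj H] [ComonObj H] (Z : V)

lemma hat_sqMul {X Y A : V} (M : V) [MonObj M] (f : A ⟶ X ⊗ Y) (x : X ⟶ M ⊗ M)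
    (y : Y ⟶ M ⊗ M) :
    hat₁₂ (f ≫ sqMul M x y) Z = hat₁₂ f Z ≫ X ◃ hat₁₂ y Z ≫ hat₁₂ x (M ⊗ M ⊗ Z) ≫
      M ◃ (swap M M (M ⊗ Z) ≫ M ◃ hat₂₁ μ[M] Z) ≫ hat₂₁ μ[M] (M ⊗ Z) := by
  simp only [hat₁₂, hat₂₁, lw, swap, sqMul, tensorμ, MonoidalCategory.tensorHom_def',
    MonoidalCategory.whiskerLeft_comp, comp_whiskerRight, Category.assoc]
  monoidal

lemma hat_mul_comul_rhs :
    hat₂₂ ((Δ[H] ⊗ₘ Δ[H]) ≫ tensorμ H H H H ≫ (μ[H] ⊗ₘ μ[H])) Z =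
      H ◃ hat₁₂ Δ[H] Z ≫ hat₁₂ Δ[H] (H ⊗ H ⊗ Z) ≫
        H ◃ (swap H H (H ⊗ Z) ≫ H ◃ hat₂₁ μ[H] Z) ≫ hat₂₁ μ[H] (H ⊗ Z) := by
  simp only [hat₁₂, hat₂₁, hat₂₂, lw, swap, tensorμ, MonoidalCategory.tensorHom_def',
    MonoidalCategory.whiskerLeft_comp, comp_whiskerRight, Category.assoc]
  monoidal

lemma hat_mulMiddle (n : 𝟙_ V ⟶ H ⊗ H) (q : H ⊗ H ⟶ H) :
    hat₀₃ ((λ_ (𝟙_ V)).inv ≫ (n ⊗ₘ n) ≫ mulMiddle q) Z =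
      hat₀₂ n Z ≫ hat₀₂ n (H ⊗ H ⊗ Z) ≫ H ◃ hat₂₁ q (H ⊗ Z) := by
  simp only [hat₀₃, hat₀₂, hat₂₁, lw, mulMiddle, MonoidalCategory.tensorHom_def',
    MonoidalCategory.whiskerLeft_comp, comp_whiskerRight, Category.assoc]
  monoidal

lemma hat_comulMiddle (n : H ⊗ H ⟶ 𝟙_ V) (q : H ⟶ H ⊗ H) :
    hat₃₀ (comulMiddle q ≫ (n ⊗ₘ n) ≫ (λ_ (𝟙_ V)).hom) Z =
      H ◃ (hat₁₂ q (H ⊗ Z) ≫ H ◃ hat₂₀ n Z) ≫ hat₂₀ n Z := by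
  simp only [hat₃₀, hat₁₂, hat₂₀, lw, comulMiddle, MonoidalCategory.tensorHom_def',
    MonoidalCategory.whiskerLeft_comp, comp_whiskerRight, Category.assoc]
  monoidal

lemma hat_one_comul_comul : hat₀₃ (η[H] ≫ Δ[H] ≫ H ◁ Δ[H]) Z =
    hat₀₁ η[H] Z ≫ hat₁₂ Δ[H] Z ≫ H ◃ hat₁₂ Δ[H] Z := by
  simp only [hat₀₃, hat₁₂, hat₀₁, lw, MonoidalCategory.whiskerLeft_comp, comp_whiskerRight,
    Category.assoc]
  monoidal

lemma hat_mul_mul_counit : hat₃₀ (μ[H] ▷ H ≫ μ[H] ≫ ε[H]) Z =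
    hat₂₁ μ[H] (H ⊗ Z) ≫ hat₂₁ μ[H] Z ≫ hat₁₀ ε[H] Z := by
  simp only [hat₃₀, hat₂₁, hat₁₀, lw, MonoidalCategory.whiskerLeft_comp, comp_whiskerRight,
    Category.assoc]
  monoidal

lemma hat_braiding_inv_mul :
    hat₂₁ ((β_ H H).inv ≫ μ[H]) Z = swapInv H H Z ≫ hat₂₁ μ[H] Z := by
  simp [hat₂₁, swapInv]

lemma hat_comul_braiding_inv :
    hat₁₂ (Δ[H] ≫ (β_ H H).inv) Z = hat₁₂ Δ[H] Z ≫ swapInv H H Z := by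
  simp [hat₁₂, swapInv]

lemma hat_idemS : hat₁₁ (idemS H) Z = hat₀₁ η[H] (H ⊗ Z) ≫ hat₁₂ Δ[H] (H ⊗ Z) ≫
    H ◃ (hat₂₁ μ[H] Z ≫ hat₁₀ ε[H] Z) := by
  simp only [hat₁₁, hat₁₂, hat₂₁, hat₁₀, hat₀₁, lw, idemS, MonoidalCategory.whiskerLeft_comp,
    comp_whiskerRight, Category.assoc]
  monoidal

lemma hat_idemT : hat₁₁ (idemT H) Z = hat₀₁ η[H] (H ⊗ Z) ≫ hat₁₂ Δ[H] (H ⊗ Z) ≫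
    H ◃ swap H H Z ≫ hat₂₁ μ[H] (H ⊗ Z) ≫ hat₁₀ ε[H] (H ⊗ Z) := by
  simp only [hat₁₁, hat₁₂, hat₂₁, hat₁₀, hat₀₁, lw, swap, idemT,
    MonoidalCategory.whiskerLeft_comp, comp_whiskerRight, Category.assoc]
  monoidal

lemma hat_idemZ : hat₁₁ (idemZ H) Z = H ◃ (hat₀₁ η[H] Z ≫ hat₁₂ Δ[H] Z) ≫
    hat₂₁ μ[H] (H ⊗ Z) ≫ hat₁₀ ε[H] (H ⊗ Z) := by
  simp only [hat₁₁, hat₁₂, hat₂₁, hat₁₀, hat₀₁, lw, idemZ, MonoidalCategory.whiskerLeft_comp,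
    comp_whiskerRight, Category.assoc]
  monoidal

lemma hat_idemR : hat₁₁ (idemR H) Z = H ◃ (hat₀₁ η[H] Z ≫ hat₁₂ Δ[H] Z) ≫
    swap H H (H ⊗ Z) ≫ H ◃ (hat₂₁ μ[H] Z ≫ hat₁₀ ε[H] Z) := by
  simp only [hat₁₁, hat₁₂, hat₂₁, hat₁₀, hat₀₁, lw, swap, idemR,
    MonoidalCategory.whiskerLeft_comp, comp_whiskerRight, Category.assoc]
  monoidal

lemma hat_convMul (f g : H ⟶ H) : hat₁₁ (convMul f g) Z =
    hat₁₂ Δ[H] Z ≫ H ◃ hat₁₁ g Z ≫ hat₁₁ f (H ⊗ Z) ≫ hat₂₁ μ[H] Z := by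
  simp only [hat₁₁, hat₁₂, hat₂₁, lw, convMul, MonoidalCategory.tensorHom_def',
    MonoidalCategory.whiskerLeft_comp, comp_whiskerRight, Category.assoc]
  monoidal

end Flatten

section Axioms

variable [WeakBimonObj H] (Z : V)

lemma hat_mul_comul : hat₂₁ μ[H] Z ≫ hat₁₂ Δ[H] Z =
    H ◃ hat₁₂ Δ[H] Z ≫ hat₁₂ Δ[H] (H ⊗ H ⊗ Z) ≫
      H ◃ (swap H H (H ⊗ Z) ≫ H ◃ hat₂₁ μ[H] Z) ≫ hat₂₁ μ[H] (H ⊗ Z) := by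
  rw [← hat_mul_comul_rhs, ← WeakBimonObj.mul_comul, hat₂₂_mid]

lemma hat_weak_unit : hat₀₁ η[H] Z ≫ hat₁₂ Δ[H] Z ≫ hat₀₁ η[H] (H ⊗ H ⊗ Z) ≫
      hat₁₂ Δ[H] (H ⊗ H ⊗ Z) ≫ H ◃ hat₂₁ μ[H] (H ⊗ Z) =
    hat₀₁ η[H] Z ≫ hat₁₂ Δ[H] Z ≫ H ◃ hat₁₂ Δ[H] Z := by
  have h := hat_mulMiddle H Z (η[H] ≫ Δ[H]) μ[H]
  rw [WeakBimonObj.weak_unit, hat_one_comul_comul] at h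
  simp only [hat₀₂_comp, Category.assoc] at h
  exact h.symm

lemma hat_weak_unit_inv : hat₀₁ η[H] Z ≫ hat₁₂ Δ[H] Z ≫ hat₀₁ η[H] (H ⊗ H ⊗ Z) ≫
      hat₁₂ Δ[H] (H ⊗ H ⊗ Z) ≫ H ◃ (swapInv H H (H ⊗ Z) ≫ hat₂₁ μ[H] (H ⊗ Z)) =
    hat₀₁ η[H] Z ≫ hat₁₂ Δ[H] Z ≫ H ◃ hat₁₂ Δ[H] Z := by
  have h := hat_mulMiddle H Z (η[H] ≫ Δ[H]) ((β_ H H).inv ≫ μ[H])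
  rw [WeakBimonObj.weak_unit', hat_one_comul_comul, hat_braiding_inv_mul] at h
  simp only [hat₀₂_comp, Category.assoc] at h
  exact h.symm

lemma hat_weak_counit : H ◃ (hat₁₂ Δ[H] (H ⊗ Z) ≫ H ◃ (hat₂₁ μ[H] Z ≫ hat₁₀ ε[H] Z)) ≫
      hat₂₁ μ[H] Z ≫ hat₁₀ ε[H] Z =
    H ◃ hat₂₁ μ[H] Z ≫ hat₂₁ μ[H] Z ≫ hat₁₀ ε[H] Z := by
  have h := hat_comulMiddle H Z (μ[H] ≫ ε[H]) Δ[H]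
  rw [WeakBimonObj.weak_counit, hat_mul_mul_counit, hat₂₀_comp, hat_mul_assoc_assoc] at h
  exact h.symm

lemma hat_weak_counit_inv : H ◃ (hat₁₂ Δ[H] (H ⊗ Z) ≫ swapInv H H (H ⊗ Z) ≫
        H ◃ (hat₂₁ μ[H] Z ≫ hat₁₀ ε[H] Z)) ≫ hat₂₁ μ[H] Z ≫ hat₁₀ ε[H] Z =
    H ◃ hat₂₁ μ[H] Z ≫ hat₂₁ μ[H] Z ≫ hat₁₀ ε[H] Z := by
  have h := hat_comulMiddle H Z (μ[H] ≫ ε[H]) (Δ[H] ≫ (β_ H H).inv)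
  rw [WeakBimonObj.weak_counit', hat_mul_mul_counit, hat_comul_braiding_inv, hat₂₀_comp,
    Category.assoc, hat_mul_assoc_assoc] at h
  exact h.symm

end Axioms

end WeakBialgebraCalculus

end Tannaka
namespace Tannaka

section WeakBialgebraIdentities

open scoped MonObj ComonObj

variable {V : Type u} [Category.{v} V] [MonoidalCategory V] [BraidedCategory V]
  (H : V) [WeakBimonObj H] (Z : V)

local notation "𝐦" => hat₂₁ (MonObj.mul (X := H))
local notation "𝐮" => hat₀₁ (MonObj.one (X := H))
local notation "𝐝" => hat₁₂ (ComonObj.comul (X := H))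
local notation "𝐞" => hat₁₀ (ComonObj.counit (X := H))
local notation "𝐬" => hat₁₁ (idemS H)
local notation "𝐭" => hat₁₁ (idemT H)
local notation "𝐳" => hat₁₁ (idemZ H)
local notation "𝐫" => hat₁₁ (idemR H)
local notation "𝐱" => swap H H

lemma weak_unit_swap : 𝐮 Z ≫ 𝐝 Z ≫ H ◃ (𝐮 (H ⊗ Z) ≫ 𝐝 (H ⊗ Z) ≫ H ◃ 𝐱 Z ≫ 𝐦 (H ⊗ Z)) =
    𝐮 Z ≫ 𝐝 Z ≫ H ◃ 𝐝 Z := by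
  have h := hat₀₂_swap H Z (η[H] ≫ Δ[H])
  have h' : 𝐮 (H ⊗ Z) ≫ 𝐝 (H ⊗ Z) ≫ H ◃ 𝐱 Z = H ◃ (𝐮 Z ≫ 𝐝 Z) ≫ swapInv H H (H ⊗ Z) := by
    simp only [hat₀₂_comp, Category.assoc] at h
    rw [← h]
    simp
  rw [reassoc_of% h', ← hat_weak_unit_inv]
  simp

lemma weak_counit_swap :
    H ◃ (𝐝 (H ⊗ Z) ≫ H ◃ 𝐱 Z ≫ 𝐦 (H ⊗ Z) ≫ 𝐞 (H ⊗ Z)) ≫ 𝐦 Z ≫ 𝐞 Z =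
      H ◃ 𝐦 Z ≫ 𝐦 Z ≫ 𝐞 Z := by
  have h := swap_swap_hat₂₀ H Z (μ[H] ≫ ε[H])
  have h' : H ◃ 𝐱 Z ≫ 𝐦 (H ⊗ Z) ≫ 𝐞 (H ⊗ Z) =
      swapInv H H (H ⊗ Z) ≫ H ◃ (𝐦 Z ≫ 𝐞 Z) := by
    rw [hat₂₀_comp, hat₂₀_comp] at h
    rw [← h]
    simp
  rw [h', ← hat_weak_counit_inv]

/-- `ε(a t(b)) = ε(ab)`. -/
lemma idemT_mul_counit : H ◃ 𝐭 Z ≫ 𝐦 Z ≫ 𝐞 Z = 𝐦 Z ≫ 𝐞 Z := by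
  have h := H ◃ 𝐮 (H ⊗ Z) ≫= weak_counit_swap H Z
  rw [hat_idemT]
  simpa using h

/-- `ε(a s(b)) = ε(ab)`. -/
lemma idemS_mul_counit : H ◃ 𝐬 Z ≫ 𝐦 Z ≫ 𝐞 Z = 𝐦 Z ≫ 𝐞 Z := by
  have h := H ◃ 𝐮 (H ⊗ Z) ≫= hat_weak_counit H Z
  rw [hat_idemS]
  simpa using h

/-- `ε(r(a) b) = ε(ab)`. -/
lemma idemR_mul_counit : 𝐫 (H ⊗ Z) ≫ 𝐦 Z ≫ 𝐞 Z = 𝐦 Z ≫ 𝐞 Z := by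
  have h := H ◃ 𝐮 (H ⊗ Z) ≫= hat_weak_counit_inv H Z
  have h' := swap_swap_lw_hat₂₀ H (H ⊗ Z) (μ[H] ≫ ε[H])
  rw [hat₂₀_comp, hat₂₀_comp] at h'
  have h'' : 𝐱 (H ⊗ H ⊗ Z) ≫ H ◃ (𝐦 (H ⊗ Z) ≫ 𝐞 (H ⊗ Z)) =
      H ◃ swapInv H H (H ⊗ Z) ≫ 𝐦 (H ⊗ H ⊗ Z) ≫ 𝐞 (H ⊗ H ⊗ Z) := by
    rw [← h']
    simp
  rw [hat_idemR]
  simp only [Category.assoc]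
  rw [reassoc_of% h'']
  simpa using h

/-- `b₁ ε(b₂c) = b s(c)`. -/
lemma comul_mul_counit : 𝐝 (H ⊗ Z) ≫ H ◃ (𝐦 Z ≫ 𝐞 Z) = H ◃ 𝐬 Z ≫ 𝐦 Z := by
  calc _ = H ◃ 𝐮 (H ⊗ Z) ≫ (𝐦 (H ⊗ Z) ≫ 𝐝 (H ⊗ Z)) ≫ H ◃ (𝐦 Z ≫ 𝐞 Z) := by simp
    _ = H ◃ (𝐮 (H ⊗ Z) ≫ 𝐝 (H ⊗ Z)) ≫ 𝐝 _ ≫ H ◃ (𝐱 _ ≫ H ◃ (H ◃ 𝐦 Z ≫ 𝐦 Z ≫ 𝐞 Z)) ≫ 𝐦 Z := by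
      rw [hat_mul_comul]; simp
    _ = H ◃ (𝐮 (H ⊗ Z) ≫ 𝐝 (H ⊗ Z) ≫ H ◃ (𝐦 Z ≫ 𝐞 Z)) ≫ (𝐦 Z ≫ 𝐝 Z) ≫ H ◃ 𝐞 Z := by
      rw [← hat_weak_counit, hat_mul_comul]; simp
    _ = _ := by rw [hat_idemS]; simp

/-- The map `b ⊗ c ↦ ε(b₁c) b₂`. -/
def comulMulCounit : H ⊗ H ⟶ H :=
  Δ[H] ▷ H ≫ (α_ H H H).hom ≫ H ◁ (β_ H H).hom ≫ (α_ H H H).inv ≫ (μ[H] ≫ ε[H]) ▷ H ≫ (λ_ H).hom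

lemma hat_comulMulCounit : hat₂₁ (comulMulCounit H) Z =
    𝐝 (H ⊗ Z) ≫ H ◃ 𝐱 Z ≫ 𝐦 (H ⊗ Z) ≫ 𝐞 (H ⊗ Z) := by
  simp only [comulMulCounit, hat₁₂, hat₂₁, hat₁₀, lw, swap, MonoidalCategory.whiskerLeft_comp,
    comp_whiskerRight, Category.assoc]
  monoidal

/-- `ε(b₁c) b₂ = b t(c)`. -/
lemma comul_mul_counit_swap :
    𝐝 (H ⊗ Z) ≫ H ◃ 𝐱 Z ≫ 𝐦 (H ⊗ Z) ≫ 𝐞 (H ⊗ Z) = H ◃ 𝐭 Z ≫ 𝐦 Z := by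
  have h₁ := hat₂₁_swap H Z μ[H]
  have h₂ := lw_hat₂₁_swap H (H ⊗ Z) (comulMulCounit H)
  have h₃ := weak_counit_swap H (H ⊗ Z)
  have h₄ := hat₁₂_swap H Z Δ[H]
  rw [← hat_comulMulCounit] at h₃
  calc _ = H ◃ 𝐮 (H ⊗ Z) ≫ (𝐦 (H ⊗ Z) ≫ 𝐝 (H ⊗ Z)) ≫ H ◃ 𝐱 Z ≫ 𝐦 (H ⊗ Z) ≫ 𝐞 (H ⊗ Z) := by
        simp
    _ = H ◃ (𝐮 (H ⊗ Z) ≫ 𝐝 (H ⊗ Z)) ≫ 𝐝 _ ≫ H ◃ (𝐱 _ ≫ H ◃ (H ◃ 𝐱 Z ≫ 𝐱 (H ⊗ Z) ≫ H ◃ 𝐦 Z)) ≫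
          H ◃ 𝐦 (H ⊗ Z) ≫ 𝐦 (H ⊗ Z) ≫ 𝐞 (H ⊗ Z) := by
      rw [← h₁, hat_mul_comul]; simp
    _ = H ◃ (𝐮 (H ⊗ Z) ≫ 𝐝 (H ⊗ Z) ≫ H ◃ 𝐱 Z) ≫ 𝐝 _ ≫
          H ◃ ((𝐱 _ ≫ H ◃ 𝐱 (H ⊗ Z) ≫ hat₂₁ (comulMulCounit H) _) ≫ H ◃ 𝐦 Z) ≫
          𝐦 (H ⊗ Z) ≫ 𝐞 (H ⊗ Z) := by
      rw [← h₃]; simp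
    _ = H ◃ (𝐮 (H ⊗ Z) ≫ 𝐝 (H ⊗ Z) ≫ H ◃ (𝐱 Z ≫ H ◃ 𝐝 Z) ≫ 𝐦 _ ≫ 𝐞 _) ≫ 𝐝 _ ≫
          H ◃ (𝐱 _ ≫ H ◃ 𝐦 Z) ≫ 𝐦 (H ⊗ Z) ≫ 𝐞 (H ⊗ Z) := by
      rw [← h₂, hat_comulMulCounit, ← h₄]; simp
    _ = H ◃ (𝐮 (H ⊗ Z) ≫ 𝐝 (H ⊗ Z) ≫ H ◃ 𝐱 Z ≫ 𝐦 _ ≫ 𝐞 _) ≫ (𝐦 Z ≫ 𝐝 Z) ≫ 𝐞 (H ⊗ Z) := by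
      rw [hat_mul_comul]; simp
    _ = _ := by rw [hat_idemT]; simp

/-- The map `h ↦ 1₁h ⊗ 1₂`. -/
def oneComulMul : H ⟶ H ⊗ H :=
  (λ_ H).inv ≫ (η[H] ≫ Δ[H]) ▷ H ≫ (α_ H H H).hom ≫ H ◁ (β_ H H).hom ≫ (α_ H H H).inv ≫ μ[H] ▷ H

lemma hat_oneComulMul : hat₁₂ (oneComulMul H) Z =
    𝐮 (H ⊗ Z) ≫ 𝐝 (H ⊗ Z) ≫ H ◃ 𝐱 Z ≫ 𝐦 (H ⊗ Z) := by
  simp only [oneComulMul, hat₁₂, hat₂₁, hat₀₁, lw, swap, MonoidalCategory.whiskerLeft_comp,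
    comp_whiskerRight, Category.assoc]
  monoidal

/-- `t(ab) = ε(1₁ab) 1₂`. -/
lemma mul_idemT : 𝐦 Z ≫ 𝐭 Z = hat₁₂ (oneComulMul H) (H ⊗ Z) ≫ H ◃ 𝐱 Z ≫ 𝐦 (H ⊗ Z) ≫
    𝐞 (H ⊗ Z) := by
  calc _ = 𝐮 _ ≫ 𝐝 _ ≫ H ◃ (H ◃ 𝐦 Z ≫ 𝐱 Z) ≫ 𝐦 (H ⊗ Z) ≫ 𝐞 (H ⊗ Z) := by
        rw [hat_idemT]; simp
    _ = _ := by rw [lw_hat₂₁_swap, hat_oneComulMul]; simp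

/-- `t(a s(b)) = t(ab)`. -/
lemma idemS_mul_idemT : H ◃ 𝐬 Z ≫ 𝐦 Z ≫ 𝐭 Z = 𝐦 Z ≫ 𝐭 Z := by
  have h₁ := lw_hat₁₁_swap H Z (idemS H)
  calc _ = hat₁₂ (oneComulMul H) (H ⊗ Z) ≫ H ◃ (H ◃ 𝐬 Z ≫ 𝐱 Z) ≫ 𝐦 (H ⊗ Z) ≫ 𝐞 (H ⊗ Z) := by
        rw [mul_idemT]; simp
    _ = hat₁₂ (oneComulMul H) (H ⊗ Z) ≫ H ◃ 𝐱 Z ≫ H ◃ 𝐬 _ ≫ 𝐦 (H ⊗ Z) ≫ 𝐞 (H ⊗ Z) := by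
      rw [h₁]; simp
    _ = _ := by rw [idemS_mul_counit, mul_idemT]

/-- `t(a t(b)) = t(ab)`. -/
lemma idemT_mul_idemT : H ◃ 𝐭 Z ≫ 𝐦 Z ≫ 𝐭 Z = 𝐦 Z ≫ 𝐭 Z := by
  have h₁ := lw_hat₁₁_swap H Z (idemT H)
  calc _ = hat₁₂ (oneComulMul H) (H ⊗ Z) ≫ H ◃ (H ◃ 𝐭 Z ≫ 𝐱 Z) ≫ 𝐦 (H ⊗ Z) ≫ 𝐞 (H ⊗ Z) := by
        rw [mul_idemT]; simp
    _ = hat₁₂ (oneComulMul H) (H ⊗ Z) ≫ H ◃ 𝐱 Z ≫ H ◃ 𝐭 _ ≫ 𝐦 (H ⊗ Z) ≫ 𝐞 (H ⊗ Z) := by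
      rw [h₁]; simp
    _ = _ := by rw [idemT_mul_counit, mul_idemT]

lemma idemT_idemT : 𝐭 Z ≫ 𝐭 Z = 𝐭 Z := by
  have h := 𝐮 (H ⊗ Z) ≫= idemT_mul_idemT H Z
  simpa using h

/-- `t(h₁) ⊗ h₂ = t(1₁) ⊗ 1₂h`. -/
lemma comul_idemT_left :
    𝐝 Z ≫ 𝐭 (H ⊗ Z) = 𝐮 (H ⊗ Z) ≫ 𝐝 (H ⊗ Z) ≫ H ◃ 𝐦 Z ≫ 𝐭 (H ⊗ Z) := by
  have h := idemS_mul_idemT H (H ⊗ Z)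
  rw [← reassoc_of% comul_mul_counit H (H ⊗ Z)] at h
  calc _ = 𝐮 (H ⊗ Z) ≫ (𝐦 Z ≫ 𝐝 Z) ≫ 𝐭 (H ⊗ Z) := by simp
    _ = 𝐮 (H ⊗ Z) ≫ H ◃ 𝐝 Z ≫ 𝐝 _ ≫ H ◃ (𝐱 _ ≫ H ◃ 𝐦 Z) ≫ 𝐦 (H ⊗ Z) ≫ 𝐭 (H ⊗ Z) := by
      rw [hat_mul_comul]; simp
    _ = 𝐮 (H ⊗ Z) ≫ 𝐝 (H ⊗ Z) ≫ H ◃ ((𝐦 Z ≫ 𝐝 Z) ≫ 𝐞 (H ⊗ Z)) ≫ 𝐭 (H ⊗ Z) := by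
      rw [← h, hat_mul_comul]; simp
    _ = _ := by simp

/-- `Δ(t(h)) = 1₁t(h) ⊗ 1₂`. -/
lemma idemT_comul : 𝐭 Z ≫ 𝐝 Z = 𝐭 Z ≫ hat₁₂ (oneComulMul H) Z := by
  have h₁ := hat₁₂_swap H Z Δ[H]
  have h₂ := hat₁₂_swap H Z (oneComulMul H)
  calc _ = 𝐮 (H ⊗ Z) ≫ 𝐝 (H ⊗ Z) ≫ H ◃ (𝐱 Z ≫ H ◃ 𝐝 Z) ≫ 𝐦 _ ≫ 𝐞 _ := by
        rw [hat_idemT]; simp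
    _ = (𝐮 (H ⊗ Z) ≫ 𝐝 (H ⊗ Z) ≫ H ◃ 𝐝 (H ⊗ Z)) ≫ H ◃ (H ◃ 𝐱 Z ≫ 𝐱 (H ⊗ Z)) ≫ 𝐦 _ ≫ 𝐞 _ := by
      rw [← h₁]; simp
    _ = 𝐮 (H ⊗ Z) ≫ 𝐝 (H ⊗ Z) ≫ H ◃ (𝐱 Z ≫ H ◃ hat₁₂ (oneComulMul H) Z) ≫ 𝐦 _ ≫ 𝐞 _ := by
      rw [← weak_unit_swap, ← h₂, ← hat_oneComulMul]; simp
    _ = _ := by rw [hat_idemT]; simp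

/-- `h₁ ⊗ t(h₂) = 1₁h ⊗ 1₂`. -/
lemma comul_idemT_right : 𝐝 Z ≫ H ◃ 𝐭 Z = hat₁₂ (oneComulMul H) Z := by
  have h₁ := hat₁₂_swap H (H ⊗ Z) Δ[H]
  have h₂ := hat₁₂_swap H (H ⊗ Z) (oneComulMul H)
  have h₃ := lw_hat₁₂_swap H Z Δ[H]
  have h₄ := weak_unit_swap H (H ⊗ H ⊗ Z)
  rw [← hat_oneComulMul] at h₄
  calc _ = 𝐮 (H ⊗ Z) ≫ (𝐦 Z ≫ 𝐝 Z) ≫ H ◃ 𝐭 Z := by simp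
    _ = 𝐝 Z ≫ 𝐮 _ ≫ 𝐝 _ ≫ H ◃ (𝐱 _ ≫ H ◃ hat₁₂ (oneComulMul H) (H ⊗ Z)) ≫
          H ◃ H ◃ (H ◃ 𝐱 Z ≫ 𝐦 (H ⊗ Z) ≫ 𝐞 (H ⊗ Z)) ≫ 𝐦 (H ⊗ Z) := by
      rw [hat_mul_comul]; simp [mul_idemT]
    _ = 𝐝 Z ≫ (𝐮 _ ≫ 𝐝 _ ≫ H ◃ hat₁₂ (oneComulMul H) _) ≫ H ◃ (H ◃ 𝐱 _ ≫ 𝐱 _) ≫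
          H ◃ H ◃ (H ◃ 𝐱 Z ≫ 𝐦 (H ⊗ Z) ≫ 𝐞 (H ⊗ Z)) ≫ 𝐦 (H ⊗ Z) := by
      rw [← h₂]; simp
    _ = 𝐮 (H ⊗ Z) ≫ 𝐝 (H ⊗ Z) ≫ H ◃ (H ◃ 𝐝 Z ≫ 𝐱 (H ⊗ Z) ≫ H ◃ 𝐱 Z) ≫ 𝐝 _ ≫
          H ◃ (𝐱 _ ≫ H ◃ (𝐦 _ ≫ 𝐞 _)) ≫ 𝐦 (H ⊗ Z) := by
      rw [h₄]; simp
    _ = 𝐮 (H ⊗ Z) ≫ 𝐝 (H ⊗ Z) ≫ H ◃ 𝐱 Z ≫ (𝐦 (H ⊗ Z) ≫ 𝐝 (H ⊗ Z)) ≫ H ◃ 𝐞 (H ⊗ Z) := by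
      rw [h₃, hat_mul_comul]; simp
    _ = _ := by rw [hat_oneComulMul]; simp

/-- `1₁ ⊗ t(1₂) = 1₁ ⊗ 1₂`. -/
lemma one_comul_idemT : 𝐮 Z ≫ 𝐝 Z ≫ H ◃ 𝐭 Z = 𝐮 Z ≫ 𝐝 Z := by
  have h₁ := lw_hat₀₁_swap H Z η[H]
  calc _ = 𝐮 Z ≫ 𝐝 Z ≫ H ◃ (H ◃ 𝐮 Z ≫ 𝐱 Z) ≫ 𝐦 (H ⊗ Z) := by
        rw [comul_idemT_right, hat_oneComulMul]; simp
    _ = _ := by rw [h₁]; simp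

/-- `Δ(s(h)) = 1₁ ⊗ 1₂s(h)`. -/
lemma idemS_comul :
    𝐬 Z ≫ 𝐝 Z = 𝐬 Z ≫ 𝐮 (H ⊗ Z) ≫ 𝐝 (H ⊗ Z) ≫ H ◃ 𝐦 Z := by
  calc _ = 𝐮 (H ⊗ Z) ≫ 𝐝 (H ⊗ Z) ≫ H ◃ (𝐝 (H ⊗ Z) ≫ H ◃ (𝐦 Z ≫ 𝐞 Z)) := by
        rw [hat_idemS]; simp
    _ = (𝐮 (H ⊗ Z) ≫ 𝐝 (H ⊗ Z) ≫ H ◃ 𝐝 (H ⊗ Z)) ≫ H ◃ H ◃ (𝐦 Z ≫ 𝐞 Z) := by simp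
    _ = _ := by
      rw [← hat_weak_unit, hat_idemS]; simp

/-- `r(h₁) ⊗ h₂ = 1₁ ⊗ h1₂`. -/
lemma comul_idemR_left :
    𝐝 Z ≫ 𝐫 (H ⊗ Z) = H ◃ (𝐮 Z ≫ 𝐝 Z) ≫ 𝐱 (H ⊗ Z) ≫ H ◃ 𝐦 Z := by
  have h₁ := lw_hat₀₂_swap H Z (η[H] ≫ Δ[H])
  have h₂ := hat₁₂_swap H (H ⊗ Z) Δ[H]
  simp only [hat₀₂_comp, Category.assoc] at h₁
  calc _ = 𝐝 Z ≫ H ◃ (𝐮 _ ≫ 𝐝 _) ≫ 𝐱 _ ≫ H ◃ (𝐦 _ ≫ 𝐞 _) := by rw [hat_idemR]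
    _ = H ◃ (𝐮 Z ≫ 𝐝 Z) ≫ (𝐝 _ ≫ H ◃ 𝐱 _ ≫ 𝐱 _) ≫ H ◃ (H ◃ 𝐱 Z ≫ 𝐦 (H ⊗ Z) ≫ 𝐞 (H ⊗ Z)) := by
      rw [← h₁]; simp
    _ = H ◃ (𝐮 Z ≫ 𝐝 Z ≫ H ◃ 𝐭 Z) ≫ 𝐱 (H ⊗ Z) ≫ H ◃ 𝐦 Z := by
      have := comul_mul_counit_swap H Z
      rw [h₂]; simp [this]
    _ = _ := by rw [one_comul_idemT]

end WeakBialgebraIdentities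

end Tannaka
namespace Tannaka

open Functor.LaxMonoidal Functor.OplaxMonoidal

section SeparableFrobenius

variable {A : Type u₁} [Category.{v₁} A] [MonoidalCategory A]
  {B : Type u₂} [Category.{v₂} B] [MonoidalCategory B]
  {C : Type u₃} [Category.{v₃} C] [MonoidalCategory C]

lemma SepFrobenius.separable_assoc (F : A ⥤ B) [SepFrobenius F] (X Y : A) {Z : B}
    (g : F.obj (X ⊗ Y) ⟶ Z) : δ F X Y ≫ μ F X Y ≫ g = g := by
  rw [← Category.assoc, SepFrobenius.separable, Category.id_comp]

instance (F : A ⥤ B) [SepFrobenius F] (X Y : A) : IsSplitEpi (μ F X Y) :=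
  ⟨⟨δ F X Y, SepFrobenius.separable X Y⟩⟩

instance (F : A ⥤ B) [SepFrobenius F] (X Y : A) : IsSplitMono (δ F X Y) :=
  ⟨⟨μ F X Y, SepFrobenius.separable X Y⟩⟩

instance (F : A ⥤ B) [SepFrobenius F] (X Y : A) (Z : B) : Epi (μ F X Y ▷ Z) :=
  inferInstanceAs (Epi ((tensorRight Z).map (μ F X Y)))

instance (F : A ⥤ B) [SepFrobenius F] (X Y : A) (Z : B) : Mono (Z ◁ δ F X Y) :=
  inferInstanceAs (Mono ((tensorLeft Z).map (δ F X Y)))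

/-- Maps in the domain of `U` that exhibit a separable Frobenius structure on `G ⋙ U` as a
composite of one on `G` with that of `U`. -/
structure FrobeniusLift (G : A ⥤ B) (U : B ⥤ C) [SepFrobenius U] (i : SepFrobenius (G ⋙ U)) where
  one : 𝟙_ B ⟶ G.obj (𝟙_ A)
  mul : ∀ X Y : A, G.obj X ⊗ G.obj Y ⟶ G.obj (X ⊗ Y)
  counit : G.obj (𝟙_ A) ⟶ 𝟙_ B
  comul : ∀ X Y : A, G.obj (X ⊗ Y) ⟶ G.obj X ⊗ G.obj Y
  one_eq : ε U ≫ U.map one = i.ε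
  mul_eq : ∀ X Y, μ U _ _ ≫ U.map (mul X Y) = i.μ X Y
  counit_eq : U.map counit ≫ η U = i.η
  comul_eq : ∀ X Y, U.map (comul X Y) ≫ δ U _ _ = i.δ X Y

namespace FrobeniusLift

variable {G : A ⥤ B} {U : B ⥤ C} [SepFrobenius U] [U.Faithful] {i : SepFrobenius (G ⋙ U)}
  (L : FrobeniusLift G U i)

lemma mul_natural {X X' Y Y' : A} (f : X ⟶ X') (g : Y ⟶ Y') :
    (G.map f ⊗ₘ G.map g) ≫ L.mul X' Y' = L.mul X Y ≫ G.map (f ⊗ₘ g) := by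
  apply U.map_injective
  rw [← cancel_epi (μ U _ _)]
  simp only [Functor.map_comp]
  rw [← μ_natural_assoc, L.mul_eq, reassoc_of% L.mul_eq]
  exact @μ_natural _ _ _ _ _ _ (G ⋙ U) i.toLaxMonoidal _ _ _ _ f g

lemma comul_natural {X X' Y Y' : A} (f : X ⟶ X') (g : Y ⟶ Y') :
    L.comul X Y ≫ (G.map f ⊗ₘ G.map g) = G.map (f ⊗ₘ g) ≫ L.comul X' Y' := by
  apply U.map_injective
  rw [← cancel_mono (δ U _ _)]
  simp only [Functor.map_comp, Category.assoc]
  rw [← δ_natural, L.comul_eq, reassoc_of% L.comul_eq]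
  exact @δ_natural _ _ _ _ _ _ (G ⋙ U) i.toOplaxMonoidal _ _ _ _ f g

lemma associativity (X Y Z : A) : L.mul X Y ▷ G.obj Z ≫ L.mul (X ⊗ Y) Z ≫ G.map (α_ X Y Z).hom =
    (α_ _ _ _).hom ≫ G.obj X ◁ L.mul Y Z ≫ L.mul X (Y ⊗ Z) := by
  apply U.map_injective
  rw [← cancel_epi (μ U _ _), ← cancel_epi (μ U _ _ ▷ _)]
  have h := i.associativity X Y Z
  have h₁ := Functor.LaxMonoidal.associativity U (G.obj X) (G.obj Y) (G.obj Z)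
  simp only [Functor.comp_obj, Functor.comp_map, ← L.mul_eq, comp_whiskerRight,
    MonoidalCategory.whiskerLeft_comp, Category.assoc, μ_natural_left_assoc,
    μ_natural_right_assoc, Functor.map_comp] at h ⊢
  rw [h, reassoc_of% h₁]

lemma coassociativity (X Y Z : A) :
    L.comul (X ⊗ Y) Z ≫ L.comul X Y ▷ G.obj Z ≫ (α_ _ _ _).hom =
      G.map (α_ X Y Z).hom ≫ L.comul X (Y ⊗ Z) ≫ G.obj X ◁ L.comul Y Z := by
  apply U.map_injective
  rw [← cancel_mono (δ U _ _), ← cancel_mono (_ ◁ δ U _ _)]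
  have h := i.oplax_associativity X Y Z
  have h₁ := Functor.OplaxMonoidal.associativity U (G.obj X) (G.obj Y) (G.obj Z)
  simp only [Functor.comp_obj, Functor.comp_map, ← L.comul_eq, comp_whiskerRight,
    MonoidalCategory.whiskerLeft_comp, Category.assoc, Functor.map_comp] at h ⊢
  rw [← δ_natural_right_assoc, ← h, ← h₁, δ_natural_left_assoc]

lemma left_unitality (X : A) : (λ_ (G.obj X)).hom =
    L.one ▷ G.obj X ≫ L.mul (𝟙_ A) X ≫ G.map (λ_ X).hom := by
  apply U.map_injective
  rw [← cancel_epi (U.map (λ_ (G.obj X)).inv), ← left_unitality_inv U (G.obj X)]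
  have h := i.left_unitality X
  simp only [Functor.comp_obj, Functor.comp_map, ← L.mul_eq, ← L.one_eq, comp_whiskerRight,
    Category.assoc, Functor.map_comp, μ_natural_left_assoc] at h ⊢
  rw [← h, ← Functor.LaxMonoidal.left_unitality]

lemma right_unitality (X : A) : (ρ_ (G.obj X)).hom =
    G.obj X ◁ L.one ≫ L.mul X (𝟙_ A) ≫ G.map (ρ_ X).hom := by
  apply U.map_injective
  rw [← cancel_epi (U.map (ρ_ (G.obj X)).inv), ← right_unitality_inv U (G.obj X)]
  have h := i.right_unitality X
  simp only [Functor.comp_obj, Functor.comp_map, ← L.mul_eq, ← L.one_eq,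
    MonoidalCategory.whiskerLeft_comp, Category.assoc, Functor.map_comp,
    μ_natural_right_assoc] at h ⊢
  rw [← h, ← Functor.LaxMonoidal.right_unitality]

lemma left_counitality (X : A) : (λ_ (G.obj X)).inv =
    G.map (λ_ X).inv ≫ L.comul (𝟙_ A) X ≫ L.counit ▷ G.obj X := by
  apply U.map_injective
  rw [← cancel_mono (U.map (λ_ (G.obj X)).hom), ← left_unitality_hom U (G.obj X)]
  have h := i.oplax_left_unitality X
  simp only [Functor.comp_obj, Functor.comp_map, ← L.comul_eq, ← L.counit_eq, comp_whiskerRight,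
    Category.assoc, Functor.map_comp] at h ⊢
  rw [← δ_natural_left_assoc, ← reassoc_of% h, ← reassoc_of% oplax_left_unitality U (G.obj X)]

lemma right_counitality (X : A) : (ρ_ (G.obj X)).inv =
    G.map (ρ_ X).inv ≫ L.comul X (𝟙_ A) ≫ G.obj X ◁ L.counit := by
  apply U.map_injective
  rw [← cancel_mono (U.map (ρ_ (G.obj X)).hom), ← right_unitality_hom U (G.obj X)]
  have h := i.oplax_right_unitality X
  simp only [Functor.comp_obj, Functor.comp_map, ← L.comul_eq, ← L.counit_eq,
    MonoidalCategory.whiskerLeft_comp, Category.assoc, Functor.map_comp] at h ⊢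
  rw [← δ_natural_right_assoc, ← reassoc_of% h, ← reassoc_of% oplax_right_unitality U (G.obj X)]

/-- The separable Frobenius structure on `G`. -/
abbrev sepFrobenius : SepFrobenius G where
  ε := L.one
  μ := L.mul
  η := L.counit
  δ := L.comul
  μ_natural_left f X := by
    have := L.mul_natural f (𝟙 X)
    simpa using this
  μ_natural_right X f := by
    have := L.mul_natural (𝟙 X) f
    simpa using this
  associativity := L.associativity
  left_unitality := L.left_unitality
  right_unitality := L.right_unitality
  δ_natural_left f X := by
    have := L.comul_natural f (𝟙 X)
    simpa using this
  δ_natural_right X f := by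
    have := L.comul_natural (𝟙 X) f
    simpa using this
  oplax_associativity := L.coassociativity
  oplax_left_unitality := L.left_counitality
  oplax_right_unitality := L.right_counitality
  frobenius_left X Y Z := by
    apply U.map_injective
    rw [← cancel_mono (δ U _ _), ← cancel_epi (μ U _ _)]
    have h := i.frobenius_left X Y Z
    have h₁ := SepFrobenius.frobenius_left (F := U) (G.obj X) (G.obj Y) (G.obj Z)
    simp only [Functor.comp_obj, Functor.comp_map, ← L.comul_eq, ← L.mul_eq, comp_whiskerRight,
      MonoidalCategory.whiskerLeft_comp, Category.assoc, Functor.map_comp] at h ⊢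
    rw [← δ_natural_right, ← μ_natural_left_assoc, ← reassoc_of% h₁, h]
  frobenius_right X Y Z := by
    apply U.map_injective
    rw [← cancel_mono (δ U _ _), ← cancel_epi (μ U _ _)]
    have h := i.frobenius_right X Y Z
    have h₁ := SepFrobenius.frobenius_right (F := U) (G.obj X) (G.obj Y) (G.obj Z)
    simp only [Functor.comp_obj, Functor.comp_map, ← L.comul_eq, ← L.mul_eq, comp_whiskerRight,
      MonoidalCategory.whiskerLeft_comp, Category.assoc, Functor.map_comp] at h ⊢
    rw [← δ_natural_left, ← μ_natural_right_assoc, ← reassoc_of% h₁, h]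
  separable X Y := by
    apply U.map_injective
    have h := i.separable X Y
    simp only [← L.comul_eq, ← L.mul_eq, Category.assoc] at h
    rw [SepFrobenius.separable_assoc] at h
    simpa using h

/-- The lift as a bundled functor. -/
abbrev toSFFunctor : SFFunctor A B where
  functor := G
  sf := L.sepFrobenius

lemma toSFFunctor_comp : L.toSFFunctor.comp ⟨U⟩ = SFFunctor.mk (G ⋙ U) (sf := i) := by
  refine SFFunctor.mk_congr L.one_eq ?_ L.counit_eq ?_
  · funext X Y
    exact L.mul_eq X Y
  · funext X Y
    exact L.comul_eq X Y

end FrobeniusLift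

section Uniqueness

variable (U : B ⥤ C) [SepFrobenius U] [U.Faithful]

lemma hom_from_unit_ext {X : B} {f g : 𝟙_ B ⟶ X} (h : ε U ≫ U.map f = ε U ≫ U.map g) :
    f = g := by
  have : f ▷ 𝟙_ B = g ▷ 𝟙_ B := by
    apply U.map_injective
    rw [← cancel_epi (U.map (λ_ (𝟙_ B)).inv), ← left_unitality_inv U]
    simp only [Category.assoc, ← μ_natural_left, ← comp_whiskerRight_assoc, h]
  exact (MonoidalCategory.whiskerRight_iff f g).1 this

lemma hom_to_unit_ext {X : B} {f g : X ⟶ 𝟙_ B} (h : U.map f ≫ η U = U.map g ≫ η U) :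
    f = g := by
  have : f ▷ 𝟙_ B = g ▷ 𝟙_ B := by
    apply U.map_injective
    rw [← cancel_mono (U.map (λ_ (𝟙_ B)).hom), ← left_unitality_hom U]
    simp only [← δ_natural_left_assoc, ← comp_whiskerRight_assoc, h]
  exact (MonoidalCategory.whiskerRight_iff f g).1 this

/-- A separable Frobenius structure on `G` is determined by the composite structure on `G ⋙ U`. -/
lemma sfFunctor_ext {G : A ⥤ B} {i j : SepFrobenius G}
    (h : (SFFunctor.mk G (sf := i)).comp ⟨U⟩ = (SFFunctor.mk G (sf := j)).comp ⟨U⟩) :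
    SFFunctor.mk G (sf := i) = SFFunctor.mk G (sf := j) := by
  rw [SFFunctor.mk.injEq] at h
  have h' := eq_of_heq h.2
  refine SFFunctor.mk_congr ?_ ?_ ?_ ?_
  · exact hom_from_unit_ext U (congrArg (fun k : SepFrobenius (G ⋙ U) => k.ε) h')
  · funext X Y
    apply U.map_injective
    rw [← cancel_epi (μ U _ _)]
    exact congrArg (fun k : SepFrobenius (G ⋙ U) => k.μ X Y) h'
  · exact hom_to_unit_ext U (congrArg (fun k : SepFrobenius (G ⋙ U) => k.η) h')
  · funext X Y
    apply U.map_injective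
    rw [← cancel_mono (δ U _ _)]
    exact congrArg (fun k : SepFrobenius (G ⋙ U) => k.δ X Y) h'

end Uniqueness

section Duals

variable (F : A ⥤ B) [SepFrobenius F]

/-- The image under a separable Frobenius functor of a copairing. -/
def mapCup {a d : A} (n : 𝟙_ A ⟶ a ⊗ d) : 𝟙_ B ⟶ F.obj a ⊗ F.obj d :=
  ε F ≫ F.map n ≫ δ F a d

/-- The image under a separable Frobenius functor of a pairing. -/
def mapCap {a d : A} (k : d ⊗ a ⟶ 𝟙_ A) : F.obj d ⊗ F.obj a ⟶ 𝟙_ B :=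
  μ F d a ≫ F.map k ≫ η F

lemma mapCup_mapCap_right {a d : A} (n : 𝟙_ A ⟶ a ⊗ d) (k : d ⊗ a ⟶ 𝟙_ A) :
    F.obj d ◁ mapCup F n ≫ (α_ _ _ _).inv ≫ mapCap F k ▷ F.obj d =
      (ρ_ _).hom ≫ F.map ((ρ_ d).inv ≫ d ◁ n ≫ (α_ _ _ _).inv ≫ k ▷ d ≫ (λ_ d).hom) ≫
        (λ_ _).inv := by
  have h := SepFrobenius.frobenius_right (F := F) d a d
  simp only [mapCup, mapCap, comp_whiskerRight, MonoidalCategory.whiskerLeft_comp, Category.assoc,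
    Functor.map_comp]
  rw [reassoc_of% h, ← left_unitality_hom, ← right_unitality_inv]
  simp only [Category.assoc, Iso.hom_inv_id, Category.comp_id, Iso.hom_inv_id_assoc,
    μ_natural_right_assoc, ← δ_natural_left_assoc, ← δ_natural_left]

lemma mapCup_mapCap_left {a d : A} (n : 𝟙_ A ⟶ a ⊗ d) (k : d ⊗ a ⟶ 𝟙_ A) :
    mapCup F n ▷ F.obj a ≫ (α_ _ _ _).hom ≫ F.obj a ◁ mapCap F k =
      (λ_ _).hom ≫ F.map ((λ_ a).inv ≫ n ▷ a ≫ (α_ _ _ _).hom ≫ a ◁ k ≫ (ρ_ a).hom) ≫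
        (ρ_ _).inv := by
  have h := SepFrobenius.frobenius_left (F := F) a d a
  simp only [mapCup, mapCap, comp_whiskerRight, MonoidalCategory.whiskerLeft_comp, Category.assoc,
    Functor.map_comp]
  rw [reassoc_of% h, ← right_unitality_hom, ← left_unitality_inv]
  simp only [Category.assoc, Iso.hom_inv_id, Category.comp_id, Iso.hom_inv_id_assoc,
    μ_natural_left_assoc, ← δ_natural_right_assoc, ← δ_natural_right]

/-- Separable Frobenius functors preserve duals. -/
abbrev mapExactPairing (a d : A) [ExactPairing a d] : ExactPairing (F.obj a) (F.obj d) where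
  coevaluation' := mapCup F (η_ a d)
  evaluation' := mapCap F (ε_ a d)
  coevaluation_evaluation' := by
    rw [mapCup_mapCap_right, ExactPairing.coevaluation_evaluation_assoc]
    simp
  evaluation_coevaluation' := by
    rw [mapCup_mapCap_left, ExactPairing.evaluation_coevaluation_assoc]
    simp

/-- Faithful separable Frobenius functors reflect duals. -/
abbrev exactPairingOfMap [F.Faithful] {a d : A} (n : 𝟙_ A ⟶ a ⊗ d) (k : d ⊗ a ⟶ 𝟙_ A)
    (h₁ : F.obj d ◁ mapCup F n ≫ (α_ _ _ _).inv ≫ mapCap F k ▷ F.obj d =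
      (ρ_ _).hom ≫ (λ_ _).inv)
    (h₂ : mapCup F n ▷ F.obj a ≫ (α_ _ _ _).hom ≫ F.obj a ◁ mapCap F k =
      (λ_ _).hom ≫ (ρ_ _).inv) : ExactPairing a d where
  coevaluation' := n
  evaluation' := k
  coevaluation_evaluation' := by
    rw [mapCup_mapCap_right, cancel_epi, ← Category.id_comp (λ_ (F.obj d)).inv, ← Category.assoc,
      cancel_mono, Category.comp_id] at h₁
    have := F.map_injective (h₁.trans (F.map_id d).symm)
    rw [Iso.inv_comp_eq, Category.comp_id] at this
    rw [← this]
    simp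
  evaluation_coevaluation' := by
    rw [mapCup_mapCap_left, cancel_epi, ← Category.id_comp (ρ_ (F.obj a)).inv, ← Category.assoc,
      cancel_mono, Category.comp_id] at h₂
    have := F.map_injective (h₂.trans (F.map_id a).symm)
    rw [Iso.inv_comp_eq, Category.comp_id] at this
    rw [← this]
    simp

end Duals

end SeparableFrobenius

end Tannaka
namespace Tannaka

section SplitTensor

variable {D : Type u₁} [Category.{v₁} D] {V : Type u} [Category.{v} V] [MonoidalCategory V]

/-- A tensor product on `D` that is obtained from that of `V` by splitting idempotents
`μ a b ≫ δ a b`. -/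
structure SplitTensor (U : D ⥤ V) where
  tensorObj : D → D → D
  tensorUnit : D
  proj : ∀ a b, U.obj a ⊗ U.obj b ⟶ U.obj (tensorObj a b)
  incl : ∀ a b, U.obj (tensorObj a b) ⟶ U.obj a ⊗ U.obj b
  one : 𝟙_ V ⟶ U.obj tensorUnit
  counit : U.obj tensorUnit ⟶ 𝟙_ V
  δ_μ : ∀ a b, incl a b ≫ proj a b = 𝟙 _
  tensorHom : ∀ {a a' b b' : D} (_ : a ⟶ a') (_ : b ⟶ b'), tensorObj a b ⟶ tensorObj a' b'
  assocHom : ∀ a b c, tensorObj (tensorObj a b) c ⟶ tensorObj a (tensorObj b c)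
  assocInv : ∀ a b c, tensorObj a (tensorObj b c) ⟶ tensorObj (tensorObj a b) c
  leftHom : ∀ a, tensorObj tensorUnit a ⟶ a
  leftInv : ∀ a, a ⟶ tensorObj tensorUnit a
  rightHom : ∀ a, tensorObj a tensorUnit ⟶ a
  rightInv : ∀ a, a ⟶ tensorObj a tensorUnit
  map_tensorHom : ∀ {a a' b b' : D} (f : a ⟶ a') (g : b ⟶ b'),
    U.map (tensorHom f g) = incl a b ≫ (U.map f ⊗ₘ U.map g) ≫ proj a' b'
  map_assocHom : ∀ a b c, U.map (assocHom a b c) =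
    incl (tensorObj a b) c ≫ incl a b ▷ U.obj c ≫ (α_ _ _ _).hom ≫ U.obj a ◁ proj b c ≫ proj a (tensorObj b c)
  map_assocInv : ∀ a b c, U.map (assocInv a b c) =
    incl a (tensorObj b c) ≫ U.obj a ◁ incl b c ≫ (α_ _ _ _).inv ≫ proj a b ▷ U.obj c ≫ proj (tensorObj a b) c
  map_leftHom : ∀ a, U.map (leftHom a) = incl tensorUnit a ≫ counit ▷ U.obj a ≫ (λ_ _).hom
  map_leftInv : ∀ a, U.map (leftInv a) = (λ_ _).inv ≫ one ▷ U.obj a ≫ proj tensorUnit a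
  map_rightHom : ∀ a, U.map (rightHom a) = incl a tensorUnit ≫ U.obj a ◁ counit ≫ (ρ_ _).hom
  map_rightInv : ∀ a, U.map (rightInv a) = (ρ_ _).inv ≫ U.obj a ◁ one ≫ proj a tensorUnit
  nabla_natural : ∀ {a a' b b' : D} (f : a ⟶ a') (g : b ⟶ b'),
    proj a b ≫ incl a b ≫ (U.map f ⊗ₘ U.map g) = (U.map f ⊗ₘ U.map g) ≫ proj a' b' ≫ incl a' b'
  nabla₃ : ∀ a b c, proj a b ▷ U.obj c ≫ proj (tensorObj a b) c ≫ incl (tensorObj a b) c ≫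
      incl a b ▷ U.obj c ≫ (α_ _ _ _).hom =
    (α_ _ _ _).hom ≫ U.obj a ◁ proj b c ≫ proj a (tensorObj b c) ≫ incl a (tensorObj b c) ≫ U.obj a ◁ incl b c
  nabla_left : ∀ a b c, proj a b ▷ U.obj c ≫ incl a b ▷ U.obj c ≫ (α_ _ _ _).hom ≫
      U.obj a ◁ proj b c ≫ U.obj a ◁ incl b c =
    (α_ _ _ _).hom ≫ U.obj a ◁ proj b c ≫ proj a (tensorObj b c) ≫ incl a (tensorObj b c) ≫ U.obj a ◁ incl b c
  nabla_right : ∀ a b c, U.obj a ◁ proj b c ≫ U.obj a ◁ incl b c ≫ (α_ _ _ _).inv ≫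
      proj a b ▷ U.obj c ≫ incl a b ▷ U.obj c =
    U.obj a ◁ proj b c ≫ proj a (tensorObj b c) ≫ incl a (tensorObj b c) ≫ U.obj a ◁ incl b c ≫ (α_ _ _ _).inv
  left_hom_inv : ∀ a, incl tensorUnit a ≫ counit ▷ U.obj a ≫ one ▷ U.obj a ≫ proj tensorUnit a = 𝟙 _
  left_inv_hom : ∀ a, one ▷ U.obj a ≫ proj tensorUnit a ≫ incl tensorUnit a ≫ counit ▷ U.obj a = 𝟙 _
  right_hom_inv : ∀ a, incl a tensorUnit ≫ U.obj a ◁ counit ≫ U.obj a ◁ one ≫ proj a tensorUnit = 𝟙 _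
  right_inv_hom : ∀ a, U.obj a ◁ one ≫ proj a tensorUnit ≫ incl a tensorUnit ≫ U.obj a ◁ counit = 𝟙 _

namespace SplitTensor

variable {U : D ⥤ V} [U.Faithful] (S : SplitTensor U)

lemma δ_μ_assoc (a b : D) {Z : V} (g : U.obj (S.tensorObj a b) ⟶ Z) :
    S.incl a b ≫ S.proj a b ≫ g = g := by
  rw [← Category.assoc, S.δ_μ, Category.id_comp]

lemma map_tensorHom_δ {a a' b b' : D} (f : a ⟶ a') (g : b ⟶ b') :
    U.map (S.tensorHom f g) ≫ S.incl a' b' = S.incl a b ≫ (U.map f ⊗ₘ U.map g) := by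
  rw [map_tensorHom, Category.assoc, Category.assoc, ← nabla_natural, δ_μ_assoc]

lemma μ_map_tensorHom {a a' b b' : D} (f : a ⟶ a') (g : b ⟶ b') :
    S.proj a b ≫ U.map (S.tensorHom f g) = (U.map f ⊗ₘ U.map g) ≫ S.proj a' b' := by
  rw [map_tensorHom, reassoc_of% S.nabla_natural, δ_μ, Category.comp_id]

lemma δ_δ_μ_μ (a b c : D) : S.incl (S.tensorObj a b) c ≫ S.incl a b ▷ U.obj c ≫ S.proj a b ▷ U.obj c ≫
    S.proj (S.tensorObj a b) c = 𝟙 _ := by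
  rw [← comp_whiskerRight_assoc, δ_μ, id_whiskerRight, Category.id_comp, δ_μ]

lemma δ_δ_μ_μ' (a b c : D) : S.incl a (S.tensorObj b c) ≫ U.obj a ◁ S.incl b c ≫ U.obj a ◁ S.proj b c ≫
    S.proj a (S.tensorObj b c) = 𝟙 _ := by
  rw [← MonoidalCategory.whiskerLeft_comp_assoc, δ_μ, MonoidalCategory.whiskerLeft_id,
    Category.id_comp, δ_μ]

lemma map_assocHom_δ (a b c : D) :
    U.map (S.assocHom a b c) ≫ S.incl a (S.tensorObj b c) ≫ U.obj a ◁ S.incl b c =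
      S.incl (S.tensorObj a b) c ≫ S.incl a b ▷ U.obj c ≫ (α_ _ _ _).hom := by
  simp only [map_assocHom, Category.assoc]
  rw [← nabla₃, reassoc_of% S.δ_δ_μ_μ]

lemma map_assocInv_δ (a b c : D) :
    U.map (S.assocInv a b c) ≫ S.incl (S.tensorObj a b) c ≫ S.incl a b ▷ U.obj c =
      S.incl a (S.tensorObj b c) ≫ U.obj a ◁ S.incl b c ≫ (α_ _ _ _).inv := by
  simp only [map_assocInv, Category.assoc]
  have h := S.nabla₃ a b c
  rw [← Iso.inv_comp_eq] at h
  have h' := h =≫ (α_ _ _ _).inv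
  simp only [Category.assoc, Iso.hom_inv_id, Category.comp_id] at h'
  rw [h', reassoc_of% S.δ_δ_μ_μ']

lemma μ_map_assocHom (a b c : D) :
    S.proj a b ▷ U.obj c ≫ S.proj (S.tensorObj a b) c ≫ U.map (S.assocHom a b c) =
      (α_ _ _ _).hom ≫ U.obj a ◁ S.proj b c ≫ S.proj a (S.tensorObj b c) := by
  simp only [map_assocHom]
  rw [reassoc_of% S.nabla₃, S.δ_δ_μ_μ', Category.comp_id]

instance (a b : D) : Mono (S.incl a b) :=
  haveI : IsSplitMono (S.incl a b) := ⟨⟨S.proj a b, S.δ_μ a b⟩⟩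
  inferInstance

instance (a b c : D) : Mono (U.obj c ◁ S.incl a b) :=
  haveI : IsSplitMono (S.incl a b) := ⟨⟨S.proj a b, S.δ_μ a b⟩⟩
  inferInstanceAs (Mono ((tensorLeft _).map (S.incl a b)))

instance (a b c : D) : Mono (S.incl a b ▷ U.obj c) :=
  haveI : IsSplitMono (S.incl a b) := ⟨⟨S.proj a b, S.δ_μ a b⟩⟩
  inferInstanceAs (Mono ((tensorRight _).map (S.incl a b)))

instance (a b c : D) : Epi (U.obj c ◁ S.proj a b) :=
  haveI : IsSplitEpi (S.proj a b) := ⟨⟨S.incl a b, S.δ_μ a b⟩⟩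
  inferInstanceAs (Epi ((tensorLeft _).map (S.proj a b)))

instance (a b c : D) : Epi (S.proj a b ▷ U.obj c) :=
  haveI : IsSplitEpi (S.proj a b) := ⟨⟨S.incl a b, S.δ_μ a b⟩⟩
  inferInstanceAs (Epi ((tensorRight _).map (S.proj a b)))

instance (a b c d : D) : Mono (U.obj a ◁ U.obj b ◁ S.incl c d) :=
  haveI : IsSplitMono (S.incl c d) := ⟨⟨S.proj c d, S.δ_μ c d⟩⟩
  inferInstanceAs (Mono ((tensorLeft _).map ((tensorLeft _).map (S.incl c d))))

/-- The tensor product, associator and unitors. -/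
abbrev monoidalCategoryStruct : MonoidalCategoryStruct D where
  tensorObj := S.tensorObj
  tensorUnit := S.tensorUnit
  tensorHom := S.tensorHom
  whiskerLeft a _ _ f := S.tensorHom (𝟙 a) f
  whiskerRight f b := S.tensorHom f (𝟙 b)
  associator a b c :=
    { hom := S.assocHom a b c
      inv := S.assocInv a b c
      hom_inv_id := U.map_injective (by
        rw [← cancel_mono (S.incl _ _), ← cancel_mono (S.incl a b ▷ _)]
        simp only [Functor.map_comp, Category.assoc, map_assocInv_δ, Functor.map_id,
          Category.id_comp]
        rw [reassoc_of% S.map_assocHom_δ]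
        simp)
      inv_hom_id := U.map_injective (by
        rw [← cancel_mono (S.incl _ _), ← cancel_mono (_ ◁ S.incl b c)]
        simp only [Functor.map_comp, Category.assoc, map_assocHom_δ, Functor.map_id,
          Category.id_comp]
        rw [reassoc_of% S.map_assocInv_δ]
        simp) }
  leftUnitor a :=
    { hom := S.leftHom a
      inv := S.leftInv a
      hom_inv_id := U.map_injective (by
        simp [map_leftHom, map_leftInv, S.left_hom_inv])
      inv_hom_id := U.map_injective (by
        simp only [Functor.map_comp, map_leftHom, map_leftInv, Category.assoc]
        rw [reassoc_of% S.left_inv_hom]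
        simp) }
  rightUnitor a :=
    { hom := S.rightHom a
      inv := S.rightInv a
      hom_inv_id := U.map_injective (by
        simp [map_rightHom, map_rightInv, S.right_hom_inv])
      inv_hom_id := U.map_injective (by
        simp only [Functor.map_comp, map_rightHom, map_rightInv, Category.assoc]
        rw [reassoc_of% S.right_inv_hom]
        simp) }

lemma associator_naturality {a₁ a₂ a₃ b₁ b₂ b₃ : D} (f₁ : a₁ ⟶ b₁) (f₂ : a₂ ⟶ b₂) (f₃ : a₃ ⟶ b₃) :
    S.tensorHom (S.tensorHom f₁ f₂) f₃ ≫ S.assocHom b₁ b₂ b₃ =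
      S.assocHom a₁ a₂ a₃ ≫ S.tensorHom f₁ (S.tensorHom f₂ f₃) := by
  apply U.map_injective
  rw [← cancel_mono (S.incl _ _), ← cancel_mono (_ ◁ S.incl _ _)]
  simp only [Functor.map_comp, Category.assoc, map_assocHom_δ]
  have h : (U.map f₁ ⊗ₘ U.map (S.tensorHom f₂ f₃)) ≫ U.obj b₁ ◁ S.incl b₂ b₃ =
      U.obj a₁ ◁ S.incl a₂ a₃ ≫ (U.map f₁ ⊗ₘ (U.map f₂ ⊗ₘ U.map f₃)) := by
    simp only [← id_tensorHom, tensorHom_comp_tensorHom, map_tensorHom_δ, Category.comp_id,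
      Category.id_comp]
  have h' : (U.map (S.tensorHom f₁ f₂) ⊗ₘ U.map f₃) ≫ S.incl b₁ b₂ ▷ U.obj b₃ =
      S.incl a₁ a₂ ▷ U.obj a₃ ≫ ((U.map f₁ ⊗ₘ U.map f₂) ⊗ₘ U.map f₃) := by
    simp only [← tensorHom_id, tensorHom_comp_tensorHom, map_tensorHom_δ, Category.comp_id,
      Category.id_comp]
  rw [reassoc_of% S.map_tensorHom_δ, reassoc_of% S.map_tensorHom_δ, h, reassoc_of% h',
    reassoc_of% S.map_assocHom_δ, MonoidalCategory.associator_naturality]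

lemma pentagon (a b c d : D) :
    S.tensorHom (S.assocHom a b c) (𝟙 d) ≫ S.assocHom a (S.tensorObj b c) d ≫
        S.tensorHom (𝟙 a) (S.assocHom b c d) =
      S.assocHom (S.tensorObj a b) c d ≫ S.assocHom a b (S.tensorObj c d) := by
  have h₁ := S.map_tensorHom_δ (𝟙 a) (S.assocHom b c d)
  have h₂ := S.map_tensorHom_δ (S.assocHom a b c) (𝟙 d)
  simp only [CategoryTheory.Functor.map_id, id_tensorHom, tensorHom_id] at h₁ h₂
  have k₁ : U.map (S.tensorHom (𝟙 a) (S.assocHom b c d)) ≫ S.incl a (S.tensorObj b (S.tensorObj c d)) ≫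
      U.obj a ◁ S.incl b (S.tensorObj c d) ≫ U.obj a ◁ U.obj b ◁ S.incl c d =
      S.incl a (S.tensorObj (S.tensorObj b c) d) ≫ U.obj a ◁ S.incl (S.tensorObj b c) d ≫
        U.obj a ◁ (S.incl b c ▷ U.obj d) ≫ U.obj a ◁ (α_ _ _ _).hom := by
    rw [reassoc_of% h₁, ← MonoidalCategory.whiskerLeft_comp, ← MonoidalCategory.whiskerLeft_comp,
      S.map_assocHom_δ]
    simp
  have k₂ : U.map (S.tensorHom (S.assocHom a b c) (𝟙 d)) ≫ S.incl (S.tensorObj a (S.tensorObj b c)) d ≫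
      S.incl a (S.tensorObj b c) ▷ U.obj d ≫ (U.obj a ◁ S.incl b c) ▷ U.obj d =
      S.incl (S.tensorObj (S.tensorObj a b) c) d ≫ S.incl (S.tensorObj a b) c ▷ U.obj d ≫
        (S.incl a b ▷ U.obj c) ▷ U.obj d ≫ (α_ _ _ _).hom ▷ U.obj d := by
    rw [reassoc_of% h₂, ← comp_whiskerRight, ← comp_whiskerRight, S.map_assocHom_δ]
    simp
  apply U.map_injective
  rw [← cancel_mono (S.incl _ _ ≫ U.obj a ◁ S.incl _ _ ≫ U.obj a ◁ U.obj b ◁ S.incl c d)]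
  simp only [Functor.map_comp, Category.assoc]
  rw [k₁, reassoc_of% S.map_assocHom_δ, ← associator_naturality_middle_assoc, reassoc_of% k₂,
    MonoidalCategory.pentagon, reassoc_of% S.map_assocHom_δ a b,
    ← associator_naturality_right, ← whisker_exchange_assoc,
    reassoc_of% S.map_assocHom_δ (S.tensorObj a b) c d, associator_naturality_left_assoc]

lemma triangle (a b : D) :
    S.assocHom a S.tensorUnit b ≫ S.tensorHom (𝟙 a) (S.leftHom b) =
      S.tensorHom (S.rightHom a) (𝟙 b) := by
  have h₁ := S.map_tensorHom_δ (𝟙 a) (S.leftHom b)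
  have h₂ := S.map_tensorHom_δ (S.rightHom a) (𝟙 b)
  simp only [CategoryTheory.Functor.map_id, id_tensorHom, tensorHom_id] at h₁ h₂
  apply U.map_injective
  rw [← cancel_mono (S.incl _ _), Functor.map_comp, Category.assoc, h₁, h₂, map_leftHom,
    map_rightHom]
  simp only [MonoidalCategory.whiskerLeft_comp, comp_whiskerRight]
  rw [reassoc_of% S.map_assocHom_δ]
  simp

lemma leftUnitor_naturality {a b : D} (f : a ⟶ b) :
    S.tensorHom (𝟙 S.tensorUnit) f ≫ S.leftHom b = S.leftHom a ≫ f := by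
  apply U.map_injective
  have h := S.map_tensorHom_δ (𝟙 S.tensorUnit) f
  simp only [CategoryTheory.Functor.map_id, id_tensorHom] at h
  simp only [Functor.map_comp, map_leftHom, Category.assoc]
  rw [reassoc_of% h, whisker_exchange_assoc]
  simp

lemma rightUnitor_naturality {a b : D} (f : a ⟶ b) :
    S.tensorHom f (𝟙 S.tensorUnit) ≫ S.rightHom b = S.rightHom a ≫ f := by
  apply U.map_injective
  have h := S.map_tensorHom_δ f (𝟙 S.tensorUnit)
  simp only [CategoryTheory.Functor.map_id, tensorHom_id] at h
  simp only [Functor.map_comp, map_rightHom, Category.assoc]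
  rw [reassoc_of% h, ← whisker_exchange_assoc]
  simp

/-- The monoidal category with the split tensor product. -/
abbrev monoidalCategory : MonoidalCategory D :=
  letI := S.monoidalCategoryStruct
  MonoidalCategory.ofTensorHom
    (id_tensorHom_id := fun a b => U.map_injective (by
      change U.map (S.tensorHom (𝟙 a) (𝟙 b)) = U.map (𝟙 (S.tensorObj a b))
      rw [map_tensorHom]
      simp [S.δ_μ]))
    (tensorHom_comp_tensorHom := fun f₁ f₂ g₁ g₂ => U.map_injective (by
      change U.map (S.tensorHom f₁ f₂ ≫ S.tensorHom g₁ g₂) =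
        U.map (S.tensorHom (f₁ ≫ g₁) (f₂ ≫ g₂))
      rw [Functor.map_comp, S.map_tensorHom g₁, reassoc_of% S.map_tensorHom_δ, map_tensorHom]
      simp))
    (id_tensorHom := fun _ _ _ _ => rfl)
    (tensorHom_id := fun _ _ => rfl)
    (associator_naturality := S.associator_naturality)
    (leftUnitor_naturality := S.leftUnitor_naturality)
    (rightUnitor_naturality := S.rightUnitor_naturality)
    (pentagon := S.pentagon)
    (triangle := S.triangle)

/-- The separable Frobenius structure given by the splittings. -/
abbrev sepFrobenius : letI := S.monoidalCategory; SepFrobenius U :=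
  letI := S.monoidalCategory
  { ε := S.one
    μ := S.proj
    η := S.counit
    δ := S.incl
    μ_natural_left := fun f b => by
      change _ = S.proj _ _ ≫ U.map (S.tensorHom f (𝟙 b))
      rw [μ_map_tensorHom]; simp
    μ_natural_right := fun a f => by
      change _ = S.proj _ _ ≫ U.map (S.tensorHom (𝟙 a) f)
      rw [μ_map_tensorHom]; simp
    associativity := S.μ_map_assocHom
    left_unitality := fun a => by
      change _ = S.one ▷ _ ≫ S.proj _ _ ≫ U.map (S.leftHom a)
      rw [map_leftHom, reassoc_of% S.left_inv_hom]
    right_unitality := fun a => by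
      change _ = _ ◁ S.one ≫ S.proj _ _ ≫ U.map (S.rightHom a)
      rw [map_rightHom, reassoc_of% S.right_inv_hom]
    δ_natural_left := fun f b => by
      change _ = U.map (S.tensorHom f (𝟙 b)) ≫ S.incl _ _
      rw [map_tensorHom_δ]; simp
    δ_natural_right := fun a f => by
      change _ = U.map (S.tensorHom (𝟙 a) f) ≫ S.incl _ _
      rw [map_tensorHom_δ]; simp
    oplax_associativity := fun a b c => (S.map_assocHom_δ a b c).symm
    oplax_left_unitality := fun a => by
      change _ = U.map (S.leftInv a) ≫ S.incl _ _ ≫ _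
      rw [map_leftInv, Category.assoc, Category.assoc, S.left_inv_hom, Category.comp_id]
    oplax_right_unitality := fun a => by
      change _ = U.map (S.rightInv a) ≫ S.incl _ _ ≫ _
      rw [map_rightInv, Category.assoc, Category.assoc, S.right_inv_hom, Category.comp_id]
    frobenius_left := fun a b c => by
      change S.incl a b ▷ U.obj c ≫ (α_ _ _ _).hom ≫ U.obj a ◁ S.proj b c =
        S.proj (S.tensorObj a b) c ≫ U.map (S.assocHom a b c) ≫ S.incl a (S.tensorObj b c)
      rw [← cancel_epi (S.proj a b ▷ U.obj c), ← cancel_mono (U.obj a ◁ S.incl b c)]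
      simp only [Category.assoc]
      rw [S.nabla_left, reassoc_of% S.μ_map_assocHom]
    frobenius_right := fun a b c => by
      change U.obj a ◁ S.incl b c ≫ (α_ _ _ _).inv ≫ S.proj a b ▷ U.obj c =
        S.proj a (S.tensorObj b c) ≫ U.map (S.assocInv a b c) ≫ S.incl (S.tensorObj a b) c
      rw [← cancel_epi (U.obj a ◁ S.proj b c), ← cancel_mono (S.incl a b ▷ U.obj c)]
      simp only [Category.assoc]
      rw [S.nabla_right, S.map_assocInv_δ]
    separable := S.δ_μ }

end SplitTensor

end SplitTensor

end Tannaka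

namespace Tannaka

section Presentation

open scoped MonObj ComonObj

variable {V : Type u} [Category.{v} V] [MonoidalCategory V] {H : V} [MonObj H]

/-- An associative (not necessarily unital) action. -/
def IsAssocAct {E : V} (d : H ⊗ E ⟶ E) : Prop :=
  μ[H] ▷ E ≫ d = (α_ H H E).hom ≫ H ◁ d ≫ d

/-- The action of the unit element. -/
def unitAct {E : V} (d : H ⊗ E ⟶ E) : E ⟶ E := (λ_ E).inv ≫ η[H] ▷ E ≫ d

section

variable {E : V} {d : H ⊗ E ⟶ E}

lemma IsAssocAct.act_unitAct (hd : IsAssocAct d) : d ≫ unitAct d = d := by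
  have h : unitAct d = (λ_ E).inv ≫ η[H] ▷ E ≫ d := rfl
  rw [h, leftUnitor_inv_naturality_assoc, whisker_exchange_assoc]
  have := (α_ H H E).inv ≫= hd
  rw [Iso.inv_hom_id_assoc] at this
  have h' := congrArg (· ▷ E) (MonObj.one_mul H)
  simp only [comp_whiskerRight] at h'
  rw [← this, associator_inv_naturality_left_assoc, reassoc_of% h']
  simp

lemma IsAssocAct.lw_unitAct_act (hd : IsAssocAct d) : H ◁ unitAct d ≫ d = d := by
  simp only [unitAct, MonoidalCategory.whiskerLeft_comp, Category.assoc]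
  have := (α_ H H E).inv ≫= hd
  rw [Iso.inv_hom_id_assoc] at this
  rw [← this]
  have h' := congrArg (· ▷ E) (MonObj.mul_one H)
  simp only [comp_whiskerRight] at h'
  rw [associator_inv_naturality_middle_assoc, reassoc_of% h']
  simp

lemma IsAssocAct.unitAct_unitAct (hd : IsAssocAct d) : unitAct d ≫ unitAct d = unitAct d := by
  simp only [unitAct, Category.assoc]
  have := hd.act_unitAct
  simp only [unitAct] at this
  rw [this]

lemma unitAct_natural {E' : V} {d' : H ⊗ E' ⟶ E'} (f : E ⟶ E') (h : d ≫ f = H ◁ f ≫ d') :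
    unitAct d ≫ f = f ≫ unitAct d' := by
  simp only [unitAct, Category.assoc, h, leftUnitor_inv_naturality_assoc, whisker_exchange_assoc]

end

/-- A presentation of the module `x : H ⊗ X ⟶ X` as a splitting of the action of the unit on `E`. -/
structure Presentation {X E : V} (x : H ⊗ X ⟶ X) (d : H ⊗ E ⟶ E) where
  p : E ⟶ X
  i : X ⟶ E
  i_p : i ≫ p = 𝟙 X
  p_i : p ≫ i = unitAct d
  act_i : x ≫ i = H ◁ i ≫ d
  p_act : H ◁ p ≫ x = d ≫ p

namespace Presentation

variable {X E : V} {x : H ⊗ X ⟶ X} {d : H ⊗ E ⟶ E} (P : Presentation x d)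

lemma i_p_assoc {W : V} (g : X ⟶ W) : P.i ≫ P.p ≫ g = g := by
  rw [← Category.assoc, P.i_p, Category.id_comp]

lemma unitAct_p : unitAct d ≫ P.p = P.p := by
  rw [← P.p_i, Category.assoc, P.i_p, Category.comp_id]

lemma i_unitAct : P.i ≫ unitAct d = P.i := by
  rw [← P.p_i, P.i_p_assoc]

lemma unitAct_eq {X E : V} {x : H ⊗ X ⟶ X} {d : H ⊗ E ⟶ E} (P : Presentation x d) : unitAct x = 𝟙 X := by
  have := unitAct_natural P.i P.act_i
  rw [← Category.comp_id (unitAct x), ← P.i_p, ← Category.assoc, this, Category.assoc, P.unitAct_p]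

/-- A map from `E` descends to a linear map. -/
lemma linear_desc {Y : V} {y : H ⊗ Y ⟶ Y} (f : E ⟶ Y)
    (h : d ≫ f = H ◁ (unitAct d ≫ f) ≫ y) : x ≫ P.i ≫ f = H ◁ (P.i ≫ f) ≫ y := by
  rw [reassoc_of% P.act_i, h, ← MonoidalCategory.whiskerLeft_comp_assoc, ← Category.assoc,
    P.i_unitAct]

/-- A map into `E` gives a linear map. -/
lemma linear_lift {Y : V} {y : H ⊗ Y ⟶ Y} (f : Y ⟶ E)
    (h : y ≫ f ≫ unitAct d = H ◁ f ≫ d) : y ≫ f ≫ P.p = H ◁ (f ≫ P.p) ≫ x := by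
  rw [MonoidalCategory.whiskerLeft_comp, Category.assoc, P.p_act, ← reassoc_of% h, P.unitAct_p]

lemma linear_map {X' E' : V} {x' : H ⊗ X' ⟶ X'} {d' : H ⊗ E' ⟶ E'} (P' : Presentation x' d')
    (f : E ⟶ E') (h : d ≫ f = H ◁ f ≫ d') :
    x ≫ P.i ≫ f ≫ P'.p = H ◁ (P.i ≫ f ≫ P'.p) ≫ x' := by
  rw [reassoc_of% P.act_i, reassoc_of% h]
  simp only [MonoidalCategory.whiskerLeft_comp, Category.assoc, P'.p_act]

end Presentation

/-- The action on a splitting. -/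
def splitAct {X E : V} (d : H ⊗ E ⟶ E) (p : E ⟶ X) (i : X ⟶ E) : H ⊗ X ⟶ X := H ◁ i ≫ d ≫ p

/-- The presentation of a splitting. -/
def splitPresentation {X E : V} {d : H ⊗ E ⟶ E} (hd : IsAssocAct d) (p : E ⟶ X) (i : X ⟶ E)
    (h : i ≫ p = 𝟙 X) (h' : p ≫ i = unitAct d) : Presentation (splitAct d p i) d where
  p := p
  i := i
  i_p := h
  p_i := h'
  act_i := by simp only [splitAct, Category.assoc, h', hd.act_unitAct]
  p_act := by
    rw [splitAct, ← MonoidalCategory.whiskerLeft_comp_assoc, h', reassoc_of% hd.lw_unitAct_act]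

lemma isAssocAct_of_presentation {X E : V} {x : H ⊗ X ⟶ X} {d : H ⊗ E ⟶ E} (hd : IsAssocAct d)
    (P : Presentation x d) : IsAssocAct x := by
  have h : (μ[H] ▷ X ≫ x) ≫ P.i = ((α_ H H X).hom ≫ H ◁ x ≫ x) ≫ P.i := by
    have hd' : μ[H] ▷ E ≫ d = (α_ H H E).hom ≫ H ◁ d ≫ d := hd
    simp only [Category.assoc, P.act_i]
    rw [← whisker_exchange_assoc, hd', ← MonoidalCategory.whiskerLeft_comp_assoc, P.act_i]
    simp
  have hp := h =≫ P.p
  simp only [Category.assoc, P.i_p, Category.comp_id] at hp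
  exact hp

/-- A module is determined by a unital associative action. -/
abbrev modMk {X : V} (x : H ⊗ X ⟶ X) (h : IsAssocAct x) (h' : unitAct x = 𝟙 X) : Mod V H where
  X := X
  mod :=
    { smul := x
      one_smul := by
        change η[H] ▷ X ≫ x = (λ_ X).hom
        rw [← cancel_epi (λ_ X).inv, Iso.inv_hom_id]
        exact h'
      mul_smul := h }

/-- The action on a module. -/
def mact (a : Mod V H) : H ⊗ a.X ⟶ a.X := ModObj.smul (M := H) (X := a.X)

lemma mact_isAssocAct (a : Mod V H) : IsAssocAct (mact a) := ModObj.mul_smul (M := H) a.X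

lemma unitAct_mact (a : Mod V H) : unitAct (mact a) = 𝟙 a.X := by
  have : η[H] ▷ a.X ≫ mact a = (λ_ a.X).hom := ModObj.one_smul (M := H) a.X
  rw [unitAct, this, Iso.inv_hom_id]

lemma mact_hom {a b : Mod V H} (f : a ⟶ b) : mact a ≫ f.hom = H ◁ f.hom ≫ mact b :=
  IsModHom.smul_hom (A := H) (f := f.hom)

/-- A linear map as a morphism of modules. -/
abbrev modHomMk {a b : Mod V H} (f : a.X ⟶ b.X) (h : mact a ≫ f = H ◁ f ≫ mact b) : a ⟶ b :=
  Mod.Hom.mk' f h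

/-- Every module presents itself. -/
@[simps]
def selfPresentation (a : Mod V H) : Presentation (mact a) (mact a) where
  p := 𝟙 _
  i := 𝟙 _
  i_p := by simp
  p_i := by rw [unitAct_mact]; simp
  act_i := by simp
  p_act := by simp

instance : (Mod.forget (D := V) H).Faithful where
  map_injective h := Mod.hom_ext _ _ h

end Presentation

section TensorAct

open scoped MonObj ComonObj

variable {V : Type u} [Category.{v} V] [MonoidalCategory V] [BraidedCategory V] {H : V}

/-- The action of `H` through `Δ` on a tensor product. -/
def tact [ComonObj H] {a b : V} (x : H ⊗ a ⟶ a) (y : H ⊗ b ⟶ b) : H ⊗ (a ⊗ b) ⟶ a ⊗ b :=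
  Δ[H] ▷ (a ⊗ b) ≫ act₂ x y

lemma hat_tact [ComonObj H] {a b : V} (x : H ⊗ a ⟶ a) (y : H ⊗ b ⟶ b) (Z : V) :
    hat₃₂ (tact x y) Z =
      hat₁₂ Δ[H] (a ⊗ b ⊗ Z) ≫ H ◃ (swap H a (b ⊗ Z) ≫ a ◃ hat₂₁ y Z) ≫ hat₂₁ x (b ⊗ Z) := by
  simp only [hat₁₂, hat₂₁, hat₃₂, lw, swap, tact, act₂, tensorμ, MonoidalCategory.tensorHom_def',
    MonoidalCategory.whiskerLeft_comp, comp_whiskerRight, Category.assoc]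
  monoidal

lemma tact_comp_tensorHom [ComonObj H] {a b a' b' : V} {x : H ⊗ a ⟶ a} {y : H ⊗ b ⟶ b}
    {x' : H ⊗ a' ⟶ a'} {y' : H ⊗ b' ⟶ b'} (f : a ⟶ a') (g : b ⟶ b')
    (hf : x ≫ f = H ◁ f ≫ x') (hg : y ≫ g = H ◁ g ≫ y') :
    tact x y ≫ (f ⊗ₘ g) = H ◁ (f ⊗ₘ g) ≫ tact x' y' := by
  simp only [tact, act₂, Category.assoc, tensorHom_comp_tensorHom, hf, hg]
  rw [whisker_exchange_assoc, ← tensorHom_comp_tensorHom]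
  have := tensorμ_natural (𝟙 H) (𝟙 H) f g
  simp only [id_tensorHom, MonoidalCategory.whiskerLeft_id, ← id_tensorHom] at this ⊢
  simp only [id_tensorHom_id] at this
  rw [reassoc_of% this]

lemma hat_isAssocAct [MonObj H] {a : V} {x : H ⊗ a ⟶ a} (hx : IsAssocAct x) (Z : V) :
    hat₂₁ μ[H] (a ⊗ Z) ≫ hat₂₁ x Z = H ◃ hat₂₁ x Z ≫ hat₂₁ x Z := by
  have h : hat₂₁ μ[H] (a ⊗ Z) ≫ hat₂₁ x Z =
      H ◁ (α_ H a Z).inv ≫ (α_ H (H ⊗ a) Z).inv ≫ (α_ H H a).inv ▷ Z ≫ (μ[H] ▷ a ≫ x) ▷ Z := by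
    simp only [hat₂₁, comp_whiskerRight]
    monoidal
  have hx' : μ[H] ▷ a ≫ x = (α_ H H a).hom ≫ H ◁ x ≫ x := hx
  rw [h, hx']
  simp only [hat₂₁, lw, comp_whiskerRight, MonoidalCategory.whiskerLeft_comp]
  monoidal

lemma hat₃₂_mul [MonObj H] {a b : V} (f : H ⊗ (a ⊗ b) ⟶ a ⊗ b) (Z : V) :
    hat₂₁ μ[H] (a ⊗ b ⊗ Z) ≫ hat₃₂ f Z = H ◁ H ◁ (α_ a b Z).inv ≫ (α_ H H ((a ⊗ b) ⊗ Z)).inv ≫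
      (α_ (H ⊗ H) (a ⊗ b) Z).inv ≫ (μ[H] ▷ (a ⊗ b) ≫ f) ▷ Z ≫ (α_ a b Z).hom := by
  simp only [hat₂₁, hat₃₂, comp_whiskerRight]
  monoidal

lemma hat₃₂_hat₃₂ {a b : V} (f : H ⊗ (a ⊗ b) ⟶ a ⊗ b) (Z : V) :
    H ◃ hat₃₂ f Z ≫ hat₃₂ f Z = H ◁ H ◁ (α_ a b Z).inv ≫ (α_ H H ((a ⊗ b) ⊗ Z)).inv ≫
      (α_ (H ⊗ H) (a ⊗ b) Z).inv ≫ ((α_ H H (a ⊗ b)).hom ≫ H ◁ f ≫ f) ▷ Z ≫ (α_ a b Z).hom := by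
  simp only [lw, hat₃₂, comp_whiskerRight, MonoidalCategory.whiskerLeft_comp]
  monoidal

lemma tact_isAssocAct [WeakBimonObj H] {a b : V} {x : H ⊗ a ⟶ a} {y : H ⊗ b ⟶ b}
    (hx : IsAssocAct x) (hy : IsAssocAct y) : IsAssocAct (tact x y) := by
  refine hat₁₁_congr fun Z => ?_
  have e₁ := hat₃₂_mul (tact x y) Z
  have e₂ := hat₃₂_hat₃₂ (tact x y) Z
  suffices h : hat₂₁ μ[H] (a ⊗ b ⊗ Z) ≫ hat₃₂ (tact x y) Z =
      H ◃ hat₃₂ (tact x y) Z ≫ hat₃₂ (tact x y) Z by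
    rw [e₁, e₂] at h
    simp only [cancel_epi, cancel_mono] at h
    exact h
  have hx' := hat_isAssocAct hx
  have hy' := hat_isAssocAct hy
  have h₁ := hat₂₁_swap a (b ⊗ Z) μ[H]
  have h₂ := lw_hat₂₁_swap H (b ⊗ Z) x
  have h₃ := hat₁₂_swap a (b ⊗ Z) Δ[H]
  rw [hat_tact]
  calc _ = (hat₂₁ μ[H] _ ≫ hat₁₂ Δ[H] _) ≫ H ◃ (swap H a (b ⊗ Z) ≫ a ◃ hat₂₁ y Z) ≫
        hat₂₁ x (b ⊗ Z) := by simp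
    _ = H ◃ hat₁₂ Δ[H] _ ≫ hat₁₂ Δ[H] _ ≫ H ◃ (swap H H _ ≫
          H ◃ ((hat₂₁ μ[H] _ ≫ swap H a _) ≫ a ◃ hat₂₁ y Z)) ≫ hat₂₁ μ[H] _ ≫ hat₂₁ x _ := by
      rw [hat_mul_comul]; simp
    _ = H ◃ hat₁₂ Δ[H] _ ≫ hat₁₂ Δ[H] _ ≫ H ◃ (H ◃ H ◃ (swap H a _ ≫ a ◃ hat₂₁ y _) ≫
          (swap H H _ ≫ H ◃ swap H a _ ≫ hat₂₁ x _) ≫ a ◃ hat₂₁ y _) ≫ hat₂₁ x _ := by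
      rw [hx', h₁]; simp [hy']
    _ = _ := by rw [← h₂]; simp

/-- The flattened form of a map `H ⊗ ((a ⊗ b) ⊗ c) ⟶ a ⊗ (b ⊗ c)`. -/
def hat₄₃ {a b c : V} (f : H ⊗ ((a ⊗ b) ⊗ c) ⟶ a ⊗ (b ⊗ c)) (Z : V) :
    H ⊗ a ⊗ b ⊗ c ⊗ Z ⟶ a ⊗ b ⊗ c ⊗ Z :=
  H ◁ ((α_ a b (c ⊗ Z)).inv ≫ (α_ (a ⊗ b) c Z).inv) ≫ (α_ _ _ _).inv ≫ f ▷ Z ≫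
    (α_ _ _ _).hom ≫ a ◁ (α_ b c Z).hom

lemma hat₄₃_congr {a b c : V} {f g : H ⊗ ((a ⊗ b) ⊗ c) ⟶ a ⊗ (b ⊗ c)}
    (h : ∀ Z, hat₄₃ f Z = hat₄₃ g Z) : f = g := by
  refine hat₁₁_congr fun Z => ?_
  have := h Z
  simp only [hat₄₃, cancel_epi, cancel_mono] at this
  exact this

lemma hat_tact_tact_left [ComonObj H] {a b c : V} (x : H ⊗ a ⟶ a) (y : H ⊗ b ⟶ b)
    (z : H ⊗ c ⟶ c) (Z : V) : hat₄₃ (tact (tact x y) z ≫ (α_ a b c).hom) Z =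
      hat₁₂ Δ[H] _ ≫ H ◃ (swap H a _ ≫ a ◃ swap H b _ ≫ a ◃ b ◃ hat₂₁ z Z) ≫
        hat₃₂ (tact x y) (c ⊗ Z) := by
  have h : hat₄₃ (tact (tact x y) z ≫ (α_ a b c).hom) Z =
      H ◁ (α_ a b (c ⊗ Z)).inv ≫ hat₃₂ (tact (tact x y) z) Z ≫ (α_ a b (c ⊗ Z)).hom := by
    simp only [hat₄₃, hat₃₂, comp_whiskerRight, MonoidalCategory.whiskerLeft_comp]
    monoidal
  rw [h, hat_tact (tact x y) z, swap_tensor_right]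
  simp only [hat₁₂, hat₂₁, hat₃₂, lw, MonoidalCategory.whiskerLeft_comp, comp_whiskerRight,
    Category.assoc]
  monoidal

lemma hat_tact_tact_right [ComonObj H] {a b c : V} (x : H ⊗ a ⟶ a) (y : H ⊗ b ⟶ b)
    (z : H ⊗ c ⟶ c) (Z : V) : hat₄₃ (H ◁ (α_ a b c).hom ≫ tact x (tact y z)) Z =
      hat₁₂ Δ[H] _ ≫ H ◃ (swap H a _ ≫ a ◃ hat₃₂ (tact y z) Z) ≫ hat₂₁ x _ := by
  have h : hat₄₃ (H ◁ (α_ a b c).hom ≫ tact x (tact y z)) Z =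
      H ◁ a ◁ (α_ b c Z).inv ≫ hat₃₂ (tact x (tact y z)) Z ≫ a ◁ (α_ b c Z).hom := by
    simp only [hat₄₃, hat₃₂, comp_whiskerRight, MonoidalCategory.whiskerLeft_comp]
    monoidal
  have h' : H ◁ a ◁ (α_ b c Z).inv ≫ hat₁₂ Δ[H] _ ≫ H ◃ swap H a _ =
      hat₁₂ Δ[H] _ ≫ H ◃ swap H a _ ≫ H ◃ a ◃ H ◃ (α_ b c Z).inv := by
    simp; rfl
  rw [h, hat_tact x (tact y z)]
  simp only [← lw_comp, Category.assoc]
  rw [reassoc_of% h']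
  simp only [hat₁₂, hat₂₁, hat₃₂, lw, MonoidalCategory.whiskerLeft_comp, comp_whiskerRight,
    Category.assoc]
  monoidal

lemma tact_assoc [ComonObj H] {a b c : V} (x : H ⊗ a ⟶ a) (y : H ⊗ b ⟶ b) (z : H ⊗ c ⟶ c) :
    tact (tact x y) z ≫ (α_ a b c).hom = H ◁ (α_ a b c).hom ≫ tact x (tact y z) := by
  refine hat₄₃_congr fun Z => ?_
  rw [hat_tact_tact_left, hat_tact_tact_right, hat_tact, hat_tact]
  have h₁ := hat₁₂_swap a (b ⊗ c ⊗ Z) Δ[H]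
  calc _ = (hat₁₂ Δ[H] _ ≫ hat₁₂ Δ[H] _) ≫ H ◃ H ◃ (swap H a _ ≫ a ◃ swap H b _ ≫ a ◃ b ◃ hat₂₁ z Z) ≫
        H ◃ (swap H a _ ≫ a ◃ hat₂₁ y _) ≫ hat₂₁ x _ := by simp
    _ = hat₁₂ Δ[H] _ ≫ H ◃ ((hat₁₂ Δ[H] _ ≫ H ◃ swap H a _ ≫ swap H a _) ≫
          a ◃ H ◃ (swap H b _ ≫ b ◃ hat₂₁ z Z) ≫ a ◃ hat₂₁ y _) ≫ hat₂₁ x _ := by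
      rw [hat_comul_assoc]; simp
    _ = _ := by rw [h₁]; simp

end TensorAct

end Tannaka

namespace Tannaka

section ModuleTensor

open scoped MonObj ComonObj

variable {V : Type u} [Category.{v} V] [MonoidalCategory V] [BraidedCategory V]
  {H : V} [WeakBimonObj H]

local notation "𝐦" => hat₂₁ (MonObj.mul (X := H))
local notation "𝐮" => hat₀₁ (MonObj.one (X := H))
local notation "𝐝" => hat₁₂ (ComonObj.comul (X := H))
local notation "𝐞" => hat₁₀ (ComonObj.counit (X := H))
local notation "𝐬" => hat₁₁ (idemS H)
local notation "𝐭" => hat₁₁ (idemT H)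
local notation "𝐱" => swap H H

lemma tact_stable {a b : V} {x : H ⊗ a ⟶ a} {y : H ⊗ b ⟶ b}
    (f : a ⟶ a) (g : b ⟶ b) (hf : x ≫ f = x) (hg : y ≫ g = y) :
    tact x y ≫ (f ⊗ₘ g) = tact x y := by
  simp only [tact, act₂, Category.assoc, tensorHom_comp_tensorHom, hf, hg]

/-- A presentation of a tensor product. -/
@[simps]
def Presentation.tensor {X Y Z E F : V} {x : H ⊗ X ⟶ X} {y : H ⊗ Y ⟶ Y} {z : H ⊗ Z ⟶ Z}
    {d : H ⊗ E ⟶ E} {e : H ⊗ F ⟶ F} (P : Presentation x d) (Q : Presentation y e)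
    (R : Presentation z (tact x y)) (hd : IsAssocAct d) (he : IsAssocAct e) :
    Presentation z (tact d e) where
  p := (P.p ⊗ₘ Q.p) ≫ R.p
  i := R.i ≫ (P.i ⊗ₘ Q.i)
  i_p := by
    rw [Category.assoc, tensorHom_comp_tensorHom_assoc, P.i_p, Q.i_p]
    simp [R.i_p]
  p_i := by
    rw [Category.assoc, reassoc_of% R.p_i, ← Category.assoc,
      ← unitAct_natural _ (tact_comp_tensorHom P.p Q.p P.p_act.symm Q.p_act.symm), Category.assoc,
      tensorHom_comp_tensorHom, P.p_i, Q.p_i]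
    simp only [unitAct, Category.assoc]
    congr 2
    exact tact_stable _ _ hd.act_unitAct he.act_unitAct
  act_i := by
    rw [reassoc_of% R.act_i, tact_comp_tensorHom P.i Q.i P.act_i Q.act_i]
    simp
  p_act := by
    rw [MonoidalCategory.whiskerLeft_comp, Category.assoc, R.p_act,
      ← reassoc_of% tact_comp_tensorHom P.p Q.p P.p_act.symm Q.p_act.symm]

lemma unitAct_comp {E Y : V} {d : H ⊗ E ⟶ E} {y : H ⊗ Y ⟶ Y} (hy : unitAct y = 𝟙 Y)
    {f g : E ⟶ Y} (h : d ≫ f = H ◁ g ≫ y) : unitAct d ≫ f = g := by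
  rw [unitAct, Category.assoc, Category.assoc, h, ← whisker_exchange_assoc,
    ← leftUnitor_inv_naturality_assoc]
  change g ≫ unitAct y = g
  rw [hy, Category.comp_id]

lemma hat_unitAct {a b : V} (d : H ⊗ (a ⊗ b) ⟶ a ⊗ b) (Z : V) :
    hat₂₂ (unitAct d) Z = 𝐮 (a ⊗ b ⊗ Z) ≫ hat₃₂ d Z := by
  simp only [hat₂₂, unitAct, hat₀₁, hat₃₂, comp_whiskerRight]
  monoidal

lemma hat_unit_act {a : V} {x : H ⊗ a ⟶ a} (hx : unitAct x = 𝟙 a) (Z : V) :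
    𝐮 (a ⊗ Z) ≫ hat₂₁ x Z = 𝟙 _ := by
  have : 𝐮 (a ⊗ Z) ≫ hat₂₁ x Z = hat₁₁ (unitAct x) Z := by
    simp only [hat₁₁, unitAct, hat₀₁, hat₂₁, comp_whiskerRight]
    monoidal
  rw [this, hx, hat₁₁_id]

variable (H) in
lemma idemT_counit (Z : V) : 𝐭 Z ≫ 𝐞 Z = 𝐞 Z := by
  have h := 𝐮 (H ⊗ Z) ≫= idemT_mul_counit H Z
  simpa using h

variable (H) in
lemma one_idemT (Z : V) : 𝐮 Z ≫ 𝐭 Z = 𝐮 Z := by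
  have h := lw_hat₀₁_swap H Z η[H]
  calc _ = 𝐮 _ ≫ 𝐝 _ ≫ H ◃ (H ◃ 𝐮 Z ≫ 𝐱 Z) ≫ 𝐦 (H ⊗ Z) ≫ 𝐞 (H ⊗ Z) := by rw [hat_idemT]; simp
    _ = _ := by rw [h]; simp

variable (H) in
lemma one_idemS (Z : V) : 𝐮 Z ≫ 𝐬 Z = 𝐮 Z := by
  have h (r : H ⊗ H ⊗ Z ⟶ Z) : 𝐮 Z ≫ 𝐮 (H ⊗ Z) ≫ 𝐝 _ ≫ H ◃ r = 𝐮 Z ≫ 𝐝 Z ≫ H ◃ (H ◃ 𝐮 Z ≫ r) := by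
    simp
  rw [hat_idemS, h]
  simp

variable (H) in
/-- The action of `H` on itself by `t ∘ mul`. -/
def idemTAct : H ⊗ H ⟶ H := μ[H] ≫ idemT H

variable (H) in
lemma idemTAct_isAssocAct : IsAssocAct (idemTAct H) := by
  have h : μ[H] ≫ idemT H = H ◁ idemT H ≫ μ[H] ≫ idemT H := by
    refine hat₂₁_congr fun Z => ?_
    rw [hat₂₁_lw, hat₂₁_comp, idemT_mul_idemT]
  simp only [IsAssocAct, idemTAct, MonoidalCategory.whiskerLeft_comp, Category.assoc, ← h]
  simp

variable (H) in
lemma unitAct_idemTAct : unitAct (idemTAct H) = idemT H := by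
  simp [unitAct, idemTAct]

section Left

variable {a : V} (y : H ⊗ a ⟶ a)

/-- `k ⊗ x ↦ ε(k) x`. -/
def leftCounit (H a : V) [WeakBimonObj H] : H ⊗ a ⟶ a := ε[H] ▷ a ≫ (λ_ a).hom

/-- `x ↦ 1 ⊗ x`. -/
def leftUnit (H a : V) [WeakBimonObj H] : a ⟶ H ⊗ a := (λ_ a).inv ≫ η[H] ▷ a

variable {y} in
lemma tact_leftCounit (hy : IsAssocAct y) :
    tact (idemTAct H) y ≫ leftCounit H a = H ◁ (idemT H ▷ a ≫ y) ≫ y := by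
  refine hat₁₁_congr fun Z => ?_
  have h₁ : hat₃₂ (tact (idemTAct H) y) Z ≫ 𝐞 (a ⊗ Z) = H ◁ (α_ H a Z).inv ≫
      (α_ H (H ⊗ a) Z).inv ≫ hat₁₁ (tact (idemTAct H) y ≫ leftCounit H a) Z := by
    simp only [hat₃₂, hat₁₁, hat₁₀, leftCounit, comp_whiskerRight]
    monoidal
  have h₂ : H ◃ (𝐭 (a ⊗ Z) ≫ hat₂₁ y Z) ≫ hat₂₁ y Z = H ◁ (α_ H a Z).inv ≫
      (α_ H (H ⊗ a) Z).inv ≫ hat₁₁ (H ◁ (idemT H ▷ a ≫ y) ≫ y) Z := by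
    simp only [hat₂₁, hat₁₁, lw, comp_whiskerRight, MonoidalCategory.whiskerLeft_comp]
    monoidal
  rw [← cancel_epi (α_ H (H ⊗ a) Z).inv, ← cancel_epi (H ◁ (α_ H a Z).inv), ← h₁, ← h₂, hat_tact]
  have h₃ := comul_mul_counit_swap H (a ⊗ Z)
  calc _ = 𝐝 _ ≫ H ◃ 𝐱 (a ⊗ Z) ≫ 𝐦 _ ≫ (𝐭 _ ≫ 𝐞 _) ≫ hat₂₁ y Z := by
        simp [idemTAct, hat₂₁_comp]
    _ = (𝐝 _ ≫ H ◃ 𝐱 (a ⊗ Z) ≫ 𝐦 _ ≫ 𝐞 _) ≫ hat₂₁ y Z := by rw [idemT_counit]; simp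
    _ = H ◃ 𝐭 _ ≫ 𝐦 _ ≫ hat₂₁ y Z := by rw [h₃]; simp
    _ = _ := by rw [hat_isAssocAct hy]; simp

lemma hat_leftUnit_tact (Z : V) : H ◃ 𝐮 (a ⊗ Z) ≫ hat₃₂ (tact (idemTAct H) y) Z =
    𝐝 (a ⊗ Z) ≫ H ◃ hat₂₁ y Z ≫ 𝐭 (a ⊗ Z) := by
  have h := lw_hat₀₁_swap H (a ⊗ Z) η[H]
  rw [hat_tact]
  calc _ = 𝐝 _ ≫ H ◃ (H ◃ 𝐮 _ ≫ 𝐱 _) ≫ H ◃ H ◃ hat₂₁ y Z ≫ 𝐦 _ ≫ 𝐭 _ := by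
        simp [idemTAct, hat₂₁_comp]
    _ = _ := by rw [h]; simp

lemma hat_leftUnit_unitAct (Z : V) : 𝐮 (a ⊗ Z) ≫ hat₂₂ (unitAct (tact (idemTAct H) y)) Z =
    𝐮 _ ≫ 𝐝 (a ⊗ Z) ≫ H ◃ hat₂₁ y Z ≫ 𝐭 (a ⊗ Z) := by
  rw [← hat_leftUnit_tact, hat_unitAct]
  simp

variable {y} in
lemma act_leftUnit (hy : IsAssocAct y) : y ≫ leftUnit H a ≫ unitAct (tact (idemTAct H) y) =
    H ◁ leftUnit H a ≫ tact (idemTAct H) y := by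
  refine hat₂₂_congr fun Z => ?_
  have h₁ : hat₂₂ (y ≫ leftUnit H a ≫ unitAct (tact (idemTAct H) y)) Z =
      hat₂₁ y Z ≫ 𝐮 (a ⊗ Z) ≫ hat₂₂ (unitAct (tact (idemTAct H) y)) Z := by
    simp only [hat₂₂, hat₂₁, hat₀₁, leftUnit, comp_whiskerRight]
    monoidal
  have h₂ : hat₂₂ (H ◁ leftUnit H a ≫ tact (idemTAct H) y) Z =
      H ◃ 𝐮 (a ⊗ Z) ≫ hat₃₂ (tact (idemTAct H) y) Z := by
    simp only [hat₂₂, hat₃₂, hat₀₁, leftUnit, lw, comp_whiskerRight,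
      MonoidalCategory.whiskerLeft_comp]
    monoidal
  rw [h₁, h₂, hat_leftUnit_unitAct, hat_leftUnit_tact]
  calc _ = 𝐮 _ ≫ 𝐝 _ ≫ H ◃ (H ◃ hat₂₁ y Z ≫ hat₂₁ y Z) ≫ 𝐭 _ := by simp
    _ = 𝐮 _ ≫ 𝐝 _ ≫ H ◃ (𝐦 _ ≫ hat₂₁ y Z) ≫ 𝐭 _ := by rw [hat_isAssocAct hy]
    _ = (𝐮 _ ≫ 𝐝 _ ≫ H ◃ 𝐦 _ ≫ 𝐭 _) ≫ H ◃ hat₂₁ y Z := by simp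
    _ = _ := by rw [← comul_idemT_left]; simp

variable {y} in
lemma leftCounit_leftUnit (hy : IsAssocAct y) (hy' : unitAct y = 𝟙 a) :
    unitAct (tact (idemTAct H) y) ≫ leftCounit H a ≫ leftUnit H a ≫
      unitAct (tact (idemTAct H) y) = unitAct (tact (idemTAct H) y) := by
  have h := unitAct_comp hy' (tact_leftCounit hy)
  rw [reassoc_of% h, act_leftUnit hy]
  refine hat₂₂_congr fun Z => ?_
  have h₂ : hat₂₂ (idemT H ▷ a ≫ H ◁ leftUnit H a ≫ tact (idemTAct H) y) Z =
      𝐭 (a ⊗ Z) ≫ H ◃ 𝐮 (a ⊗ Z) ≫ hat₃₂ (tact (idemTAct H) y) Z := by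
    simp only [hat₂₂, hat₃₂, hat₁₁, hat₀₁, leftUnit, lw, comp_whiskerRight,
      MonoidalCategory.whiskerLeft_comp]
    monoidal
  have h₃ := idemT_comul H (a ⊗ Z)
  have h₄ := lw_hat₁₁_swap H (a ⊗ Z) (idemT H)
  have h₅ := idemT_mul_idemT H (a ⊗ Z)
  rw [h₂, hat_leftUnit_tact, reassoc_of% h₃, hat_unitAct, hat_tact, hat_oneComulMul]
  calc _ = 𝐮 _ ≫ 𝐝 _ ≫ H ◃ ((H ◃ 𝐭 _ ≫ 𝐱 _) ≫ H ◃ hat₂₁ y Z) ≫ 𝐦 _ ≫ 𝐭 _ := by simp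
    _ = 𝐮 _ ≫ 𝐝 _ ≫ H ◃ (𝐱 _ ≫ H ◃ hat₂₁ y Z) ≫ H ◃ 𝐭 _ ≫ 𝐦 _ ≫ 𝐭 _ := by rw [h₄]; simp
    _ = _ := by rw [h₅]; simp [idemTAct, hat₂₁_comp]

variable {y} in
lemma leftUnit_leftCounit (hy : IsAssocAct y) (hy' : unitAct y = 𝟙 a) :
    leftUnit H a ≫ unitAct (tact (idemTAct H) y) ≫ leftCounit H a = 𝟙 a := by
  rw [unitAct_comp hy' (tact_leftCounit hy)]
  refine hat₁₁_congr fun Z => ?_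
  have h : hat₁₁ (leftUnit H a ≫ idemT H ▷ a ≫ y) Z = 𝐮 (a ⊗ Z) ≫ 𝐭 _ ≫ hat₂₁ y Z := by
    simp only [hat₁₁, hat₀₁, hat₂₁, leftUnit, comp_whiskerRight]
    monoidal
  rw [h, reassoc_of% one_idemT H, hat_unit_act hy', hat₁₁_id]

end Left

section Right

variable {a : V} (x : H ⊗ a ⟶ a)

/-- `x ⊗ k ↦ ε(k) x`. -/
def rightCounit (H a : V) [WeakBimonObj H] : a ⊗ H ⟶ a := a ◁ ε[H] ≫ (ρ_ a).hom

/-- `x ↦ x ⊗ 1`. -/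
def rightUnit (H a : V) [WeakBimonObj H] : a ⟶ a ⊗ H := (ρ_ a).inv ≫ a ◁ η[H]

variable {x} in
lemma tact_rightCounit (hx : IsAssocAct x) :
    tact x (idemTAct H) ≫ rightCounit H a = H ◁ ((β_ H a).inv ≫ idemS H ▷ a ≫ x) ≫ x := by
  refine hat₁₁_congr fun Z => ?_
  have h₁ : hat₃₂ (tact x (idemTAct H)) Z ≫ a ◃ 𝐞 Z = H ◁ (α_ a H Z).inv ≫
      (α_ H (a ⊗ H) Z).inv ≫ hat₁₁ (tact x (idemTAct H) ≫ rightCounit H a) Z := by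
    simp only [hat₃₂, hat₁₁, hat₁₀, rightCounit, comp_whiskerRight, lw,
      MonoidalCategory.whiskerLeft_comp]
    monoidal
  have h₂ : H ◃ (swapInv H a Z ≫ 𝐬 (a ⊗ Z) ≫ hat₂₁ x Z) ≫ hat₂₁ x Z = H ◁ (α_ a H Z).inv ≫
      (α_ H (a ⊗ H) Z).inv ≫ hat₁₁ (H ◁ ((β_ H a).inv ≫ idemS H ▷ a ≫ x) ≫ x) Z := by
    simp only [hat₂₁, hat₁₁, lw, swapInv, comp_whiskerRight, MonoidalCategory.whiskerLeft_comp]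
    monoidal
  rw [← cancel_epi (α_ H (a ⊗ H) Z).inv, ← cancel_epi (H ◁ (α_ a H Z).inv), ← h₁, ← h₂, hat_tact]
  have h₃ := swap_swap_lw_hat₂₀ a Z (μ[H] ≫ ε[H])
  have h₄ : swap H a (H ⊗ Z) ≫ a ◃ (𝐦 Z ≫ 𝐞 Z) = H ◃ swapInv H a Z ≫ 𝐦 _ ≫ 𝐞 _ := by
    rw [hat₂₀_comp, hat₂₀_comp] at h₃
    rw [← h₃]; simp
  have h₅ := comul_mul_counit H (a ⊗ Z)
  calc _ = 𝐝 _ ≫ H ◃ (swap H a (H ⊗ Z) ≫ a ◃ (𝐦 Z ≫ 𝐭 _ ≫ 𝐞 Z)) ≫ hat₂₁ x Z := by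
        simp [idemTAct, hat₂₁_comp]
    _ = H ◃ swapInv H a Z ≫ (𝐝 _ ≫ H ◃ (𝐦 _ ≫ 𝐞 _)) ≫ hat₂₁ x Z := by
        rw [idemT_counit, h₄]; simp
    _ = H ◃ (swapInv H a Z ≫ 𝐬 _) ≫ 𝐦 _ ≫ hat₂₁ x Z := by rw [h₅]; simp
    _ = _ := by rw [hat_isAssocAct hx]; simp

lemma hat_rightUnit_tact (Z : V) : H ◃ a ◃ 𝐮 Z ≫ hat₃₂ (tact x (idemTAct H)) Z =
    𝐝 (a ⊗ Z) ≫ H ◃ 𝐭 _ ≫ H ◃ swap H a Z ≫ hat₂₁ x _ := by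
  have h := hat₁₁_swap a Z (idemT H)
  rw [hat_tact]
  calc _ = 𝐝 _ ≫ H ◃ (swap H a Z ≫ a ◃ (H ◃ 𝐮 Z ≫ hat₂₁ (idemTAct H) Z)) ≫ hat₂₁ x _ := by simp
    _ = 𝐝 _ ≫ H ◃ (swap H a Z ≫ a ◃ 𝐭 _) ≫ hat₂₁ x _ := by simp [idemTAct, hat₂₁_comp]
    _ = _ := by rw [← h]; simp

lemma hat_rightUnit_unitAct (Z : V) : a ◃ 𝐮 Z ≫ hat₂₂ (unitAct (tact x (idemTAct H))) Z =
    𝐮 _ ≫ 𝐝 (a ⊗ Z) ≫ H ◃ swap H a Z ≫ hat₂₁ x _ := by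
  have h := hat_rightUnit_tact x Z
  have h' := one_comul_idemT H (a ⊗ Z)
  calc _ = 𝐮 _ ≫ H ◃ a ◃ 𝐮 Z ≫ hat₃₂ (tact x (idemTAct H)) Z := by rw [hat_unitAct]; simp
    _ = _ := by rw [h, reassoc_of% h']

variable {x} in
lemma act_rightUnit (hx : IsAssocAct x) : x ≫ rightUnit H a ≫ unitAct (tact x (idemTAct H)) =
    H ◁ rightUnit H a ≫ tact x (idemTAct H) := by
  refine hat₂₂_congr fun Z => ?_
  have h₁ : hat₂₂ (x ≫ rightUnit H a ≫ unitAct (tact x (idemTAct H))) Z =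
      hat₂₁ x Z ≫ a ◃ 𝐮 Z ≫ hat₂₂ (unitAct (tact x (idemTAct H))) Z := by
    simp only [hat₂₂, hat₂₁, hat₀₁, rightUnit, comp_whiskerRight, lw,
      MonoidalCategory.whiskerLeft_comp]
    monoidal
  have h₂ : hat₂₂ (H ◁ rightUnit H a ≫ tact x (idemTAct H)) Z =
      H ◃ a ◃ 𝐮 Z ≫ hat₃₂ (tact x (idemTAct H)) Z := by
    simp only [hat₂₂, hat₃₂, hat₀₁, rightUnit, lw, comp_whiskerRight,
      MonoidalCategory.whiskerLeft_comp]
    monoidal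
  have h₃ := lw_hat₂₁_swap H Z x
  have h₄ := comul_idemT_right H (a ⊗ Z)
  rw [h₁, h₂, hat_rightUnit_unitAct, hat_rightUnit_tact, reassoc_of% h₄, hat_oneComulMul]
  calc _ = 𝐮 _ ≫ 𝐝 _ ≫ H ◃ (H ◃ hat₂₁ x Z ≫ swap H a Z) ≫ hat₂₁ x _ := by simp
    _ = 𝐮 _ ≫ 𝐝 _ ≫ H ◃ 𝐱 _ ≫ H ◃ H ◃ swap H a Z ≫ H ◃ hat₂₁ x _ ≫ hat₂₁ x _ := by rw [h₃]; simp
    _ = _ := by rw [← hat_isAssocAct hx]; simp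

variable {x} in
lemma rightCounit_rightUnit (hx : IsAssocAct x) (hx' : unitAct x = 𝟙 a) :
    unitAct (tact x (idemTAct H)) ≫ rightCounit H a ≫ rightUnit H a ≫
      unitAct (tact x (idemTAct H)) = unitAct (tact x (idemTAct H)) := by
  have h := unitAct_comp hx' (tact_rightCounit hx)
  rw [reassoc_of% h, act_rightUnit hx]
  refine hat₂₂_congr fun Z => ?_
  have h₂ : hat₂₂ ((β_ H a).inv ≫ idemS H ▷ a ≫ H ◁ rightUnit H a ≫ tact x (idemTAct H)) Z =
      swapInv H a Z ≫ 𝐬 (a ⊗ Z) ≫ H ◃ a ◃ 𝐮 Z ≫ hat₃₂ (tact x (idemTAct H)) Z := by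
    simp only [hat₂₂, hat₃₂, hat₁₁, hat₀₁, rightUnit, lw, swapInv, comp_whiskerRight,
      MonoidalCategory.whiskerLeft_comp]
    monoidal
  have h₃ := idemS_comul H (a ⊗ Z)
  have h₄ := hat₂₁_swap a Z μ[H]
  have h₅ := idemS_mul_idemT H Z
  have h₆ := hat₁₁_swap a Z (idemT H)
  have h₇ := hat₁₁_swap a Z (idemS H)
  rw [h₂, hat_rightUnit_tact, reassoc_of% h₃, hat_unitAct, hat_tact]
  calc _ = swapInv H a Z ≫ 𝐬 _ ≫ 𝐮 _ ≫ 𝐝 _ ≫ H ◃ (𝐦 _ ≫ 𝐭 _ ≫ swap H a Z) ≫ hat₂₁ x _ := by simp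
    _ = swapInv H a Z ≫ 𝐬 _ ≫ 𝐮 _ ≫ 𝐝 _ ≫ H ◃ ((𝐦 _ ≫ swap H a Z) ≫ a ◃ 𝐭 _) ≫ hat₂₁ x _ := by
        rw [h₆]; simp
    _ = swapInv H a Z ≫ 𝐮 _ ≫ 𝐝 _ ≫ H ◃ (H ◃ (𝐬 _ ≫ swap H a Z) ≫ swap H a _ ≫ a ◃ 𝐦 _ ≫ a ◃ 𝐭 _) ≫
          hat₂₁ x _ := by
        rw [h₄]; simp
    _ = 𝐮 _ ≫ 𝐝 _ ≫ H ◃ (swap H a _ ≫ a ◃ (H ◃ 𝐬 _ ≫ 𝐦 _ ≫ 𝐭 _)) ≫ hat₂₁ x _ := by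
        rw [h₇]; simp
    _ = _ := by rw [h₅]; simp [idemTAct, hat₂₁_comp]

variable {x} in
lemma rightUnit_rightCounit (hx : IsAssocAct x) (hx' : unitAct x = 𝟙 a) :
    rightUnit H a ≫ unitAct (tact x (idemTAct H)) ≫ rightCounit H a = 𝟙 a := by
  rw [unitAct_comp hx' (tact_rightCounit hx)]
  refine hat₁₁_congr fun Z => ?_
  have h : hat₁₁ (rightUnit H a ≫ (β_ H a).inv ≫ idemS H ▷ a ≫ x) Z =
      a ◃ 𝐮 Z ≫ swapInv H a Z ≫ 𝐬 _ ≫ hat₂₁ x Z := by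
    simp only [hat₁₁, hat₀₁, hat₂₁, rightUnit, comp_whiskerRight, swapInv, lw,
      MonoidalCategory.whiskerLeft_comp]
    monoidal
  have h₁ := hat₀₁_swap a Z η[H]
  rw [h, ← h₁, Category.assoc, swap_swapInv_assoc, reassoc_of% one_idemS H, hat_unit_act hx',
    hat₁₁_id]

end Right

section Nabla

variable {a b c : V} (x : H ⊗ a ⟶ a) (y : H ⊗ b ⟶ b) (z : H ⊗ c ⟶ c)

/-- The map `h ↦ h1₁ ⊗ 1₂`. -/
def mulOneComul (H : V) [WeakBimonObj H] : H ⟶ H ⊗ H :=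
  (ρ_ H).inv ≫ H ◁ (η[H] ≫ Δ[H]) ≫ (α_ H H H).inv ≫ μ[H] ▷ H

lemma hat_mulOneComul (Z : V) : hat₁₂ (mulOneComul H) Z = H ◃ (𝐮 Z ≫ 𝐝 Z) ≫ 𝐦 _ := by
  simp only [mulOneComul, hat₁₂, hat₂₁, hat₀₁, lw, MonoidalCategory.whiskerLeft_comp,
    comp_whiskerRight, Category.assoc]
  monoidal

lemma hat_unitAct_tact_tact (Z : V) : hat₁₁ (unitAct (tact x (tact y z))) Z =
    (α_ _ _ _).hom ≫ a ◁ (α_ _ _ _).hom ≫ 𝐮 _ ≫ 𝐝 _ ≫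
      H ◃ (swap H a _ ≫ a ◃ hat₃₂ (tact y z) Z) ≫ hat₂₁ x _ ≫
        a ◁ (α_ _ _ _).inv ≫ (α_ _ _ _).inv := by
  have h := hat_tact_tact_right x y z Z
  rw [← reassoc_of% h]
  simp only [hat₁₁, unitAct, hat₀₁, hat₄₃, comp_whiskerRight, MonoidalCategory.whiskerLeft_comp]
  monoidal

lemma nabla_comp_left (hy : IsAssocAct y) :
    unitAct (tact x y) ▷ c ≫ (α_ a b c).hom ≫ a ◁ unitAct (tact y z) =
      (α_ a b c).hom ≫ unitAct (tact x (tact y z)) := by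
  refine hat₁₁_congr fun Z => ?_
  have h₁ : hat₁₁ (unitAct (tact x y) ▷ c ≫ (α_ a b c).hom ≫ a ◁ unitAct (tact y z)) Z =
      (α_ _ _ _).hom ≫ (α_ _ _ _).hom ≫ (hat₂₂ (unitAct (tact x y)) (c ⊗ Z) ≫
      a ◃ hat₂₂ (unitAct (tact y z)) Z) ≫ a ◁ (α_ _ _ _).inv ≫ (α_ _ _ _).inv := by
    simp only [hat₂₂, hat₁₁, lw, MonoidalCategory.whiskerLeft_comp, comp_whiskerRight]
    monoidal
  have h₂ := lw_hat₂₁_swap H (c ⊗ Z) y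
  have h₃ := hat₁₂_swap a (b ⊗ c ⊗ Z) (oneComulMul H)
  have h₄ := hat₁₂_swap a (b ⊗ c ⊗ Z) Δ[H]
  have h₅ := weak_unit_swap H (a ⊗ b ⊗ c ⊗ Z)
  have key : hat₂₂ (unitAct (tact x y)) (c ⊗ Z) ≫ a ◃ hat₂₂ (unitAct (tact y z)) Z =
      𝐮 _ ≫ 𝐝 _ ≫ H ◃ (swap H a _ ≫ a ◃ hat₃₂ (tact y z) Z) ≫ hat₂₁ x _ := by
    simp only [hat_unitAct, hat_tact]
    calc _ = 𝐮 _ ≫ 𝐝 _ ≫ H ◃ (swap H a _ ≫ a ◃ (𝐮 _ ≫ 𝐝 _ ≫ H ◃ ((H ◃ hat₂₁ y _ ≫ swap H b _) ≫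
            b ◃ hat₂₁ z Z) ≫ hat₂₁ y _)) ≫ hat₂₁ x _ := by simp
      _ = 𝐮 _ ≫ 𝐝 _ ≫ H ◃ (swap H a _ ≫ a ◃ (𝐮 _ ≫ 𝐝 _ ≫ H ◃ 𝐱 _ ≫ H ◃ H ◃ (swap H b _ ≫
            b ◃ hat₂₁ z Z) ≫ H ◃ hat₂₁ y _ ≫ hat₂₁ y _)) ≫ hat₂₁ x _ := by rw [h₂]; simp
      _ = 𝐮 _ ≫ 𝐝 _ ≫ H ◃ ((swap H a _ ≫ a ◃ hat₁₂ (oneComulMul H) _) ≫ a ◃ (H ◃ (swap H b _ ≫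
            b ◃ hat₂₁ z Z) ≫ hat₂₁ y _)) ≫ hat₂₁ x _ := by
        rw [← hat_isAssocAct hy, hat_oneComulMul]; simp
      _ = (𝐮 _ ≫ 𝐝 _ ≫ H ◃ hat₁₂ (oneComulMul H) _) ≫ H ◃ ((H ◃ swap H a _ ≫ swap H a _) ≫
            a ◃ (H ◃ (swap H b _ ≫ b ◃ hat₂₁ z Z) ≫ hat₂₁ y _)) ≫ hat₂₁ x _ := by
        rw [← h₃]; simp
      _ = 𝐮 _ ≫ 𝐝 _ ≫ H ◃ ((𝐝 _ ≫ H ◃ swap H a _ ≫ swap H a _) ≫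
            a ◃ (H ◃ (swap H b _ ≫ b ◃ hat₂₁ z Z) ≫ hat₂₁ y _)) ≫ hat₂₁ x _ := by
        rw [hat_oneComulMul, h₅]; simp
      _ = _ := by rw [h₄]; simp
  rw [h₁, key, hat₁₁_comp, hat_unitAct_tact_tact]
  simp only [hat₁₁, Category.assoc]
  rw [pentagon_assoc]

lemma nabla_comp_right (hy : IsAssocAct y) :
    a ◁ unitAct (tact y z) ≫ (α_ a b c).inv ≫ unitAct (tact x y) ▷ c =
      unitAct (tact x (tact y z)) ≫ (α_ a b c).inv := by
  refine hat₁₁_congr fun Z => ?_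
  have h₁ : hat₁₁ (a ◁ unitAct (tact y z) ≫ (α_ a b c).inv ≫ unitAct (tact x y) ▷ c) Z =
      (α_ _ _ _).hom ≫ a ◁ (α_ _ _ _).hom ≫ (a ◃ hat₂₂ (unitAct (tact y z)) Z ≫
      hat₂₂ (unitAct (tact x y)) (c ⊗ Z)) ≫ (α_ _ _ _).inv ≫ (α_ _ _ _).inv := by
    simp only [hat₂₂, hat₁₁, lw, MonoidalCategory.whiskerLeft_comp, comp_whiskerRight]
    monoidal
  have h₃ := hat₁₂_swap a (b ⊗ c ⊗ Z) (mulOneComul H)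
  have h₄ := hat₁₂_swap a (b ⊗ c ⊗ Z) Δ[H]
  have h₅ := hat_weak_unit H (a ⊗ b ⊗ c ⊗ Z)
  have key : a ◃ hat₂₂ (unitAct (tact y z)) Z ≫ hat₂₂ (unitAct (tact x y)) (c ⊗ Z) =
      𝐮 _ ≫ 𝐝 _ ≫ H ◃ (swap H a _ ≫ a ◃ hat₃₂ (tact y z) Z) ≫ hat₂₁ x _ := by
    simp only [hat_unitAct, hat_tact]
    calc _ = 𝐮 _ ≫ 𝐝 _ ≫ H ◃ (swap H a _ ≫ a ◃ (H ◃ (𝐮 _ ≫ 𝐝 _ ≫ H ◃ (swap H b _ ≫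
            b ◃ hat₂₁ z Z)) ≫ H ◃ hat₂₁ y _ ≫ hat₂₁ y _)) ≫ hat₂₁ x _ := by simp
      _ = 𝐮 _ ≫ 𝐝 _ ≫ H ◃ ((swap H a _ ≫ a ◃ hat₁₂ (mulOneComul H) _) ≫ a ◃ (H ◃ (swap H b _ ≫
            b ◃ hat₂₁ z Z) ≫ hat₂₁ y _)) ≫ hat₂₁ x _ := by
        rw [← hat_isAssocAct hy, hat_mulOneComul]; simp
      _ = (𝐮 _ ≫ 𝐝 _ ≫ 𝐮 _ ≫ 𝐝 _ ≫ H ◃ 𝐦 _) ≫ H ◃ ((H ◃ swap H a _ ≫ swap H a _) ≫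
            a ◃ (H ◃ (swap H b _ ≫ b ◃ hat₂₁ z Z) ≫ hat₂₁ y _)) ≫ hat₂₁ x _ := by
        rw [← h₃, hat_mulOneComul]; simp
      _ = 𝐮 _ ≫ 𝐝 _ ≫ H ◃ ((𝐝 _ ≫ H ◃ swap H a _ ≫ swap H a _) ≫
            a ◃ (H ◃ (swap H b _ ≫ b ◃ hat₂₁ z Z) ≫ hat₂₁ y _)) ≫ hat₂₁ x _ := by
        rw [h₅]; simp
      _ = _ := by rw [h₄]; simp
  rw [h₁, key, hat₁₁_comp, hat_unitAct_tact_tact]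
  simp only [hat₁₁, Category.assoc]
  rw [pentagon_inv]

end Nabla

end ModuleTensor

end Tannaka

namespace Tannaka

section Duals

variable {V : Type u} [Category.{v} V] [MonoidalCategory V]

section

variable {X Y : V} (n : 𝟙_ V ⟶ X ⊗ Y) (k : Y ⊗ X ⟶ 𝟙_ V)

lemma hat_coev_ev_eq (Z : V) : hat₀₂ n (X ⊗ Z) ≫ X ◃ hat₂₀ k Z =
    hat₁₁ ((λ_ X).inv ≫ n ▷ X ≫ (α_ X Y X).hom ≫ X ◁ k ≫ (ρ_ X).hom) Z := by
  simp only [hat₀₂, hat₂₀, hat₁₁, lw, MonoidalCategory.whiskerLeft_comp, comp_whiskerRight]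
  monoidal

lemma hat_ev_coev_eq (Z : V) : Y ◃ hat₀₂ n Z ≫ hat₂₀ k (Y ⊗ Z) =
    hat₁₁ ((ρ_ Y).inv ≫ Y ◁ n ≫ (α_ Y X Y).inv ≫ k ▷ Y ≫ (λ_ Y).hom) Z := by
  simp only [hat₀₂, hat₂₀, hat₁₁, lw, MonoidalCategory.whiskerLeft_comp, comp_whiskerRight]
  monoidal

/-- An exact pairing from the flattened triangle identities. -/
abbrev exactPairingOfHat (h : ∀ Z, hat₀₂ n (X ⊗ Z) ≫ X ◃ hat₂₀ k Z = 𝟙 _)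
    (h' : ∀ Z, Y ◃ hat₀₂ n Z ≫ hat₂₀ k (Y ⊗ Z) = 𝟙 _) : ExactPairing X Y where
  coevaluation' := n
  evaluation' := k
  coevaluation_evaluation' := by
    have : (ρ_ Y).inv ≫ Y ◁ n ≫ (α_ Y X Y).inv ≫ k ▷ Y ≫ (λ_ Y).hom = 𝟙 Y :=
      hat₁₁_congr fun Z => by rw [← hat_ev_coev_eq, h', hat₁₁_id]
    rw [← cancel_epi (ρ_ Y).inv, ← cancel_mono (λ_ Y).hom]
    simpa using this
  evaluation_coevaluation' := by
    have : (λ_ X).inv ≫ n ▷ X ≫ (α_ X Y X).hom ≫ X ◁ k ≫ (ρ_ X).hom = 𝟙 X :=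
      hat₁₁_congr fun Z => by rw [← hat_coev_ev_eq, h, hat₁₁_id]
    rw [← cancel_epi (λ_ X).inv, ← cancel_mono (ρ_ X).hom]
    simpa using this

end

section

variable (X Y : V) [ExactPairing X Y]

@[simp] lemma hat_coev_ev (Z : V) : hat₀₂ (η_ X Y) (X ⊗ Z) ≫ X ◃ hat₂₀ (ε_ X Y) Z = 𝟙 _ := by
  rw [hat_coev_ev_eq, ← hat₁₁_id]
  congr 1
  have := ExactPairing.evaluation_coevaluation X Y
  rw [reassoc_of% this]
  simp

@[simp] lemma hat_ev_coev (Z : V) : Y ◃ hat₀₂ (η_ X Y) Z ≫ hat₂₀ (ε_ X Y) (Y ⊗ Z) = 𝟙 _ := by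
  rw [hat_ev_coev_eq, ← hat₁₁_id]
  congr 1
  have := ExactPairing.coevaluation_evaluation X Y
  rw [reassoc_of% this]
  simp

@[simp] lemma hat_coev_ev_assoc (Z : V) {W : V} (g : X ⊗ Z ⟶ W) :
    hat₀₂ (η_ X Y) (X ⊗ Z) ≫ X ◃ hat₂₀ (ε_ X Y) Z ≫ g = g := by
  rw [← Category.assoc, hat_coev_ev, Category.id_comp]

@[simp] lemma hat_ev_coev_assoc (Z : V) {W : V} (g : Y ⊗ Z ⟶ W) :
    Y ◃ hat₀₂ (η_ X Y) Z ≫ hat₂₀ (ε_ X Y) (Y ⊗ Z) ≫ g = g := by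
  rw [← Category.assoc, hat_ev_coev, Category.id_comp]

end

lemma dualizable_retract [IsIdempotentComplete V] {X Y : V} (i : Y ⟶ X) (p : X ⟶ Y)
    (h : i ≫ p = 𝟙 Y) (hX : dualizable V X) : dualizable V Y := by
  let : HasRightDual X := hX.some
  have he : (p ≫ i)ᘁ ≫ (p ≫ i)ᘁ = (p ≫ i)ᘁ := by
    rw [← comp_rightAdjointMate, Category.assoc, reassoc_of% h]
  obtain ⟨Y', i', p', hi, hp⟩ := IsIdempotentComplete.idempotents_split (Xᘁ) ((p ≫ i)ᘁ) he
  have hn (Z : V) : hat₀₂ (η_ X (Xᘁ) ≫ (p ⊗ₘ p')) Z =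
      hat₀₂ (η_ X (Xᘁ)) Z ≫ X ◃ hat₁₁ p' Z ≫ hat₁₁ p _ := by
    simp only [hat₀₂, hat₁₁, lw, MonoidalCategory.tensorHom_def', comp_whiskerRight]
    monoidal
  have hk (Z : V) : hat₂₀ ((i' ⊗ₘ i) ≫ ε_ X (Xᘁ)) Z =
      Y' ◃ hat₁₁ i Z ≫ hat₁₁ i' _ ≫ hat₂₀ (ε_ X (Xᘁ)) Z := by
    simp only [hat₂₀, hat₁₁, lw, MonoidalCategory.tensorHom_def', comp_whiskerRight]
    monoidal
  have hm (Z : V) : hat₁₁ ((p ≫ i)ᘁ) (X ⊗ Z) ≫ hat₂₀ (ε_ X (Xᘁ)) Z =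
      Xᘁ ◃ hat₁₁ (p ≫ i) Z ≫ hat₂₀ (ε_ X (Xᘁ)) Z := by
    have h := rightAdjointMate_comp_evaluation (p ≫ i)
    have h₁ : hat₁₁ ((p ≫ i)ᘁ) (X ⊗ Z) ≫ hat₂₀ (ε_ X (Xᘁ)) Z =
        hat₂₀ ((p ≫ i)ᘁ ▷ X ≫ ε_ X (Xᘁ)) Z := by
      simp only [hat₂₀, hat₁₁, comp_whiskerRight]
      monoidal
    rw [h₁, h]
    simp only [hat₂₀, hat₁₁, lw, comp_whiskerRight]
    monoidal
  have hm' (Z : V) : hat₀₂ (η_ X (Xᘁ)) Z ≫ X ◃ hat₁₁ ((p ≫ i)ᘁ) Z =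
      hat₀₂ (η_ X (Xᘁ)) Z ≫ hat₁₁ (p ≫ i) _ := by
    have h := coevaluation_comp_rightAdjointMate (p ≫ i)
    have h₁ : hat₀₂ (η_ X (Xᘁ)) Z ≫ X ◃ hat₁₁ ((p ≫ i)ᘁ) Z =
        hat₀₂ (η_ X (Xᘁ) ≫ X ◁ (p ≫ i)ᘁ) Z := by
      simp only [hat₀₂, hat₁₁, lw, comp_whiskerRight]
      monoidal
    rw [h₁, h]
    simp only [hat₀₂, hat₁₁, comp_whiskerRight]
    monoidal
  have hp' (Z : V) : hat₁₁ p' Z ≫ hat₁₁ i' Z = hat₁₁ ((p ≫ i)ᘁ) Z := by rw [← hat₁₁_comp, hp]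
  have hi' (Z : V) : hat₁₁ i' Z ≫ hat₁₁ p' Z = 𝟙 _ := by rw [← hat₁₁_comp, hi, hat₁₁_id]
  have hpi (Z : V) : hat₁₁ i Z ≫ hat₁₁ p Z = 𝟙 _ := by rw [← hat₁₁_comp, h, hat₁₁_id]
  suffices ExactPairing Y Y' from ⟨{ rightDual := Y' }⟩
  refine exactPairingOfHat (η_ X (Xᘁ) ≫ (p ⊗ₘ p')) ((i' ⊗ₘ i) ≫ ε_ X (Xᘁ)) (fun Z => ?_)
    (fun Z => ?_)
  · rw [hn, hk]
    calc _ = hat₁₁ i Z ≫ hat₀₂ (η_ X (Xᘁ)) _ ≫ X ◃ ((hat₁₁ p' _ ≫ hat₁₁ i' _) ≫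
          hat₂₀ (ε_ X (Xᘁ)) Z) ≫ hat₁₁ p _ := by simp
      _ = hat₁₁ i Z ≫ hat₁₁ p Z ≫ hat₁₁ i Z ≫ hat₁₁ p Z := by
        rw [hp', hm, hat₁₁_comp]; simp
      _ = _ := by rw [hpi, Category.comp_id, hpi]
  · rw [hn, hk]
    calc _ = hat₁₁ i' _ ≫ Xᘁ ◃ (hat₀₂ (η_ X (Xᘁ)) Z ≫ hat₁₁ (p ≫ i) _) ≫
          hat₂₀ (ε_ X (Xᘁ)) _ ≫ hat₁₁ p' _ := by
            rw [hat₁₁_comp]; simp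
      _ = hat₁₁ i' _ ≫ Xᘁ ◃ hat₀₂ (η_ X (Xᘁ)) Z ≫ Xᘁ ◃ X ◃ hat₁₁ ((p ≫ i)ᘁ) Z ≫
          hat₂₀ (ε_ X (Xᘁ)) _ ≫ hat₁₁ p' _ := by
        rw [← hm']; simp
      _ = hat₁₁ i' _ ≫ Xᘁ ◃ hat₀₂ (η_ X (Xᘁ)) Z ≫ hat₂₀ (ε_ X (Xᘁ)) _ ≫
            hat₁₁ ((p ≫ i)ᘁ) Z ≫ hat₁₁ p' _ := by
        rw [← reassoc_of% hat₂₀_nat (hat₁₁ ((p ≫ i)ᘁ) Z)]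
      _ = hat₁₁ i' _ ≫ (hat₁₁ p' _ ≫ hat₁₁ i' _) ≫ hat₁₁ p' _ := by
        rw [hat_ev_coev_assoc, hp']
      _ = _ := by simp only [Category.assoc]; rw [hi', Category.comp_id, hi']

lemma dualizable_tensor {X Y : V} (hX : dualizable V X) (hY : dualizable V Y) :
    dualizable V (X ⊗ Y) := by
  let := hX.some
  let := hY.some
  exact ⟨hasRightDualTensor⟩

lemma MonoidallyComplete.isIdempotentComplete [MonoidallyComplete V] : IsIdempotentComplete V := by
  have : HasLimits V := MonoidallyComplete.hasLimits
  rw [Idempotents.isIdempotentComplete_iff_hasEqualizer_of_id_and_idempotent]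
  intro X p _
  infer_instance

end Duals

end Tannaka

namespace Tannaka

section ModuleCategory

open scoped MonObj ComonObj

variable {V : Type u} [Category.{v} V] [MonoidalCategory V] [BraidedCategory V]
  [IsIdempotentComplete V] {H : V} [WeakBimonObj H]

section Split

variable {E : V} {e : E ⟶ E} (he : e ≫ e = e)

lemma exists_split {E : V} {e : E ⟶ E} (he : e ≫ e = e) :
    ∃ (X : V) (i : X ⟶ E) (p : E ⟶ X), i ≫ p = 𝟙 X ∧ p ≫ i = e :=
  IsIdempotentComplete.idempotents_split E e he

/-- A chosen splitting of an idempotent. -/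
def splitObj : V := (exists_split he).choose

/-- The inclusion of a chosen splitting. -/
def splitI : splitObj he ⟶ E := (exists_split he).choose_spec.choose

/-- The projection of a chosen splitting. -/
def splitP : E ⟶ splitObj he := (exists_split he).choose_spec.choose_spec.choose

lemma splitI_splitP : splitI he ≫ splitP he = 𝟙 _ :=
  (exists_split he).choose_spec.choose_spec.choose_spec.1

lemma splitP_splitI : splitP he ≫ splitI he = e :=
  (exists_split he).choose_spec.choose_spec.choose_spec.2

end Split

/-- The chosen presentation of a splitting of an associative action. -/
abbrev chosenPresentation {E : V} {d : H ⊗ E ⟶ E} (hd : IsAssocAct d) :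
    Presentation (splitAct d (splitP hd.unitAct_unitAct) (splitI hd.unitAct_unitAct)) d :=
  splitPresentation hd _ _ (splitI_splitP _) (splitP_splitI _)

/-- The module that splits an associative action. -/
def splitMod {E : V} {d : H ⊗ E ⟶ E} (hd : IsAssocAct d) : Mod V H :=
  modMk _ (isAssocAct_of_presentation hd (chosenPresentation hd)) (chosenPresentation hd).unitAct_eq

/-- The presentation of `splitMod`. -/
def splitModPresentation {E : V} {d : H ⊗ E ⟶ E} (hd : IsAssocAct d) :
    Presentation (mact (splitMod hd)) d :=
  chosenPresentation hd

/-- The tensor product of modules. -/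
def modTensor (a b : Mod V H) : Mod V H :=
  splitMod (tact_isAssocAct (mact_isAssocAct a) (mact_isAssocAct b))

/-- The presentation of the tensor product. -/
def tensorPres (a b : Mod V H) : Presentation (mact (modTensor a b)) (tact (mact a) (mact b)) :=
  splitModPresentation _

variable (H) in
/-- The unit module. -/
def modUnit : Mod V H := splitMod (idemTAct_isAssocAct H)

variable (H) in
/-- The presentation of the unit module. -/
def unitPres : Presentation (mact (modUnit H)) (idemTAct H) := splitModPresentation _

/-- The presentation of `(a ⊗ b) ⊗ c`. -/
def tensorPresLeft (a b c : Mod V H) : Presentation (mact (modTensor (modTensor a b) c))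
    (tact (tact (mact a) (mact b)) (mact c)) :=
  (tensorPres a b).tensor (selfPresentation c) (tensorPres (modTensor a b) c)
    (tact_isAssocAct (mact_isAssocAct a) (mact_isAssocAct b)) (mact_isAssocAct c)

/-- The presentation of `a ⊗ (b ⊗ c)`. -/
def tensorPresRight (a b c : Mod V H) : Presentation (mact (modTensor a (modTensor b c)))
    (tact (mact a) (tact (mact b) (mact c))) :=
  (selfPresentation a).tensor (tensorPres b c) (tensorPres a (modTensor b c))
    (mact_isAssocAct a) (tact_isAssocAct (mact_isAssocAct b) (mact_isAssocAct c))

/-- The presentation of `1 ⊗ a`. -/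
def unitTensorPres (a : Mod V H) : Presentation (mact (modTensor (modUnit H) a))
    (tact (idemTAct H) (mact a)) :=
  (unitPres H).tensor (selfPresentation a) (tensorPres (modUnit H) a)
    (idemTAct_isAssocAct H) (mact_isAssocAct a)

/-- The presentation of `a ⊗ 1`. -/
def tensorUnitPres (a : Mod V H) : Presentation (mact (modTensor a (modUnit H)))
    (tact (mact a) (idemTAct H)) :=
  (selfPresentation a).tensor (unitPres H) (tensorPres a (modUnit H))
    (mact_isAssocAct a) (idemTAct_isAssocAct H)

lemma tensorPresLeft_p (a b c : Mod V H) : (tensorPresLeft a b c).p =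
    (tensorPres a b).p ▷ c.X ≫ (tensorPres (modTensor a b) c).p := by
  simp [tensorPresLeft]

lemma tensorPresLeft_i (a b c : Mod V H) : (tensorPresLeft a b c).i =
    (tensorPres (modTensor a b) c).i ≫ (tensorPres a b).i ▷ c.X := by
  simp [tensorPresLeft]

lemma tensorPresRight_p (a b c : Mod V H) : (tensorPresRight a b c).p =
    a.X ◁ (tensorPres b c).p ≫ (tensorPres a (modTensor b c)).p := by
  simp [tensorPresRight]

lemma tensorPresRight_i (a b c : Mod V H) : (tensorPresRight a b c).i =
    (tensorPres a (modTensor b c)).i ≫ a.X ◁ (tensorPres b c).i := by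
  simp [tensorPresRight]

lemma unitTensorPres_p (a : Mod V H) : (unitTensorPres a).p =
    (unitPres H).p ▷ a.X ≫ (tensorPres (modUnit H) a).p := by
  simp [unitTensorPres]

lemma unitTensorPres_i (a : Mod V H) : (unitTensorPres a).i =
    (tensorPres (modUnit H) a).i ≫ (unitPres H).i ▷ a.X := by
  simp [unitTensorPres]

lemma tensorUnitPres_p (a : Mod V H) : (tensorUnitPres a).p =
    a.X ◁ (unitPres H).p ≫ (tensorPres a (modUnit H)).p := by
  simp [tensorUnitPres]

lemma tensorUnitPres_i (a : Mod V H) : (tensorUnitPres a).i =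
    (tensorPres a (modUnit H)).i ≫ a.X ◁ (unitPres H).i := by
  simp [tensorUnitPres]

lemma tact_assoc_inv {a b c : V} (x : H ⊗ a ⟶ a) (y : H ⊗ b ⟶ b) (z : H ⊗ c ⟶ c) :
    tact x (tact y z) ≫ (α_ a b c).inv = H ◁ (α_ a b c).inv ≫ tact (tact x y) z := by
  rw [← cancel_mono (α_ a b c).hom, Category.assoc, Category.assoc, tact_assoc]
  simp

variable (H) in
/-- The tensor product of modules over a weak bialgebra. -/
def modSplitTensor : SplitTensor (Mod.forget (D := V) H) where
  tensorObj := modTensor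
  tensorUnit := modUnit H
  proj a b := (tensorPres a b).p
  incl a b := (tensorPres a b).i
  one := η[H] ≫ (unitPres H).p
  counit := (unitPres H).i ≫ ε[H]
  δ_μ a b := (tensorPres a b).i_p
  tensorHom {a a' b b'} f g :=
    modHomMk ((tensorPres a b).i ≫ (f.hom ⊗ₘ g.hom) ≫ (tensorPres a' b').p)
      ((tensorPres a b).linear_map (tensorPres a' b') _
        (tact_comp_tensorHom _ _ (mact_hom f) (mact_hom g)))
  assocHom a b c := modHomMk ((tensorPresLeft a b c).i ≫ (α_ _ _ _).hom ≫ (tensorPresRight a b c).p)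
    ((tensorPresLeft a b c).linear_map (tensorPresRight a b c) _ (tact_assoc _ _ _))
  assocInv a b c := modHomMk ((tensorPresRight a b c).i ≫ (α_ _ _ _).inv ≫ (tensorPresLeft a b c).p)
    ((tensorPresRight a b c).linear_map (tensorPresLeft a b c) _ (tact_assoc_inv _ _ _))
  leftHom a := modHomMk ((unitTensorPres a).i ≫ leftCounit H a.X)
    ((unitTensorPres a).linear_desc _ (by
      rw [unitAct_comp (unitAct_mact a) (tact_leftCounit (mact_isAssocAct a)),
        tact_leftCounit (mact_isAssocAct a)]))
  leftInv a := modHomMk (leftUnit H a.X ≫ (unitTensorPres a).p)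
    ((unitTensorPres a).linear_lift _ (act_leftUnit (mact_isAssocAct a)))
  rightHom a := modHomMk ((tensorUnitPres a).i ≫ rightCounit H a.X)
    ((tensorUnitPres a).linear_desc _ (by
      rw [unitAct_comp (unitAct_mact a) (tact_rightCounit (mact_isAssocAct a)),
        tact_rightCounit (mact_isAssocAct a)]))
  rightInv a := modHomMk (rightUnit H a.X ≫ (tensorUnitPres a).p)
    ((tensorUnitPres a).linear_lift _ (act_rightUnit (mact_isAssocAct a)))
  map_tensorHom _ _ := rfl
  map_assocHom a b c := by
    change (tensorPresLeft a b c).i ≫ _ ≫ (tensorPresRight a b c).p = _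
    rw [tensorPresLeft_i, tensorPresRight_p, Category.assoc]
    rfl
  map_assocInv a b c := by
    change (tensorPresRight a b c).i ≫ _ ≫ (tensorPresLeft a b c).p = _
    rw [tensorPresRight_i, tensorPresLeft_p, Category.assoc]
    rfl
  map_leftHom a := by
    change (unitTensorPres a).i ≫ leftCounit H a.X =
      (tensorPres (modUnit H) a).i ≫ ((unitPres H).i ≫ ε[H]) ▷ a.X ≫ (λ_ a.X).hom
    rw [unitTensorPres_i, leftCounit, Category.assoc, comp_whiskerRight_assoc]
  map_leftInv a := by
    change leftUnit H a.X ≫ (unitTensorPres a).p =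
      (λ_ a.X).inv ≫ (η[H] ≫ (unitPres H).p) ▷ a.X ≫ (tensorPres (modUnit H) a).p
    rw [unitTensorPres_p, leftUnit, Category.assoc, comp_whiskerRight_assoc]
  map_rightHom a := by
    change (tensorUnitPres a).i ≫ rightCounit H a.X =
      (tensorPres a (modUnit H)).i ≫ a.X ◁ ((unitPres H).i ≫ ε[H]) ≫ (ρ_ a.X).hom
    rw [tensorUnitPres_i, rightCounit, Category.assoc, MonoidalCategory.whiskerLeft_comp_assoc]
  map_rightInv a := by
    change rightUnit H a.X ≫ (tensorUnitPres a).p =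
      (ρ_ a.X).inv ≫ a.X ◁ (η[H] ≫ (unitPres H).p) ≫ (tensorPres a (modUnit H)).p
    rw [tensorUnitPres_p, rightUnit, Category.assoc, MonoidalCategory.whiskerLeft_comp_assoc]
  nabla_natural {a a' b b'} f g := by
    have h := unitAct_natural _ (tact_comp_tensorHom _ _ (mact_hom f) (mact_hom g))
    rw [← (tensorPres a b).p_i, ← (tensorPres a' b').p_i, Category.assoc] at h
    exact h
  nabla₃ a b c := by
    have h := unitAct_natural _ (tact_assoc (mact a) (mact b) (mact c))
    rw [← (tensorPresLeft a b c).p_i, ← (tensorPresRight a b c).p_i, tensorPresLeft_p,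
      tensorPresLeft_i, tensorPresRight_p, tensorPresRight_i] at h
    simp only [Category.assoc] at h
    exact h
  nabla_left a b c := by
    have h := nabla_comp_left (mact a) (mact b) (mact c) (mact_isAssocAct b)
    rw [← (tensorPresRight a b c).p_i, tensorPresRight_p, tensorPresRight_i, ← (tensorPres a b).p_i,
      ← (tensorPres b c).p_i] at h
    simp only [Category.assoc, comp_whiskerRight, MonoidalCategory.whiskerLeft_comp] at h
    exact h
  nabla_right a b c := by
    have h := nabla_comp_right (mact a) (mact b) (mact c) (mact_isAssocAct b)
    rw [← (tensorPresRight a b c).p_i, tensorPresRight_p, tensorPresRight_i, ← (tensorPres a b).p_i,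
      ← (tensorPres b c).p_i] at h
    simp only [Category.assoc, comp_whiskerRight, MonoidalCategory.whiskerLeft_comp] at h
    exact h
  left_hom_inv a := by
    have h := leftCounit_leftUnit (mact_isAssocAct a) (unitAct_mact a)
    have h' := (unitTensorPres a).i ≫= h =≫ (unitTensorPres a).p
    simp only [Category.assoc, (unitTensorPres a).unitAct_p, (unitTensorPres a).i_p] at h'
    rw [← Category.assoc, (unitTensorPres a).i_unitAct, unitTensorPres_i, unitTensorPres_p] at h'
    simp only [leftCounit, leftUnit, Category.assoc, Iso.hom_inv_id_assoc] at h'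
    change (tensorPres (modUnit H) a).i ≫ ((unitPres H).i ≫ ε[H]) ▷ a.X ≫
      (η[H] ≫ (unitPres H).p) ▷ a.X ≫ (tensorPres (modUnit H) a).p = 𝟙 _
    simpa only [comp_whiskerRight, Category.assoc] using h'
  left_inv_hom a := by
    have h := leftUnit_leftCounit (mact_isAssocAct a) (unitAct_mact a)
    rw [← (unitTensorPres a).p_i, unitTensorPres_i, unitTensorPres_p, leftCounit, leftUnit] at h
    simp only [Category.assoc] at h
    rw [Iso.inv_comp_eq, Category.comp_id] at h
    have h' := h =≫ (λ_ a.X).inv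
    simp only [Category.assoc, Iso.hom_inv_id, Category.comp_id] at h'
    change (η[H] ≫ (unitPres H).p) ▷ a.X ≫ (tensorPres (modUnit H) a).p ≫
      (tensorPres (modUnit H) a).i ≫ ((unitPres H).i ≫ ε[H]) ▷ a.X = 𝟙 _
    simpa only [comp_whiskerRight, Category.assoc] using h'
  right_hom_inv a := by
    have h := rightCounit_rightUnit (mact_isAssocAct a) (unitAct_mact a)
    have h' := (tensorUnitPres a).i ≫= h =≫ (tensorUnitPres a).p
    simp only [Category.assoc, (tensorUnitPres a).unitAct_p, (tensorUnitPres a).i_p] at h'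
    rw [← Category.assoc, (tensorUnitPres a).i_unitAct, tensorUnitPres_i, tensorUnitPres_p] at h'
    simp only [rightCounit, rightUnit, Category.assoc, Iso.hom_inv_id_assoc] at h'
    change (tensorPres a (modUnit H)).i ≫ a.X ◁ ((unitPres H).i ≫ ε[H]) ≫
      a.X ◁ (η[H] ≫ (unitPres H).p) ≫ (tensorPres a (modUnit H)).p = 𝟙 _
    simpa only [MonoidalCategory.whiskerLeft_comp, Category.assoc] using h'
  right_inv_hom a := by
    have h := rightUnit_rightCounit (mact_isAssocAct a) (unitAct_mact a)
    rw [← (tensorUnitPres a).p_i, tensorUnitPres_i, tensorUnitPres_p, rightCounit, rightUnit] at h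
    simp only [Category.assoc] at h
    rw [Iso.inv_comp_eq, Category.comp_id] at h
    have h' := h =≫ (ρ_ a.X).inv
    simp only [Category.assoc, Iso.hom_inv_id, Category.comp_id] at h'
    change a.X ◁ (η[H] ≫ (unitPres H).p) ≫ (tensorPres a (modUnit H)).p ≫
      (tensorPres a (modUnit H)).i ≫ a.X ◁ ((unitPres H).i ≫ ε[H]) = 𝟙 _
    simpa only [MonoidalCategory.whiskerLeft_comp, Category.assoc] using h'

end ModuleCategory

end Tannaka

namespace Tannaka

section FullSub

variable {D : Type u₁} [Category.{v₁} D] {V : Type u} [Category.{v} V] [MonoidalCategory V]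

/-- The restriction of a split tensor product to a full subcategory. -/
def SplitTensor.fullSubcategory {U : D ⥤ V} (S : SplitTensor U) (P : ObjectProperty D)
    (hT : ∀ a b, P a → P b → P (S.tensorObj a b)) (hU : P S.tensorUnit) :
    SplitTensor (P.ι ⋙ U) where
  tensorObj a b := ⟨S.tensorObj a.obj b.obj, hT _ _ a.property b.property⟩
  tensorUnit := ⟨S.tensorUnit, hU⟩
  proj a b := S.proj a.obj b.obj
  incl a b := S.incl a.obj b.obj
  one := S.one
  counit := S.counit
  δ_μ a b := S.δ_μ a.obj b.obj
  tensorHom f g := ⟨S.tensorHom f.hom g.hom⟩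
  assocHom a b c := ⟨S.assocHom a.obj b.obj c.obj⟩
  assocInv a b c := ⟨S.assocInv a.obj b.obj c.obj⟩
  leftHom a := ⟨S.leftHom a.obj⟩
  leftInv a := ⟨S.leftInv a.obj⟩
  rightHom a := ⟨S.rightHom a.obj⟩
  rightInv a := ⟨S.rightInv a.obj⟩
  map_tensorHom f g := S.map_tensorHom f.hom g.hom
  map_assocHom a b c := S.map_assocHom a.obj b.obj c.obj
  map_assocInv a b c := S.map_assocInv a.obj b.obj c.obj
  map_leftHom a := S.map_leftHom a.obj
  map_leftInv a := S.map_leftInv a.obj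
  map_rightHom a := S.map_rightHom a.obj
  map_rightInv a := S.map_rightInv a.obj
  nabla_natural f g := S.nabla_natural f.hom g.hom
  nabla₃ a b c := S.nabla₃ a.obj b.obj c.obj
  nabla_left a b c := S.nabla_left a.obj b.obj c.obj
  nabla_right a b c := S.nabla_right a.obj b.obj c.obj
  left_hom_inv a := S.left_hom_inv a.obj
  left_inv_hom a := S.left_inv_hom a.obj
  right_hom_inv a := S.right_hom_inv a.obj
  right_inv_hom a := S.right_inv_hom a.obj

/-- The unit object has a dual underlying object. -/
lemma SplitTensor.dualizable_tensorUnit {U : D ⥤ V} [U.Faithful] (S : SplitTensor U) :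
    dualizable V (U.obj S.tensorUnit) := by
  let := S.monoidalCategory
  let := S.sepFrobenius
  let : ExactPairing (U.obj S.tensorUnit) (U.obj S.tensorUnit) := mapExactPairing U (𝟙_ D) (𝟙_ D)
  exact ⟨{ rightDual := U.obj S.tensorUnit }⟩

end FullSub

section Rep

open scoped MonObj ComonObj

variable {V : Type u} [Category.{v} V] [MonoidalCategory V] [BraidedCategory V]

instance (H : WBA V) : (DMod.forget H).Faithful :=
  inferInstanceAs (ObjectProperty.ι _ ⋙ Mod.forget H.X).Faithful

section

variable [IsIdempotentComplete V]

/-- The tensor product of modules with dualizable underlying object. -/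
def dmodSplitTensor (H : WBA V) : SplitTensor (DMod.forget H) :=
  (modSplitTensor H.X).fullSubcategory ((dualizable V).inverseImage (Mod.forget (D := V) H.X))
    (fun a b ha hb => dualizable_retract (tensorPres a b).i (tensorPres a b).p (tensorPres a b).i_p
      (dualizable_tensor ha hb))
    (modSplitTensor H.X).dualizable_tensorUnit

end

lemma essentiallySmall_dmod [EssentiallySmall.{v} (dualizable V).FullSubcategory] (H : WBA V) :
    EssentiallySmall.{v} (DMod H) := by
  let D := (dualizable V).FullSubcategory
  let e := equivSmallModel.{v} D
  let W := Σ x : SmallModel.{v} D,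
    { d : H.X ⊗ (e.inverse.obj x).obj ⟶ (e.inverse.obj x).obj //
      IsAssocAct d ∧ unitAct d = 𝟙 _ }
  let f : W → Skeleton (DMod H) := fun w => toSkeleton
    (⟨modMk w.2.1 w.2.2.1 w.2.2.2, (e.inverse.obj w.1).property⟩ : DMod H)
  have hf : Function.Surjective f := by
    intro s
    obtain ⟨a, rfl⟩ : ∃ a, toSkeleton a = s := ⟨s.out, Quotient.out_eq s⟩
    let i : (⟨a.obj.X, a.property⟩ : D) ≅ e.inverse.obj (e.functor.obj ⟨a.obj.X, a.property⟩) :=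
      e.unitIso.app _
    let j : a.obj.X ≅ (e.inverse.obj (e.functor.obj ⟨a.obj.X, a.property⟩)).obj :=
      (dualizable V).ι.mapIso i
    let P := splitPresentation (mact_isAssocAct a.obj) j.hom j.inv (by simp)
      (by rw [unitAct_mact]; simp)
    refine ⟨⟨e.functor.obj ⟨a.obj.X, a.property⟩, _,
      isAssocAct_of_presentation (mact_isAssocAct a.obj) P, P.unitAct_eq⟩, ?_⟩
    refine Quotient.sound ⟨?_⟩
    exact
      { hom := ⟨modHomMk j.inv P.act_i⟩
        inv := ⟨modHomMk j.hom P.p_act.symm⟩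
        hom_inv_id := by
          apply (DMod.forget H).map_injective
          exact j.inv_hom_id
        inv_hom_id := by
          apply (DMod.forget H).map_injective
          exact j.hom_inv_id }
  rw [essentiallySmall_iff]
  exact ⟨small_of_surjective hf, inferInstance⟩

lemma Presentation.act_eq {H X E : V} [MonObj H] {x : H ⊗ X ⟶ X} {d : H ⊗ E ⟶ E}
    (P : Presentation x d) : x = H ◁ P.i ≫ d ≫ P.p := by
  rw [← P.p_act, ← MonoidalCategory.whiskerLeft_comp_assoc, P.i_p]
  simp

/-- The representations of a weak bialgebra. -/
def rep [IsIdempotentComplete V] [EssentiallySmall.{v} (dualizable V).FullSubcategory]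
    (H : WBA V) : RepStructure H :=
  letI := (dmodSplitTensor H).monoidalCategory
  { mon := (dmodSplitTensor H).monoidalCategory
    small := essentiallySmall_dmod H
    sf := (dmodSplitTensor H).sepFrobenius
    μ_δ := fun a b => (tensorPres a.obj b.obj).p_i.trans (by
      simp only [unitAct, tact, DMod.nabla, comp_whiskerRight, Category.assoc]
      rfl)
    act_tensor := fun a b => by
      change mact (modTensor a.obj b.obj) = H.X ◁ (tensorPres a.obj b.obj).i ≫ ComonObj.comul ▷ _ ≫
        act₂ (mact a.obj) (mact b.obj) ≫ (tensorPres a.obj b.obj).p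
      exact (tensorPres a.obj b.obj).act_eq.trans
        (congrArg (H.X ◁ (tensorPres a.obj b.obj).i ≫ ·) (Category.assoc _ _ _))
    p := (unitPres H.X).p
    i := (unitPres H.X).i
    i_p := (unitPres H.X).i_p
    p_i := by
      rw [← unitAct_idemTAct]
      exact (unitPres H.X).p_i
    act_unit := by
      change mact (modUnit H.X) = H.X ◁ (unitPres H.X).i ≫ MonObj.mul ≫ (unitPres H.X).p
      have h := (unitPres H.X).unitAct_p
      rw [unitAct_idemTAct] at h
      exact (unitPres H.X).act_eq.trans (congrArg (H.X ◁ (unitPres H.X).i ≫ ·)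
        ((Category.assoc _ _ _).trans (congrArg (MonObj.mul ≫ ·) h)))
    ε_eq := rfl
    η_eq := rfl }

section

variable [IsIdempotentComplete V] [EssentiallySmall.{v} (dualizable V).FullSubcategory]

instance (H : WBA V) : MonoidalCategory (DMod H) := (rep H).mon

instance (H : WBA V) : SepFrobenius (DMod.forget H) := (rep H).sf

end

end Rep

end Tannaka

namespace Tannaka

section UnitModule

open scoped MonObj ComonObj

variable {V : Type u} [Category.{v} V] [MonoidalCategory V] [BraidedCategory V]
  {H : V} [WeakBimonObj H]

local notation "𝐦" => hat₂₁ (MonObj.mul (X := H))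
local notation "𝐮" => hat₀₁ (MonObj.one (X := H))
local notation "𝐝" => hat₁₂ (ComonObj.comul (X := H))
local notation "𝐞" => hat₁₀ (ComonObj.counit (X := H))
local notation "𝐭" => hat₁₁ (idemT H)
local notation "𝐫" => hat₁₁ (idemR H)
local notation "𝐱" => swap H H

variable {X : V} (x : H ⊗ X ⟶ X) (n : 𝟙_ V ⟶ X) (k : X ⟶ 𝟙_ V)

/-- The map `h ↦ h · n`. -/
def orbit : H ⟶ X := (ρ_ H).inv ≫ H ◁ n ≫ x

/-- The map `x ↦ k(1₁ · x) 1₂`. -/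
def coorbit : X ⟶ H :=
  (λ_ X).inv ≫ (η[H] ≫ Δ[H]) ▷ X ≫ (α_ H H X).hom ≫ H ◁ (β_ H X).hom ≫ (α_ H X H).inv ≫
    (x ≫ k) ▷ H ≫ (λ_ H).hom

lemma hat_coorbit (Z : V) : hat₁₁ (coorbit x k) Z =
    𝐮 _ ≫ 𝐝 _ ≫ H ◃ swap H X Z ≫ hat₂₁ x _ ≫ hat₁₀ k _ := by
  simp only [coorbit, hat₁₁, hat₁₂, hat₂₁, hat₀₁, hat₁₀, lw, swap, MonoidalCategory.whiskerLeft_comp,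
    comp_whiskerRight, Category.assoc]
  monoidal

variable {x n k}

lemma mul_orbit (hx : IsAssocAct x) : μ[H] ≫ orbit x n = H ◁ orbit x n ≫ x := by
  have hx' : μ[H] ▷ X ≫ x = (α_ H H X).hom ≫ H ◁ x ≫ x := hx
  simp only [orbit]
  rw [rightUnitor_inv_naturality_assoc, ← whisker_exchange_assoc, hx']
  simp

lemma one_orbit (hx : unitAct x = 𝟙 X) : η[H] ≫ orbit x n = n := by
  rw [orbit, rightUnitor_inv_naturality_assoc, ← whisker_exchange_assoc]
  have h : η[H] ▷ X ≫ x = (λ_ X).hom := by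
    rw [← cancel_epi (λ_ X).inv, Iso.inv_hom_id]
    exact hx
  rw [h]
  simp [← unitors_inv_equal]

lemma fromUnit_linear {Y : V} {y : H ⊗ Y ⟶ Y} (P : Presentation y (idemTAct H))
    (hx : IsAssocAct x) (hn : idemT H ≫ orbit x n = orbit x n) :
    y ≫ P.i ≫ orbit x n = H ◁ (P.i ≫ orbit x n) ≫ x := by
  refine P.linear_desc _ ?_
  rw [unitAct_idemTAct, hn, ← mul_orbit hx, idemTAct, Category.assoc, hn]

lemma one_idemT_eq : η[H] ≫ idemT H = η[H] :=
  hat₀₁_congr fun Z => by rw [hat₀₁_comp, one_idemT]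

lemma idemT_counit_eq : idemT H ≫ ε[H] = ε[H] :=
  hat₁₀_congr fun Z => by rw [hat₁₀_comp, idemT_counit]

lemma one_fromUnit {Y : V} {y : H ⊗ Y ⟶ Y} (P : Presentation y (idemTAct H))
    (hx : unitAct x = 𝟙 X) : (η[H] ≫ P.p) ≫ P.i ≫ orbit x n = n := by
  rw [Category.assoc, reassoc_of% P.p_i, unitAct_idemTAct, ← Category.assoc, one_idemT_eq,
    one_orbit hx]

lemma act_coorbit (hx : IsAssocAct x) (hk : x ≫ k = idemR H ▷ X ≫ x ≫ k) :
    x ≫ coorbit x k ≫ unitAct (idemTAct H) = H ◁ coorbit x k ≫ idemTAct H := by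
  rw [unitAct_idemTAct, idemTAct]
  refine hat₂₁_congr fun Z => ?_
  have hk' (W : V) : hat₂₁ x W ≫ hat₁₀ k W = 𝐫 _ ≫ hat₂₁ x W ≫ hat₁₀ k W := by
    have h₀ := congrArg (hat₂₀ · W) hk
    have h₁ : hat₂₀ (idemR H ▷ X ≫ x ≫ k) W = 𝐫 _ ≫ hat₂₀ (x ≫ k) W := by
      simp [hat₂₀, hat₁₁]
    rw [h₁, hat₂₀_comp] at h₀
    exact h₀
  have h₁ := one_comul_idemT H (X ⊗ Z)
  have h₂ := hat₁₁_swap X Z (idemT H)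
  have h₃ := lw_hat₂₁_swap H Z x
  have h₄ := comul_idemT_right H (X ⊗ Z)
  have h₅ := swap_swap_hat₂₀ H (H ⊗ Z) (x ≫ k)
  have h₆ := hat₂₁_swap X Z μ[H]
  have h₇ := comul_idemR_left H (X ⊗ Z)
  simp only [hat₂₀_comp] at h₅
  rw [hat₂₁_comp, hat₁₁_comp, hat₂₁_lw, hat₂₁_comp, hat_coorbit]
  have e₁ : H ◃ (H ◃ swap H X Z ≫ hat₂₁ x _ ≫ hat₁₀ k _) ≫ 𝐦 Z =
      𝐱 _ ≫ H ◃ (𝐦 _ ≫ swap H X Z) ≫ hat₂₁ x _ ≫ hat₁₀ k _ := by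
    calc _ = H ◃ H ◃ swap H X Z ≫ H ◃ (hat₂₁ x _ ≫ hat₁₀ k _) ≫ 𝐦 Z := by simp
      _ = 𝐱 _ ≫ H ◃ (H ◃ swap H X Z ≫ swap H X _ ≫ X ◃ 𝐦 Z) ≫ hat₂₁ x _ ≫ hat₁₀ k _ := by
        rw [← h₅]; simp
      _ = _ := by rw [← h₆]
  calc _ = 𝐮 _ ≫ 𝐝 _ ≫ H ◃ (H ◃ hat₂₁ x Z ≫ swap H X Z ≫ X ◃ 𝐭 Z) ≫ hat₂₁ x _ ≫ hat₁₀ k _ := by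
        simp
    _ = hat₂₁ x Z ≫ (𝐮 _ ≫ 𝐝 _ ≫ H ◃ 𝐭 _) ≫ H ◃ swap H X Z ≫ hat₂₁ x _ ≫ hat₁₀ k _ := by
        rw [← h₂]; simp
    _ = 𝐮 _ ≫ 𝐝 _ ≫ H ◃ (H ◃ hat₂₁ x Z ≫ swap H X Z) ≫ hat₂₁ x _ ≫ hat₁₀ k _ := by
        rw [h₁]; simp
    _ = 𝐮 _ ≫ 𝐝 _ ≫ H ◃ (𝐱 _ ≫ H ◃ swap H X Z) ≫ (H ◃ hat₂₁ x _ ≫ hat₂₁ x _) ≫ hat₁₀ k _ := by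
        rw [h₃]; simp
    _ = hat₁₂ (oneComulMul H) _ ≫ H ◃ swap H X Z ≫ hat₂₁ x _ ≫ hat₁₀ k _ := by
        rw [← hat_isAssocAct hx, hat_oneComulMul]; simp
    _ = 𝐝 _ ≫ H ◃ (𝐭 _ ≫ swap H X Z) ≫ hat₂₁ x _ ≫ hat₁₀ k _ := by
        rw [← h₄]; simp
    _ = (𝐝 _ ≫ 𝐫 _) ≫ H ◃ (swap H X Z ≫ X ◃ 𝐭 _) ≫ hat₂₁ x _ ≫ hat₁₀ k _ := by
        rw [h₂]; conv_lhs => rw [hk']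
        simp
    _ = H ◃ (𝐮 _ ≫ 𝐝 _) ≫ (𝐱 _ ≫ H ◃ (𝐦 _ ≫ swap H X Z) ≫ hat₂₁ x _ ≫ hat₁₀ k _) ≫ 𝐭 _ := by
        rw [h₇]; simp
    _ = _ := by rw [← e₁]; simp

lemma coorbit_counit (hx : unitAct x = 𝟙 X) : coorbit x k ≫ ε[H] = k := by
  refine hat₁₀_congr fun Z => ?_
  have h := swap_lw_hat₁₀ X Z ε[H]
  rw [hat₁₀_comp, hat_coorbit]
  calc _ = 𝐮 _ ≫ 𝐝 _ ≫ H ◃ (swap H X Z ≫ X ◃ 𝐞 _) ≫ hat₂₁ x _ ≫ hat₁₀ k _ := by simp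
    _ = 𝐮 _ ≫ hat₂₁ x _ ≫ hat₁₀ k _ := by rw [h]; simp
    _ = _ := by rw [← Category.assoc, hat_unit_act hx, Category.id_comp]

lemma toUnit_linear {Y : V} {y : H ⊗ Y ⟶ Y} (P : Presentation y (idemTAct H))
    (hx : IsAssocAct x) (hk : x ≫ k = idemR H ▷ X ≫ x ≫ k) :
    x ≫ coorbit x k ≫ P.p = H ◁ (coorbit x k ≫ P.p) ≫ y :=
  P.linear_lift _ (act_coorbit hx hk)

lemma toUnit_counit {Y : V} {y : H ⊗ Y ⟶ Y} (P : Presentation y (idemTAct H))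
    (hx : unitAct x = 𝟙 X) : (coorbit x k ≫ P.p) ≫ P.i ≫ ε[H] = k := by
  rw [Category.assoc, reassoc_of% P.p_i, unitAct_idemTAct, idemT_counit_eq, coorbit_counit hx]

/-- The unit module is generated by the unit. -/
lemma orbit_one {Y : V} {y : H ⊗ Y ⟶ Y} (P : Presentation y (idemTAct H)) :
    orbit y (η[H] ≫ P.p) = P.p := by
  have h := P.unitAct_p
  rw [unitAct_idemTAct] at h
  have h' : idemTAct H ≫ P.p = μ[H] ≫ P.p :=
    (Category.assoc _ _ _).trans (congrArg (μ[H] ≫ ·) h)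
  rw [orbit, MonoidalCategory.whiskerLeft_comp, Category.assoc, P.p_act, h']
  simp

lemma act_unit_counit {Y : V} {y : H ⊗ Y ⟶ Y} (P : Presentation y (idemTAct H)) :
    idemR H ▷ Y ≫ y ≫ P.i ≫ ε[H] = y ≫ P.i ≫ ε[H] := by
  have h : idemR H ▷ H ≫ μ[H] ≫ ε[H] = μ[H] ≫ ε[H] := by
    refine hat₂₀_congr fun Z => ?_
    have := idemR_mul_counit H Z
    rw [← hat₂₀_comp] at this
    rw [← this]
    simp [hat₂₀, hat₁₁]
  have h' : idemTAct H ≫ ε[H] = μ[H] ≫ ε[H] := by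
    rw [idemTAct, Category.assoc, idemT_counit_eq]
  rw [reassoc_of% P.act_i, h', ← whisker_exchange_assoc, h]

end UnitModule

end Tannaka

namespace Tannaka

section SquareAction

open scoped MonObj ComonObj

variable {V : Type u} [Category.{v} V] [MonoidalCategory V] [BraidedCategory V]

lemma hat₃₂_comp_act {X Y a b : V} (g : Y ⊗ (a ⊗ b) ⟶ a ⊗ b) (k : X ⊗ (a ⊗ b) ⟶ a ⊗ b) (Z : V) :
    hat₃₂ ((α_ X Y (a ⊗ b)).hom ≫ X ◁ g ≫ k) Z =
      (α_ X Y (a ⊗ b ⊗ Z)).hom ≫ X ◃ hat₃₂ g Z ≫ hat₃₂ k Z := by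
  simp only [lw, hat₃₂, comp_whiskerRight, MonoidalCategory.whiskerLeft_comp]
  monoidal

/-- The tensor square of an algebra acts on the tensor product of two modules. -/
lemma sqMul_act₂ {N X Y a b : V} [MonObj N] {x : N ⊗ a ⟶ a} {y : N ⊗ b ⟶ b} (hx : IsAssocAct x)
    (hy : IsAssocAct y) (f : X ⟶ N ⊗ N) (g : Y ⟶ N ⊗ N) :
    sqMul N f g ▷ (a ⊗ b) ≫ act₂ x y =
      (α_ X Y (a ⊗ b)).hom ≫ X ◁ (g ▷ (a ⊗ b) ≫ act₂ x y) ≫ f ▷ (a ⊗ b) ≫ act₂ x y := by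
  refine hat₃₂_congr fun Z => ?_
  have h₀ := hat_sqMul (a ⊗ b ⊗ Z) N (𝟙 (X ⊗ Y)) f g
  have e : hat₁₂ (𝟙 (X ⊗ Y)) (a ⊗ b ⊗ Z) = (α_ X Y _).hom := by simp [hat₁₂]
  rw [Category.id_comp, e] at h₀
  rw [hat₃₂_comp_act, hat_act₂, hat_act₂, hat_act₂, h₀]
  have hx' := hat_isAssocAct hx
  have hy' := hat_isAssocAct hy
  have h₁ := hat₂₁_swap a (b ⊗ Z) μ[N]
  have h₂ := lw_hat₂₁_swap N (b ⊗ Z) x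
  simp only [Category.assoc]
  congr 1
  calc _ = X ◃ hat₁₂ g _ ≫ hat₁₂ f _ ≫ N ◃ (swap N N _ ≫
          N ◃ ((hat₂₁ μ[N] _ ≫ swap N a _) ≫ a ◃ hat₂₁ y Z)) ≫ hat₂₁ μ[N] _ ≫ hat₂₁ x _ := by
        simp
    _ = X ◃ hat₁₂ g _ ≫ hat₁₂ f _ ≫ N ◃ (N ◃ N ◃ (swap N a _ ≫ a ◃ hat₂₁ y _) ≫
          (swap N N _ ≫ N ◃ swap N a _ ≫ hat₂₁ x _) ≫ a ◃ hat₂₁ y _) ≫ hat₂₁ x _ := by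
      rw [hx', h₁]; simp [hy']
    _ = _ := by rw [← h₂]; simp

lemma act₂_map {M N a b : V} (f : M ⟶ N) (x : N ⊗ a ⟶ a) (y : N ⊗ b ⟶ b) :
    act₂ (f ▷ a ≫ x) (f ▷ b ≫ y) = (f ⊗ₘ f) ▷ (a ⊗ b) ≫ act₂ x y := by
  have := tensorμ_natural f f (𝟙 a) (𝟙 b)
  rw [id_tensorHom_id] at this
  simp only [tensorHom_id] at this
  rw [act₂, act₂, ← tensorHom_comp_tensorHom, reassoc_of% this]

lemma tact_map {M N a b : V} [ComonObj M] (f : M ⟶ N) (x : N ⊗ a ⟶ a) (y : N ⊗ b ⟶ b) :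
    tact (f ▷ a ≫ x) (f ▷ b ≫ y) = (Δ[M] ≫ (f ⊗ₘ f)) ▷ (a ⊗ b) ≫ act₂ x y := by
  rw [tact, act₂_map, comp_whiskerRight, Category.assoc]

lemma unitAct_tact {N a b : V} [WeakBimonObj N] (x : N ⊗ a ⟶ a) (y : N ⊗ b ⟶ b) :
    unitAct (tact x y) = (λ_ _).inv ≫ (η[N] ≫ Δ[N]) ▷ (a ⊗ b) ≫ act₂ x y := by
  simp [unitAct, tact]

section

variable {M N a b : V} [WeakBimonObj M] [WeakBimonObj N] (f : M ⟶ N) [IsWeakHom f]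
  {x : N ⊗ a ⟶ a} {y : N ⊗ b ⟶ b}

lemma whisker_tact_eq_comp_unitAct (hx : IsAssocAct x) (hy : IsAssocAct y) :
    f ▷ (a ⊗ b) ≫ tact x y = tact (f ▷ a ≫ x) (f ▷ b ≫ y) ≫ unitAct (tact x y) := by
  have h := congrArg (· ▷ (a ⊗ b) ≫ act₂ x y) (IsWeakHom.comul_left (f := f))
  simp only [comp_whiskerRight (λ_ M).inv, Category.assoc, sqMul_act₂ hx hy] at h
  rw [unitAct_tact, tact_map, tact, ← comp_whiskerRight_assoc, h,
    leftUnitor_inv_naturality_assoc]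
  simp

lemma whisker_tact_eq_unitAct_comp (hx : IsAssocAct x) (hy : IsAssocAct y) :
    f ▷ (a ⊗ b) ≫ tact x y = M ◁ unitAct (tact x y) ≫ tact (f ▷ a ≫ x) (f ▷ b ≫ y) := by
  have h := congrArg (· ▷ (a ⊗ b) ≫ act₂ x y) (IsWeakHom.comul_right (f := f))
  simp only [comp_whiskerRight (ρ_ M).inv, Category.assoc, sqMul_act₂ hx hy] at h
  rw [unitAct_tact, tact_map, tact, ← comp_whiskerRight_assoc, h]
  simp only [MonoidalCategory.whiskerLeft_comp, Category.assoc]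
  monoidal

end

lemma orbit_map {M N X : V} (f : M ⟶ N) (x : N ⊗ X ⟶ X) (n : 𝟙_ V ⟶ X) :
    orbit (f ▷ X ≫ x) n = f ≫ orbit x n := by
  rw [orbit, orbit, whisker_exchange_assoc, rightUnitor_inv_naturality_assoc]

end SquareAction

section Lift

open Functor.LaxMonoidal Functor.OplaxMonoidal

variable {V : Type u} [Category.{v} V] [MonoidalCategory V] [BraidedCategory V]

lemma DMod.act_isAssocAct {H : WBA V} (a : DMod H) : IsAssocAct a.act := mact_isAssocAct a.obj

lemma DMod.unitAct_act {H : WBA V} (a : DMod H) : unitAct a.act = 𝟙 _ := unitAct_mact a.obj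

lemma DMod.act_hom {H : WBA V} {a b : DMod H} (f : a ⟶ b) :
    a.act ≫ (DMod.forget H).map f = H.X ◁ (DMod.forget H).map f ≫ b.act := mact_hom f.hom

/-- A linear map as a morphism of modules. -/
abbrev dmodHomMk {H : WBA V} {a b : DMod H} (f : (DMod.forget H).obj a ⟶ (DMod.forget H).obj b)
    (h : a.act ≫ f = H.X ◁ f ≫ b.act) : a ⟶ b :=
  ⟨modHomMk (a := a.obj) (b := b.obj) f h⟩

/-- The module determined by a unital and associative action. -/
abbrev dmodMk {H : WBA V} {X : V} (hX : dualizable V X) (x : H.X ⊗ X ⟶ X) (h : IsAssocAct x)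
    (h' : unitAct x = 𝟙 X) : DMod H :=
  ⟨modMk x h h', hX⟩

variable [IsIdempotentComplete V] [EssentiallySmall.{v} (dualizable V).FullSubcategory]

/-- The tensor product of modules splits the action of `Δ(1)`. -/
def dmodTensorPres {H : WBA V} (a b : DMod H) :
    Presentation (a ⊗ b).act (tact a.act b.act) :=
  tensorPres a.obj b.obj

/-- The unit module splits `t`. -/
def dmodUnitPres (H : WBA V) : Presentation (𝟙_ (DMod H)).act (idemTAct H.X) := unitPres H.X

lemma dmodTensorPres_p {H : WBA V} (a b : DMod H) :
    (dmodTensorPres a b).p = μ (DMod.forget H) a b := rfl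

lemma dmodTensorPres_i {H : WBA V} (a b : DMod H) :
    (dmodTensorPres a b).i = δ (DMod.forget H) a b := rfl

lemma forget_ε (H : WBA V) :
    ε (DMod.forget H) = MonObj.one (X := H.X) ≫ (dmodUnitPres H).p := rfl

lemma forget_η (H : WBA V) :
    η (DMod.forget H) = (dmodUnitPres H).i ≫ ComonObj.counit (X := H.X) := rfl

section

variable {A : Type u₁} [Category.{v₁} A] [MonoidalCategory A] {H : WBA V} (G : A ⥤ DMod H)
  (i : SepFrobenius (G ⋙ DMod.forget H))

/-- A separable Frobenius structure on the underlying functor of a functor into modules lifts to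
the functor if its structure maps are linear. -/
abbrev dmodLift
    (hμ : ∀ a b, tact (G.obj a).act (G.obj b).act ≫ i.μ a b =
      H.X ◁ i.μ a b ≫ (G.obj (a ⊗ b)).act)
    (hδ : ∀ a b, (G.obj (a ⊗ b)).act ≫ i.δ a b =
      H.X ◁ i.δ a b ≫ tact (G.obj a).act (G.obj b).act)
    (hε : idemT H.X ≫ orbit (G.obj (𝟙_ A)).act i.ε = orbit (G.obj (𝟙_ A)).act i.ε)
    (hη : (G.obj (𝟙_ A)).act ≫ i.η = idemR H.X ▷ _ ≫ (G.obj (𝟙_ A)).act ≫ i.η) :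
    FrobeniusLift G (DMod.forget H) i where
  one := dmodHomMk ((dmodUnitPres H).i ≫ orbit (G.obj (𝟙_ A)).act i.ε)
    (fromUnit_linear _ (DMod.act_isAssocAct _) hε)
  mul a b := dmodHomMk ((dmodTensorPres _ _).i ≫ i.μ a b)
    ((dmodTensorPres _ _).linear_desc _ (by
      rw [unitAct_comp (DMod.unitAct_act _) (hμ a b), hμ]))
  counit := dmodHomMk (coorbit (G.obj (𝟙_ A)).act i.η ≫ (dmodUnitPres H).p)
    (toUnit_linear _ (DMod.act_isAssocAct _) hη)
  comul a b := dmodHomMk (i.δ a b ≫ (dmodTensorPres _ _).p)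
    ((dmodTensorPres _ _).linear_lift _ (by
      rw [reassoc_of% (hδ a b),
        (tact_isAssocAct (DMod.act_isAssocAct _) (DMod.act_isAssocAct _)).act_unitAct]))
  one_eq := one_fromUnit (dmodUnitPres H) (DMod.unitAct_act _)
  mul_eq a b := by
    have h := (dmodTensorPres (G.obj a) (G.obj b)).p_i =≫ i.μ a b
    rw [unitAct_comp (DMod.unitAct_act _) (hμ a b), Category.assoc] at h
    exact h
  counit_eq := toUnit_counit (dmodUnitPres H) (DMod.unitAct_act _)
  comul_eq a b := by
    have h := i.δ a b ≫= (dmodTensorPres (G.obj a) (G.obj b)).p_i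
    rw [← unitAct_natural _ (hδ a b), DMod.unitAct_act, Category.id_comp, ← Category.assoc] at h
    exact h

end

section

variable {H J : WBA V} (f : H ⟶ J)

/-- Restriction of scalars lifts the separable Frobenius structure of the forgetful functor. -/
abbrev restrictLift : FrobeniusLift (DMod.restrict f) (DMod.forget H)
    (inferInstanceAs (SepFrobenius (DMod.forget J))) :=
  dmodLift _ _
    (fun a b => by
      change tact (f.hom ▷ _ ≫ a.act) (f.hom ▷ _ ≫ b.act) ≫ (dmodTensorPres a b).p =
        H.X ◁ (dmodTensorPres a b).p ≫ f.hom ▷ _ ≫ (a ⊗ b).act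
      rw [whisker_exchange_assoc, (dmodTensorPres a b).p_act, ← Category.assoc (f.hom ▷ _),
        whisker_tact_eq_comp_unitAct f.hom a.act_isAssocAct b.act_isAssocAct, Category.assoc,
        (dmodTensorPres a b).unitAct_p])
    (fun a b => by
      change (f.hom ▷ _ ≫ (a ⊗ b).act) ≫ (dmodTensorPres a b).i =
        H.X ◁ (dmodTensorPres a b).i ≫ tact (f.hom ▷ _ ≫ a.act) (f.hom ▷ _ ≫ b.act)
      rw [Category.assoc, (dmodTensorPres a b).act_i, ← whisker_exchange_assoc,
        whisker_tact_eq_unitAct_comp f.hom a.act_isAssocAct b.act_isAssocAct,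
        ← MonoidalCategory.whiskerLeft_comp_assoc, (dmodTensorPres a b).i_unitAct])
    (by
      change idemT H.X ≫ orbit (f.hom ▷ _ ≫ (𝟙_ (DMod J)).act) (ε (DMod.forget J)) =
        orbit (f.hom ▷ _ ≫ (𝟙_ (DMod J)).act) (ε (DMod.forget J))
      have h := (dmodUnitPres J).unitAct_p
      rw [unitAct_idemTAct] at h
      rw [orbit_map, forget_ε, orbit_one, reassoc_of% IsWeakHom.idemT_comm (f := f.hom), h])
    (by
      change (f.hom ▷ _ ≫ (𝟙_ (DMod J)).act) ≫ η (DMod.forget J) =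
        idemR H.X ▷ _ ≫ (f.hom ▷ _ ≫ (𝟙_ (DMod J)).act) ≫ η (DMod.forget J)
      rw [Category.assoc, ← comp_whiskerRight_assoc, IsWeakHom.idemR_comm (f := f.hom),
        comp_whiskerRight_assoc, forget_η, act_unit_counit])

end

end Lift

end Tannaka

namespace Tannaka

section RepFunctor

variable {V : Type u} [Category.{v} V] [MonoidalCategory V] [BraidedCategory V]

lemma DMod.ext_heq {H : WBA V} {a b : DMod H}
    (h : (DMod.forget H).obj a = (DMod.forget H).obj b) (h' : HEq a.act b.act) : a = b := by
  obtain ⟨@⟨X, x⟩, hX⟩ := a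
  obtain ⟨@⟨Y, y⟩, hY⟩ := b
  obtain rfl : X = Y := h
  obtain ⟨x, _, _⟩ := x
  obtain ⟨y, _, _⟩ := y
  obtain rfl : x = y := eq_of_heq h'
  rfl

lemma DMod.hom_heq {H : WBA V} {a b a' b' : DMod H} (ha : a = a') (hb : b = b') {f : a ⟶ b}
    {g : a' ⟶ b'} (h : HEq ((DMod.forget H).map f) ((DMod.forget H).map g)) : HEq f g := by
  subst ha hb
  exact heq_of_eq ((DMod.forget H).map_injective (eq_of_heq h))

lemma DMod.functor_ext {A : Type u₁} [Category.{v₁} A] {H : WBA V} {G G' : A ⥤ DMod H}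
    (h : G ⋙ DMod.forget H = G' ⋙ DMod.forget H)
    (h' : ∀ a, HEq (G.obj a).act (G'.obj a).act) : G = G' := by
  have h₀ : ∀ a, G.obj a = G'.obj a := fun a => DMod.ext_heq (Functor.congr_obj h a) (h' a)
  refine Functor.hext h₀ fun a b f => DMod.hom_heq (h₀ a) (h₀ b) ?_
  change HEq ((G ⋙ DMod.forget H).map f) ((G' ⋙ DMod.forget H).map f)
  rw [h]

variable [IsIdempotentComplete V] [EssentiallySmall.{v} (dualizable V).FullSubcategory]

lemma SFFunctor.functor_congr {A : Type u₁} [Category.{v₁} A] [MonoidalCategory A]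
    {B : Type u₂} [Category.{v₂} B] [MonoidalCategory B] {F G : SFFunctor A B} (h : F = G) :
    F.functor = G.functor := congrArg _ h

/-- A morphism into the forgetful functor of modules is determined by the actions. -/
lemma rep_hom_ext {H : WBA V} {F : SFOver V} {f g : F ⟶ (rep H).toSFOver}
    (h : ∀ a, HEq (DMod.act (H := H) (f.H.functor.obj a)) (DMod.act (H := H) (g.H.functor.obj a))) :
    f = g := by
  have e : f.H.functor = g.H.functor :=
    DMod.functor_ext (H := H) (G := f.H.functor) (G' := g.H.functor)
      (SFFunctor.functor_congr (f.comm.trans g.comm.symm)) h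
  obtain ⟨⟨G, i⟩, hf⟩ := f
  obtain ⟨⟨G', j⟩, hg⟩ := g
  obtain rfl : G = G' := e
  exact SFOver.Hom.ext (sfFunctor_ext (DMod.forget H) (hf.trans hg.symm))

/-- Restriction of scalars as a morphism over `V`. -/
def restr {H J : WBA V} (f : H ⟶ J) : (rep J).toSFOver ⟶ (rep H).toSFOver :=
  SFOver.Hom.mk (F := (rep J).toSFOver) (G := (rep H).toSFOver)
    (restrictLift f).toSFFunctor (restrictLift f).toSFFunctor_comp

variable (V) in
/-- The representation functor. -/
def repFunctor : RepFunctor V where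
  rep := rep
  restr := restr
  restr_functor _ := rfl
  restr_id H := rep_hom_ext fun a => by
    refine heq_of_eq ?_
    change 𝟙 H.X ▷ (DMod.forget H).obj a ≫ DMod.act (H := H) a = DMod.act (H := H) a
    simp
  restr_comp {H J K} f g := rep_hom_ext fun a => by
    refine heq_of_eq ?_
    change (f.hom ≫ g.hom) ▷ (DMod.forget K).obj a ≫ DMod.act (H := K) a =
      f.hom ▷ (DMod.forget K).obj a ≫ g.hom ▷ (DMod.forget K).obj a ≫ DMod.act (H := K) a
    simp

end RepFunctor

end Tannaka

namespace Tannaka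

section Ends

variable {V : Type u} [Category.{v} V] [MonoidalCategory V] [BraidedCategory V]

/-- The map `Y ⊗ P ⟶ P ⊗ W` obtained from `f : Y ⟶ T ⊗ W` and an action of `T` on `P`. -/
def actOn {T P W Y : V} (x : T ⊗ P ⟶ P) (f : Y ⟶ T ⊗ W) : Y ⊗ P ⟶ P ⊗ W :=
  f ▷ P ≫ (α_ T W P).hom ≫ T ◁ (β_ W P).hom ≫ (α_ T P W).inv ≫ x ▷ W

lemma hat_actOn {T P W Y : V} (x : T ⊗ P ⟶ P) (f : Y ⟶ T ⊗ W) (Z : V) :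
    hat₂₂ (actOn x f) Z = hat₁₂ f (P ⊗ Z) ≫ T ◃ swap W P Z ≫ hat₂₁ x (W ⊗ Z) := by
  simp only [hat₁₂, hat₂₁, hat₂₂, lw, swap, actOn, MonoidalCategory.whiskerLeft_comp,
    comp_whiskerRight, Category.assoc]
  monoidal

section Mate

variable {P D W Y : V} [ExactPairing P D]

/-- The transpose `Y ⟶ (P ⊗ D) ⊗ W` of `Y ⊗ P ⟶ P ⊗ W`, where `D` is dual to `P`. -/
def mate (φ : Y ⊗ P ⟶ P ⊗ W) : Y ⟶ (P ⊗ D) ⊗ W :=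
  (ρ_ Y).inv ≫ Y ◁ η_ P D ≫ (α_ Y P D).inv ≫ φ ▷ D ≫ (α_ P W D).hom ≫ P ◁ (β_ W D).hom ≫
    (α_ P D W).inv

/-- The inverse of `mate`. -/
def unmate (ψ : Y ⟶ (P ⊗ D) ⊗ W) : Y ⊗ P ⟶ P ⊗ W :=
  ψ ▷ P ≫ (α_ (P ⊗ D) W P).hom ≫ (P ⊗ D) ◁ (β_ W P).hom ≫ (α_ P D (P ⊗ W)).hom ≫
    P ◁ ((α_ D P W).inv ≫ ε_ P D ▷ W ≫ (λ_ W).hom)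

/-- The flattening of a map `Y ⟶ (A ⊗ B) ⊗ C`. -/
def hat₁₃ {A B C : V} (f : Y ⟶ (A ⊗ B) ⊗ C) (Z : V) : Y ⊗ Z ⟶ A ⊗ B ⊗ C ⊗ Z :=
  f ▷ Z ≫ (α_ (A ⊗ B) C Z).hom ≫ (α_ A B (C ⊗ Z)).hom

lemma hat₁₃_congr {A B C : V} {f g : Y ⟶ (A ⊗ B) ⊗ C} (h : ∀ Z, hat₁₃ f Z = hat₁₃ g Z) :
    f = g := by
  refine hat₁₁_congr fun Z => ?_
  have := h Z
  rw [hat₁₃, hat₁₃] at this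
  exact (cancel_mono ((α_ (A ⊗ B) C Z).hom ≫ (α_ A B (C ⊗ Z)).hom)).1 this

lemma hat₁₃_nat {A B C : V} (f : Y ⟶ (A ⊗ B) ⊗ C) {Z Z' : V} (g : Z ⟶ Z') :
    hat₁₃ f Z ≫ A ◃ B ◃ C ◃ g = Y ◃ g ≫ hat₁₃ f Z' := by
  simp only [hat₁₃, lw, Category.assoc]
  rw [← associator_naturality_right, ← associator_naturality_right_assoc, whisker_exchange_assoc]

lemma hat_mate (φ : Y ⊗ P ⟶ P ⊗ W) (Z : V) : hat₁₃ (mate (D := D) φ) Z =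
    Y ◃ hat₀₂ (η_ P D) Z ≫ hat₂₂ φ (D ⊗ Z) ≫ P ◃ swap W D Z := by
  simp only [hat₁₃, hat₂₂, hat₀₂, lw, swap, mate, MonoidalCategory.whiskerLeft_comp,
    comp_whiskerRight, Category.assoc]
  monoidal

lemma hat_unmate (ψ : Y ⟶ (P ⊗ D) ⊗ W) (Z : V) : hat₂₂ (unmate ψ) Z =
    hat₁₃ ψ (P ⊗ Z) ≫ P ◃ (D ◃ swap W P Z ≫ hat₂₀ (ε_ P D) (W ⊗ Z)) := by
  simp only [hat₁₃, hat₂₂, hat₂₀, lw, swap, unmate, MonoidalCategory.whiskerLeft_comp,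
    comp_whiskerRight, Category.assoc]
  monoidal

lemma hat₂₂_nat {A B C E : V} (φ : A ⊗ B ⟶ C ⊗ E) {Z Z' : V} (g : Z ⟶ Z') :
    hat₂₂ φ Z ≫ C ◃ E ◃ g = A ◃ B ◃ g ≫ hat₂₂ φ Z' := by
  simp only [hat₂₂, lw, Category.assoc]
  rw [← associator_naturality_right, ← whisker_exchange_assoc, associator_inv_naturality_right_assoc]

lemma unmate_mate (φ : Y ⊗ P ⟶ P ⊗ W) : unmate (mate (D := D) φ) = φ := by
  refine hat₂₂_congr fun Z => ?_
  rw [hat_unmate, hat_mate]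
  have h := swap_swap_hat₂₀ W Z (ε_ P D)
  calc _ = Y ◃ hat₀₂ (η_ P D) _ ≫ hat₂₂ φ _ ≫ P ◃ (swap W D _ ≫ D ◃ swap W P Z ≫
        hat₂₀ (ε_ P D) (W ⊗ Z)) := by simp
    _ = Y ◃ (hat₀₂ (η_ P D) _ ≫ P ◃ hat₂₀ (ε_ P D) Z) ≫ hat₂₂ φ _ := by
        rw [h, hat₂₂_nat]; simp only [lw_comp_assoc]
    _ = _ := by simp

lemma mate_unmate (ψ : Y ⟶ (P ⊗ D) ⊗ W) : mate (unmate ψ) = ψ := by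
  refine hat₁₃_congr fun Z => ?_
  rw [hat_mate, hat_unmate]
  have h := lw_hat₀₂_swap W Z (η_ P D)
  calc _ = (Y ◃ hat₀₂ (η_ P D) Z ≫ hat₁₃ ψ _) ≫ P ◃ (D ◃ swap W P _ ≫
        hat₂₀ (ε_ P D) _ ≫ swap W D Z) := by simp
    _ = hat₁₃ ψ _ ≫ P ◃ (D ◃ (W ◃ hat₀₂ (η_ P D) Z ≫ swap W P _ ≫ P ◃ swap W D Z) ≫
        hat₂₀ (ε_ P D) _) := by
        rw [← hat₁₃_nat]; simp
    _ = _ := by rw [h]; simp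

lemma unmate_comp {T : V} (π : T ⟶ P ⊗ D) (f : Y ⟶ T ⊗ W) :
    unmate (f ≫ π ▷ W) =
      actOn (π ▷ P ≫ (α_ P D P).hom ≫ P ◁ ε_ P D ≫ (ρ_ P).hom) f := by
  refine hat₂₂_congr fun Z => ?_
  have h (Z : V) : hat₂₁ (π ▷ P ≫ (α_ P D P).hom ≫ P ◁ ε_ P D ≫ (ρ_ P).hom) Z =
      hat₁₂ π (P ⊗ Z) ≫ P ◃ hat₂₀ (ε_ P D) Z := by
    simp only [hat₁₂, hat₂₁, hat₂₀, lw, MonoidalCategory.whiskerLeft_comp,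
      comp_whiskerRight, Category.assoc]
    monoidal
  have h' (Z : V) : hat₁₃ (f ≫ π ▷ W) Z = hat₁₂ f Z ≫ hat₁₂ π (W ⊗ Z) := by
    simp only [hat₁₂, hat₁₃, comp_whiskerRight]
    monoidal
  rw [hat_unmate, hat_actOn, h, h']
  simp

end Mate

variable {A : Type u₁} [Category.{v₁} A]

/-- The actions `x` exhibit `T ⊗ W`, for all `W`, as the object of natural families
`P a ⟶ P a ⊗ W`. -/
structure IsActEnd (P : A ⥤ V) (T : V) (x : ∀ a, T ⊗ P.obj a ⟶ P.obj a) : Prop where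
  natural : ∀ {a b : A} (f : a ⟶ b), x a ≫ P.map f = T ◁ P.map f ≫ x b
  exists_lift : ∀ {W Y : V} (φ : ∀ a, Y ⊗ P.obj a ⟶ P.obj a ⊗ W)
    (_ : ∀ {a b : A} (f : a ⟶ b), φ a ≫ P.map f ▷ W = Y ◁ P.map f ≫ φ b),
    ∃ f : Y ⟶ T ⊗ W, ∀ a, actOn (x a) f = φ a
  hom_ext : ∀ {W Y : V} {f g : Y ⟶ T ⊗ W}, (∀ a, actOn (x a) f = actOn (x a) g) → f = g

section Existence

/-- The diagram `(b, a) ↦ P a ⊗ *(P b)`. -/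
abbrev dualDiagram (P : A ⥤ V) [∀ a, HasRightDual (P.obj a)] : Aᵒᵖ ⥤ A ⥤ V where
  obj b := P ⋙ tensorRight ((P.obj b.unop)ᘁ)
  map g := { app := fun a => P.obj a ◁ ((P.map g.unop)ᘁ)
             naturality := fun _ _ h => (whisker_exchange _ _).symm }
  map_id b := by
    ext a
    simp
  map_comp g h := by
    ext a
    simp [comp_rightAdjointMate]

variable (P : A ⥤ V) [∀ a, HasRightDual (P.obj a)]

/-- The action of an object on `P a` that corresponds to a map into `P a ⊗ *(P a)`. -/
def actOfProj {T : V} {a : A} (π : T ⟶ P.obj a ⊗ (P.obj a)ᘁ) : T ⊗ P.obj a ⟶ P.obj a :=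
  π ▷ _ ≫ (α_ _ _ _).hom ≫ _ ◁ ε_ _ _ ≫ (ρ_ _).hom

lemma mate_dinatural {W Y : V} (φ : ∀ a, Y ⊗ P.obj a ⟶ P.obj a ⊗ W)
    (hφ : ∀ {a b : A} (f : a ⟶ b), φ a ≫ P.map f ▷ W = Y ◁ P.map f ≫ φ b) {a b : A} (f : a ⟶ b) :
    mate (D := (P.obj a)ᘁ) (φ a) ≫ P.map f ▷ _ ▷ W =
      mate (D := (P.obj b)ᘁ) (φ b) ≫ (P.obj b ◁ (P.map f)ᘁ) ▷ W := by
  have h₁ : mate (D := (P.obj a)ᘁ) (φ a) ≫ P.map f ▷ _ ▷ W =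
      (ρ_ Y).inv ≫ Y ◁ η_ (P.obj a) ((P.obj a)ᘁ) ≫ (α_ Y _ _).inv ≫ (φ a ≫ P.map f ▷ W) ▷ _ ≫
        (α_ _ W _).hom ≫ _ ◁ (β_ W _).hom ≫ (α_ _ _ W).inv := by
    simp only [mate, comp_whiskerRight, Category.assoc]
    rw [associator_naturality_left_assoc, ← whisker_exchange_assoc,
      associator_inv_naturality_left]
  have h₂ : mate (D := (P.obj b)ᘁ) (φ b) ≫ (P.obj b ◁ (P.map f)ᘁ) ▷ W =
      (ρ_ Y).inv ≫ Y ◁ (η_ (P.obj b) ((P.obj b)ᘁ) ≫ _ ◁ (P.map f)ᘁ) ≫ (α_ Y _ _).inv ≫ φ b ▷ _ ≫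
        (α_ _ W _).hom ≫ _ ◁ (β_ W _).hom ≫ (α_ _ _ W).inv := by
    simp only [mate, MonoidalCategory.whiskerLeft_comp, Category.assoc]
    rw [← associator_inv_naturality_middle, ← MonoidalCategory.whiskerLeft_comp_assoc,
      ← braiding_naturality_right, associator_inv_naturality_right_assoc, whisker_exchange_assoc,
      MonoidalCategory.whiskerLeft_comp_assoc, associator_naturality_right_assoc]
  rw [h₁, h₂, hφ, coevaluation_comp_rightAdjointMate]
  simp

lemma actOfProj_natural {T : V} {a b : A} (f : a ⟶ b) (π : T ⟶ P.obj a ⊗ (P.obj a)ᘁ)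
    (π' : T ⟶ P.obj b ⊗ (P.obj b)ᘁ) (h : π ≫ P.map f ▷ _ = π' ≫ _ ◁ (P.map f)ᘁ) :
    actOfProj P π ≫ P.map f = T ◁ P.map f ≫ actOfProj P π' := by
  have h₁ : actOfProj P π ≫ P.map f =
      (π ≫ P.map f ▷ _) ▷ _ ≫ (α_ _ _ _).hom ≫ _ ◁ ε_ _ _ ≫ (ρ_ _).hom := by
    simp only [actOfProj, comp_whiskerRight, Category.assoc]
    rw [associator_naturality_left_assoc, ← whisker_exchange_assoc, rightUnitor_naturality]
  rw [h₁, h, actOfProj, whisker_exchange_assoc, associator_naturality_right_assoc,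
    ← MonoidalCategory.whiskerLeft_comp_assoc, ← rightAdjointMate_comp_evaluation]
  simp

lemma isActEnd_of_isLimit {T : V} (π : ∀ a, T ⟶ P.obj a ⊗ (P.obj a)ᘁ)
    (hπ : ∀ ⦃a b : A⦄ (f : a ⟶ b), π a ≫ P.map f ▷ _ = π b ≫ _ ◁ (P.map f)ᘁ)
    (hT : ∀ W : V, Nonempty (IsLimit (Multifork.map
      (Wedge.mk (F := dualDiagram P) T π hπ) (tensorRight W)))) :
    IsActEnd P T (fun a => actOfProj P (π a)) where
  natural f := actOfProj_natural P f _ _ (hπ f)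
  exists_lift {W Y} φ hφ := by
    refine ⟨Multifork.IsLimit.lift (hT W).some (fun a => mate (φ a))
      (fun f => mate_dinatural P φ hφ f.hom), fun a => ?_⟩
    have h := Multifork.IsLimit.fac (hT W).some (fun a => mate (φ a))
      (fun f => mate_dinatural P φ hφ f.hom) a
    rw [← unmate_mate (D := (P.obj a)ᘁ) (φ a), ← h]
    exact (unmate_comp _ _).symm
  hom_ext {W Y f g} h := by
    refine Multifork.IsLimit.hom_ext (hT W).some fun a => ?_
    change f ≫ π a ▷ W = g ≫ π a ▷ W
    rw [← mate_unmate (f ≫ π a ▷ W), ← mate_unmate (g ≫ π a ▷ W), unmate_comp, unmate_comp]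
    exact congrArg mate (h a)

end Existence

lemma exists_isActEnd_of_small [MonoidallyComplete V] {S : Type v} [SmallCategory S] (P : S ⥤ V)
    (hP : ∀ a, dualizable V (P.obj a)) : ∃ T x, IsActEnd P T x := by
  have := MonoidallyComplete.hasLimits (V := V)
  let (a : S) : HasRightDual (P.obj a) := (hP a).some
  let c : Wedge (dualDiagram P) := limit.cone (multicospanIndexEnd (dualDiagram P)).multicospan
  have hc : IsLimit (Wedge.mk (F := dualDiagram P) c.pt c.ι fun _ _ f => c.condition f) :=
    IsLimit.ofIsoLimit (limit.isLimit _) (Wedge.ext (Iso.refl _) fun _ => (Category.id_comp _).symm)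
  refine ⟨_, _, isActEnd_of_isLimit P c.ι (fun _ _ f => c.condition f) fun W => ?_⟩
  have := MonoidallyComplete.preservesLimits_tensorRight W
  exact ⟨Multifork.isLimitMapOfPreserves _ (tensorRight W) hc⟩

lemma actOn_comp {T P P' W Y : V} (x : T ⊗ P ⟶ P) (x' : T ⊗ P' ⟶ P') (g : P ⟶ P')
    (h : x ≫ g = T ◁ g ≫ x') (f : Y ⟶ T ⊗ W) :
    actOn x f ≫ g ▷ W = Y ◁ g ≫ actOn x' f := by
  simp only [actOn, Category.assoc]
  rw [← comp_whiskerRight, h, comp_whiskerRight, ← associator_inv_naturality_middle_assoc,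
    ← MonoidalCategory.whiskerLeft_comp_assoc, ← braiding_naturality_right,
    MonoidalCategory.whiskerLeft_comp_assoc, ← associator_naturality_right_assoc,
    whisker_exchange_assoc]

lemma exists_isActEnd [MonoidallyComplete V] [EssentiallySmall.{v} A] (P : A ⥤ V)
    (hP : ∀ a, dualizable V (P.obj a)) : ∃ T x, IsActEnd P T x := by
  let e := equivSmallModel.{v} A
  obtain ⟨T, x, hx⟩ := exists_isActEnd_of_small (e.inverse ⋙ P) (fun s => hP _)
  let u (a : A) : a ⟶ e.inverse.obj (e.functor.obj a) := e.unit.app a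
  let j (a : A) : P.obj a ≅ P.obj (e.inverse.obj (e.functor.obj a)) :=
    P.mapIso (e.unitIso.app a)
  have hj {a b : A} (f : a ⟶ b) : P.map f ≫ (j b).hom =
      (j a).hom ≫ P.map (e.inverse.map (e.functor.map f)) :=
    (P.map_comp _ _).symm.trans ((congrArg P.map (e.unit.naturality f)).trans (P.map_comp _ _))
  have hj' (s : SmallModel.{v} A) :
      (j (e.inverse.obj s)).hom = P.map (e.inverse.map (e.counitInv.app s)) :=
    congrArg P.map (e.unit_app_inverse s)
  obtain ⟨y, hy⟩ : ∃ y : ∀ a, T ⊗ P.obj a ⟶ P.obj a,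
      ∀ a, y a ≫ (j a).hom = T ◁ (j a).hom ≫ x (e.functor.obj a) :=
    ⟨fun a => T ◁ (j a).hom ≫ x (e.functor.obj a) ≫ (j a).inv, fun a => by simp⟩
  have hn {a b : A} (f : a ⟶ b) : y a ≫ P.map f = T ◁ P.map f ≫ y b := by
    have := hx.natural (e.functor.map f)
    simp only [Functor.comp_map] at this
    rw [← cancel_mono (j b).hom, Category.assoc, Category.assoc, hj, reassoc_of% hy a, hy,
      ← MonoidalCategory.whiskerLeft_comp_assoc, hj, this]
    simp
  have hxy (s : SmallModel.{v} A) : y (e.inverse.obj s) = x s := by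
    rw [← cancel_mono (j _).hom, hy, hj']
    exact (hx.natural (e.counitInv.app s)).symm
  refine ⟨T, y, hn, ?_, ?_⟩
  · intro W Y φ hφ
    obtain ⟨f, hf⟩ := hx.exists_lift (fun s => φ (e.inverse.obj s)) (fun g => hφ (e.inverse.map g))
    refine ⟨f, fun a => ?_⟩
    have h := hf (e.functor.obj a)
    rw [← hxy] at h
    rw [← cancel_mono ((j a).hom ▷ W)]
    exact (actOn_comp _ _ _ (hn (u a)) f).trans ((congrArg _ h).trans (hφ (u a)).symm)
  · intro W Y f g h
    refine hx.hom_ext fun s => ?_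
    rw [← hxy]
    exact h _
end Ends

end Tannaka

namespace Tannaka

namespace IsActEnd

variable {V : Type u} [Category.{v} V] [MonoidalCategory V] [BraidedCategory V]
  {A : Type u₁} [Category.{v₁} A] {P : A ⥤ V} {T : V} {x : ∀ a, T ⊗ P.obj a ⟶ P.obj a}

lemma actOn_rightUnitor_inv {T P Y : V} (x : T ⊗ P ⟶ P) (f : Y ⟶ T) :
    actOn x (f ≫ (ρ_ T).inv) = (f ▷ P ≫ x) ≫ (ρ_ P).inv := by
  simp only [actOn, comp_whiskerRight, Category.assoc, braiding_tensorUnit_left]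
  monoidal

lemma actOn_braiding {T P X Y : V} (x : T ⊗ P ⟶ P) (f : Y ⟶ X ⊗ T) :
    actOn x (f ≫ (β_ X T).hom) = (f ▷ P ≫ (α_ X T P).hom ≫ X ◁ x) ≫ (β_ X P).hom := by
  rw [actOn, Category.assoc, Category.assoc, braiding_naturality_right, braiding_tensor_right_hom]
  simp

lemma actOn_swap {T P X W Y : V} (x : T ⊗ P ⟶ P) (f : Y ⟶ X ⊗ (T ⊗ W)) :
    actOn x (f ≫ swap X T W) = (f ▷ P ≫ (α_ X (T ⊗ W) P).hom ≫ X ◁ actOn x (𝟙 _)) ≫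
      swap X P W := by
  have h := lw_hat₂₁_swap X W x
  simp only [actOn, id_whiskerRight, Category.id_comp]
  have e₁ : f ▷ P ≫ (α_ X (T ⊗ W) P).hom ≫ X ◁ ((α_ T W P).hom ≫ T ◁ (β_ W P).hom ≫
      (α_ T P W).inv ≫ x ▷ W) = f ▷ P ≫ (α_ X (T ⊗ W) P).hom ≫ X ◁ ((α_ T W P).hom ≫
        T ◁ (β_ W P).hom) ≫ X ◃ hat₂₁ x W := by
    simp [lw, hat₂₁]
  rw [e₁]
  have h' := swap_nat (A := X) (B := T) (β_ W P).hom
  rw [lw, lw, lw, lw] at h'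
  simp only [Category.assoc, MonoidalCategory.whiskerLeft_comp]
  rw [h, ← reassoc_of% h']
  simp only [lw, swap, hat₂₁, braiding_tensor_left_hom, MonoidalCategory.whiskerLeft_comp,
    comp_whiskerRight, Category.assoc]
  monoidal

lemma whisker_act₂ {T a b Y : V} (x : T ⊗ a ⟶ a) (y : T ⊗ b ⟶ b) (f : Y ⟶ T ⊗ T) :
    f ▷ (a ⊗ b) ≫ act₂ x y = (α_ Y a b).inv ≫ actOn x f ▷ b ≫ (α_ a T b).hom ≫ a ◁ y := by
  simp only [act₂, actOn, tensorμ, MonoidalCategory.tensorHom_def, comp_whiskerRight,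
    Category.assoc, MonoidalCategory.whiskerLeft_comp]
  monoidal

variable (E : IsActEnd P T x)

lemma hat_natural (E : IsActEnd P T x) {a b : A} (f : a ⟶ b) (Z : V) :
    hat₂₁ (x a) Z ≫ hat₁₁ (P.map f) Z = T ◃ hat₁₁ (P.map f) Z ≫ hat₂₁ (x b) Z := by
  rw [← hat₂₁_comp, E.natural, hat₂₁_lw]

lemma ext₁ (E : IsActEnd P T x) {Y : V} {f g : Y ⟶ T}
    (h : ∀ a, f ▷ P.obj a ≫ x a = g ▷ P.obj a ≫ x a) : f = g := by
  rw [← cancel_mono (ρ_ T).inv]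
  refine E.hom_ext fun a => ?_
  rw [actOn_rightUnitor_inv, actOn_rightUnitor_inv, h]

lemma hat_ext₁ (E : IsActEnd P T x) {Y : V} {f g : Y ⟶ T}
    (h : ∀ a Z, hat₁₁ f (P.obj a ⊗ Z) ≫ hat₂₁ (x a) Z = hat₁₁ g (P.obj a ⊗ Z) ≫ hat₂₁ (x a) Z) :
    f = g := by
  refine E.ext₁ fun a => hat₂₁_congr fun Z => ?_
  rw [hat₂₁_rw, hat₂₁_rw, h]

lemma exists_lift₁ (E : IsActEnd P T x) {Y : V} (φ : ∀ a, Y ⊗ P.obj a ⟶ P.obj a)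
    (hφ : ∀ {a b : A} (f : a ⟶ b), φ a ≫ P.map f = Y ◁ P.map f ≫ φ b) :
    ∃ f : Y ⟶ T, ∀ a, f ▷ P.obj a ≫ x a = φ a := by
  obtain ⟨f, hf⟩ := E.exists_lift (fun a => φ a ≫ (ρ_ _).inv) (fun {a b} g => by
    rw [Category.assoc, ← rightUnitor_inv_naturality, ← Category.assoc, hφ, Category.assoc])
  refine ⟨f ≫ (ρ_ T).hom, fun a => ?_⟩
  have h := actOn_rightUnitor_inv (x a) (f ≫ (ρ_ T).hom)
  rw [Category.assoc, Iso.hom_inv_id, Category.comp_id, hf] at h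
  exact ((cancel_mono _).1 h).symm

lemma ext_right (E : IsActEnd P T x) {X Y : V} {f g : Y ⟶ X ⊗ T}
    (h : ∀ a, f ▷ P.obj a ≫ (α_ _ _ _).hom ≫ X ◁ x a =
      g ▷ P.obj a ≫ (α_ _ _ _).hom ≫ X ◁ x a) : f = g := by
  rw [← cancel_mono (β_ X T).hom]
  refine E.hom_ext fun a => ?_
  rw [actOn_braiding, actOn_braiding, h]

lemma exists_lift_right (E : IsActEnd P T x) {X Y : V} (φ : ∀ a, Y ⊗ P.obj a ⟶ X ⊗ P.obj a)
    (hφ : ∀ {a b : A} (f : a ⟶ b), φ a ≫ X ◁ P.map f = Y ◁ P.map f ≫ φ b) :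
    ∃ f : Y ⟶ X ⊗ T, ∀ a, f ▷ P.obj a ≫ (α_ _ _ _).hom ≫ X ◁ x a = φ a := by
  obtain ⟨f, hf⟩ := E.exists_lift (fun a => φ a ≫ (β_ X _).hom) (fun {a b} g => by
    rw [Category.assoc, ← braiding_naturality_right, ← Category.assoc, hφ, Category.assoc])
  refine ⟨f ≫ (β_ X T).inv, fun a => ?_⟩
  have h := actOn_braiding (x a) (f ≫ (β_ X T).inv)
  rw [Category.assoc, Iso.inv_hom_id, Category.comp_id, hf] at h
  exact ((cancel_mono _).1 h).symm

lemma ext_middle (E : IsActEnd P T x) {X W Y : V} {f g : Y ⟶ X ⊗ (T ⊗ W)}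
    (h : ∀ a, f ▷ P.obj a ≫ (α_ _ _ _).hom ≫ X ◁ actOn (x a) (𝟙 (T ⊗ W)) =
      g ▷ P.obj a ≫ (α_ _ _ _).hom ≫ X ◁ actOn (x a) (𝟙 (T ⊗ W))) : f = g := by
  have : f ≫ swap X T W = g ≫ swap X T W := by
    refine E.hom_ext fun a => ?_
    rw [actOn_swap, actOn_swap, h]
  have h' := this =≫ swapInv X T W
  simpa using h'

lemma ext₂ (E : IsActEnd P T x) {Y : V} {f g : Y ⟶ T ⊗ T}
    (h : ∀ a b, f ▷ (P.obj a ⊗ P.obj b) ≫ act₂ (x a) (x b) =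
      g ▷ (P.obj a ⊗ P.obj b) ≫ act₂ (x a) (x b)) : f = g := by
  refine E.hom_ext fun a => E.ext_right fun b => ?_
  have := h a b
  rwa [whisker_act₂, whisker_act₂, cancel_epi] at this

lemma exists_lift₂ (E : IsActEnd P T x) {Y : V}
    (φ : ∀ a b, Y ⊗ (P.obj a ⊗ P.obj b) ⟶ P.obj a ⊗ P.obj b)
    (hl : ∀ {a a' : A} (f : a ⟶ a') (b : A),
      φ a b ≫ P.map f ▷ _ = Y ◁ P.map f ▷ _ ≫ φ a' b)
    (hr : ∀ (a : A) {b b' : A} (f : b ⟶ b'),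
      φ a b ≫ _ ◁ P.map f = Y ◁ _ ◁ P.map f ≫ φ a b') :
    ∃ f : Y ⟶ T ⊗ T, ∀ a b, f ▷ (P.obj a ⊗ P.obj b) ≫ act₂ (x a) (x b) = φ a b := by
  have h₁ (a : A) := E.exists_lift_right (Y := Y ⊗ P.obj a) (X := P.obj a)
    (fun b => (α_ _ _ _).hom ≫ φ a b) (fun {b b'} f => by
      rw [Category.assoc, hr, associator_naturality_right_assoc])
  choose g hg using h₁
  obtain ⟨f, hf⟩ := E.exists_lift g (fun {a a'} f => E.ext_right fun b => by
    have := hg a' b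
    simp only [comp_whiskerRight, Category.assoc]
    rw [this, associator_naturality_left_assoc, ← whisker_exchange, reassoc_of% hg a b, hl,
      associator_naturality_middle_assoc])
  refine ⟨f, fun a b => ?_⟩
  rw [whisker_act₂, hf, hg, Iso.inv_hom_id_assoc]

/-- The flattening of a map `Y ⟶ A ⊗ (B ⊗ C)`. -/
def hatR₁₃ {A B C Y : V} (f : Y ⟶ A ⊗ (B ⊗ C)) (Z : V) : Y ⊗ Z ⟶ A ⊗ B ⊗ C ⊗ Z :=
  f ▷ Z ≫ (α_ A (B ⊗ C) Z).hom ≫ A ◁ (α_ B C Z).hom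

/-- The flattened action of `T ⊗ (T ⊗ T)` on `a ⊗ (b ⊗ c)`. -/
def hatAct₃ {a b c : V} (x : T ⊗ a ⟶ a) (y : T ⊗ b ⟶ b) (z : T ⊗ c ⟶ c) (Z : V) :
    T ⊗ T ⊗ T ⊗ a ⊗ b ⊗ c ⊗ Z ⟶ a ⊗ b ⊗ c ⊗ Z :=
  T ◃ (T ◃ (swap T a _ ≫ a ◃ (swap T b _ ≫ b ◃ hat₂₁ z Z)) ≫ swap T a _ ≫ a ◃ hat₂₁ y _) ≫
    hat₂₁ x _

lemma hat_ext₃_aux {a b c Y : V} (x : T ⊗ a ⟶ a) (y : T ⊗ b ⟶ b) (z : T ⊗ c ⟶ c) (Z : V)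
    (f : Y ⟶ T ⊗ (T ⊗ T)) :
    ((((actOn x f ▷ b ≫ (α_ _ _ _).hom ≫ a ◁ actOn y (𝟙 (T ⊗ T))) ≫ (α_ _ _ _).inv) ▷ c) ≫
      (α_ _ _ _).hom ≫ (a ⊗ b) ◁ z) ▷ Z =
    (α_ _ _ _).hom ≫ (α_ _ _ _).hom ≫ (α_ _ _ _).hom ≫ hatR₁₃ f (a ⊗ b ⊗ c ⊗ Z) ≫
      hatAct₃ x y z Z ≫ (α_ _ _ _).inv ≫ (α_ _ _ _).inv := by
  have e : hatAct₃ x y z Z = T ◃ (T ◃ swap T a _ ≫ swap T a _) ≫ hat₂₁ x _ ≫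
      a ◃ (T ◃ swap T b _ ≫ hat₂₁ y _ ≫ b ◃ hat₂₁ z Z) := by
    simp [hatAct₃]
  rw [e]
  simp only [hatR₁₃, actOn, lw, hat₂₁, swap, braiding_tensor_left_hom, id_whiskerRight,
    MonoidalCategory.whiskerLeft_comp, comp_whiskerRight, Category.assoc, Category.id_comp]
  monoidal

lemma hat_ext₃ (E : IsActEnd P T x) {Y : V} {f g : Y ⟶ T ⊗ (T ⊗ T)}
    (h : ∀ a b c Z, hatR₁₃ f (P.obj a ⊗ P.obj b ⊗ P.obj c ⊗ Z) ≫ hatAct₃ (x a) (x b) (x c) Z =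
      hatR₁₃ g (P.obj a ⊗ P.obj b ⊗ P.obj c ⊗ Z) ≫ hatAct₃ (x a) (x b) (x c) Z) : f = g := by
  refine E.hom_ext fun a => E.ext_middle fun b => ?_
  rw [← cancel_mono (α_ _ _ _).inv]
  refine E.ext_right fun c => hat₁₁_congr fun Z => ?_
  rw [hat₁₁, hat₁₁, hat_ext₃_aux, hat_ext₃_aux, reassoc_of% h]

end IsActEnd

end Tannaka

namespace Tannaka

open Functor.LaxMonoidal Functor.OplaxMonoidal

section FrobeniusCalculus

variable {V : Type u} [Category.{v} V] [MonoidalCategory V]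
  {A : Type u₁} [Category.{v₁} A] [MonoidalCategory A] (P : A ⥤ V) [SepFrobenius P]

section

variable (a b c : A) (Z : V)

lemma hat_μ_assoc : hat₂₁ (μ P a b) (P.obj c ⊗ Z) ≫ hat₂₁ (μ P (a ⊗ b) c) Z ≫
    hat₁₁ (P.map (α_ a b c).hom) Z =
      P.obj a ◃ hat₂₁ (μ P b c) Z ≫ hat₂₁ (μ P a (b ⊗ c)) Z := by
  have h : (P.obj a ◃ hat₂₁ (μ P b c) Z ≫ hat₂₁ (μ P a (b ⊗ c)) Z) =
      P.obj a ◁ (α_ _ _ _).inv ≫ (α_ _ _ _).inv ≫ (α_ _ _ _).inv ▷ Z ≫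
        ((α_ _ _ _).hom ≫ P.obj a ◁ μ P b c ≫ μ P a (b ⊗ c)) ▷ Z := by
    simp only [hat₂₁, lw, MonoidalCategory.whiskerLeft_comp, comp_whiskerRight, Category.assoc]
    monoidal
  rw [h, ← Functor.LaxMonoidal.associativity]
  simp only [hat₂₁, hat₁₁, comp_whiskerRight]
  monoidal

lemma hat_δ_assoc : hat₁₂ (δ P (a ⊗ b) c) Z ≫ hat₁₂ (δ P a b) (P.obj c ⊗ Z) =
    hat₁₁ (P.map (α_ a b c).hom) Z ≫ hat₁₂ (δ P a (b ⊗ c)) Z ≫ P.obj a ◃ hat₁₂ (δ P b c) Z := by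
  have h : hat₁₂ (δ P (a ⊗ b) c) Z ≫ hat₁₂ (δ P a b) (P.obj c ⊗ Z) =
      (δ P (a ⊗ b) c ≫ δ P a b ▷ P.obj c ≫ (α_ _ _ _).hom) ▷ Z ≫ (α_ _ _ _).hom ≫
        P.obj a ◁ (α_ _ _ _).hom := by
    simp only [hat₁₂, comp_whiskerRight]
    monoidal
  rw [h, Functor.OplaxMonoidal.associativity]
  simp only [hat₁₂, hat₁₁, lw, MonoidalCategory.whiskerLeft_comp, comp_whiskerRight, Category.assoc]
  monoidal

lemma hat_ε_μ : hat₀₁ (ε P) (P.obj a ⊗ Z) ≫ hat₂₁ (μ P (𝟙_ A) a) Z ≫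
    hat₁₁ (P.map (λ_ a).hom) Z = 𝟙 _ := by
  have h : hat₀₁ (ε P) (P.obj a ⊗ Z) ≫ hat₂₁ (μ P (𝟙_ A) a) Z ≫ hat₁₁ (P.map (λ_ a).hom) Z =
      (λ_ _).inv ≫ (α_ _ _ _).inv ≫ (ε P ▷ P.obj a ≫ μ P (𝟙_ A) a ≫ P.map (λ_ a).hom) ▷ Z := by
    simp only [hat₀₁, hat₂₁, hat₁₁, comp_whiskerRight]
    monoidal
  rw [h, ← Functor.LaxMonoidal.left_unitality]
  monoidal

lemma hat_μ_ε : P.obj a ◃ hat₀₁ (ε P) Z ≫ hat₂₁ (μ P a (𝟙_ A)) Z ≫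
    hat₁₁ (P.map (ρ_ a).hom) Z = 𝟙 _ := by
  have h : P.obj a ◃ hat₀₁ (ε P) Z ≫ hat₂₁ (μ P a (𝟙_ A)) Z ≫ hat₁₁ (P.map (ρ_ a).hom) Z =
      (ρ_ _).inv ▷ Z ≫ (P.obj a ◁ ε P ≫ μ P a (𝟙_ A) ≫ P.map (ρ_ a).hom) ▷ Z := by
    simp only [hat₀₁, hat₂₁, hat₁₁, lw, MonoidalCategory.whiskerLeft_comp, comp_whiskerRight]
    monoidal
  rw [h, ← Functor.LaxMonoidal.right_unitality, ← comp_whiskerRight, Iso.inv_hom_id,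
    id_whiskerRight]

lemma hat_ε_μ' : hat₀₁ (ε P) (P.obj a ⊗ Z) ≫ hat₂₁ (μ P (𝟙_ A) a) Z =
    hat₁₁ (P.map (λ_ a).inv) Z := by
  have h := hat_ε_μ P a Z =≫ hat₁₁ (P.map (λ_ a).inv) Z
  simp only [Category.assoc, ← hat₁₁_comp, Category.id_comp] at h
  rw [← h, ← P.map_comp, Iso.hom_inv_id, CategoryTheory.Functor.map_id, hat₁₁_id,
    Category.comp_id]

lemma hat_μ_ε' : P.obj a ◃ hat₀₁ (ε P) Z ≫ hat₂₁ (μ P a (𝟙_ A)) Z =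
    hat₁₁ (P.map (ρ_ a).inv) Z := by
  have h := hat_μ_ε P a Z =≫ hat₁₁ (P.map (ρ_ a).inv) Z
  simp only [Category.assoc, ← hat₁₁_comp, Category.id_comp] at h
  rw [← h, ← P.map_comp, Iso.hom_inv_id, CategoryTheory.Functor.map_id, hat₁₁_id,
    Category.comp_id]

lemma hat_δ_η : hat₁₁ (P.map (λ_ a).inv) Z ≫ hat₁₂ (δ P (𝟙_ A) a) Z ≫
    hat₁₀ (η P) (P.obj a ⊗ Z) = 𝟙 _ := by
  have h : hat₁₁ (P.map (λ_ a).inv) Z ≫ hat₁₂ (δ P (𝟙_ A) a) Z ≫ hat₁₀ (η P) (P.obj a ⊗ Z) =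
      (P.map (λ_ a).inv ≫ δ P (𝟙_ A) a ≫ η P ▷ P.obj a) ▷ Z ≫ (α_ _ _ _).hom ≫ (λ_ _).hom := by
    simp only [hat₁₀, hat₁₂, hat₁₁, comp_whiskerRight]
    monoidal
  rw [h, ← Functor.OplaxMonoidal.left_unitality]
  monoidal

lemma hat_η_δ : hat₁₁ (P.map (ρ_ a).inv) Z ≫ hat₁₂ (δ P a (𝟙_ A)) Z ≫
    P.obj a ◃ hat₁₀ (η P) Z = 𝟙 _ := by
  have h : hat₁₁ (P.map (ρ_ a).inv) Z ≫ hat₁₂ (δ P a (𝟙_ A)) Z ≫ P.obj a ◃ hat₁₀ (η P) Z =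
      (P.map (ρ_ a).inv ≫ δ P a (𝟙_ A) ≫ P.obj a ◁ η P) ▷ Z ≫ (ρ_ _).hom ▷ Z := by
    simp only [hat₁₀, hat₁₂, hat₁₁, lw, MonoidalCategory.whiskerLeft_comp, comp_whiskerRight]
    monoidal
  rw [h, ← Functor.OplaxMonoidal.right_unitality, ← comp_whiskerRight, Iso.inv_hom_id,
    id_whiskerRight]

lemma hat_δ_η' : hat₁₂ (δ P (𝟙_ A) a) Z ≫ hat₁₀ (η P) (P.obj a ⊗ Z) =
    hat₁₁ (P.map (λ_ a).hom) Z := by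
  have h := hat₁₁ (P.map (λ_ a).hom) Z ≫= hat_δ_η P a Z
  rw [← reassoc_of% hat₁₁_comp, ← P.map_comp, Iso.hom_inv_id, CategoryTheory.Functor.map_id,
    hat₁₁_id, Category.comp_id, Category.id_comp] at h
  exact h

lemma hat_η_δ' : hat₁₂ (δ P a (𝟙_ A)) Z ≫ P.obj a ◃ hat₁₀ (η P) Z =
    hat₁₁ (P.map (ρ_ a).hom) Z := by
  have h := hat₁₁ (P.map (ρ_ a).hom) Z ≫= hat_η_δ P a Z
  rw [← reassoc_of% hat₁₁_comp, ← P.map_comp, Iso.hom_inv_id, CategoryTheory.Functor.map_id,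
    hat₁₁_id, Category.comp_id, Category.id_comp] at h
  exact h

lemma hat_frobenius_left : hat₁₂ (δ P a b) (P.obj c ⊗ Z) ≫ P.obj a ◃ hat₂₁ (μ P b c) Z =
    hat₂₁ (μ P (a ⊗ b) c) Z ≫ hat₁₁ (P.map (α_ a b c).hom) Z ≫ hat₁₂ (δ P a (b ⊗ c)) Z := by
  have h : hat₂₁ (μ P (a ⊗ b) c) Z ≫ hat₁₁ (P.map (α_ a b c).hom) Z ≫ hat₁₂ (δ P a (b ⊗ c)) Z =
      (α_ _ _ _).inv ≫ (μ P (a ⊗ b) c ≫ P.map (α_ a b c).hom ≫ δ P a (b ⊗ c)) ▷ Z ≫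
        (α_ _ _ _).hom := by
    simp only [hat₁₂, hat₂₁, hat₁₁, comp_whiskerRight, Category.assoc]
  rw [h, ← SepFrobenius.frobenius_left]
  simp only [hat₁₂, hat₂₁, lw, MonoidalCategory.whiskerLeft_comp, comp_whiskerRight]
  monoidal

lemma hat_frobenius_right : P.obj a ◃ hat₁₂ (δ P b c) Z ≫ hat₂₁ (μ P a b) (P.obj c ⊗ Z) =
    hat₂₁ (μ P a (b ⊗ c)) Z ≫ hat₁₁ (P.map (α_ a b c).inv) Z ≫ hat₁₂ (δ P (a ⊗ b) c) Z := by
  have h : hat₂₁ (μ P a (b ⊗ c)) Z ≫ hat₁₁ (P.map (α_ a b c).inv) Z ≫ hat₁₂ (δ P (a ⊗ b) c) Z =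
      (α_ _ _ _).inv ≫ (μ P a (b ⊗ c) ≫ P.map (α_ a b c).inv ≫ δ P (a ⊗ b) c) ▷ Z ≫
        (α_ _ _ _).hom := by
    simp only [hat₁₂, hat₂₁, hat₁₁, comp_whiskerRight, Category.assoc]
  rw [h, ← SepFrobenius.frobenius_right]
  simp only [hat₁₂, hat₂₁, lw, MonoidalCategory.whiskerLeft_comp, comp_whiskerRight]
  monoidal

lemma hat_separable : hat₁₂ (δ P a b) Z ≫ hat₂₁ (μ P a b) Z = 𝟙 _ := by
  rw [← hat₁₁_mid, SepFrobenius.separable, hat₁₁_id]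

lemma hat_map_inv_hom {a b : A} (f : a ≅ b) (Z : V) :
    hat₁₁ (P.map f.inv) Z ≫ hat₁₁ (P.map f.hom) Z = 𝟙 _ := by
  rw [← hat₁₁_comp, ← P.map_comp, Iso.inv_hom_id, CategoryTheory.Functor.map_id, hat₁₁_id]

end

end FrobeniusCalculus

end Tannaka

namespace Tannaka

open Functor.LaxMonoidal Functor.OplaxMonoidal

namespace IsActEnd

variable {V : Type u} [Category.{v} V] [MonoidalCategory V] [BraidedCategory V]
  {A : Type u₁} [Category.{v₁} A] [MonoidalCategory A] {P : A ⥤ V} [SepFrobenius P]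
  {T : V} {x : ∀ a, T ⊗ P.obj a ⟶ P.obj a} (E : IsActEnd P T x)

lemma exists_mul (E : IsActEnd P T x) : ∃ m : T ⊗ T ⟶ T,
    ∀ a, m ▷ P.obj a ≫ x a = (α_ _ _ _).hom ≫ T ◁ x a ≫ x a :=
  E.exists_lift₁ _ fun f => by
    rw [Category.assoc, Category.assoc, E.natural, ← MonoidalCategory.whiskerLeft_comp_assoc,
      E.natural]
    simp

lemma exists_one (E : IsActEnd P T x) : ∃ e : 𝟙_ V ⟶ T,
    ∀ a, e ▷ P.obj a ≫ x a = (λ_ _).hom :=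
  E.exists_lift₁ _ fun _ => (leftUnitor_naturality _).symm

lemma exists_comul (E : IsActEnd P T x) : ∃ d : T ⟶ T ⊗ T,
    ∀ a b, d ▷ (P.obj a ⊗ P.obj b) ≫ act₂ (x a) (x b) =
      T ◁ μ P a b ≫ x (a ⊗ b) ≫ δ P a b :=
  E.exists_lift₂ _
    (fun f b => by
      simp only [Category.assoc]
      rw [δ_natural_left, reassoc_of% E.natural, ← MonoidalCategory.whiskerLeft_comp_assoc,
        ← μ_natural_left, MonoidalCategory.whiskerLeft_comp_assoc])
    (fun a _ _ f => by
      simp only [Category.assoc]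
      rw [δ_natural_right, reassoc_of% E.natural, ← MonoidalCategory.whiskerLeft_comp_assoc,
        ← μ_natural_right, MonoidalCategory.whiskerLeft_comp_assoc])

/-- The multiplication of the Tannaka object. -/
def mul : T ⊗ T ⟶ T := E.exists_mul.choose

/-- The unit of the Tannaka object. -/
def one : 𝟙_ V ⟶ T := E.exists_one.choose

/-- The comultiplication of the Tannaka object. -/
def comul : T ⟶ T ⊗ T := E.exists_comul.choose

variable (P x) in
/-- The counit of the Tannaka object. -/
def counit : T ⟶ 𝟙_ V := (ρ_ T).inv ≫ T ◁ ε P ≫ x (𝟙_ A) ≫ η P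

lemma mul_act (a : A) : E.mul ▷ P.obj a ≫ x a = (α_ _ _ _).hom ≫ T ◁ x a ≫ x a :=
  E.exists_mul.choose_spec a

lemma one_act (a : A) : E.one ▷ P.obj a ≫ x a = (λ_ _).hom := E.exists_one.choose_spec a

lemma comul_act (a b : A) : E.comul ▷ (P.obj a ⊗ P.obj b) ≫ act₂ (x a) (x b) =
    T ◁ μ P a b ≫ x (a ⊗ b) ≫ δ P a b := E.exists_comul.choose_spec a b

lemma hat_mul_act (a : A) (Z : V) : hat₂₁ E.mul (P.obj a ⊗ Z) ≫ hat₂₁ (x a) Z =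
    T ◃ hat₂₁ (x a) Z ≫ hat₂₁ (x a) Z := by
  have h : hat₂₁ E.mul (P.obj a ⊗ Z) ≫ hat₂₁ (x a) Z =
      (α_ _ _ _).inv ≫ (α_ _ _ _).inv ≫ (E.mul ▷ P.obj a ≫ x a) ▷ Z := by
    simp only [hat₂₁, comp_whiskerRight]
    monoidal
  rw [h, E.mul_act]
  simp only [hat₂₁, lw, comp_whiskerRight, MonoidalCategory.whiskerLeft_comp]
  monoidal

lemma hat_one_act (a : A) (Z : V) : hat₀₁ E.one (P.obj a ⊗ Z) ≫ hat₂₁ (x a) Z = 𝟙 _ := by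
  have h : hat₀₁ E.one (P.obj a ⊗ Z) ≫ hat₂₁ (x a) Z =
      (λ_ _).inv ≫ (α_ _ _ _).inv ≫ (E.one ▷ P.obj a ≫ x a) ▷ Z := by
    simp only [hat₂₁, hat₀₁, comp_whiskerRight]
    monoidal
  rw [h, E.one_act]
  monoidal

lemma hat_comul_act (a b : A) (Z : V) : hat₁₂ E.comul (P.obj a ⊗ P.obj b ⊗ Z) ≫
    T ◃ (swap T (P.obj a) _ ≫ P.obj a ◃ hat₂₁ (x b) Z) ≫ hat₂₁ (x a) _ =
      T ◃ hat₂₁ (μ P a b) Z ≫ hat₂₁ (x (a ⊗ b)) Z ≫ hat₁₂ (δ P a b) Z := by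
  rw [← hat_act₂, E.comul_act]
  simp only [hat₂₁, hat₁₂, hat₃₂, lw, comp_whiskerRight, MonoidalCategory.whiskerLeft_comp]
  monoidal

variable (P x) in
lemma hat_counit_eq (Z : V) : hat₁₀ (counit P x) Z =
    T ◃ hat₀₁ (ε P) Z ≫ hat₂₁ (x (𝟙_ A)) Z ≫ hat₁₀ (η P) Z := by
  simp only [counit, hat₂₁, hat₀₁, hat₁₀, lw, comp_whiskerRight, MonoidalCategory.whiskerLeft_comp]
  monoidal

/-- The algebra structure of the Tannaka object. -/
abbrev monObj : MonObj T where
  one := E.one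
  mul := E.mul
  one_mul := E.ext₁ fun a => by
    rw [comp_whiskerRight, Category.assoc, E.mul_act, associator_naturality_left_assoc,
      ← whisker_exchange_assoc, E.one_act]
    simp only [leftUnitor_naturality]
    monoidal
  mul_one := E.ext₁ fun a => by
    rw [comp_whiskerRight, Category.assoc, E.mul_act, associator_naturality_middle_assoc,
      ← MonoidalCategory.whiskerLeft_comp_assoc, E.one_act]
    monoidal
  mul_assoc := E.ext₁ fun a => by
    simp only [comp_whiskerRight, Category.assoc]
    rw [E.mul_act, associator_naturality_left_assoc, ← whisker_exchange_assoc, E.mul_act,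
      associator_naturality_middle_assoc, ← MonoidalCategory.whiskerLeft_comp_assoc, E.mul_act]
    simp

/-- The Tannaka object detects the comultiplication applied twice. -/
lemma comul_comul_act (a b c : A) (Z : V) :
    hatR₁₃ (E.comul ≫ T ◁ E.comul) (P.obj a ⊗ P.obj b ⊗ P.obj c ⊗ Z) ≫
        hatAct₃ (x a) (x b) (x c) Z =
      T ◃ (P.obj a ◃ hat₂₁ (μ P b c) Z ≫ hat₂₁ (μ P a (b ⊗ c)) Z) ≫ hat₂₁ (x (a ⊗ b ⊗ c)) Z ≫
        hat₁₂ (δ P a (b ⊗ c)) Z ≫ P.obj a ◃ hat₁₂ (δ P b c) Z := by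
  have e (Z : V) : hatR₁₃ (E.comul ≫ T ◁ E.comul) Z = hat₁₂ E.comul Z ≫ T ◃ hat₁₂ E.comul Z := by
    simp only [hatR₁₃, hat₁₂, lw, comp_whiskerRight, MonoidalCategory.whiskerLeft_comp]
    monoidal
  have h₁ := hat₁₂_swap (P.obj a) (P.obj b ⊗ P.obj c ⊗ Z) E.comul
  have h₂ := E.hat_comul_act b c Z
  have h₃ := E.hat_comul_act a (b ⊗ c) Z
  rw [e, hatAct₃]
  calc _ = hat₁₂ E.comul _ ≫ T ◃ ((hat₁₂ E.comul _ ≫ T ◃ swap T (P.obj a) _ ≫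
          swap T (P.obj a) _) ≫ P.obj a ◃ (T ◃ (swap T (P.obj b) _ ≫ P.obj b ◃ hat₂₁ (x c) Z) ≫
            hat₂₁ (x b) _)) ≫ hat₂₁ (x a) _ := by simp
    _ = hat₁₂ E.comul _ ≫ T ◃ (swap T (P.obj a) _ ≫ P.obj a ◃ (hat₁₂ E.comul _ ≫
          T ◃ (swap T (P.obj b) _ ≫ P.obj b ◃ hat₂₁ (x c) Z) ≫ hat₂₁ (x b) _)) ≫
            hat₂₁ (x a) _ := by rw [h₁]; simp
    _ = T ◃ P.obj a ◃ hat₂₁ (μ P b c) Z ≫ (hat₁₂ E.comul _ ≫ T ◃ (swap T (P.obj a) _ ≫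
          P.obj a ◃ hat₂₁ (x (b ⊗ c)) _) ≫ hat₂₁ (x a) _) ≫ P.obj a ◃ hat₁₂ (δ P b c) Z := by
        rw [h₂]; simp
    _ = _ := by rw [h₃]; simp

lemma comul_comul_act' (a b c : A) (Z : V) :
    hatR₁₃ (E.comul ≫ E.comul ▷ T ≫ (α_ T T T).hom) (P.obj a ⊗ P.obj b ⊗ P.obj c ⊗ Z) ≫
        hatAct₃ (x a) (x b) (x c) Z =
      T ◃ (hat₂₁ (μ P a b) _ ≫ hat₂₁ (μ P (a ⊗ b) c) Z) ≫ hat₂₁ (x ((a ⊗ b) ⊗ c)) Z ≫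
        hat₁₂ (δ P (a ⊗ b) c) Z ≫ hat₁₂ (δ P a b) _ := by
  have e (Z : V) : hatR₁₃ (E.comul ≫ E.comul ▷ T ≫ (α_ T T T).hom) Z =
      hat₁₂ E.comul Z ≫ hat₁₂ E.comul _ := by
    simp only [hatR₁₃, hat₁₂, lw, comp_whiskerRight, MonoidalCategory.whiskerLeft_comp]
    monoidal
  have h₁ := lw_hat₂₁_swap T (P.obj c ⊗ Z) (μ P a b)
  have h₂ := E.hat_comul_act a b (P.obj c ⊗ Z)
  have h₃ := E.hat_comul_act (a ⊗ b) c Z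
  rw [e, hatAct₃]
  calc _ = hat₁₂ E.comul _ ≫ T ◃ (swap T (P.obj a) _ ≫ P.obj a ◃ (swap T (P.obj b) _ ≫
          P.obj b ◃ hat₂₁ (x c) Z)) ≫ hat₁₂ E.comul _ ≫
            T ◃ (swap T (P.obj a) _ ≫ P.obj a ◃ hat₂₁ (x b) _) ≫ hat₂₁ (x a) _ := by simp
    _ = hat₁₂ E.comul _ ≫ T ◃ ((swap T (P.obj a) _ ≫ P.obj a ◃ swap T (P.obj b) _ ≫
          hat₂₁ (μ P a b) _) ≫ P.obj (a ⊗ b) ◃ hat₂₁ (x c) Z) ≫ hat₂₁ (x (a ⊗ b)) _ ≫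
            hat₁₂ (δ P a b) _ := by rw [h₂]; simp
    _ = T ◃ hat₂₁ (μ P a b) _ ≫ (hat₁₂ E.comul _ ≫ T ◃ (swap T (P.obj (a ⊗ b)) _ ≫
          P.obj (a ⊗ b) ◃ hat₂₁ (x c) Z) ≫ hat₂₁ (x (a ⊗ b)) _) ≫ hat₁₂ (δ P a b) _ := by
        rw [← h₁]; simp
    _ = _ := by rw [h₃]; simp

lemma act_assoc (E : IsActEnd P T x) (a b c : A) (Z : V) :
    T ◃ (hat₂₁ (μ P a b) _ ≫ hat₂₁ (μ P (a ⊗ b) c) Z) ≫ hat₂₁ (x ((a ⊗ b) ⊗ c)) Z ≫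
        hat₁₂ (δ P (a ⊗ b) c) Z ≫ hat₁₂ (δ P a b) _ =
      T ◃ (P.obj a ◃ hat₂₁ (μ P b c) Z ≫ hat₂₁ (μ P a (b ⊗ c)) Z) ≫ hat₂₁ (x (a ⊗ b ⊗ c)) Z ≫
        hat₁₂ (δ P a (b ⊗ c)) Z ≫ P.obj a ◃ hat₁₂ (δ P b c) Z := by
  rw [hat_δ_assoc, ← hat_μ_assoc, reassoc_of% E.hat_natural (α_ a b c).hom]
  simp

/-- The coalgebra structure of the Tannaka object. -/
abbrev comonObj : ComonObj T where
  counit := counit P x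
  comul := E.comul
  counit_comul := by
    rw [← cancel_mono (λ_ T).hom, Iso.inv_hom_id]
    refine E.hat_ext₁ fun a Z => ?_
    have e : hat₁₁ ((E.comul ≫ counit P x ▷ T) ≫ (λ_ T).hom) (P.obj a ⊗ Z) =
        hat₁₂ E.comul _ ≫ hat₁₀ (counit P x) _ := by
      simp only [hat₁₁, hat₁₂, hat₁₀, comp_whiskerRight]
      monoidal
    have h₁ := lw_hat₀₁_swap T (P.obj a ⊗ Z) (ε P)
    have h₂ := E.hat_comul_act (𝟙_ A) a Z
    have h₃ := E.hat_natural (λ_ a).hom Z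
    rw [e, hat_counit_eq]
    calc _ = hat₁₂ E.comul _ ≫ T ◃ (hat₀₁ (ε P) _ ≫ P.obj (𝟙_ A) ◃ hat₂₁ (x a) Z) ≫
          hat₂₁ (x (𝟙_ A)) _ ≫ hat₁₀ (η P) _ := by simp
      _ = T ◃ hat₀₁ (ε P) _ ≫ (hat₁₂ E.comul _ ≫ T ◃ (swap T (P.obj (𝟙_ A)) _ ≫
          P.obj (𝟙_ A) ◃ hat₂₁ (x a) Z) ≫ hat₂₁ (x (𝟙_ A)) _) ≫ hat₁₀ (η P) _ := by
          rw [← h₁]; simp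
      _ = T ◃ (hat₀₁ (ε P) _ ≫ hat₂₁ (μ P (𝟙_ A) a) Z ≫ hat₁₁ (P.map (λ_ a).hom) Z) ≫
          hat₂₁ (x a) Z := by
          rw [h₂, Category.assoc, Category.assoc, hat_δ_η', h₃]; simp
      _ = _ := by rw [hat_ε_μ]; simp
  comul_counit := by
    rw [← cancel_mono (ρ_ T).hom, Iso.inv_hom_id]
    refine E.hat_ext₁ fun a Z => ?_
    have e : hat₁₁ ((E.comul ≫ T ◁ counit P x) ≫ (ρ_ T).hom) (P.obj a ⊗ Z) =
        hat₁₂ E.comul _ ≫ T ◃ hat₁₀ (counit P x) _ := by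
      simp only [hat₁₁, hat₁₂, hat₁₀, lw, comp_whiskerRight, MonoidalCategory.whiskerLeft_comp]
      monoidal
    have h₁ := swap_lw_hat₁₀ (P.obj a) Z (counit P x)
    have h₂ := E.hat_comul_act a (𝟙_ A) Z
    have h₃ := E.hat_natural (ρ_ a).hom Z
    rw [e, ← h₁, hat_counit_eq]
    calc _ = T ◃ P.obj a ◃ hat₀₁ (ε P) _ ≫ (hat₁₂ E.comul _ ≫ T ◃ (swap T (P.obj a) _ ≫
          P.obj a ◃ hat₂₁ (x (𝟙_ A)) Z) ≫ hat₂₁ (x a) _) ≫ P.obj a ◃ hat₁₀ (η P) _ := by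
          simp
      _ = T ◃ (P.obj a ◃ hat₀₁ (ε P) _ ≫ hat₂₁ (μ P a (𝟙_ A)) Z ≫ hat₁₁ (P.map (ρ_ a).hom) Z) ≫
          hat₂₁ (x a) Z := by
          rw [h₂, Category.assoc, Category.assoc, hat_η_δ', h₃]; simp
      _ = _ := by rw [hat_μ_ε]; simp
  comul_assoc := E.hat_ext₃ fun a b c Z => by
    rw [comul_comul_act, comul_comul_act', E.act_assoc]

lemma one_comul_act (a b : A) (Z : V) : hat₀₂ (E.one ≫ E.comul) (P.obj a ⊗ P.obj b ⊗ Z) ≫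
    T ◃ (swap T (P.obj a) _ ≫ P.obj a ◃ hat₂₁ (x b) Z) ≫ hat₂₁ (x a) _ =
      hat₂₁ (μ P a b) Z ≫ hat₁₂ (δ P a b) Z := by
  have h := E.hat_one_act (a ⊗ b) Z
  rw [hat₀₂_comp, Category.assoc, E.hat_comul_act, hat₀₁_nat_assoc, reassoc_of% h]

lemma hat_ext₀₃ (E : IsActEnd P T x) {f g : 𝟙_ V ⟶ T ⊗ (T ⊗ T)}
    (h : ∀ a b c Z, hat₀₃ f (P.obj a ⊗ P.obj b ⊗ P.obj c ⊗ Z) ≫ hatAct₃ (x a) (x b) (x c) Z =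
      hat₀₃ g (P.obj a ⊗ P.obj b ⊗ P.obj c ⊗ Z) ≫ hatAct₃ (x a) (x b) (x c) Z) : f = g := by
  have e (f : 𝟙_ V ⟶ T ⊗ (T ⊗ T)) (Z : V) : hatR₁₃ f Z = (λ_ Z).hom ≫ hat₀₃ f Z := by
    simp [hatR₁₃, hat₀₃]
  refine E.hat_ext₃ fun a b c Z => ?_
  rw [e, e, Category.assoc, Category.assoc, h]

lemma one_comul_comul_act (a b c : A) (Z : V) :
    hat₀₃ (E.one ≫ E.comul ≫ T ◁ E.comul) (P.obj a ⊗ P.obj b ⊗ P.obj c ⊗ Z) ≫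
        hatAct₃ (x a) (x b) (x c) Z =
      P.obj a ◃ hat₂₁ (μ P b c) Z ≫ hat₂₁ (μ P a (b ⊗ c)) Z ≫
        hat₁₂ (δ P a (b ⊗ c)) Z ≫ P.obj a ◃ hat₁₂ (δ P b c) Z := by
  have e (Z : V) : hat₀₃ (E.one ≫ E.comul ≫ T ◁ E.comul) Z =
      hat₀₁ E.one Z ≫ hatR₁₃ (E.comul ≫ T ◁ E.comul) Z := by
    simp [hatR₁₃, hat₀₃, hat₀₁]
  have h := E.hat_one_act (a ⊗ b ⊗ c) Z
  rw [e, Category.assoc, comul_comul_act, hat₀₁_nat_assoc, reassoc_of% h, Category.assoc]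

lemma mulMiddle_act (a b c : A) (Z : V) :
    (hat₀₂ (E.one ≫ E.comul) _ ≫ hat₀₂ (E.one ≫ E.comul) _ ≫ T ◃ hat₂₁ E.mul _) ≫
        hatAct₃ (x a) (x b) (x c) Z =
      P.obj a ◃ (hat₂₁ (μ P b c) Z ≫ hat₁₂ (δ P b c) Z) ≫
        hat₂₁ (μ P a b) _ ≫ hat₁₂ (δ P a b) _ := by
  have h₁ := hat₂₁_swap (P.obj a) (P.obj b ⊗ P.obj c ⊗ Z) E.mul
  have h₂ := E.hat_mul_act b (P.obj c ⊗ Z)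
  have h₃ := hat₀₂_swap (P.obj a) (P.obj b ⊗ P.obj c ⊗ Z) (E.one ≫ E.comul)
  have h₄ := E.one_comul_act b c Z
  have h₅ := E.one_comul_act a b (P.obj c ⊗ Z)
  rw [hatAct₃]
  calc _ = hat₀₂ (E.one ≫ E.comul) _ ≫ hat₀₂ (E.one ≫ E.comul) _ ≫ T ◃ (T ◃ T ◃ (swap T (P.obj a) _ ≫
          P.obj a ◃ (swap T (P.obj b) _ ≫ P.obj b ◃ hat₂₁ (x c) Z)) ≫
            (hat₂₁ E.mul _ ≫ swap T (P.obj a) _) ≫ P.obj a ◃ hat₂₁ (x b) _) ≫ hat₂₁ (x a) _ := by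
        simp
    _ = (hat₀₂ (E.one ≫ E.comul) _ ≫ T ◃ swap T (P.obj a) _ ≫ swap T (P.obj a) _) ≫
          P.obj a ◃ (T ◃ (swap T (P.obj b) _ ≫ P.obj b ◃ hat₂₁ (x c) Z) ≫ hat₂₁ (x b) _) ≫
            hat₀₂ (E.one ≫ E.comul) _ ≫
              T ◃ (swap T (P.obj a) _ ≫ P.obj a ◃ hat₂₁ (x b) _) ≫ hat₂₁ (x a) _ := by
        rw [h₁]; simp [h₂]
    _ = P.obj a ◃ (hat₀₂ (E.one ≫ E.comul) _ ≫
          T ◃ (swap T (P.obj b) _ ≫ P.obj b ◃ hat₂₁ (x c) Z) ≫ hat₂₁ (x b) _) ≫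
            hat₀₂ (E.one ≫ E.comul) _ ≫
              T ◃ (swap T (P.obj a) _ ≫ P.obj a ◃ hat₂₁ (x b) _) ≫ hat₂₁ (x a) _ := by
        rw [h₃]; simp
    _ = _ := by rw [h₄, h₅]

lemma swapInv_lw_hat₂₁ {T b : V} (y : T ⊗ b ⟶ b) (Z : V) :
    swapInv T T (b ⊗ Z) ≫ T ◃ hat₂₁ y Z = T ◃ swap T b Z ≫ hat₂₁ y (T ⊗ Z) ≫ swapInv T b Z := by
  have h := swapInv T T (b ⊗ Z) ≫= lw_hat₂₁_swap T Z y =≫ swapInv T b Z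
  simpa using h

lemma swapInv_swap_swap (T a Z : V) :
    swapInv T T (a ⊗ Z) ≫ T ◃ swap T a Z ≫ swap T a (T ⊗ Z) =
      T ◃ swap T a Z ≫ swap T a (T ⊗ Z) ≫ a ◃ swapInv T T Z := by
  have h := swapInv T T (a ⊗ Z) ≫= swap_yang_baxter T T a Z =≫ a ◃ swapInv T T Z
  simp only [Category.assoc, swapInv_swap_assoc, lw_comp, swap_swapInv, lw_id,
    Category.comp_id] at h
  exact h.symm

lemma mulMiddle_inv_act (a b c : A) (Z : V) :
    (hat₀₂ (E.one ≫ E.comul) _ ≫ hat₀₂ (E.one ≫ E.comul) _ ≫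
        T ◃ (swapInv T T _ ≫ hat₂₁ E.mul _)) ≫ hatAct₃ (x a) (x b) (x c) Z =
      (hat₂₁ (μ P a b) _ ≫ hat₁₂ (δ P a b) _) ≫
        P.obj a ◃ (hat₂₁ (μ P b c) Z ≫ hat₁₂ (δ P b c) Z) := by
  have h₁ := hat₂₁_swap (P.obj a) (P.obj b ⊗ P.obj c ⊗ Z) E.mul
  have h₂ := E.hat_mul_act b (P.obj c ⊗ Z)
  have h₃ := hat₀₂_swap (P.obj a) (P.obj b ⊗ P.obj c ⊗ Z) (E.one ≫ E.comul)
  have h₄ := E.one_comul_act b c Z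
  have h₅ := E.one_comul_act a b (P.obj c ⊗ Z)
  have h₆ := hat₀₂_swap (P.obj b) (P.obj c ⊗ Z) (E.one ≫ E.comul)
  have h₇ := swapInv_lw_hat₂₁ (x b) (P.obj c ⊗ Z)
  have h₈ := swapInv_swap_swap T (P.obj a) (P.obj b ⊗ P.obj c ⊗ Z)
  have h₉ : P.obj b ◃ (hat₀₂ (E.one ≫ E.comul) _ ≫ T ◃ hat₂₁ (x c) Z) ≫
      swapInv T (P.obj b) _ ≫ hat₂₁ (x b) _ = hat₂₁ (μ P b c) Z ≫ hat₁₂ (δ P b c) Z := by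
    rw [← h₄, ← lw_comp, ← h₆]
    simp
  rw [hatAct₃, ← h₅]
  calc _ = hat₀₂ (E.one ≫ E.comul) _ ≫ hat₀₂ (E.one ≫ E.comul) _ ≫ T ◃ (swapInv T T _ ≫
          T ◃ T ◃ (swap T (P.obj a) _ ≫
          P.obj a ◃ (swap T (P.obj b) _ ≫ P.obj b ◃ hat₂₁ (x c) Z)) ≫
            (hat₂₁ E.mul _ ≫ swap T (P.obj a) _) ≫ P.obj a ◃ hat₂₁ (x b) _) ≫ hat₂₁ (x a) _ := by
        simp
    _ = hat₀₂ (E.one ≫ E.comul) _ ≫ hat₀₂ (E.one ≫ E.comul) _ ≫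
          T ◃ (T ◃ T ◃ (swap T (P.obj a) _ ≫
          P.obj a ◃ (swap T (P.obj b) _ ≫ P.obj b ◃ hat₂₁ (x c) Z)) ≫
            (swapInv T T _ ≫ T ◃ swap T (P.obj a) _ ≫ swap T (P.obj a) _) ≫
              P.obj a ◃ (T ◃ hat₂₁ (x b) _ ≫ hat₂₁ (x b) _)) ≫ hat₂₁ (x a) _ := by
        rw [h₁]; simp [h₂]
    _ = (hat₀₂ (E.one ≫ E.comul) _ ≫ T ◃ swap T (P.obj a) _ ≫ swap T (P.obj a) _) ≫
          P.obj a ◃ T ◃ (swap T (P.obj b) _ ≫ P.obj b ◃ hat₂₁ (x c) Z) ≫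
            hat₀₂ (E.one ≫ E.comul) _ ≫ T ◃ (swap T (P.obj a) _ ≫ P.obj a ◃
              ((swapInv T T _ ≫ T ◃ hat₂₁ (x b) _) ≫ hat₂₁ (x b) _)) ≫ hat₂₁ (x a) _ := by
        rw [h₈]; simp
    _ = hat₀₂ (E.one ≫ E.comul) _ ≫ T ◃ (swap T (P.obj a) _ ≫ P.obj a ◃
          (T ◃ ((hat₀₂ (E.one ≫ E.comul) _ ≫ T ◃ swap T (P.obj b) _ ≫ swap T (P.obj b) _) ≫
            P.obj b ◃ T ◃ hat₂₁ (x c) Z) ≫ hat₂₁ (x b) _ ≫ swapInv T (P.obj b) _ ≫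
              hat₂₁ (x b) _)) ≫ hat₂₁ (x a) _ := by
        rw [h₃, h₇]; simp
    _ = (hat₀₂ (E.one ≫ E.comul) _ ≫ T ◃ (swap T (P.obj a) _ ≫ P.obj a ◃ hat₂₁ (x b) _) ≫
          hat₂₁ (x a) _) ≫ P.obj a ◃ (P.obj b ◃ (hat₀₂ (E.one ≫ E.comul) _ ≫
            T ◃ hat₂₁ (x c) Z) ≫ swapInv T (P.obj b) _ ≫ hat₂₁ (x b) _) := by
        rw [h₆]; simp
    _ = _ := by rw [h₉]

lemma act_isAssocAct (a : A) : @IsAssocAct _ _ _ _ E.monObj _ (x a) := E.mul_act a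

lemma unitAct_act (a : A) : @unitAct _ _ _ _ E.monObj _ (x a) = 𝟙 _ := by
  have h := E.one_act a
  change (λ_ _).inv ≫ E.one ▷ P.obj a ≫ x a = 𝟙 _
  rw [h, Iso.inv_hom_id]

lemma weak_counit_aux (Z : V) : hat₁₂ E.comul (P.obj (𝟙_ A) ⊗ Z) ≫
    T ◃ (hat₂₁ (x (𝟙_ A)) Z ≫ hat₁₀ (η P) Z ≫ hat₀₁ (ε P) Z) ≫ hat₂₁ (x (𝟙_ A)) Z =
      hat₂₁ (x (𝟙_ A)) Z := by
  have h₁ := lw_hat₀₁_swap T (P.obj (𝟙_ A) ⊗ Z) (ε P)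
  have h₂ := E.hat_comul_act (𝟙_ A) (𝟙_ A) Z
  have h₃ := E.hat_natural (ρ_ (𝟙_ A)).hom Z
  have e : (ρ_ (𝟙_ A)).hom = (λ_ (𝟙_ A)).hom := unitors_equal.symm
  calc _ = hat₁₂ E.comul _ ≫ T ◃ (hat₀₁ (ε P) _ ≫ P.obj (𝟙_ A) ◃ (hat₂₁ (x (𝟙_ A)) Z ≫
          hat₁₀ (η P) Z)) ≫ hat₂₁ (x (𝟙_ A)) Z := by simp
    _ = T ◃ hat₀₁ (ε P) _ ≫ (hat₁₂ E.comul _ ≫ T ◃ (swap T (P.obj (𝟙_ A)) _ ≫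
          P.obj (𝟙_ A) ◃ hat₂₁ (x (𝟙_ A)) Z) ≫ hat₂₁ (x (𝟙_ A)) _) ≫
            P.obj (𝟙_ A) ◃ hat₁₀ (η P) Z := by
        rw [← h₁]; simp
    _ = T ◃ (hat₀₁ (ε P) _ ≫ hat₂₁ (μ P (𝟙_ A) (𝟙_ A)) Z ≫ hat₁₁ (P.map (λ_ (𝟙_ A)).hom) Z) ≫
          hat₂₁ (x (𝟙_ A)) Z := by
        rw [h₂, Category.assoc, Category.assoc, hat_η_δ', h₃, e]; simp
    _ = _ := by rw [hat_ε_μ]; simp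

lemma weak_counit_inv_aux (Z : V) : hat₁₂ E.comul (P.obj (𝟙_ A) ⊗ Z) ≫ swapInv T T _ ≫
    T ◃ (hat₂₁ (x (𝟙_ A)) Z ≫ hat₁₀ (η P) Z ≫ hat₀₁ (ε P) Z) ≫ hat₂₁ (x (𝟙_ A)) Z =
      hat₂₁ (x (𝟙_ A)) Z := by
  have h₁ := swapInv_lw_hat₂₁ (x (𝟙_ A)) Z
  have h₂ := E.hat_comul_act (𝟙_ A) (𝟙_ A) Z
  have h₃ := E.hat_natural (λ_ (𝟙_ A)).hom Z
  have h₄ : swapInv T (P.obj (𝟙_ A)) Z ≫ T ◃ hat₁₀ (η P) Z = hat₁₀ (η P) _ := by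
    rw [← swap_hat₁₀, swapInv_swap_assoc]
  have e : (λ_ (𝟙_ A)).hom = (ρ_ (𝟙_ A)).hom := unitors_equal
  calc _ = hat₁₂ E.comul _ ≫ (swapInv T T _ ≫ T ◃ hat₂₁ (x (𝟙_ A)) Z) ≫
          T ◃ (hat₁₀ (η P) Z ≫ hat₀₁ (ε P) Z) ≫ hat₂₁ (x (𝟙_ A)) Z := by simp
    _ = hat₁₂ E.comul _ ≫ T ◃ swap T (P.obj (𝟙_ A)) _ ≫ hat₂₁ (x (𝟙_ A)) _ ≫
          (swapInv T (P.obj (𝟙_ A)) Z ≫ T ◃ hat₁₀ (η P) Z) ≫ T ◃ hat₀₁ (ε P) Z ≫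
            hat₂₁ (x (𝟙_ A)) Z := by rw [h₁, ← lw_comp]; simp only [Category.assoc]
    _ = T ◃ P.obj (𝟙_ A) ◃ hat₀₁ (ε P) _ ≫ (hat₁₂ E.comul _ ≫ T ◃ (swap T (P.obj (𝟙_ A)) _ ≫
          P.obj (𝟙_ A) ◃ hat₂₁ (x (𝟙_ A)) Z) ≫ hat₂₁ (x (𝟙_ A)) _) ≫ hat₁₀ (η P) _ := by
        rw [h₄]; simp
    _ = T ◃ (P.obj (𝟙_ A) ◃ hat₀₁ (ε P) _ ≫ hat₂₁ (μ P (𝟙_ A) (𝟙_ A)) Z ≫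
          hat₁₁ (P.map (ρ_ (𝟙_ A)).hom) Z) ≫ hat₂₁ (x (𝟙_ A)) Z := by
        rw [h₂, Category.assoc, Category.assoc, hat_δ_η', h₃, e]; simp
    _ = _ := by rw [hat_μ_ε]; simp

lemma hat_mul_counit_eq (Z : V) : hat₂₁ E.mul Z ≫ hat₁₀ (counit P x) Z =
    T ◃ (T ◃ hat₀₁ (ε P) Z ≫ hat₂₁ (x (𝟙_ A)) Z) ≫ hat₂₁ (x (𝟙_ A)) Z ≫ hat₁₀ (η P) Z := by
  have h := E.hat_mul_act (𝟙_ A) Z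
  rw [hat_counit_eq, hat₂₁_nat_assoc, reassoc_of% h]
  simp

/-- The weak bialgebra structure of the Tannaka object. -/
abbrev weakBimonObj : WeakBimonObj T where
  toMonObj := E.monObj
  toComonObj := E.comonObj
  mul_comul := by
    let := E.monObj
    refine E.ext₂ fun a b => ?_
    have h := sqMul_act₂ (E.act_isAssocAct a) (E.act_isAssocAct b) E.comul E.comul
    rw [sqMul] at h
    refine Eq.trans ?_ h.symm
    rw [E.comul_act, ← Category.assoc, comp_whiskerRight]
    change (E.mul ▷ _ ≫ E.comul ▷ _) ≫ act₂ (x a) (x b) = _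
    rw [Category.assoc, E.comul_act, ← whisker_exchange_assoc, reassoc_of% E.mul_act]
    simp only [Category.assoc, MonoidalCategory.whiskerLeft_comp, tensor_whiskerLeft,
      Iso.inv_hom_id_assoc]
    rw [← MonoidalCategory.whiskerLeft_comp_assoc T (δ P a b), SepFrobenius.separable,
      MonoidalCategory.whiskerLeft_id, Category.id_comp]
  weak_unit := by
    let := E.monObj
    let := E.comonObj
    refine E.hat_ext₀₃ fun a b c Z => ?_
    have h := hat_mulMiddle T (P.obj a ⊗ P.obj b ⊗ P.obj c ⊗ Z) (E.one ≫ E.comul) E.mul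
    refine (congrArg (· ≫ hatAct₃ (x a) (x b) (x c) Z) h).trans ?_
    refine (E.mulMiddle_act a b c Z).trans (Eq.trans ?_ (E.one_comul_comul_act a b c Z).symm)
    rw [← lw_comp, Category.assoc, reassoc_of% hat_frobenius_right, hat_δ_assoc,
      reassoc_of% hat_map_inv_hom P (α_ a b c)]
  weak_unit' := by
    let := E.monObj
    let := E.comonObj
    refine E.hat_ext₀₃ fun a b c Z => ?_
    have h := hat_mulMiddle T (P.obj a ⊗ P.obj b ⊗ P.obj c ⊗ Z) (E.one ≫ E.comul)
      ((β_ T T).inv ≫ E.mul)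
    have h' := hat_braiding_inv_mul T (P.obj a ⊗ P.obj b ⊗ P.obj c ⊗ Z)
    refine (congrArg (· ≫ hatAct₃ (x a) (x b) (x c) Z) h).trans ?_
    refine Eq.trans ?_ ((E.mulMiddle_inv_act a b c Z).trans
      (Eq.trans ?_ (E.one_comul_comul_act a b c Z).symm))
    · simp [hat₂₁, swapInv]
    · rw [Category.assoc, ← lw_comp, reassoc_of% hat_frobenius_left, reassoc_of% hat_μ_assoc]
  weak_counit := by
    let := E.monObj
    let := E.comonObj
    refine hat₃₀_congr fun Z => ?_
    refine (hat_comulMiddle T Z (E.mul ≫ counit P x) E.comul).trans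
      (Eq.trans ?_ (hat_mul_mul_counit T Z).symm)
    change _ = hat₂₁ E.mul (T ⊗ Z) ≫ hat₂₁ E.mul Z ≫ hat₁₀ (counit P x) Z
    have h := E.weak_counit_aux Z
    have h' := E.hat_mul_act (𝟙_ A) Z
    rw [hat₂₀_comp, E.hat_mul_counit_eq]
    calc _ = T ◃ (T ◃ (T ◃ hat₀₁ (ε P) Z ≫ hat₂₁ (x (𝟙_ A)) Z) ≫ (hat₁₂ E.comul _ ≫ 
          T ◃ (hat₂₁ (x (𝟙_ A)) Z ≫ hat₁₀ (η P) Z ≫ hat₀₁ (ε P) Z) ≫ hat₂₁ (x (𝟙_ A)) Z)) ≫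
            hat₂₁ (x (𝟙_ A)) Z ≫ hat₁₀ (η P) Z := by simp
      _ = T ◃ T ◃ (T ◃ hat₀₁ (ε P) Z ≫ hat₂₁ (x (𝟙_ A)) Z) ≫ (hat₂₁ E.mul _ ≫
            hat₂₁ (x (𝟙_ A)) Z) ≫ hat₁₀ (η P) Z := by rw [h, h']; simp
      _ = _ := by simp
  weak_counit' := by
    let := E.monObj
    let := E.comonObj
    refine hat₃₀_congr fun Z => ?_
    refine (hat_comulMiddle T Z (E.mul ≫ counit P x) (E.comul ≫ (β_ T T).inv)).trans
      (Eq.trans ?_ (hat_mul_mul_counit T Z).symm)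
    change _ = hat₂₁ E.mul (T ⊗ Z) ≫ hat₂₁ E.mul Z ≫ hat₁₀ (counit P x) Z
    have h := E.weak_counit_inv_aux Z
    have e : hat₁₂ (E.comul ≫ (β_ T T).inv) (T ⊗ Z) = hat₁₂ E.comul _ ≫ swapInv T T _ :=
      hat_comul_braiding_inv T (T ⊗ Z)
    have h' := E.hat_mul_act (𝟙_ A) Z
    rw [hat₂₀_comp, E.hat_mul_counit_eq]
    calc _ = T ◃ (T ◃ (T ◃ hat₀₁ (ε P) Z ≫ hat₂₁ (x (𝟙_ A)) Z) ≫ (hat₁₂ E.comul _ ≫ swapInv T T _ ≫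
          T ◃ (hat₂₁ (x (𝟙_ A)) Z ≫ hat₁₀ (η P) Z ≫ hat₀₁ (ε P) Z) ≫ hat₂₁ (x (𝟙_ A)) Z)) ≫
            hat₂₁ (x (𝟙_ A)) Z ≫ hat₁₀ (η P) Z := by rw [e]; simp
      _ = T ◃ T ◃ (T ◃ hat₀₁ (ε P) Z ≫ hat₂₁ (x (𝟙_ A)) Z) ≫ (hat₂₁ E.mul _ ≫
            hat₂₁ (x (𝟙_ A)) Z) ≫ hat₁₀ (η P) Z := by rw [h, h']; simp
      _ = _ := by simp

end IsActEnd

end Tannaka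

namespace Tannaka

open Functor.LaxMonoidal Functor.OplaxMonoidal

namespace IsActEnd

section Idempotents

variable {V : Type u} [Category.{v} V] [MonoidalCategory V] [BraidedCategory V]
  {A : Type u₁} [Category.{v₁} A] [MonoidalCategory A] {P : A ⥤ V} [SepFrobenius P]
  {T : V} {x : ∀ a, T ⊗ P.obj a ⟶ P.obj a} (E : IsActEnd P T x)

/-- `s` on the Tannaka object. -/
abbrev s : T ⟶ T := @idemS _ _ _ T E.monObj E.comonObj

/-- `t` on the Tannaka object. -/
abbrev t : T ⟶ T := @idemT _ _ _ _ T E.monObj E.comonObj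

/-- `z` on the Tannaka object. -/
abbrev z : T ⟶ T := @idemZ _ _ _ T E.monObj E.comonObj

/-- `r` on the Tannaka object. -/
abbrev r : T ⟶ T := @idemR _ _ _ _ T E.monObj E.comonObj

lemma one_comul_act' (a b : A) (Z : V) : hat₀₁ E.one _ ≫ hat₁₂ E.comul (P.obj a ⊗ P.obj b ⊗ Z) ≫
    T ◃ (swap T (P.obj a) _ ≫ P.obj a ◃ hat₂₁ (x b) Z) ≫ hat₂₁ (x a) _ =
      hat₂₁ (μ P a b) Z ≫ hat₁₂ (δ P a b) Z := by
  rw [← E.one_comul_act, hat₀₂_comp, Category.assoc]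

lemma hat_mul_counit_eq' (a : A) (Z : V) :
    hat₂₁ E.mul (P.obj a ⊗ Z) ≫ hat₁₀ (counit P x) (P.obj a ⊗ Z) =
      T ◃ swap T (P.obj a) Z ≫ swap T (P.obj a) _ ≫ P.obj a ◃ (T ◃ (T ◃ hat₀₁ (ε P) Z ≫
        hat₂₁ (x (𝟙_ A)) Z) ≫ hat₂₁ (x (𝟙_ A)) Z ≫ hat₁₀ (η P) Z) := by
  have h := swap_swap_lw_hat₂₀ (P.obj a) Z (E.mul ≫ counit P x)
  rw [hat₂₀_comp, hat₂₀_comp, E.hat_mul_counit_eq] at h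
  exact h.symm

lemma idemT_act (a : A) (Z : V) : hat₁₁ E.t (P.obj a ⊗ Z) ≫ hat₂₁ (x a) Z =
    (T ◃ hat₀₁ (ε P) _ ≫ hat₂₁ (x (𝟙_ A)) _) ≫
      hat₂₁ (μ P (𝟙_ A) a ≫ P.map (λ_ a).hom) Z := by
  let := E.monObj
  let := E.comonObj
  have h₀ : hat₁₁ E.t (P.obj a ⊗ Z) = hat₀₁ E.one _ ≫ hat₁₂ E.comul _ ≫
      T ◃ swap T T _ ≫ hat₂₁ E.mul _ ≫ hat₁₀ (counit P x) _ := hat_idemT T _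
  have h₁ := lw_hat₂₁_swap T (P.obj a ⊗ Z) (x (𝟙_ A))
  have h₂ := E.one_comul_act' (𝟙_ A) a Z
  have h₃ := lw_hat₀₁_swap T (P.obj a ⊗ Z) (ε P)
  rw [h₀, E.hat_mul_counit_eq]
  calc _ = hat₀₁ E.one _ ≫ hat₁₂ E.comul _ ≫ T ◃ (swap T T _ ≫ T ◃ hat₀₁ (ε P) _ ≫
          hat₂₁ (x (𝟙_ A)) _) ≫ hat₂₁ (x (𝟙_ A)) _ ≫ hat₁₀ (η P) _ ≫ hat₂₁ (x a) Z := by simp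
    _ = hat₀₁ E.one _ ≫ hat₁₂ E.comul _ ≫ T ◃ (T ◃ T ◃ hat₀₁ (ε P) _ ≫ swap T T _ ≫
          T ◃ swap T (P.obj (𝟙_ A)) _ ≫ hat₂₁ (x (𝟙_ A)) _) ≫
            hat₂₁ (x (𝟙_ A)) _ ≫ hat₁₀ (η P) _ ≫ hat₂₁ (x a) Z := by
        rw [← h₃]; simp
    _ = (T ◃ hat₀₁ (ε P) _ ≫ hat₂₁ (x (𝟙_ A)) _) ≫ (hat₀₁ E.one _ ≫ hat₁₂ E.comul _ ≫
          T ◃ (swap T _ _ ≫ P.obj (𝟙_ A) ◃ hat₂₁ (x a) Z) ≫ hat₂₁ (x (𝟙_ A)) _) ≫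
            hat₁₀ (η P) _ := by
        rw [← h₁]; simp
    _ = _ := by rw [h₂, Category.assoc (hat₂₁ (μ P _ _) _), hat_δ_η', hat₂₁_comp]

lemma idemS_act (a : A) (Z : V) : hat₁₁ E.s (P.obj a ⊗ Z) ≫ hat₂₁ (x a) Z =
    swap T (P.obj a) Z ≫ P.obj a ◃ (T ◃ hat₀₁ (ε P) _ ≫ hat₂₁ (x (𝟙_ A)) _) ≫
      hat₂₁ (μ P a (𝟙_ A) ≫ P.map (ρ_ a).hom) Z := by
  let := E.monObj
  let := E.comonObj
  have h₀ : hat₁₁ E.s (P.obj a ⊗ Z) = hat₀₁ E.one _ ≫ hat₁₂ E.comul _ ≫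
      T ◃ (hat₂₁ E.mul _ ≫ hat₁₀ (counit P x) _) := hat_idemS T _
  have h₂ := E.one_comul_act' a (𝟙_ A) Z
  rw [h₀, E.hat_mul_counit_eq']
  calc _ = swap T (P.obj a) Z ≫ P.obj a ◃ (T ◃ hat₀₁ (ε P) _ ≫ hat₂₁ (x (𝟙_ A)) _) ≫
          (hat₀₁ E.one _ ≫ hat₁₂ E.comul _ ≫ T ◃ (swap T _ _ ≫ P.obj a ◃ hat₂₁ (x (𝟙_ A)) Z) ≫
            hat₂₁ (x a) _) ≫ P.obj a ◃ hat₁₀ (η P) _ := by simp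
    _ = _ := by rw [h₂, Category.assoc (hat₂₁ (μ P _ _) _), hat_η_δ', hat₂₁_comp]

lemma idemZ_act (a : A) (Z : V) : hat₁₁ E.z (P.obj a ⊗ Z) ≫ hat₂₁ (x a) Z =
    T ◃ hat₁₂ (P.map (λ_ a).inv ≫ δ P (𝟙_ A) a) Z ≫ hat₂₁ (x (𝟙_ A)) _ ≫ hat₁₀ (η P) _ := by
  let := E.monObj
  let := E.comonObj
  have h₀ : hat₁₁ E.z (P.obj a ⊗ Z) = T ◃ (hat₀₁ E.one _ ≫ hat₁₂ E.comul _) ≫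
      hat₂₁ E.mul _ ≫ hat₁₀ (counit P x) _ := hat_idemZ T _
  have h₂ := E.one_comul_act' (𝟙_ A) a Z
  have h₃ := lw_hat₀₁_swap T (P.obj a ⊗ Z) (ε P)
  have h₄ := hat_ε_μ' P a Z
  rw [h₀, E.hat_mul_counit_eq]
  calc _ = T ◃ (hat₀₁ E.one _ ≫ hat₁₂ E.comul _ ≫ T ◃ (hat₀₁ (ε P) _ ≫
          P.obj (𝟙_ A) ◃ hat₂₁ (x a) Z) ≫ hat₂₁ (x (𝟙_ A)) _) ≫ hat₂₁ (x (𝟙_ A)) _ ≫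
            hat₁₀ (η P) _ := by simp
    _ = T ◃ (hat₀₁ (ε P) _ ≫ hat₀₁ E.one _ ≫ hat₁₂ E.comul _ ≫ T ◃ (swap T _ _ ≫
          P.obj (𝟙_ A) ◃ hat₂₁ (x a) Z) ≫ hat₂₁ (x (𝟙_ A)) _) ≫ hat₂₁ (x (𝟙_ A)) _ ≫
            hat₁₀ (η P) _ := by
        rw [← h₃]; simp
    _ = _ := by rw [h₂, reassoc_of% h₄, hat₁₂_comp]

lemma idemR_act (a : A) (Z : V) : hat₁₁ E.r (P.obj a ⊗ Z) ≫ hat₂₁ (x a) Z =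
    T ◃ hat₁₂ (P.map (ρ_ a).inv ≫ δ P a (𝟙_ A)) Z ≫ swap T (P.obj a) _ ≫
      P.obj a ◃ (hat₂₁ (x (𝟙_ A)) _ ≫ hat₁₀ (η P) _) := by
  let := E.monObj
  let := E.comonObj
  have h₀ : hat₁₁ E.r (P.obj a ⊗ Z) = T ◃ (hat₀₁ E.one _ ≫ hat₁₂ E.comul _) ≫ swap T T _ ≫
      T ◃ (hat₂₁ E.mul _ ≫ hat₁₀ (counit P x) _) := hat_idemR T _
  have h₁ := lw_hat₂₁_swap T (P.obj (𝟙_ A) ⊗ Z) (x a)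
  have h₂ := E.one_comul_act' a (𝟙_ A) Z
  have h₄ := hat_μ_ε' P a Z
  rw [h₀, E.hat_mul_counit_eq']
  calc _ = T ◃ (hat₀₁ E.one _ ≫ hat₁₂ E.comul _ ≫ T ◃ (swap T _ _ ≫
          P.obj a ◃ (T ◃ hat₀₁ (ε P) _ ≫ hat₂₁ (x (𝟙_ A)) Z))) ≫
          (swap T T _ ≫ T ◃ swap T (P.obj a) _ ≫ hat₂₁ (x a) _) ≫
            P.obj a ◃ (hat₂₁ (x (𝟙_ A)) _ ≫ hat₁₀ (η P) _) := by simp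
    _ = T ◃ (P.obj a ◃ hat₀₁ (ε P) _ ≫ (hat₀₁ E.one _ ≫ hat₁₂ E.comul _ ≫ T ◃ (swap T _ _ ≫
          P.obj a ◃ hat₂₁ (x (𝟙_ A)) Z) ≫ hat₂₁ (x a) _)) ≫ swap T (P.obj a) _ ≫
            P.obj a ◃ (hat₂₁ (x (𝟙_ A)) _ ≫ hat₁₀ (η P) _) := by
        rw [← h₁]; simp
    _ = _ := by rw [h₂, reassoc_of% h₄, hat₁₂_comp]

end Idempotents

section Map

variable {V : Type u} [Category.{v} V] [MonoidalCategory V] [BraidedCategory V]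
  {A : Type u₁} [Category.{v₁} A] [MonoidalCategory A]
  {C : Type u₂} [Category.{v₂} C] [MonoidalCategory C]

/-- The isomorphisms `e` identify `P` with `K ⋙ Q` as separable Frobenius functors. -/
structure CompIso (K : A ⥤ C) [SepFrobenius K] (Q : C ⥤ V) [SepFrobenius Q] (P : A ⥤ V)
    [SepFrobenius P] (e : ∀ a, P.obj a ≅ Q.obj (K.obj a)) : Prop where
  map_eq : ∀ {a b : A} (f : a ⟶ b), P.map f = (e a).hom ≫ Q.map (K.map f) ≫ (e b).inv
  ε_eq : ε P = ε Q ≫ Q.map (ε K) ≫ (e (𝟙_ A)).inv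
  η_eq : η P = (e (𝟙_ A)).hom ≫ Q.map (η K) ≫ η Q
  μ_eq : ∀ a b, μ P a b = ((e a).hom ⊗ₘ (e b).hom) ≫ μ Q _ _ ≫ Q.map (μ K a b) ≫ (e _).inv
  δ_eq : ∀ a b, δ P a b = (e _).hom ≫ Q.map (δ K a b) ≫ δ Q _ _ ≫ ((e a).inv ⊗ₘ (e b).inv)

variable {K : A ⥤ C} [SepFrobenius K] {Q : C ⥤ V} [SepFrobenius Q] {P : A ⥤ V} [SepFrobenius P]
  {e : ∀ a, P.obj a ≅ Q.obj (K.obj a)}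

namespace CompIso

lemma unit_μ (h : CompIso K Q P e) (a : A) :
    (Q.map (ε K) ≫ (e (𝟙_ A)).inv) ▷ P.obj a ≫ μ P (𝟙_ A) a ≫ P.map (λ_ a).hom =
      Q.obj (𝟙_ C) ◁ (e a).hom ≫ (μ Q (𝟙_ C) (K.obj a) ≫ Q.map (λ_ (K.obj a)).hom) ≫
        (e a).inv := by
  rw [h.μ_eq, h.map_eq, Functor.LaxMonoidal.left_unitality K a]
  simp only [Functor.map_comp, Category.assoc, Iso.inv_hom_id_assoc, comp_whiskerRight,
    MonoidalCategory.tensorHom_def, ← μ_natural_left_assoc]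
  simp only [← comp_whiskerRight_assoc, Category.assoc, Iso.inv_hom_id, Category.comp_id,
    whisker_exchange_assoc]

lemma μ_unit (h : CompIso K Q P e) (a : A) :
    P.obj a ◁ (Q.map (ε K) ≫ (e (𝟙_ A)).inv) ≫ μ P a (𝟙_ A) ≫ P.map (ρ_ a).hom =
      (e a).hom ▷ Q.obj (𝟙_ C) ≫ (μ Q (K.obj a) (𝟙_ C) ≫ Q.map (ρ_ (K.obj a)).hom) ≫
        (e a).inv := by
  rw [h.μ_eq, h.map_eq, Functor.LaxMonoidal.right_unitality K a]
  simp only [Functor.map_comp, Category.assoc, Iso.inv_hom_id_assoc,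
    MonoidalCategory.whiskerLeft_comp,
    MonoidalCategory.tensorHom_def', ← μ_natural_right_assoc]
  simp only [← MonoidalCategory.whiskerLeft_comp_assoc, Category.assoc, Iso.inv_hom_id,
    Category.comp_id, ← whisker_exchange_assoc]

lemma δ_counit (h : CompIso K Q P e) (a : A) :
    (P.map (λ_ a).inv ≫ δ P (𝟙_ A) a) ≫ ((e (𝟙_ A)).hom ≫ Q.map (η K)) ▷ P.obj a =
      (e a).hom ≫ (Q.map (λ_ (K.obj a)).inv ≫ δ Q (𝟙_ C) (K.obj a)) ≫
        Q.obj (𝟙_ C) ◁ (e a).inv := by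
  rw [h.δ_eq, h.map_eq, Functor.OplaxMonoidal.left_unitality K a]
  simp only [Functor.map_comp, Category.assoc, Iso.inv_hom_id_assoc, comp_whiskerRight,
    MonoidalCategory.tensorHom_def', ← δ_natural_left_assoc]
  simp only [← comp_whiskerRight_assoc, ← comp_whiskerRight, Category.assoc, Iso.inv_hom_id_assoc,
    Iso.inv_hom_id, Category.comp_id, ← whisker_exchange]

lemma counit_δ (h : CompIso K Q P e) (a : A) :
    (P.map (ρ_ a).inv ≫ δ P a (𝟙_ A)) ≫ P.obj a ◁ ((e (𝟙_ A)).hom ≫ Q.map (η K)) =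
      (e a).hom ≫ (Q.map (ρ_ (K.obj a)).inv ≫ δ Q (K.obj a) (𝟙_ C)) ≫
        (e a).inv ▷ Q.obj (𝟙_ C) := by
  rw [h.δ_eq, h.map_eq, Functor.OplaxMonoidal.right_unitality K a]
  simp only [Functor.map_comp, Category.assoc, Iso.inv_hom_id_assoc,
    MonoidalCategory.whiskerLeft_comp,
    MonoidalCategory.tensorHom_def, ← δ_natural_right_assoc]
  simp only [← MonoidalCategory.whiskerLeft_comp_assoc, ← MonoidalCategory.whiskerLeft_comp,
    Category.assoc, Iso.inv_hom_id_assoc, Iso.inv_hom_id, Category.comp_id, whisker_exchange]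

end CompIso

lemma act₂_conj {N a b a' b' : V} (p : a ⟶ a') (q : b ⟶ b') (x : N ⊗ a' ⟶ a') (y : N ⊗ b' ⟶ b')
    (p' : a' ⟶ a) (q' : b' ⟶ b) : act₂ (N ◁ p ≫ x ≫ p') (N ◁ q ≫ y ≫ q') =
      (N ⊗ N) ◁ (p ⊗ₘ q) ≫ act₂ x y ≫ (p' ⊗ₘ q') := by
  have := tensorμ_natural (𝟙 N) (𝟙 N) p q
  rw [id_tensorHom_id] at this
  simp only [id_tensorHom] at this
  rw [act₂, act₂, ← tensorHom_comp_tensorHom, ← tensorHom_comp_tensorHom, Category.assoc,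
    reassoc_of% this]

variable {S : V} {y : ∀ c, S ⊗ Q.obj c ⟶ Q.obj c} (D : IsActEnd Q S y)
  {T : V} {x : ∀ a, T ⊗ P.obj a ⟶ P.obj a} (E : IsActEnd P T x) {f : S ⟶ T}

/-- The comparison of Tannaka objects along a separable Frobenius functor is a weak morphism. -/
lemma isWeakHom (h : CompIso K Q P e)
    (hf : ∀ a, f ▷ P.obj a ≫ x a = S ◁ (e a).hom ≫ y (K.obj a) ≫ (e a).inv) :
    @IsWeakHom _ _ _ _ _ _ D.weakBimonObj E.weakBimonObj f := by
  have B (a : A) (Z : V) : hat₁₁ f (P.obj a ⊗ Z) ≫ hat₂₁ (x a) Z =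
      S ◃ hat₁₁ (e a).hom Z ≫ hat₂₁ (y (K.obj a)) Z ≫ hat₁₁ (e a).inv Z := by
    rw [← hat₂₁_comp, ← hat₂₁_lw, ← hf, hat₂₁_rw]
  have A₁ (Z : V) : hat₁₁ f Z ≫ T ◃ hat₀₁ (ε P) Z ≫ hat₂₁ (x (𝟙_ A)) Z =
      S ◃ hat₀₁ (ε Q) Z ≫ hat₂₁ (y (𝟙_ C)) Z ≫ hat₁₁ (Q.map (ε K) ≫ (e (𝟙_ A)).inv) Z := by
    have h₁ := B (𝟙_ A) Z
    have h₂ := D.hat_natural (ε K) Z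
    rw [hat₁₁_nat_assoc, h₁, h.ε_eq, hat₁₁_comp, reassoc_of% h₂, hat₀₁_comp, hat₁₁_comp]
    have h₃ : hat₁₁ (e (𝟙_ A)).inv Z ≫ hat₁₁ (e (𝟙_ A)).hom Z = 𝟙 _ := by
      rw [← hat₁₁_comp, Iso.inv_hom_id, hat₁₁_id]
    simp only [lw_comp_assoc, Category.assoc, h₃, Category.comp_id]
  have A₂ (Z : V) : hat₁₁ f _ ≫ hat₂₁ (x (𝟙_ A)) Z ≫ hat₁₀ (η P) Z =
      S ◃ hat₁₁ ((e (𝟙_ A)).hom ≫ Q.map (η K)) Z ≫ hat₂₁ (y (𝟙_ C)) Z ≫ hat₁₀ (η Q) Z := by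
    have h₁ := B (𝟙_ A) Z
    have h₂ := D.hat_natural (η K) Z
    rw [reassoc_of% h₁, h.η_eq, ← hat₁₀_comp, Iso.inv_hom_id_assoc, hat₁₀_comp, reassoc_of% h₂,
      hat₁₁_comp, lw_comp_assoc]
  have hM (a b : A) : f ▷ _ ≫ E.comul ▷ (P.obj a ⊗ P.obj b) ≫ act₂ (x a) (x b) =
      S ◁ (((e a).hom ⊗ₘ (e b).hom) ≫ μ Q (K.obj a) (K.obj b)) ≫ y _ ≫
        Q.map (μ K a b ≫ δ K a b) ≫ δ Q _ _ ≫ ((e a).inv ⊗ₘ (e b).inv) := by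
    rw [E.comul_act, ← whisker_exchange_assoc, reassoc_of% hf, h.μ_eq, h.δ_eq,
      ← MonoidalCategory.whiskerLeft_comp_assoc]
    simp only [Category.assoc, Iso.inv_hom_id_assoc, Iso.inv_hom_id, Category.comp_id]
    simp only [MonoidalCategory.whiskerLeft_comp, Functor.map_comp, Category.assoc]
    rw [← reassoc_of% D.natural]
  have h₁ (a b : A) : (E.one ≫ E.comul) ▷ (P.obj a ⊗ P.obj b) ≫ act₂ (x a) (x b) =
      (λ_ _).hom ≫ μ P a b ≫ δ P a b := by
    rw [comp_whiskerRight, Category.assoc, E.comul_act, ← whisker_exchange_assoc,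
      reassoc_of% E.one_act, leftUnitor_naturality_assoc]
  have h₂ (a b : A) : μ P a b ≫ δ P a b = (((e a).hom ⊗ₘ (e b).hom) ≫ μ Q _ _) ≫
      Q.map (μ K a b ≫ δ K a b) ≫ δ Q _ _ ≫ ((e a).inv ⊗ₘ (e b).inv) := by
    rw [h.μ_eq, h.δ_eq]
    simp only [Category.assoc, Iso.inv_hom_id_assoc, Functor.map_comp]
  have hS (a b : A) : (D.comul ≫ (f ⊗ₘ f)) ▷ (P.obj a ⊗ P.obj b) ≫ act₂ (x a) (x b) =
      S ◁ (((e a).hom ⊗ₘ (e b).hom) ≫ μ Q (K.obj a) (K.obj b)) ≫ y _ ≫ δ Q _ _ ≫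
        ((e a).inv ⊗ₘ (e b).inv) := by
    rw [comp_whiskerRight, Category.assoc, ← act₂_map, hf, hf, act₂_conj,
      ← whisker_exchange_assoc, reassoc_of% D.comul_act, MonoidalCategory.whiskerLeft_comp,
      Category.assoc]
  have h₃ (a b : A) : (((e a).inv ⊗ₘ (e b).inv) ≫ ((e a).hom ⊗ₘ (e b).hom)) = 𝟙 _ := by
    rw [tensorHom_comp_tensorHom, Iso.inv_hom_id, Iso.inv_hom_id, id_tensorHom_id]
  let := D.weakBimonObj
  let := E.weakBimonObj
  exact {
    one_hom := E.ext₁ fun a => by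
      rw [comp_whiskerRight, Category.assoc, hf, ← whisker_exchange_assoc]
      have h : D.one ▷ _ ≫ y (K.obj a) = _ := D.one_act _
      refine Eq.trans ?_ (E.one_act a).symm
      change _ ≫ D.one ▷ _ ≫ y (K.obj a) ≫ _ = _
      rw [reassoc_of% h, leftUnitor_naturality_assoc, Iso.hom_inv_id, Category.comp_id]
    mul_hom := E.ext₁ fun a => by
      have h : (f ⊗ₘ f) ▷ _ ≫ E.mul ▷ P.obj a ≫ x a =
          (α_ _ _ _).hom ≫ S ◁ (f ▷ P.obj a ≫ x a) ≫ f ▷ P.obj a ≫ x a := by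
        rw [E.mul_act]
        rw [MonoidalCategory.tensorHom_def, comp_whiskerRight, Category.assoc,
          associator_naturality_middle_assoc, associator_naturality_left_assoc,
          MonoidalCategory.whiskerLeft_comp, Category.assoc, whisker_exchange_assoc,
          whisker_exchange_assoc]
      have h' : D.mul ▷ _ ≫ f ▷ P.obj a ≫ x a =
          (α_ _ _ _).hom ≫ S ◁ (f ▷ P.obj a ≫ x a) ≫ f ▷ P.obj a ≫ x a := by
        rw [hf, ← whisker_exchange_assoc, reassoc_of% D.mul_act]
        simp only [← MonoidalCategory.whiskerLeft_comp_assoc, Category.assoc, Iso.inv_hom_id,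
          Category.comp_id]
        simp
      rw [comp_whiskerRight, Category.assoc, comp_whiskerRight, Category.assoc]
      exact h'.trans h.symm
    idemT_comm := E.hat_ext₁ fun a Z => by
      have l₁ := B a Z
      have l₂ := E.idemT_act a Z
      have l₃ := D.idemT_act (K.obj a) Z
      have l₄ := A₁ (P.obj a ⊗ Z)
      have l₅ := hat₂₁_rw Z (Q.map (ε K) ≫ (e (𝟙_ A)).inv) (μ P (𝟙_ A) a ≫ P.map (λ_ a).hom)
      rw [h.unit_μ, hat₂₁_lw, hat₂₁_comp _ (μ Q _ _ ≫ _)] at l₅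
      rw [hat₁₁_comp, hat₁₁_comp, Category.assoc, Category.assoc]
      refine Eq.trans ?_ (congrArg (hat₁₁ f _ ≫ ·) l₂).symm
      change hat₁₁ D.t _ ≫ _ = hat₁₁ f _ ≫ _ ≫ _
      rw [Category.assoc, reassoc_of% l₄, l₁, hat₁₁_nat_assoc, reassoc_of% l₃]
      rw [← l₅]
      simp
    idemS_comm := E.hat_ext₁ fun a Z => by
      have l₁ := B a Z
      have l₂ := E.idemS_act a Z
      have l₃ := D.idemS_act (K.obj a) Z
      have l₄ := A₁ Z
      have l₅ := hat₂₁_lw Z (Q.map (ε K) ≫ (e (𝟙_ A)).inv) (μ P a (𝟙_ A) ≫ P.map (ρ_ a).hom)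
      rw [h.μ_unit, hat₂₁_rw, hat₂₁_comp _ (μ Q _ _ ≫ _)] at l₅
      have l₆ := hat₁₁_swap (P.obj a) Z f
      have l₇ := lw_hat₁₁_swap S Z (e a).hom
      rw [hat₁₁_comp, hat₁₁_comp, Category.assoc, Category.assoc]
      refine Eq.trans ?_ (congrArg (hat₁₁ f _ ≫ ·) l₂).symm
      change hat₁₁ D.s _ ≫ _ = hat₁₁ f _ ≫ _ ≫ _
      rw [reassoc_of% l₆, lw_comp_assoc, l₄, l₁, hat₁₁_nat_assoc, reassoc_of% l₃,
        reassoc_of% l₇]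
      simp only [← lw_comp_assoc, Category.assoc, ← l₅]
      simp
    idemZ_comm := E.hat_ext₁ fun a Z => by
      have l₁ := B a Z
      have l₂ := E.idemZ_act a Z
      have l₃ := D.idemZ_act (K.obj a) Z
      have l₄ := A₂ (P.obj a ⊗ Z)
      have l₅ := hat₁₂_rw Z ((e (𝟙_ A)).hom ≫ Q.map (η K)) (P.map (λ_ a).inv ≫ δ P (𝟙_ A) a)
      rw [h.δ_counit, hat₁₂_comp, hat₁₂_lw] at l₅
      rw [hat₁₁_comp, hat₁₁_comp, Category.assoc, Category.assoc]
      refine Eq.trans ?_ (congrArg (hat₁₁ f _ ≫ ·) l₂).symm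
      change hat₁₁ D.z _ ≫ _ = hat₁₁ f _ ≫ _ ≫ _
      rw [hat₁₁_nat_assoc, l₄, l₁, hat₁₁_nat_assoc, reassoc_of% l₃, lw_comp_assoc S _ (hat₁₁ _ _), ← l₅]
      simp
    idemR_comm := E.hat_ext₁ fun a Z => by
      have l₁ := B a Z
      have l₂ := E.idemR_act a Z
      have l₃ := D.idemR_act (K.obj a) Z
      have l₄ := A₂ Z
      have l₅ := hat₁₂_lw Z ((e (𝟙_ A)).hom ≫ Q.map (η K)) (P.map (ρ_ a).inv ≫ δ P a (𝟙_ A))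
      rw [h.counit_δ, hat₁₂_comp, hat₁₂_rw] at l₅
      have l₆ := hat₁₁_swap (P.obj a) (P.obj (𝟙_ A) ⊗ Z) f
      have l₇ := lw_hat₁₁_swap S (Q.obj (𝟙_ C) ⊗ Z) (e a).inv
      rw [hat₁₁_comp, hat₁₁_comp, Category.assoc, Category.assoc]
      refine Eq.trans ?_ (congrArg (hat₁₁ f _ ≫ ·) l₂).symm
      change hat₁₁ D.r _ ≫ _ = hat₁₁ f _ ≫ _ ≫ _
      rw [hat₁₁_nat_assoc, reassoc_of% l₆, lw_comp, l₄, l₁, hat₁₁_nat_assoc, reassoc_of% l₃,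
        ← lw_comp (P.obj a), swap_nat_assoc, lw_comp_assoc S (hat₁₂ _ _), ← l₅]
      simp only [← lw_comp_assoc, Category.assoc, reassoc_of% l₇]
      simp
    comul_left := E.ext₂ fun a b => by
      have l := sqMul_act₂ (E.act_isAssocAct a) (E.act_isAssocAct b) (E.one ≫ E.comul)
        (D.comul ≫ (f ⊗ₘ f))
      rw [comp_whiskerRight, Category.assoc]
      refine (hM a b).trans ?_
      rw [comp_whiskerRight, Category.assoc]
      refine Eq.trans ?_ (congrArg ((λ_ S).inv ▷ _ ≫ ·) l.symm)
      rw [hS, h₁, h₂, leftUnitor_naturality_assoc]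
      simp only [Category.assoc, reassoc_of% h₃, SepFrobenius.separable_assoc]
      monoidal
    comul_right := E.ext₂ fun a b => by
      have l := sqMul_act₂ (E.act_isAssocAct a) (E.act_isAssocAct b) (D.comul ≫ (f ⊗ₘ f))
        (E.one ≫ E.comul)
      rw [comp_whiskerRight, Category.assoc]
      refine (hM a b).trans ?_
      rw [comp_whiskerRight, Category.assoc]
      refine Eq.trans ?_ (congrArg ((ρ_ S).inv ▷ _ ≫ ·) l.symm)
      have l' : Q.map (μ K a b ≫ δ K a b) ≫ δ Q _ _ ≫ ((e a).inv ⊗ₘ (e b).inv) ≫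
          ((e a).hom ⊗ₘ (e b).hom) ≫ μ Q _ _ = Q.map (μ K a b ≫ δ K a b) := by
        rw [reassoc_of% h₃, SepFrobenius.separable, Category.comp_id]
      rw [hS, h₁, h₂]
      simp only [← MonoidalCategory.whiskerLeft_comp_assoc, Category.assoc, l']
      rw [reassoc_of% D.natural (μ K a b ≫ δ K a b)]
      simp only [MonoidalCategory.whiskerLeft_comp, Category.assoc]
      monoidal }

end Map

end IsActEnd

end Tannaka

namespace Tannaka

open Functor.LaxMonoidal Functor.OplaxMonoidal

section TannakaFunctor

variable {V : Type u} [Category.{v} V] [MonoidalCategory V] [BraidedCategory V]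

lemma IsActEnd.compIso_of_comp_eq {A : Type u₁} [Category.{v₁} A] [MonoidalCategory A]
    {C : Type u₂} [Category.{v₂} C] [MonoidalCategory C] (K : SFFunctor A C) (Q : SFFunctor C V)
    {P : SFFunctor A V} (h : K.comp Q = P) (e : ∀ a, P.functor.obj a = Q.functor.obj (K.functor.obj a)) :
    CompIso K.functor Q.functor P.functor (fun a => eqToIso (e a)) := by
  subst h
  refine ⟨fun f => ?_, ?_, ?_, fun a b => ?_, fun a b => ?_⟩
  · simp
  · simp
  · simp
  · simp
  · simp

/-- A morphism over `V` identifies its source with a composite. -/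
lemma SFOver.Hom.compIso {F G : SFOver V} (f : F ⟶ G) :
    IsActEnd.CompIso f.H.functor G.F.functor F.F.functor
      (fun a => eqToIso (SFOver.Hom.obj_eq f a).symm) :=
  IsActEnd.compIso_of_comp_eq f.H G.F f.comm _

lemma IsActEnd.exists_map {A : Type u₁} [Category.{v₁} A] [MonoidalCategory A]
    {C : Type u₂} [Category.{v₂} C] [MonoidalCategory C]
    {K : A ⥤ C} [SepFrobenius K] {Q : C ⥤ V} [SepFrobenius Q] {P : A ⥤ V} [SepFrobenius P]
    {e : ∀ a, P.obj a ≅ Q.obj (K.obj a)} {S : V} {y : ∀ c, S ⊗ Q.obj c ⟶ Q.obj c}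
    (D : IsActEnd Q S y) {T : V} {x : ∀ a, T ⊗ P.obj a ⟶ P.obj a} (E : IsActEnd P T x)
    (h : CompIso K Q P e) :
    ∃ f : S ⟶ T, ∀ a, f ▷ P.obj a ≫ x a = S ◁ (e a).hom ≫ y (K.obj a) ≫ (e a).inv := by
  refine E.exists_lift₁ _ fun {a b} f => ?_
  have hn := D.natural (K.map f)
  rw [h.map_eq]
  simp only [Category.assoc, Iso.inv_hom_id_assoc, reassoc_of% hn,
    ← MonoidalCategory.whiskerLeft_comp_assoc, Iso.inv_hom_id, Category.comp_id]

section Structure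

variable (F : SFOver V) {T : V} {x : ∀ a, T ⊗ F.F.functor.obj a ⟶ F.F.functor.obj a}
  (E : IsActEnd F.F.functor T x)

/-- The map into `Fa ⊗ *(Fa)` that corresponds to an action. -/
def SFOver.proj {a : F.A} (y : T ⊗ F.F.functor.obj a ⟶ F.F.functor.obj a) :
    T ⟶ F.F.functor.obj a ⊗ (F.F.functor.obj a)ᘁ :=
  tensorRightHomEquiv T (F.F.functor.obj a) ((F.F.functor.obj a)ᘁ) _ y

lemma SFOver.act_proj {a : F.A} (y : T ⊗ F.F.functor.obj a ⟶ F.F.functor.obj a) :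
    F.act (F.proj y) = y :=
  (tensorRightHomEquiv T (F.F.functor.obj a) ((F.F.functor.obj a)ᘁ) _).symm_apply_apply y

lemma SFOver.act_injective {a : F.A} : Function.Injective (F.act (T := T) (a := a)) :=
  (tensorRightHomEquiv T (F.F.functor.obj a) ((F.F.functor.obj a)ᘁ) _).symm.injective

lemma SFOver.act_comp {S : V} {a : F.A} (f : S ⟶ T)
    (π : T ⟶ F.F.functor.obj a ⊗ (F.F.functor.obj a)ᘁ) :
    F.act (f ≫ π) = f ▷ _ ≫ F.act π := by
  simp [SFOver.act]

lemma SFOver.proj_dinatural {a b : F.A} (f : a ⟶ b)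
    {y : T ⊗ F.F.functor.obj a ⟶ F.F.functor.obj a} {z : T ⊗ F.F.functor.obj b ⟶ F.F.functor.obj b}
    (h : y ≫ F.F.functor.map f = T ◁ F.F.functor.map f ≫ z) :
    F.proj y ≫ F.F.functor.map f ▷ _ = F.proj z ≫ _ ◁ ((F.F.functor.map f)ᘁ) := by
  apply (tensorRightHomEquiv T (F.F.functor.obj a) ((F.F.functor.obj a)ᘁ) _).symm.injective
  have h₁ := F.act_proj y
  have h₂ := F.act_proj z
  have h₃ := rightAdjointMate_comp_evaluation (F.F.functor.map f)
  rw [SFOver.act] at h₁ h₂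
  change (_ ≫ _) ▷ _ ≫ _ = (_ ≫ _) ▷ _ ≫ _
  calc _ = (F.proj y ▷ F.F.functor.obj a ≫ (α_ _ _ _).hom ≫
        F.F.functor.obj a ◁ ε_ _ _ ≫ (ρ_ _).hom) ≫ F.F.functor.map f := by
        simp only [comp_whiskerRight, Category.assoc]
        rw [← rightUnitor_naturality, whisker_exchange_assoc, associator_naturality_left_assoc]
    _ = T ◁ F.F.functor.map f ≫ F.proj z ▷ F.F.functor.obj b ≫ (α_ _ _ _).hom ≫
        F.F.functor.obj b ◁ ε_ _ _ ≫ (ρ_ _).hom := by rw [h₁, h₂, h]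
    _ = F.proj z ▷ F.F.functor.obj a ≫ (α_ _ _ _).hom ≫
        F.F.functor.obj b ◁ (_ ◁ F.F.functor.map f ≫ ε_ _ _) ≫ (ρ_ _).hom := by
        rw [whisker_exchange_assoc]; simp
    _ = _ := by rw [← h₃]; simp

/-- An object with the universal property of the end is a Tannaka object. -/
def IsActEnd.tannakaStructure : TannakaStructure F (WBA.mk T (str := E.weakBimonObj)) where
  π a := F.proj (x a)
  dinatural a b f := F.proj_dinatural f (E.natural f)
  isEnd := Multifork.IsLimit.mk _
    (fun c => (E.exists_lift₁ (fun a => F.act (c.ι a))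
      (fun {a b} f => actOfProj_natural F.F.functor f _ _ (c.condition (.mk f)))).choose)
    (fun c a => by
      have h := (E.exists_lift₁ (fun a => F.act (c.ι a))
        (fun {a b} f => actOfProj_natural F.F.functor f _ _ (c.condition (.mk f)))).choose_spec a
      refine F.act_injective ((F.act_comp _ _).trans ?_)
      refine Eq.trans ?_ h
      exact congrArg (_ ≫ ·) (F.act_proj (x a)))
    (fun c m h => by
      have h' := (E.exists_lift₁ (fun a => F.act (c.ι a))
        (fun {a b} f => actOfProj_natural F.F.functor f _ _ (c.condition (.mk f)))).choose_spec
      refine E.ext₁ fun a => (Eq.trans ?_ (h' a).symm)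
      refine (congrArg (_ ≫ ·) (F.act_proj (x a))).symm.trans ?_
      exact (F.act_comp _ _).symm.trans (congrArg F.act (h a)))
  mul_act a := by rw [F.act_proj]; exact E.mul_act a
  one_act a := by rw [F.act_proj]; exact E.one_act a
  comul_act a b := by rw [F.act_proj, F.act_proj, F.act_proj]; exact E.comul_act a b
  counit_eq := by rw [F.act_proj]; rfl

end Structure

section Complete

variable [MonoidallyComplete V]

/-- The Tannaka object of `F`, carried by the end `∫ Fa ⊗ *(Fa)`. -/
def SFOver.tan (F : SFOver V) : WBA V :=
  letI h := exists_isActEnd F.F.functor F.dual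
  WBA.mk h.choose (str := IsActEnd.weakBimonObj h.choose_spec.choose_spec)

/-- The canonical action of the Tannaka object on the values of `F`. -/
def SFOver.tanAct (F : SFOver V) (a : F.A) : F.tan.X ⊗ F.F.functor.obj a ⟶ F.F.functor.obj a :=
  (exists_isActEnd F.F.functor F.dual).choose_spec.choose a

lemma SFOver.isActEnd (F : SFOver V) : IsActEnd F.F.functor F.tan.X F.tanAct :=
  (exists_isActEnd F.F.functor F.dual).choose_spec.choose_spec

lemma SFOver.tan_hom_ext {F : SFOver V} {H : WBA V} {f g : H ⟶ F.tan}
    (h : ∀ a, f.hom ▷ F.F.functor.obj a ≫ F.tanAct a = g.hom ▷ F.F.functor.obj a ≫ F.tanAct a) :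
    f = g :=
  WBA.Hom.ext (F.isActEnd.ext₁ h)

/-- The map of Tannaka objects given by restriction of the action. -/
def SFOver.tanMap {F G : SFOver V} (f : F ⟶ G) : G.tan ⟶ F.tan :=
  letI h := IsActEnd.exists_map G.isActEnd F.isActEnd (SFOver.Hom.compIso f)
  WBA.Hom.mk (H := G.tan) (J := F.tan) h.choose
    (weak := IsActEnd.isWeakHom G.isActEnd F.isActEnd (SFOver.Hom.compIso f) h.choose_spec)

lemma SFOver.tanMap_act {F G : SFOver V} (f : F ⟶ G) (a : F.A) :
    (SFOver.tanMap f).hom ▷ F.F.functor.obj a ≫ F.tanAct a =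
      G.tan.X ◁ eqToHom (SFOver.Hom.obj_eq f a).symm ≫ G.tanAct (f.H.functor.obj a) ≫
        eqToHom (SFOver.Hom.obj_eq f a) :=
  (IsActEnd.exists_map G.isActEnd F.isActEnd (SFOver.Hom.compIso f)).choose_spec a

lemma SFOver.tanMap_id (F : SFOver V) : SFOver.tanMap (𝟙 F) = 𝟙 F.tan :=
  SFOver.tan_hom_ext fun a => by
    rw [SFOver.tanMap_act]
    change F.tan.X ◁ 𝟙 _ ≫ F.tanAct a ≫ 𝟙 _ = 𝟙 F.tan.X ▷ _ ≫ F.tanAct a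
    simp

lemma SFOver.tanMap_comp {F G K : SFOver V} (f : F ⟶ G) (g : G ⟶ K) :
    SFOver.tanMap (f ≫ g) = SFOver.tanMap g ≫ SFOver.tanMap f :=
  SFOver.tan_hom_ext fun a => by
    change _ = ((SFOver.tanMap g).hom ≫ (SFOver.tanMap f).hom) ▷ _ ≫ _
    have hg := SFOver.tanMap_act g (f.H.functor.obj a)
    rw [comp_whiskerRight, Category.assoc, SFOver.tanMap_act f, ← whisker_exchange_assoc,
      reassoc_of% hg, SFOver.tanMap_act]
    simp only [eqToHom_trans, ← MonoidalCategory.whiskerLeft_comp_assoc]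
    rfl

variable (V) in
/-- The Tannaka functor. -/
def tannakaFunctor : TannakaFunctor V where
  functor :=
    { obj := fun F => op F.tan
      map := fun f => (SFOver.tanMap f).op
      map_id := fun F => congrArg Quiver.Hom.op (SFOver.tanMap_id F)
      map_comp := fun f g => congrArg Quiver.Hom.op (SFOver.tanMap_comp f g) }
  str F := F.isActEnd.tannakaStructure
  map_act {F G} f a := by
    change _ ≫ F.act (F.proj (F.tanAct a)) = _ ≫ G.act (G.proj (G.tanAct _)) ≫ _
    rw [F.act_proj, G.act_proj]
    exact SFOver.tanMap_act f a

end Complete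

end TannakaFunctor

end Tannaka

namespace Tannaka

open Functor.LaxMonoidal Functor.OplaxMonoidal

section Unit

variable {V : Type u} [Category.{v} V] [MonoidalCategory V] [BraidedCategory V]

lemma hat_orbit {H X : V} (x : H ⊗ X ⟶ X) (n : 𝟙_ V ⟶ X) (Z : V) :
    hat₁₁ (orbit x n) Z = H ◃ hat₀₁ n Z ≫ hat₂₁ x Z := by
  simp only [orbit, hat₁₁, hat₂₁, hat₀₁, lw, MonoidalCategory.whiskerLeft_comp,
    comp_whiskerRight, Category.assoc]
  monoidal

namespace IsActEnd

variable {A : Type u₁} [Category.{v₁} A] [MonoidalCategory A] {P : A ⥤ V} [SepFrobenius P]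
  {T : V} {x : ∀ a, T ⊗ P.obj a ⟶ P.obj a} (E : IsActEnd P T x)

lemma tact_μ (a b : A) :
    (E.comul ▷ (P.obj a ⊗ P.obj b) ≫ act₂ (x a) (x b)) ≫ μ P a b = T ◁ μ P a b ≫ x (a ⊗ b) := by
  rw [E.comul_act, Category.assoc, Category.assoc, SepFrobenius.separable, Category.comp_id]

lemma δ_tact (a b : A) : x (a ⊗ b) ≫ δ P a b =
    T ◁ δ P a b ≫ E.comul ▷ (P.obj a ⊗ P.obj b) ≫ act₂ (x a) (x b) := by
  rw [E.comul_act, ← MonoidalCategory.whiskerLeft_comp_assoc, SepFrobenius.separable,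
    MonoidalCategory.whiskerLeft_id, Category.id_comp]

lemma idemT_orbit : E.t ≫ orbit (x (𝟙_ A)) (ε P) = orbit (x (𝟙_ A)) (ε P) := by
  refine hat₁₁_congr fun Z => ?_
  have h := hat_μ_ε P (𝟙_ A) Z
  rw [hat₁₁_comp, hat_orbit, hat₁₁_nat_assoc, E.idemT_act, unitors_equal, hat₂₁_comp,
    Category.assoc]
  calc _ = T ◃ hat₀₁ (ε P) Z ≫ hat₂₁ (x (𝟙_ A)) Z ≫ P.obj (𝟙_ A) ◃ hat₀₁ (ε P) Z ≫
          hat₂₁ (μ P (𝟙_ A) (𝟙_ A)) Z ≫ hat₁₁ (P.map (ρ_ (𝟙_ A)).hom) Z := by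
        rw [hat₂₁_nat_assoc, lw_comp_assoc, lw_comp_assoc, hat₀₁_nat]
    _ = _ := by rw [h, Category.comp_id]

lemma act_η : x (𝟙_ A) ≫ η P = E.r ▷ _ ≫ x (𝟙_ A) ≫ η P := by
  refine hat₂₀_congr fun Z => ?_
  have e : hat₂₀ (E.r ▷ P.obj (𝟙_ A) ≫ x (𝟙_ A) ≫ η P) Z =
      hat₁₁ E.r _ ≫ hat₂₁ (x (𝟙_ A)) _ ≫ hat₁₀ (η P) Z := by
    simp [hat₂₀, hat₁₁, hat₂₁, hat₁₀]
  have h₁ := swap_hat₁₀ T (P.obj (𝟙_ A) ⊗ Z) (η P)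
  have h₂ := hat_δ_η P (𝟙_ A) Z
  rw [e, hat₂₀_comp, reassoc_of% (E.idemR_act (𝟙_ A) Z), ← hat₁₀_nat, reassoc_of% h₁,
    lw_comp_assoc, hat₁₂_comp, ← unitors_inv_equal, Category.assoc, h₂]
  simp

end IsActEnd

end Unit

section Adjunction

variable {V : Type u} [Category.{v} V] [MonoidalCategory V] [BraidedCategory V]
  [MonoidallyComplete V]

instance : IsIdempotentComplete V := MonoidallyComplete.isIdempotentComplete

/-- The values of `F` as modules over the Tannaka object. -/
abbrev SFOver.toDMod (F : SFOver V) : F.A ⥤ DMod F.tan where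
  obj a := dmodMk (F.dual a) (F.tanAct a) (F.isActEnd.act_isAssocAct a) (F.isActEnd.unitAct_act a)
  map f := dmodHomMk (F.F.functor.map f) (F.isActEnd.natural f)
  map_id a := (DMod.forget _).map_injective (F.F.functor.map_id a)
  map_comp f g := (DMod.forget _).map_injective (F.F.functor.map_comp f g)

variable [EssentiallySmall.{v} (dualizable V).FullSubcategory]

/-- The canonical functor to modules lifts the separable Frobenius structure of `F`. -/
abbrev SFOver.toDModLift (F : SFOver V) :
    FrobeniusLift F.toDMod (DMod.forget F.tan) F.F.sf :=
  dmodLift F.toDMod F.F.sf (fun a b => F.isActEnd.tact_μ a b) (fun a b => F.isActEnd.δ_tact a b)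
    F.isActEnd.idemT_orbit F.isActEnd.act_η

/-- The unit of the Tannaka adjunction. -/
def SFOver.toRep (F : SFOver V) : F ⟶ (rep F.tan).toSFOver :=
  SFOver.Hom.mk (F := F) (G := (rep F.tan).toSFOver)
    F.toDModLift.toSFFunctor F.toDModLift.toSFFunctor_comp

lemma exists_toTan (H : WBA V) : ∃ c : H.X ⟶ (rep H).toSFOver.tan.X, ∀ a : DMod H,
    c ▷ (DMod.forget H).obj a ≫ (rep H).toSFOver.tanAct a = a.act :=
  (rep H).toSFOver.isActEnd.exists_lift₁ (fun a : DMod H => a.act) (fun f => DMod.act_hom f)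

section Counit

variable {H : WBA V} {T : V} {x : ∀ a : DMod H, T ⊗ (DMod.forget H).obj a ⟶ (DMod.forget H).obj a}
  (E : IsActEnd (DMod.forget H) T x) {c : H.X ⟶ T}

lemma IsActEnd.mul_lift_act
    (hc : ∀ a : DMod H, c ▷ (DMod.forget H).obj a ≫ x a = a.act) :
    MonObj.mul (X := H.X) ≫ c = (c ⊗ₘ c) ≫ E.mul := by
  refine E.ext₁ fun a => ?_
  have h : MonObj.mul (X := H.X) ▷ _ ≫ a.act = (α_ _ _ _).hom ≫ H.X ◁ a.act ≫ a.act :=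
    a.act_isAssocAct
  rw [comp_whiskerRight_assoc, comp_whiskerRight_assoc, hc, E.mul_act, h, ← hc,
    MonoidalCategory.tensorHom_def, comp_whiskerRight_assoc, associator_naturality_middle_assoc,
    associator_naturality_left_assoc, ← whisker_exchange_assoc,
    MonoidalCategory.whiskerLeft_comp_assoc, ← whisker_exchange_assoc]

lemma IsActEnd.one_lift_act
    (hc : ∀ a : DMod H, c ▷ (DMod.forget H).obj a ≫ x a = a.act) :
    MonObj.one (X := H.X) ≫ c = E.one := by
  refine E.ext₁ fun a => ?_
  have h := a.unitAct_act
  rw [unitAct, Iso.inv_comp_eq, Category.comp_id] at h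
  rw [comp_whiskerRight_assoc, hc, E.one_act, h]

lemma IsActEnd.lift_act_comul
    (hc : ∀ a : DMod H, c ▷ (DMod.forget H).obj a ≫ x a = a.act) :
    c ≫ E.comul = ComonObj.comul (X := H.X) ≫ (c ⊗ₘ c) := by
  refine E.ext₂ fun a b => ?_
  have h₁ := (dmodTensorPres a b).p_act
  have h₂ := (dmodTensorPres a b).p_i
  rw [dmodTensorPres_p, dmodTensorPres_i] at h₂
  rw [dmodTensorPres_p] at h₁
  rw [comp_whiskerRight_assoc, comp_whiskerRight_assoc, ← act₂_map, hc, hc, E.comul_act,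
    ← whisker_exchange_assoc, ← Category.assoc (c ▷ _), hc, reassoc_of% h₁, h₂]
  exact (tact_isAssocAct a.act_isAssocAct b.act_isAssocAct).act_unitAct

lemma IsActEnd.lift_act_counit
    (hc : ∀ a : DMod H, c ▷ (DMod.forget H).obj a ≫ x a = a.act) :
    c ≫ IsActEnd.counit (DMod.forget H) x = ComonObj.counit (X := H.X) := by
  have h₁ := orbit_one (dmodUnitPres H)
  have h₂ := (dmodUnitPres H).p_i
  rw [unitAct_idemTAct] at h₂
  rw [IsActEnd.counit, rightUnitor_inv_naturality_assoc, ← whisker_exchange_assoc,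
    ← Category.assoc (c ▷ _), hc]
  have h₃ : (ρ_ H.X).inv ≫ H.X ◁ ε (DMod.forget H) ≫ (𝟙_ (DMod H)).act = (dmodUnitPres H).p := h₁
  rw [reassoc_of% h₃, forget_η, reassoc_of% h₂, idemT_counit_eq]

lemma IsActEnd.isWeakHom_lift_act
    (hc : ∀ a : DMod H, c ▷ (DMod.forget H).obj a ≫ x a = a.act) :
    @IsWeakHom _ _ _ _ H.X T _ E.weakBimonObj c := by
  let := E.weakBimonObj
  have : IsMonHom c := ⟨E.one_lift_act hc, E.mul_lift_act hc⟩
  have : IsComonHom c := ⟨lift_act_counit hc, E.lift_act_comul hc⟩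
  exact isWeakHom_of_strict c

end Counit

/-- The counit of the Tannaka adjunction. -/
def toTan (H : WBA V) : H ⟶ (rep H).toSFOver.tan :=
  WBA.Hom.mk (H := H) (J := (rep H).toSFOver.tan) (exists_toTan H).choose
    (weak := IsActEnd.isWeakHom_lift_act (H := H) (rep H).toSFOver.isActEnd
      (exists_toTan H).choose_spec)

lemma toTan_act (H : WBA V) (a : DMod H) :
    (toTan H).hom ▷ (DMod.forget H).obj a ≫ (rep H).toSFOver.tanAct a = a.act :=
  (exists_toTan H).choose_spec a

lemma heq_conj_eqToHom {T X Y : V} (e : X = Y) (x : T ⊗ X ⟶ X) :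
    HEq x (T ◁ eqToHom e.symm ≫ x ≫ eqToHom e) := by
  subst e
  simp

lemma conj_eqToHom_self {T X : V} (e e' : X = X) (x : T ⊗ X ⟶ X) :
    T ◁ eqToHom e ≫ x ≫ eqToHom e' = x := by
  simp

lemma toRep_naturality {F G : SFOver V} (f : F ⟶ G) :
    f ≫ G.toRep = F.toRep ≫ restr (SFOver.tanMap f) :=
  rep_hom_ext fun a => by
    change HEq (G.tanAct (f.H.functor.obj a)) ((SFOver.tanMap f).hom ▷ _ ≫ F.tanAct a)
    rw [SFOver.tanMap_act]
    exact heq_conj_eqToHom _ _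

lemma toTan_naturality {H J : WBA V} (g : H ⟶ J) :
    g ≫ toTan J = toTan H ≫ SFOver.tanMap (restr g) :=
  SFOver.tan_hom_ext fun a => by
    have h₁ := toTan_act J a
    have h₂ := toTan_act H ((restr g).H.functor.obj a)
    have h₃ := SFOver.tanMap_act (restr g) a
    change (g.hom ≫ (toTan J).hom) ▷ _ ≫ _ =
      ((toTan H).hom ≫ (SFOver.tanMap (restr g)).hom) ▷ _ ≫ _
    rw [comp_whiskerRight_assoc, comp_whiskerRight_assoc, h₃]
    refine (congrArg (g.hom ▷ (DMod.forget J).obj a ≫ ·) h₁).trans ?_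
    exact h₂.symm.trans (congrArg ((toTan H).hom ▷ (DMod.forget J).obj a ≫ ·)
      (conj_eqToHom_self _ _ _).symm)

lemma toTan_tanMap_toRep (F : SFOver V) : toTan F.tan ≫ SFOver.tanMap F.toRep = 𝟙 F.tan :=
  SFOver.tan_hom_ext fun a => by
    have h₂ := toTan_act F.tan (F.toRep.H.functor.obj a)
    have h₃ := SFOver.tanMap_act F.toRep a
    change ((toTan F.tan).hom ≫ (SFOver.tanMap F.toRep).hom) ▷ _ ≫ _ = 𝟙 F.tan.X ▷ _ ≫ _
    rw [comp_whiskerRight_assoc, h₃, id_whiskerRight, Category.id_comp]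
    refine Eq.trans ?_ h₂
    exact congrArg ((toTan F.tan).hom ▷ F.F.functor.obj a ≫ ·) (conj_eqToHom_self _ _ _)

lemma toRep_restr_toTan (H : WBA V) :
    (rep H).toSFOver.toRep ≫ restr (toTan H) = 𝟙 (rep H).toSFOver :=
  rep_hom_ext fun a => heq_of_eq (toTan_act H a)

variable (V) in
/-- The Tannaka adjunction. -/
def tannakaAdjunction : (tannakaFunctor V).functor ⊣ (repFunctor V).functor :=
  Adjunction.mkOfUnitCounit
    { unit :=
        { app := fun F => F.toRep
          naturality := fun _ _ f => toRep_naturality f }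
      counit :=
        { app := fun H => (toTan H.unop).op
          naturality := fun _ _ g => congrArg Quiver.Hom.op (toTan_naturality g.unop).symm }
      left_triangle := by
        ext F
        refine (congrArg (_ ≫ ·) (Category.id_comp _)).trans ?_
        exact congrArg Quiver.Hom.op (toTan_tanMap_toRep F)
      right_triangle := by
        ext H
        refine (congrArg (_ ≫ ·) (Category.id_comp _)).trans ?_
        exact toRep_restr_toTan H.unop }

lemma isTannakaAdjunction : IsTannakaAdjunction (tannakaAdjunction V) where
  unit_act F a := by
    change F.tanAct a = F.tan.X ◁ 𝟙 _ ≫ F.act (F.proj (F.tanAct a)) ≫ 𝟙 _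
    rw [F.act_proj, MonoidalCategory.whiskerLeft_id, Category.id_comp, Category.comp_id]
  counit_act H a := by
    refine Eq.trans ?_ (toTan_act H a)
    exact congrArg ((toTan H).hom ▷ (DMod.forget H).obj a ≫ ·)
      ((rep H).toSFOver.act_proj ((rep H).toSFOver.tanAct a))

end Adjunction

end Tannaka

namespace Tannaka

open Functor.LaxMonoidal Functor.OplaxMonoidal

section Strong

variable {A : Type u₁} [Category.{v₁} A] [MonoidalCategory A]
  {B : Type u₂} [Category.{v₂} B] [MonoidalCategory B]
  {C : Type u₃} [Category.{v₃} C] [MonoidalCategory C]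

/-- A separable Frobenius functor is strong if it becomes so after composition with a faithful
strong functor. -/
lemma IsStrong.of_comp {K : A ⥤ B} {Q : B ⥤ C} [SepFrobenius K] [SepFrobenius Q] [Q.Faithful]
    (h : IsStrong (K ⋙ Q)) (hQ : IsStrong Q) : IsStrong K where
  μ_δ X Y := by
    apply Q.map_injective
    have h₁ := h.μ_δ X Y
    rw [comp_μ, comp_δ] at h₁
    have h₂ := SepFrobenius.separable (F := Q) (K.obj X) (K.obj Y)
    calc Q.map (μ K X Y ≫ δ K X Y) = (δ Q _ _ ≫ μ Q _ _) ≫ Q.map (μ K X Y ≫ δ K X Y) ≫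
          (δ Q _ _ ≫ μ Q _ _) := by rw [h₂]; simp
      _ = δ Q _ _ ≫ ((μ Q _ _ ≫ Q.map (μ K X Y)) ≫ Q.map (δ K X Y) ≫ δ Q _ _) ≫ μ Q _ _ := by simp
      _ = _ := by rw [h₁]; simp [h₂]
  ε_η := by
    apply Q.map_injective
    have h₁ := h.ε_η
    rw [comp_ε, comp_η] at h₁
    have h₂ := hQ.η_ε
    calc Q.map (ε K ≫ η K) = (η Q ≫ ε Q) ≫ Q.map (ε K ≫ η K) ≫ (η Q ≫ ε Q) := by rw [h₂]; simp
      _ = η Q ≫ ((ε Q ≫ Q.map (ε K)) ≫ Q.map (η K) ≫ η Q) ≫ ε Q := by simp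
      _ = _ := by rw [h₁]; simp [h₂]
  η_ε := by
    apply Q.map_injective
    have h₁ := h.η_ε
    rw [comp_ε, comp_η, Category.assoc, reassoc_of% hQ.η_ε, ← Q.map_comp] at h₁
    rw [h₁, CategoryTheory.Functor.map_id]
    rfl

variable {V : Type u} [Category.{v} V] [MonoidalCategory V]

lemma SFOver.Hom.isStrong {F G : SFOver V} (f : F ⟶ G) [G.F.functor.Faithful]
    (hF : IsStrong F.F.functor) (hG : IsStrong G.F.functor) : IsStrong f.H.functor := by
  refine IsStrong.of_comp (Q := G.F.functor) ?_ hG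
  have h : ∀ K : SFFunctor F.A V, K = F.F → IsStrong K.functor := by
    rintro _ rfl
    exact hF
  exact h _ f.comm

end Strong

section Bialgebra

open scoped MonObj ComonObj

variable {V : Type u} [Category.{v} V] [MonoidalCategory V] [BraidedCategory V]

/-- The conditions for a weak bialgebra to be a bialgebra. -/
structure IsBialgebra (M : V) [WeakBimonObj M] : Prop where
  one_comul : η[M] ≫ Δ[M] = (λ_ (𝟙_ V)).inv ≫ (η[M] ⊗ₘ η[M])
  mul_counit : μ[M] ≫ ε[M] = (ε[M] ⊗ₘ ε[M]) ≫ (λ_ (𝟙_ V)).hom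
  one_counit : η[M] ≫ ε[M] = 𝟙 (𝟙_ V)

/-- The bialgebra given by a weak bialgebra. -/
abbrev IsBialgebra.bimonObj {M : V} [WeakBimonObj M] (h : IsBialgebra M) : BimonObj M where
  mul_comul := WeakBimonObj.mul_comul
  one_comul := h.one_comul.trans MonObj.tensorObj.one_def.symm
  mul_counit := h.mul_counit
  one_counit := h.one_counit

lemma isBialgebra_of_bimonObj (M : V) [BimonObj M] :
    @IsBialgebra _ _ _ _ M (weakBimonObjOfBimonObj M) :=
  let _ := weakBimonObjOfBimonObj M
  { one_comul := Bimon.one_comul M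
    mul_counit := Bimon.mul_counit M
    one_counit := BimonObj.one_counit M }

/-- A weak morphism between bialgebras is a morphism of bialgebras. -/
lemma IsWeakHom.isBimonHom {M N : V} [BimonObj M] [BimonObj N] (f : M ⟶ N)
    (h : @IsWeakHom _ _ _ _ M N (weakBimonObjOfBimonObj M) (weakBimonObjOfBimonObj N) f) :
    IsBimonHom f where
  one_hom := h.one_hom
  mul_hom := h.mul_hom
  hom_counit := by
    have h₁ := h.idemT_comm =≫ ε[N]
    have h₂ : η[M] ≫ f = η[N] := h.one_hom
    rw [idemT_of_bimonObj, idemT_of_bimonObj, Category.assoc, Category.assoc, Category.assoc,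
      Category.assoc, reassoc_of% h₂, BimonObj.one_counit, Category.comp_id, Category.comp_id] at h₁
    exact h₁.symm
  hom_comul := by
    rw [h.comul_left, Bimon.one_comul]
    have h₁ : sqMul N ((λ_ (𝟙_ V)).inv ≫ (η[N] ⊗ₘ η[N])) (Δ[M] ≫ (f ⊗ₘ f)) =
        (𝟙_ V ◁ (Δ[M] ≫ (f ⊗ₘ f))) ≫ η[N ⊗ N] ▷ (N ⊗ N) ≫ μ[N ⊗ N] := by
      rw [MonObj.tensorObj.one_def, MonObj.tensorObj.mul_def, sqMul,
        MonoidalCategory.tensorHom_def', Category.assoc]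
    rw [h₁, MonObj.one_mul, leftUnitor_naturality, Iso.inv_hom_id_assoc]

variable [IsIdempotentComplete V] [EssentiallySmall.{v} (dualizable V).FullSubcategory]

/-- The forgetful functor of modules over a bialgebra is strong. -/
lemma IsBialgebra.isStrong_forget {H : WBA V} (h : IsBialgebra H.X) :
    IsStrong (DMod.forget H) where
  μ_δ a b := by
    refine ((rep H).μ_δ a b).trans ?_
    have h₁ := a.unitAct_act
    have h₂ := b.unitAct_act
    rw [unitAct, Iso.inv_comp_eq, Category.comp_id] at h₁ h₂
    rw [DMod.nabla, h.one_comul, comp_whiskerRight, Category.assoc, ← act₂_map, h₁, h₂, act₂,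
      ← tensor_left_unitality, Iso.inv_hom_id]
  ε_η := by
    have h₂ := (dmodUnitPres H).p_i
    rw [unitAct_idemTAct] at h₂
    rw [forget_ε, forget_η, Category.assoc, reassoc_of% h₂, idemT_counit_eq, h.one_counit]
  η_ε := by
    have h₂ := (dmodUnitPres H).p_i
    have h₃ : idemT H.X = ε[H.X] ≫ η[H.X] := @idemT_of_bimonObj _ _ _ _ H.X h.bimonObj
    rw [unitAct_idemTAct, h₃] at h₂
    rw [forget_ε, forget_η, Category.assoc, ← Category.assoc ε[H.X], ← h₂, Category.assoc,
      (dmodUnitPres H).i_p, Category.comp_id, (dmodUnitPres H).i_p]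

end Bialgebra

section Tan

variable {V : Type u} [Category.{v} V] [MonoidalCategory V] [BraidedCategory V]
  {A : Type u₁} [Category.{v₁} A] [MonoidalCategory A] {P : A ⥤ V} [SepFrobenius P]
  {T : V} {x : ∀ a, T ⊗ P.obj a ⟶ P.obj a} (E : IsActEnd P T x)

/-- The Tannaka object of a strong functor is a bialgebra. -/
lemma IsActEnd.isBialgebra (h : IsStrong P) : @IsBialgebra _ _ _ _ T E.weakBimonObj :=
  let _ := E.weakBimonObj
  { one_comul := E.ext₂ fun a b => by
      change (E.one ≫ E.comul) ▷ _ ≫ _ = ((λ_ (𝟙_ V)).inv ≫ (E.one ⊗ₘ E.one)) ▷ _ ≫ _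
      have h₁ := h.μ_δ a b
      have h₂ := E.one_act (a ⊗ b)
      rw [comp_whiskerRight_assoc, comp_whiskerRight_assoc, ← act₂_map, E.one_act, E.one_act,
        E.comul_act, act₂, ← tensor_left_unitality, ← whisker_exchange_assoc, reassoc_of% h₂,
        leftUnitor_naturality_assoc, h₁, Category.comp_id]
    mul_counit := hat₂₀_congr fun Z => by
      change hat₂₀ (E.mul ≫ counit P x) Z = hat₂₀ ((counit P x ⊗ₘ counit P x) ≫ _) Z
      have h₁ : hat₁₀ (η P) Z ≫ hat₀₁ (ε P) Z = 𝟙 _ := by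
        rw [← hat₁₁_zero, h.η_ε, hat₁₁_id]
      have e : hat₂₀ ((counit P x ⊗ₘ counit P x) ≫ (λ_ (𝟙_ V)).hom) Z =
          T ◃ hat₁₀ (counit P x) Z ≫ hat₁₀ (counit P x) Z := by
        simp only [hat₂₀, hat₁₀, lw, MonoidalCategory.tensorHom_def', comp_whiskerRight,
          MonoidalCategory.whiskerLeft_comp, Category.assoc]
        monoidal
      rw [hat₂₀_comp, E.hat_mul_counit_eq, e, hat_counit_eq, lw_comp_assoc]
      simp only [Category.assoc]
      rw [h₁, Category.comp_id]
    one_counit := by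
      change E.one ≫ counit P x = _
      have h₁ := E.one_act (𝟙_ A)
      rw [counit, rightUnitor_inv_naturality_assoc, ← whisker_exchange_assoc, reassoc_of% h₁,
        leftUnitor_naturality_assoc, h.ε_η, Category.comp_id, ← unitors_inv_equal,
        Iso.inv_hom_id] }

end Tan

end Tannaka

namespace Tannaka

section WeakHopfIdentities

open scoped MonObj ComonObj

variable {V : Type u} [Category.{v} V] [MonoidalCategory V] [BraidedCategory V] (H : V)

local notation "𝐦" => hat₂₁ (MonObj.mul (X := H))
local notation "𝐮" => hat₀₁ (MonObj.one (X := H))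
local notation "𝐝" => hat₁₂ (ComonObj.comul (X := H))
local notation "𝐞" => hat₁₀ (ComonObj.counit (X := H))
local notation "𝐭" => hat₁₁ (idemT H)
local notation "𝐫" => hat₁₁ (idemR H)
local notation "𝐱" => swap H H
local notation "𝐒" => hat₁₁ (WeakHopfObj.antipode (M := H))

section WeakBialgebra

variable [WeakBimonObj H] (Z : V)

/-- `r(r(a)b) = r(ab)`. -/
lemma idemR_mul_idemR : 𝐫 (H ⊗ Z) ≫ 𝐦 Z ≫ 𝐫 Z = 𝐦 Z ≫ 𝐫 Z := by
  have h₁ := hat₂₁_swap H (H ⊗ Z) μ[H]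
  have h₂ := hat₁₁_swap H (H ⊗ H ⊗ Z) (idemR H)
  have h₃ := idemR_mul_counit H Z
  have e : 𝐦 Z ≫ 𝐫 Z = H ◃ H ◃ (𝐮 Z ≫ 𝐝 Z) ≫ H ◃ 𝐱 _ ≫ 𝐱 _ ≫ H ◃ (H ◃ 𝐦 Z ≫ 𝐦 Z ≫ 𝐞 Z) := by
    calc _ = H ◃ H ◃ (𝐮 Z ≫ 𝐝 Z) ≫ (𝐦 _ ≫ 𝐱 _) ≫ H ◃ (𝐦 Z ≫ 𝐞 Z) := by
          rw [hat_idemR]; simp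
      _ = _ := by rw [h₁]; simp
  rw [e]
  calc _ = H ◃ H ◃ (𝐮 Z ≫ 𝐝 Z) ≫ H ◃ 𝐱 _ ≫ (𝐫 _ ≫ 𝐱 _) ≫ H ◃ (H ◃ 𝐦 Z ≫ 𝐦 Z ≫ 𝐞 Z) := by
        simp
    _ = H ◃ H ◃ (𝐮 Z ≫ 𝐝 Z) ≫ H ◃ 𝐱 _ ≫ 𝐱 _ ≫ H ◃ (H ◃ 𝐦 Z ≫ 𝐫 _ ≫ 𝐦 Z ≫ 𝐞 Z) := by
        rw [h₂]; simp
    _ = _ := by rw [h₃]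

lemma one_idemR : 𝐮 Z ≫ 𝐫 Z = 𝐮 Z := by
  have h₁ := hat₀₁_swap H (H ⊗ Z) η[H]
  rw [hat_idemR]
  calc _ = 𝐮 Z ≫ 𝐝 Z ≫ (𝐮 _ ≫ 𝐱 _) ≫ H ◃ (𝐦 Z ≫ 𝐞 Z) := by simp
    _ = _ := by rw [h₁]; simp

lemma idemR_idemR : 𝐫 Z ≫ 𝐫 Z = 𝐫 Z := by
  have h := H ◃ 𝐮 Z ≫= idemR_mul_idemR H Z
  rwa [← hat₁₁_nat_assoc, hat_mul_one_assoc] at h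

lemma comul_oneComulMul : H ◃ hat₁₂ (oneComulMul H) Z ≫ 𝐝 _ ≫ H ◃ (𝐱 _ ≫ H ◃ 𝐦 Z) ≫ 𝐦 _ =
    𝐝 (H ⊗ Z) ≫ H ◃ 𝐱 Z ≫ 𝐦 _ := by
  have h₁ := hat₂₁_swap H Z μ[H]
  have h₂ := lw_hat₂₁_swap H (H ⊗ Z) μ[H]
  rw [hat_oneComulMul]
  symm
  calc _ = H ◃ 𝐮 _ ≫ (𝐦 _ ≫ 𝐝 _) ≫ H ◃ 𝐱 Z ≫ 𝐦 _ := by simp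
    _ = H ◃ (𝐮 _ ≫ 𝐝 _) ≫ 𝐝 _ ≫ H ◃ (𝐱 _ ≫ H ◃ (𝐦 _ ≫ 𝐱 Z)) ≫ H ◃ 𝐦 _ ≫ 𝐦 _ := by
        rw [hat_mul_comul]; simp
    _ = H ◃ (𝐮 _ ≫ 𝐝 _ ≫ H ◃ 𝐱 Z) ≫ 𝐝 _ ≫
          H ◃ ((𝐱 _ ≫ H ◃ 𝐱 _ ≫ 𝐦 _) ≫ H ◃ 𝐦 Z) ≫ 𝐦 _ := by
        rw [h₁]; simp
    _ = _ := by rw [← h₂]; simp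

/-- `Δ(h t(k)) = h₁t(k) ⊗ h₂`. -/
lemma idemT_mul_comul :
    H ◃ 𝐭 Z ≫ 𝐦 Z ≫ 𝐝 Z = H ◃ 𝐭 Z ≫ 𝐝 (H ⊗ Z) ≫ H ◃ 𝐱 Z ≫ 𝐦 _ := by
  calc _ = H ◃ (𝐭 Z ≫ 𝐝 Z) ≫ 𝐝 _ ≫ H ◃ (𝐱 _ ≫ H ◃ 𝐦 Z) ≫ 𝐦 _ := by
        rw [hat_mul_comul]; simp
    _ = _ := by rw [idemT_comul, ← comul_oneComulMul]; simp

lemma idemR_comul_aux : 𝐫 Z ≫ 𝐝 Z =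
    H ◃ (𝐮 Z ≫ 𝐝 Z ≫ H ◃ 𝐝 Z) ≫ 𝐱 _ ≫ H ◃ (𝐱 _ ≫ H ◃ (𝐦 _ ≫ 𝐞 _)) := by
  have h₁ := lw_hat₁₂_swap H (H ⊗ Z) Δ[H]
  calc _ = H ◃ (𝐮 Z ≫ 𝐝 Z) ≫ (𝐱 _ ≫ 𝐝 _) ≫ H ◃ H ◃ (𝐦 Z ≫ 𝐞 Z) := by
        rw [hat_idemR]; simp
    _ = _ := by rw [← h₁]; simp

/-- `Δ(r(h)) = 1₁ ⊗ 1₂r(h)`. -/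
lemma idemR_comul : 𝐫 Z ≫ 𝐝 Z = 𝐫 Z ≫ 𝐮 (H ⊗ Z) ≫ 𝐝 (H ⊗ Z) ≫ H ◃ 𝐦 Z := by
  have h₁ := lw_hat₀₂_swap H (H ⊗ H ⊗ Z) (η[H] ≫ Δ[H])
  have h₂ := lw_hat₂₁_swap H (H ⊗ Z) μ[H]
  simp only [hat₀₂_comp, Category.assoc] at h₁
  rw [idemR_comul_aux, ← hat_weak_unit, hat_idemR]
  calc _ = H ◃ (𝐮 Z ≫ 𝐝 Z) ≫ H ◃ (𝐮 _ ≫ 𝐝 _) ≫ 𝐱 _ ≫ H ◃ ((H ◃ 𝐦 _ ≫ 𝐱 _) ≫ H ◃ (𝐦 _ ≫ 𝐞 _)) := by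
        simp
    _ = H ◃ (𝐮 Z ≫ 𝐝 Z) ≫ (H ◃ (𝐮 _ ≫ 𝐝 _) ≫ 𝐱 _ ≫ H ◃ 𝐱 _) ≫ H ◃ H ◃ (𝐱 _ ≫ H ◃ (𝐦 _ ≫ 𝐞 _)) ≫
          H ◃ 𝐦 _ := by
        rw [h₂]; simp
    _ = _ := by rw [h₁]; simp

lemma oneComulMul_mul_counit :
    H ◃ hat₁₂ (oneComulMul H) Z ≫ 𝐱 _ ≫ H ◃ (𝐦 Z ≫ 𝐞 Z) = 𝐫 (H ⊗ Z) ≫ 𝐦 Z := by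
  have h₁ := lw_hat₂₁_swap H (H ⊗ Z) μ[H]
  have h₂ := swap_swap_lw_hat₂₀ H Z (μ[H] ≫ ε[H])
  rw [hat₂₀_comp, hat₂₀_comp] at h₂
  rw [hat_oneComulMul, hat_idemR]
  calc _ = H ◃ (𝐮 _ ≫ 𝐝 _ ≫ H ◃ 𝐱 Z) ≫ (H ◃ 𝐦 _ ≫ 𝐱 _) ≫ H ◃ (𝐦 Z ≫ 𝐞 Z) := by simp
    _ = H ◃ (𝐮 _ ≫ 𝐝 _) ≫ 𝐱 _ ≫ H ◃ (H ◃ 𝐱 Z ≫ 𝐱 _ ≫ H ◃ (𝐦 Z ≫ 𝐞 Z)) ≫ 𝐦 _ := by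
        rw [h₁]; simp
    _ = _ := by rw [h₂]; simp

/-- `Δ(r(h)) = 1₁ ⊗ r(h)1₂`. -/
lemma idemR_comul' : 𝐫 Z ≫ 𝐝 Z = H ◃ (𝐮 Z ≫ 𝐝 Z) ≫ 𝐱 _ ≫ H ◃ (𝐫 _ ≫ 𝐦 _) := by
  rw [idemR_comul_aux, ← weak_unit_swap, ← hat_oneComulMul, ← oneComulMul_mul_counit]
  simp

/-- `Δ(r(h)k) = k₁ ⊗ r(h)k₂`. -/
lemma idemR_mul_comul :
    𝐫 (H ⊗ Z) ≫ 𝐦 Z ≫ 𝐝 Z = H ◃ 𝐝 Z ≫ 𝐱 _ ≫ H ◃ (𝐫 _ ≫ 𝐦 Z) := by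
  have h₁ := lw_hat₂₁_swap H (H ⊗ Z) μ[H]
  have h₂ := hat₂₁_swap H (H ⊗ Z) μ[H]
  have h₃ := hat₁₁_swap H (H ⊗ H ⊗ Z) (idemR H)
  calc _ = H ◃ 𝐝 Z ≫ (𝐫 _ ≫ 𝐝 _) ≫ H ◃ (𝐱 _ ≫ H ◃ 𝐦 Z) ≫ 𝐦 _ := by
        rw [hat_mul_comul]; simp
    _ = H ◃ 𝐝 Z ≫ H ◃ (𝐮 _ ≫ 𝐝 _) ≫ 𝐱 _ ≫ H ◃ (𝐫 _ ≫ (𝐦 _ ≫ 𝐱 _) ≫ H ◃ 𝐦 Z) ≫ 𝐦 _ := by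
        rw [idemR_comul']; simp
    _ = H ◃ 𝐝 Z ≫ H ◃ (𝐮 _ ≫ 𝐝 _) ≫ 𝐱 _ ≫ H ◃ (H ◃ 𝐱 _ ≫ (𝐫 _ ≫ 𝐱 _) ≫ H ◃ (𝐦 _ ≫ 𝐦 Z)) ≫ 𝐦 _ := by
        rw [h₂]; simp
    _ = H ◃ (𝐮 _ ≫ H ◃ 𝐝 Z ≫ 𝐝 _ ≫ H ◃ (𝐱 _ ≫ H ◃ 𝐦 Z)) ≫ (𝐱 _ ≫ H ◃ 𝐱 _ ≫ 𝐦 _) ≫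
          H ◃ (𝐫 _ ≫ 𝐦 Z) := by
        rw [h₃]; simp
    _ = H ◃ (𝐮 _ ≫ 𝐦 Z ≫ 𝐝 Z) ≫ 𝐱 _ ≫ H ◃ (𝐫 _ ≫ 𝐦 Z) := by
        rw [← h₁, hat_mul_comul]; simp
    _ = _ := by simp

/-- `r(h)t(k) = t(k)r(h)`. -/
lemma idemR_mul_idemT_comm :
    H ◃ 𝐭 Z ≫ 𝐫 _ ≫ 𝐦 Z = 𝐱 Z ≫ H ◃ 𝐫 Z ≫ 𝐭 _ ≫ 𝐦 Z := by
  have h₁ := hat₂₁_swap H Z μ[H]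
  have h₂ := hat₁₁_swap H Z (idemR H)
  calc _ = 𝐫 _ ≫ H ◃ 𝐭 Z ≫ 𝐦 Z := by simp
    _ = (𝐫 _ ≫ 𝐝 _) ≫ H ◃ 𝐱 Z ≫ 𝐦 _ ≫ 𝐞 _ := by rw [← comul_mul_counit_swap]; simp
    _ = 𝐫 _ ≫ 𝐮 _ ≫ 𝐝 _ ≫ H ◃ (𝐦 _ ≫ 𝐱 Z) ≫ 𝐦 _ ≫ 𝐞 _ := by rw [idemR_comul]; simp
    _ = (𝐫 _ ≫ 𝐱 Z) ≫ (𝐮 _ ≫ 𝐝 _ ≫ H ◃ 𝐱 _ ≫ 𝐦 _ ≫ 𝐞 _) ≫ 𝐦 _ := by rw [h₁]; simp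
    _ = _ := by rw [← hat_idemT, h₂]; simp

end WeakBialgebra

section Antipode

variable [WeakHopfObj H] (Z : V)

lemma antipode_conv_id : 𝐝 Z ≫ 𝐒 _ ≫ 𝐦 Z = 𝐫 Z := by
  rw [← WeakHopfObj.antipode_conv_id, hat_convMul]
  simp

lemma id_conv_antipode : 𝐝 Z ≫ H ◃ 𝐒 _ ≫ 𝐦 Z = 𝐭 Z := by
  rw [← WeakHopfObj.id_conv_antipode, hat_convMul]
  simp

lemma idemR_conv_antipode : 𝐝 Z ≫ H ◃ 𝐒 _ ≫ 𝐫 _ ≫ 𝐦 Z = 𝐒 Z := by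
  have h := hat_convMul H Z (convMul (WeakHopfObj.antipode (M := H)) (𝟙 H))
    (WeakHopfObj.antipode (M := H))
  rw [WeakHopfObj.antipode_conv_id_conv_antipode, WeakHopfObj.antipode_conv_id] at h
  exact h.symm

lemma antipode_conv_idemT : 𝐝 Z ≫ H ◃ 𝐭 _ ≫ 𝐒 _ ≫ 𝐦 Z = 𝐒 Z := by
  have h := idemR_conv_antipode H Z
  rw [← antipode_conv_id] at h
  rw [← id_conv_antipode]
  calc _ = 𝐝 Z ≫ H ◃ 𝐒 _ ≫ (𝐝 _ ≫ 𝐒 _ ≫ 𝐦 _) ≫ 𝐦 Z := by simp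
    _ = _ := h

lemma one_antipode : 𝐮 Z ≫ 𝐒 Z = 𝐮 Z := by
  rw [← antipode_conv_idemT]
  have h := reassoc_of% one_comul_idemT H Z
  rw [h, antipode_conv_id, one_idemR]

/-- `S(k₁) S(h₁) h₂ k₂ = r(hk)`. -/
lemma mul_idemR_eq : 𝐦 Z ≫ 𝐫 Z = H ◃ 𝐝 Z ≫ 𝐝 _ ≫ H ◃ (𝐱 _ ≫ H ◃ 𝐦 Z) ≫
    𝐱 _ ≫ H ◃ 𝐒 _ ≫ 𝐒 _ ≫ 𝐦 _ ≫ 𝐦 Z := by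
  have h₁ := hat₁₂_swap H (H ⊗ Z) Δ[H]
  calc _ = (𝐫 _ ≫ 𝐦 Z ≫ 𝐝 Z) ≫ 𝐒 _ ≫ 𝐦 Z := by
        rw [← idemR_mul_idemR]
        conv_lhs => rw [← antipode_conv_id H Z]
        simp
    _ = H ◃ 𝐝 Z ≫ (𝐱 _ ≫ H ◃ 𝐝 _) ≫ H ◃ (𝐒 _ ≫ 𝐦 _ ≫ 𝐦 Z) ≫ 𝐒 _ ≫ 𝐦 Z := by
        rw [idemR_mul_comul, ← antipode_conv_id]; simp
    _ = _ := by rw [← h₁]; simp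

/-- `h₁ t(k) S(h₂) = t(hk)`. -/
lemma mul_idemT_eq : 𝐦 Z ≫ 𝐭 Z = H ◃ 𝐭 Z ≫ 𝐝 _ ≫ H ◃ (𝐱 _ ≫ H ◃ 𝐒 _ ≫ 𝐦 _) ≫ 𝐦 Z := by
  calc _ = (H ◃ 𝐭 Z ≫ 𝐦 Z ≫ 𝐝 Z) ≫ H ◃ 𝐒 _ ≫ 𝐦 Z := by
        rw [← idemT_mul_idemT, ← id_conv_antipode]; simp
    _ = _ := by rw [idemT_mul_comul]; simp

/-- `S(h₁) h₂ t(k) S(h₃) = t(k) S(h)`. -/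
lemma antipode_conv_mul_idemT :
    𝐝 _ ≫ H ◃ (𝐦 Z ≫ 𝐭 Z) ≫ 𝐒 _ ≫ 𝐦 Z = 𝐱 Z ≫ H ◃ 𝐒 Z ≫ 𝐭 _ ≫ 𝐦 Z := by
  have h₁ := hat₁₂_swap H Z Δ[H]
  have h₂ := lw_hat₁₁_swap H Z (idemT H)
  calc _ = H ◃ 𝐭 Z ≫ 𝐝 _ ≫ H ◃ (𝐱 _ ≫ H ◃ 𝐒 _ ≫ 𝐦 _) ≫ (𝐝 _ ≫ 𝐒 _ ≫ 𝐦 _) ≫ 𝐦 Z := by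
        rw [mul_idemT_eq]; simp
    _ = H ◃ 𝐭 Z ≫ 𝐝 _ ≫ H ◃ (𝐱 _ ≫ H ◃ 𝐒 _) ≫ 𝐫 _ ≫ 𝐦 _ ≫ 𝐦 Z := by
        rw [antipode_conv_id]; simp
    _ = 𝐝 _ ≫ H ◃ ((H ◃ 𝐭 Z ≫ 𝐱 _) ≫ H ◃ 𝐒 _) ≫ 𝐫 _ ≫ 𝐦 _ ≫ 𝐦 Z := by simp
    _ = 𝐝 _ ≫ H ◃ (𝐱 _ ≫ H ◃ 𝐒 _) ≫ (H ◃ 𝐭 _ ≫ 𝐫 _ ≫ 𝐦 _) ≫ 𝐦 Z := by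
        rw [h₂]; simp
    _ = (𝐝 _ ≫ H ◃ 𝐱 _ ≫ 𝐱 _) ≫ H ◃ (H ◃ 𝐒 _ ≫ 𝐫 _ ≫ 𝐦 _) ≫ 𝐭 _ ≫ 𝐦 Z := by
        rw [idemR_mul_idemT_comm]; simp
    _ = 𝐱 _ ≫ H ◃ (𝐝 _ ≫ H ◃ 𝐒 _ ≫ 𝐫 _ ≫ 𝐦 _) ≫ 𝐭 _ ≫ 𝐦 Z := by rw [h₁]; simp
    _ = _ := by rw [idemR_conv_antipode]

lemma comul_comul_swap :
    H ◃ 𝐝 Z ≫ 𝐝 _ ≫ H ◃ (𝐱 _ ≫ H ◃ (H ◃ 𝐝 Z ≫ 𝐝 _ ≫ H ◃ 𝐱 _)) =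
      H ◃ 𝐝 Z ≫ 𝐝 _ ≫ H ◃ (𝐱 _ ≫ 𝐝 _) ≫ 𝐝 _ ≫ H ◃ 𝐱 _ := by
  have h₁ := hat₁₂_swap H (H ⊗ H ⊗ Z) Δ[H]
  have h₂ := lw_hat₁₂_swap H (H ⊗ Z) Δ[H]
  calc _ = H ◃ 𝐝 Z ≫ 𝐝 _ ≫ H ◃ (H ◃ H ◃ 𝐝 _ ≫ (𝐱 _ ≫ H ◃ 𝐝 _) ≫ H ◃ H ◃ 𝐱 _) := by simp
    _ = H ◃ 𝐝 Z ≫ 𝐝 _ ≫ H ◃ (H ◃ 𝐝 _ ≫ 𝐱 _ ≫ H ◃ 𝐱 _) ≫ 𝐝 _ ≫ H ◃ 𝐱 _ := by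
        rw [← h₁]; simp
    _ = _ := by rw [h₂]

/-- `S(hk) = S(k)S(h)`. -/
lemma mul_antipode : 𝐦 Z ≫ 𝐒 Z = 𝐱 Z ≫ H ◃ 𝐒 _ ≫ 𝐒 _ ≫ 𝐦 Z := by
  have h₁ := hat₁₂_swap H (H ⊗ Z) Δ[H]
  have h₂ := lw_hat₁₂_swap H Z Δ[H]
  have hat_mul_comul_assoc := reassoc_of% (hat_mul_comul H Z)
  symm
  calc _ = 𝐱 _ ≫ H ◃ 𝐒 _ ≫ (𝐝 _ ≫ H ◃ 𝐭 _ ≫ 𝐒 _ ≫ 𝐦 _) ≫ 𝐦 Z := by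
        rw [antipode_conv_idemT]
    _ = (𝐱 _ ≫ 𝐝 _) ≫ H ◃ (H ◃ 𝐒 _ ≫ 𝐭 _ ≫ 𝐦 _) ≫ 𝐒 _ ≫ 𝐦 Z := by simp
    _ = H ◃ 𝐝 _ ≫ 𝐱 _ ≫ H ◃ (𝐱 _ ≫ H ◃ 𝐒 _ ≫ 𝐭 _ ≫ 𝐦 _) ≫ 𝐒 _ ≫ 𝐦 Z := by
        rw [← h₂]; simp
    _ = H ◃ 𝐝 _ ≫ (𝐱 _ ≫ H ◃ 𝐝 _) ≫ H ◃ (H ◃ (𝐦 Z ≫ 𝐭 Z) ≫ 𝐒 _ ≫ 𝐦 Z) ≫ 𝐒 _ ≫ 𝐦 Z := by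
        rw [← antipode_conv_mul_idemT]; simp
    _ = H ◃ 𝐝 _ ≫ 𝐝 _ ≫ H ◃ 𝐱 _ ≫ 𝐱 _ ≫ H ◃ (H ◃ (𝐦 Z ≫ 𝐝 Z ≫ H ◃ 𝐒 _ ≫ 𝐦 Z) ≫ 𝐒 _ ≫ 𝐦 Z) ≫
          𝐒 _ ≫ 𝐦 Z := by
        rw [← h₁, id_conv_antipode]; simp
    _ = (H ◃ 𝐝 Z ≫ 𝐝 _ ≫ H ◃ (𝐱 _ ≫ H ◃ (H ◃ 𝐝 Z ≫ 𝐝 _ ≫ H ◃ 𝐱 _))) ≫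
          H ◃ H ◃ H ◃ (H ◃ (𝐦 Z ≫ 𝐒 _)) ≫ H ◃ H ◃ 𝐦 _ ≫
          𝐱 _ ≫ H ◃ 𝐒 _ ≫ 𝐒 _ ≫ 𝐦 _ ≫ 𝐦 _ ≫ 𝐦 Z := by
        rw [hat_mul_comul_assoc]
        simp
    _ = H ◃ 𝐝 Z ≫ 𝐝 _ ≫ H ◃ (𝐱 _ ≫ H ◃ (𝐦 Z ≫ 𝐒 _)) ≫ (𝐦 _ ≫ 𝐫 _) ≫ 𝐦 Z := by
        rw [comul_comul_swap, mul_idemR_eq]; simp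
    _ = (𝐦 Z ≫ 𝐝 Z) ≫ H ◃ 𝐒 _ ≫ 𝐫 _ ≫ 𝐦 Z := by
        rw [hat_mul_comul]; simp
    _ = _ := by
      conv_rhs => rw [← idemR_conv_antipode]
      simp

end Antipode

end WeakHopfIdentities

end Tannaka

namespace Tannaka

section DualModule

open scoped MonObj ComonObj

variable {V : Type u} [Category.{v} V] [MonoidalCategory V] [BraidedCategory V]
  {H : V} [WeakHopfObj H] {X D : V} [ExactPairing X D]

local notation "𝐦" => hat₂₁ (MonObj.mul (X := H))
local notation "𝐮" => hat₀₁ (MonObj.one (X := H))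
local notation "𝐝" => hat₁₂ (ComonObj.comul (X := H))
local notation "𝐭" => hat₁₁ (idemT H)
local notation "𝐫" => hat₁₁ (idemR H)
local notation "𝐒" => hat₁₁ (WeakHopfObj.antipode (M := H))
local notation "𝐧" => hat₀₂ (ExactPairing.coevaluation X D)
local notation "𝐤" => hat₂₀ (ExactPairing.evaluation X D)

/-- The action of a weak Hopf algebra on the dual of a module, `(h · f)(x) = f(S(h) · x)`. -/
def dualAct (D : V) [ExactPairing X D] (x : H ⊗ X ⟶ X) : H ⊗ D ⟶ D :=
  H ◁ ((ρ_ D).inv ≫ D ◁ η_ X D) ≫ (α_ H D (X ⊗ D)).inv ≫ (β_ H D).hom ▷ (X ⊗ D) ≫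
    (α_ D H (X ⊗ D)).hom ≫
      D ◁ ((α_ H X D).inv ≫ (WeakHopfObj.antipode (M := H) ▷ X ≫ x) ▷ D) ≫
        (α_ D X D).inv ≫ ε_ X D ▷ D ≫ (λ_ D).hom

variable (x : H ⊗ X ⟶ X)

lemma hat_dualAct (Z : V) : hat₂₁ (dualAct D x) Z =
    H ◃ D ◃ 𝐧 Z ≫ swap H D _ ≫ D ◃ (𝐒 _ ≫ hat₂₁ x _) ≫ 𝐤 _ := by
  simp only [dualAct, hat₂₁, hat₀₂, hat₂₀, hat₁₁, lw, swap, MonoidalCategory.whiskerLeft_comp,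
    comp_whiskerRight, Category.assoc]
  monoidal

lemma dualAct_ev (Z : V) : hat₂₁ (dualAct D x) (X ⊗ Z) ≫ 𝐤 Z =
    swap H D _ ≫ D ◃ (𝐒 _ ≫ hat₂₁ x Z) ≫ 𝐤 Z := by
  rw [hat_dualAct]
  calc _ = swap H D _ ≫ D ◃ (𝐒 _ ≫ hat₂₁ x Z) ≫ D ◃ (𝐧 _ ≫ X ◃ 𝐤 Z) ≫ 𝐤 Z := by simp
    _ = _ := by rw [hat_coev_ev]; simp

lemma coev_dualAct (Z : V) : H ◃ 𝐧 Z ≫ swap H X _ ≫ X ◃ hat₂₁ (dualAct D x) Z =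
    H ◃ 𝐧 Z ≫ 𝐒 _ ≫ hat₂₁ x _ := by
  have h := lw_hat₀₂_swap H (X ⊗ D ⊗ Z) (η_ X D)
  rw [hat_dualAct]
  calc _ = H ◃ 𝐧 Z ≫ (H ◃ 𝐧 _ ≫ swap H X _ ≫ X ◃ swap H D _) ≫ X ◃ (D ◃ (𝐒 _ ≫ hat₂₁ x _) ≫ 𝐤 _) := by
        simp
    _ = H ◃ 𝐧 Z ≫ 𝐒 _ ≫ hat₂₁ x _ ≫ 𝐧 _ ≫ X ◃ 𝐤 _ := by
        rw [h]; simp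
    _ = _ := by rw [hat_coev_ev]; simp

variable {x}

lemma dualAct_isAssocAct (hx : IsAssocAct x) : IsAssocAct (dualAct D x) := by
  have e (Z : V) : 𝐦 _ ≫ hat₂₁ (dualAct D x) (X ⊗ Z) ≫ 𝐤 Z =
      H ◃ hat₂₁ (dualAct D x) _ ≫ hat₂₁ (dualAct D x) _ ≫ 𝐤 Z := by
    have h₁ := hat₂₁_swap D (X ⊗ Z) μ[H]
    have h₂ := swap_yang_baxter H H D (X ⊗ Z)
    have h₃ := lw_hat₂₁_swap H (X ⊗ Z) (dualAct D x)
    calc _ = (𝐦 _ ≫ swap H D _) ≫ D ◃ (𝐒 _ ≫ hat₂₁ x Z) ≫ 𝐤 Z := by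
          rw [dualAct_ev]; simp
      _ = H ◃ swap H D _ ≫ swap H D _ ≫ D ◃ ((𝐦 _ ≫ 𝐒 _) ≫ hat₂₁ x Z) ≫ 𝐤 Z := by
          rw [h₁]; simp
      _ = (H ◃ swap H D _ ≫ swap H D _ ≫ D ◃ swap H H _) ≫
            D ◃ (H ◃ 𝐒 _ ≫ 𝐒 _ ≫ 𝐦 _ ≫ hat₂₁ x Z) ≫ 𝐤 Z := by
          rw [mul_antipode]; simp
      _ = (H ◃ swap H D _ ≫ swap H D _ ≫ D ◃ swap H H _) ≫
            D ◃ (H ◃ (𝐒 _ ≫ hat₂₁ x _) ≫ 𝐒 _ ≫ hat₂₁ x Z) ≫ 𝐤 Z := by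
          rw [hat_isAssocAct hx]; simp
      _ = swap H H _ ≫ H ◃ (swap H D _ ≫ D ◃ (𝐒 _ ≫ hat₂₁ x _)) ≫ swap H D _ ≫
            D ◃ (𝐒 _ ≫ hat₂₁ x Z) ≫ 𝐤 Z := by
          rw [← h₂]; simp
      _ = swap H H _ ≫ H ◃ (swap H D _ ≫ D ◃ (𝐒 _ ≫ hat₂₁ x _)) ≫ hat₂₁ (dualAct D x) _ ≫ 𝐤 Z := by
          rw [dualAct_ev]
      _ = (swap H H _ ≫ H ◃ swap H D _ ≫ hat₂₁ (dualAct D x) _) ≫ D ◃ (𝐒 _ ≫ hat₂₁ x _) ≫ 𝐤 Z := by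
          simp
      _ = _ := by rw [← h₃, dualAct_ev]; simp
  refine hat₂₁_congr fun Z => ?_
  have e₁ : hat₂₁ (μ[H] ▷ D ≫ dualAct D x) Z =
      (α_ H H _).hom ≫ 𝐦 _ ≫ hat₂₁ (dualAct D x) Z := by
    simp only [hat₂₁, comp_whiskerRight]
    monoidal
  have e₂ : hat₂₁ ((α_ H H D).hom ≫ H ◁ dualAct D x ≫ dualAct D x) Z =
      (α_ H H _).hom ≫ H ◃ hat₂₁ (dualAct D x) Z ≫ hat₂₁ (dualAct D x) Z := by
    simp only [hat₂₁, lw, comp_whiskerRight, MonoidalCategory.whiskerLeft_comp]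
    monoidal
  rw [e₁, e₂]
  congr 1
  calc _ = 𝐦 _ ≫ hat₂₁ (dualAct D x) Z ≫ D ◃ 𝐧 Z ≫ 𝐤 _ := by rw [hat_ev_coev, Category.comp_id]
    _ = H ◃ H ◃ D ◃ 𝐧 Z ≫ 𝐦 _ ≫ hat₂₁ (dualAct D x) _ ≫ 𝐤 _ := by
        simp [-hat_ev_coev]
    _ = H ◃ hat₂₁ (dualAct D x) Z ≫ hat₂₁ (dualAct D x) Z ≫ D ◃ 𝐧 Z ≫ 𝐤 _ := by
        rw [e]; simp [-hat_ev_coev]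
    _ = _ := by rw [hat_ev_coev, Category.comp_id]

lemma unitAct_dualAct (hx : unitAct x = 𝟙 X) : unitAct (dualAct D x) = 𝟙 D := by
  refine hat₁₁_congr fun Z => ?_
  have e : hat₁₁ (unitAct (dualAct D x)) Z = 𝐮 _ ≫ hat₂₁ (dualAct D x) Z := by
    simp only [unitAct, hat₁₁, hat₂₁, hat₀₁, comp_whiskerRight, Category.assoc]
    monoidal
  have h := hat₀₁_swap D (X ⊗ D ⊗ Z) η[H]
  have h' := hat_unit_act hx (D ⊗ Z)
  rw [e, hat_dualAct, hat₁₁_id]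
  calc _ = D ◃ 𝐧 Z ≫ (𝐮 _ ≫ swap H D _) ≫ D ◃ (𝐒 _ ≫ hat₂₁ x _) ≫ 𝐤 _ := by simp
    _ = D ◃ 𝐧 Z ≫ D ◃ ((𝐮 _ ≫ 𝐒 _) ≫ hat₂₁ x _) ≫ 𝐤 _ := by rw [h]; simp
    _ = _ := by rw [one_antipode, h']; simp

lemma coev_tact (hx : IsAssocAct x) (Z : V) : H ◃ 𝐧 Z ≫ hat₃₂ (tact x (dualAct D x)) Z =
    𝐭 _ ≫ H ◃ 𝐧 Z ≫ hat₂₁ x _ := by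
  rw [hat_tact]
  calc _ = 𝐝 _ ≫ H ◃ (H ◃ 𝐧 Z ≫ swap H X _ ≫ X ◃ hat₂₁ (dualAct D x) Z) ≫ hat₂₁ x _ := by
        simp
    _ = H ◃ 𝐧 Z ≫ 𝐝 _ ≫ H ◃ 𝐒 _ ≫ H ◃ hat₂₁ x _ ≫ hat₂₁ x _ := by
        rw [coev_dualAct]; simp
    _ = H ◃ 𝐧 Z ≫ (𝐝 _ ≫ H ◃ 𝐒 _ ≫ 𝐦 _) ≫ hat₂₁ x _ := by
        rw [← hat_isAssocAct hx]; simp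
    _ = _ := by rw [id_conv_antipode]; simp

lemma tact_ev (hx : IsAssocAct x) (Z : V) : hat₃₂ (tact (dualAct D x) x) Z ≫ 𝐤 Z =
    swap H D _ ≫ D ◃ (𝐫 _ ≫ hat₂₁ x _) ≫ 𝐤 Z := by
  have h := hat₁₂_swap D (X ⊗ Z) Δ[H]
  rw [hat_tact]
  calc _ = 𝐝 _ ≫ H ◃ (swap H D _ ≫ D ◃ hat₂₁ x _) ≫ hat₂₁ (dualAct D x) _ ≫ 𝐤 Z := by
        simp
    _ = (𝐝 _ ≫ H ◃ swap H D _ ≫ swap H D _) ≫ D ◃ (𝐒 _ ≫ H ◃ hat₂₁ x _ ≫ hat₂₁ x Z) ≫ 𝐤 Z := by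
        rw [dualAct_ev]; simp
    _ = swap H D _ ≫ D ◃ ((𝐝 _ ≫ 𝐒 _ ≫ 𝐦 _) ≫ hat₂₁ x Z) ≫ 𝐤 Z := by
        rw [h, ← hat_isAssocAct hx]; simp
    _ = _ := by rw [antipode_conv_id]

lemma hat_orbit₂ {A B : V} (d : H ⊗ (A ⊗ B) ⟶ A ⊗ B) (n : 𝟙_ V ⟶ A ⊗ B) (Z : V) :
    hat₁₂ (orbit d n) Z = H ◃ hat₀₂ n Z ≫ hat₃₂ d Z := by
  simp only [orbit, hat₁₂, hat₀₂, hat₃₂, lw, MonoidalCategory.whiskerLeft_comp,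
    comp_whiskerRight, Category.assoc]
  monoidal

lemma idemT_orbit_coev (hx : IsAssocAct x) :
    idemT H ≫ orbit (tact x (dualAct D x)) (η_ X D) = orbit (tact x (dualAct D x)) (η_ X D) := by
  refine hat₁₂_congr fun Z => ?_
  have e : hat₁₂ (idemT H ≫ orbit (tact x (dualAct D x)) (η_ X D)) Z =
      𝐭 _ ≫ hat₁₂ (orbit (tact x (dualAct D x)) (η_ X D)) Z := by
    simp [hat₁₂, hat₁₁]
  have h := reassoc_of% idemT_idemT H
  rw [e, hat_orbit₂, coev_tact hx, h]

lemma coev_unitAct_tact (hx : IsAssocAct x) (hx' : unitAct x = 𝟙 X) :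
    η_ X D ≫ unitAct (tact x (dualAct D x)) = η_ X D := by
  refine hat₀₂_congr fun Z => ?_
  have e : hat₀₂ (η_ X D ≫ unitAct (tact x (dualAct D x))) Z =
      𝐧 Z ≫ hat₂₂ (unitAct (tact x (dualAct D x))) Z := by
    simp [hat₀₂, hat₂₂]
  have h := hat_unit_act hx' (D ⊗ Z)
  rw [e, hat_unitAct]
  calc _ = 𝐮 _ ≫ H ◃ 𝐧 _ ≫ hat₃₂ (tact x (dualAct D x)) Z := by simp
    _ = (𝐮 _ ≫ 𝐭 _) ≫ H ◃ 𝐧 _ ≫ hat₂₁ x _ := by rw [coev_tact hx, Category.assoc]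
    _ = 𝐧 Z ≫ 𝐮 _ ≫ hat₂₁ x _ := by rw [one_idemT]; simp
    _ = _ := by rw [h, Category.comp_id]

lemma idemR_tact_ev (hx : IsAssocAct x) : tact (dualAct D x) x ≫ ε_ X D =
    idemR H ▷ _ ≫ tact (dualAct D x) x ≫ ε_ X D := by
  refine hat₂₀_congr fun Z => ?_
  have e : hat₂₀ (tact (dualAct D x) x ≫ ε_ X D) Z =
      H ◁ (α_ D X Z).hom ≫ hat₃₂ (tact (dualAct D x) x) Z ≫ 𝐤 Z := by
    simp [hat₂₀, hat₃₂]
  have e' : hat₂₀ (idemR H ▷ _ ≫ tact (dualAct D x) x ≫ ε_ X D) Z =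
      H ◁ (α_ D X Z).hom ≫ 𝐫 _ ≫ hat₃₂ (tact (dualAct D x) x) Z ≫ 𝐤 Z := by
    simp [hat₂₀, hat₃₂, hat₁₁]
  have h := hat₁₁_swap D (X ⊗ Z) (idemR H)
  rw [e, e', tact_ev hx]
  congr 1
  symm
  calc _ = (𝐫 _ ≫ swap H D _) ≫ D ◃ (𝐫 _ ≫ hat₂₁ x _) ≫ 𝐤 Z := by simp
    _ = swap H D _ ≫ D ◃ ((𝐫 _ ≫ 𝐫 _) ≫ hat₂₁ x _) ≫ 𝐤 Z := by rw [h]; simp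
    _ = _ := by rw [idemR_idemR]

lemma unitAct_tact_ev (hx : IsAssocAct x) (hx' : unitAct x = 𝟙 X) :
    unitAct (tact (dualAct D x) x) ≫ ε_ X D = ε_ X D := by
  refine hat₂₀_congr fun Z => ?_
  have e : hat₂₀ (unitAct (tact (dualAct D x) x) ≫ ε_ X D) Z =
      hat₂₂ (unitAct (tact (dualAct D x) x)) Z ≫ 𝐤 Z := by
    simp [hat₂₀, hat₂₂]
  have h := hat_unit_act hx' Z
  have h₁ := hat₀₁_swap D (X ⊗ Z) η[H]
  rw [e, hat_unitAct]
  calc _ = 𝐮 _ ≫ hat₃₂ (tact (dualAct D x) x) Z ≫ 𝐤 Z := by simp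
    _ = (𝐮 _ ≫ swap H D _) ≫ D ◃ (𝐫 _ ≫ hat₂₁ x _) ≫ 𝐤 Z := by rw [tact_ev hx, Category.assoc]
    _ = D ◃ ((𝐮 _ ≫ 𝐫 _) ≫ hat₂₁ x _) ≫ 𝐤 Z := by rw [h₁]; simp
    _ = _ := by rw [one_idemR, h]; simp

end DualModule

section DualObject

variable {V : Type u} [Category.{v} V] [MonoidalCategory V] [BraidedCategory V]
  [IsIdempotentComplete V] [EssentiallySmall.{v} (dualizable V).FullSubcategory]

open Functor.LaxMonoidal Functor.OplaxMonoidal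

/-- A module has a dual if its underlying object has a dual which carries a compatible action. -/
lemma dualizable_of_tact {H : WBA V} (a d : DMod H)
    (n : 𝟙_ V ⟶ (DMod.forget H).obj a ⊗ (DMod.forget H).obj d)
    (k : (DMod.forget H).obj d ⊗ (DMod.forget H).obj a ⟶ 𝟙_ V)
    (h₁ : (DMod.forget H).obj d ◁ n ≫ (α_ _ _ _).inv ≫ k ▷ (DMod.forget H).obj d =
      (ρ_ _).hom ≫ (λ_ _).inv)
    (h₂ : n ▷ (DMod.forget H).obj a ≫ (α_ _ _ _).hom ≫ (DMod.forget H).obj a ◁ k =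
      (λ_ _).hom ≫ (ρ_ _).inv)
    (hn : idemT H.X ≫ orbit (tact a.act d.act) n = orbit (tact a.act d.act) n)
    (hn' : n ≫ unitAct (tact a.act d.act) = n)
    (hk : tact d.act a.act ≫ k = idemR H.X ▷ _ ≫ tact d.act a.act ≫ k)
    (hk' : unitAct (tact d.act a.act) ≫ k = k) : dualizable (DMod H) a := by
  let Q := dmodTensorPres a d
  let R := dmodTensorPres d a
  have hn₁ : idemT H.X ≫ orbit (a ⊗ d).act (n ≫ Q.p) = orbit (a ⊗ d).act (n ≫ Q.p) := by
    have h : orbit (a ⊗ d).act (n ≫ Q.p) = orbit (tact a.act d.act) n ≫ Q.p := by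
      simp only [orbit, MonoidalCategory.whiskerLeft_comp, Category.assoc]
      rw [Q.p_act]
    rw [h, reassoc_of% hn]
  have hk₁ : (d ⊗ a).act ≫ R.i ≫ k = idemR H.X ▷ _ ≫ (d ⊗ a).act ≫ R.i ≫ k := by
    rw [reassoc_of% R.act_i, ← whisker_exchange_assoc]
    exact congrArg (H.X ◁ R.i ≫ ·) hk
  let cup : 𝟙_ (DMod H) ⟶ a ⊗ d :=
    dmodHomMk ((dmodUnitPres H).i ≫ orbit (a ⊗ d).act (n ≫ Q.p))
      (fromUnit_linear _ (DMod.act_isAssocAct _) hn₁)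
  let cap : d ⊗ a ⟶ 𝟙_ (DMod H) :=
    dmodHomMk (coorbit (d ⊗ a).act (R.i ≫ k) ≫ (dmodUnitPres H).p)
      (toUnit_linear _ (DMod.act_isAssocAct _) hk₁)
  have hcup : mapCup (DMod.forget H) cup = n := by
    have h := one_fromUnit (n := n ≫ Q.p) (dmodUnitPres H) (a ⊗ d).unitAct_act =≫ Q.i
    rw [Category.assoc n, Q.p_i, hn'] at h
    exact (Category.assoc _ _ _).symm.trans h
  have hcap : mapCap (DMod.forget H) cap = k := by
    have h := R.p ≫= toUnit_counit (k := R.i ≫ k) (dmodUnitPres H) (d ⊗ a).unitAct_act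
    rw [← Category.assoc R.p R.i, R.p_i, hk'] at h
    exact h
  let : ExactPairing a d := exactPairingOfMap (DMod.forget H) cup cap
    (by rw [hcup, hcap, h₁]) (by rw [hcup, hcap, h₂])
  exact ⟨{ rightDual := d }⟩

/-- The modules over a weak Hopf algebra have duals. -/
theorem dualizable_dmod (H : WHA V) (a : DMod H.toWBA) : dualizable (DMod H.toWBA) a := by
  have hx : IsAssocAct (H := H.X) a.act := a.act_isAssocAct
  have hx' : unitAct (H := H.X) a.act = 𝟙 _ := a.unitAct_act
  let : HasRightDual ((DMod.forget H.toWBA).obj a) := a.property.some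
  let D := ((DMod.forget H.toWBA).obj a)ᘁ
  have hD : dualizable V D :=
    let : ExactPairing D _ := BraidedCategory.exactPairing_swap ((DMod.forget H.toWBA).obj a) D
    ⟨{ rightDual := (DMod.forget H.toWBA).obj a }⟩
  let d : DMod H.toWBA := dmodMk hD (dualAct (H := H.X) D a.act)
    (dualAct_isAssocAct (H := H.X) hx) (unitAct_dualAct (H := H.X) hx')
  exact dualizable_of_tact a d (η_ ((DMod.forget H.toWBA).obj a) D)
    (ε_ ((DMod.forget H.toWBA).obj a) D)
    (ExactPairing.coevaluation_evaluation _ D) (ExactPairing.evaluation_coevaluation _ D)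
    (idemT_orbit_coev (H := H.X) (D := D) hx) (coev_unitAct_tact (H := H.X) (D := D) hx hx')
    (idemR_tact_ev (H := H.X) (D := D) hx) (unitAct_tact_ev (H := H.X) (D := D) hx hx')

end DualObject

end Tannaka

namespace Tannaka

open Functor.LaxMonoidal Functor.OplaxMonoidal

section MapDuals

variable {V : Type u} [Category.{v} V] [MonoidalCategory V]
  {A : Type u₁} [Category.{v₁} A] [MonoidalCategory A] (P : A ⥤ V) [SepFrobenius P]

lemma hat_mapCup {a d : A} (n : 𝟙_ A ⟶ a ⊗ d) (Z : V) : hat₀₂ (mapCup P n) Z =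
    hat₀₁ (ε P) Z ≫ hat₁₁ (P.map n) Z ≫ hat₁₂ (δ P a d) Z := by
  rw [mapCup, hat₀₂_comp, hat₁₂_comp]

lemma hat_mapCap {a d : A} (k : d ⊗ a ⟶ 𝟙_ A) (Z : V) : hat₂₀ (mapCap P k) Z =
    hat₂₁ (μ P d a) Z ≫ hat₁₁ (P.map k) Z ≫ hat₁₀ (η P) Z := by
  rw [mapCap, hat₂₀_comp, hat₁₀_comp]

section

variable {a d : A} [ExactPairing a d]

lemma map_coev_δ_mapCap : P.map (η_ a d) ▷ P.obj a ≫ δ P a d ▷ P.obj a ≫ (α_ _ _ _).hom ≫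
    P.obj a ◁ mapCap P (ε_ a d) ≫ (ρ_ _).hom = μ P (𝟙_ A) a ≫ P.map (λ_ a).hom := by
  have h := SepFrobenius.frobenius_left (F := P) a d a
  have h' := congrArg P.map (ExactPairing.evaluation_coevaluation a d)
  simp only [Functor.map_comp] at h'
  simp only [mapCap, MonoidalCategory.whiskerLeft_comp, Category.assoc]
  have h'' := Functor.OplaxMonoidal.right_unitality P a =≫ (ρ_ _).hom
  simp only [Category.assoc, Iso.inv_hom_id] at h''
  rw [reassoc_of% h, μ_natural_left_assoc, δ_natural_right_assoc, reassoc_of% h', ← h'',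
    Category.comp_id]

lemma mapCup_μ_map_ev : (λ_ _).inv ≫ mapCup P (η_ a d) ▷ P.obj a ≫ (α_ _ _ _).hom ≫
    P.obj a ◁ (μ P d a ≫ P.map (ε_ a d)) = P.map (ρ_ a).inv ≫ δ P a (𝟙_ A) := by
  have h := SepFrobenius.frobenius_left (F := P) a d a
  have h' := congrArg P.map (ExactPairing.evaluation_coevaluation a d)
  simp only [Functor.map_comp] at h'
  simp only [mapCup, MonoidalCategory.whiskerLeft_comp, comp_whiskerRight, Category.assoc]
  rw [reassoc_of% h, μ_natural_left_assoc, δ_natural_right, reassoc_of% h']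
  have h'' := (λ_ _).inv ≫= Functor.LaxMonoidal.left_unitality P a
  rw [Iso.inv_hom_id] at h''
  rw [← reassoc_of% h'']

lemma mapCup_δ_μ (n : 𝟙_ A ⟶ a ⊗ d) :
    mapCup P n ≫ (P.map (ρ_ a).inv ≫ δ P a (𝟙_ A)) ▷ P.obj d ≫ (α_ _ _ _).hom ≫
      P.obj a ◁ (μ P (𝟙_ A) d ≫ P.map (λ_ d).hom) = mapCup P n := by
  have h := SepFrobenius.frobenius_left (F := P) a (𝟙_ A) d
  have h' : (ρ_ a).inv ▷ d ≫ (α_ _ _ _).hom ≫ a ◁ (λ_ d).hom = 𝟙 _ := by simp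
  have h'' := congrArg P.map h'
  simp only [Functor.map_comp] at h''
  simp only [mapCup, MonoidalCategory.whiskerLeft_comp, comp_whiskerRight, Category.assoc]
  rw [reassoc_of% h, μ_natural_left_assoc, δ_natural_right, SepFrobenius.separable_assoc,
    reassoc_of% h'', CategoryTheory.Functor.map_id, Category.id_comp]

lemma hat_map_coev_δ_mapCap (Z : V) : hat₁₁ (P.map (η_ a d)) (P.obj a ⊗ Z) ≫ hat₁₂ (δ P a d) _ ≫
    P.obj a ◃ hat₂₀ (mapCap P (ε_ a d)) Z = hat₂₁ (μ P (𝟙_ A) a ≫ P.map (λ_ a).hom) Z := by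
  rw [← map_coev_δ_mapCap P (a := a) (d := d)]
  simp only [hat₁₁, hat₁₂, hat₂₀, hat₂₁, lw, comp_whiskerRight, MonoidalCategory.whiskerLeft_comp,
    Category.assoc]
  monoidal

lemma hat_mapCup_μ_map_ev (Z : V) : hat₀₂ (mapCup P (η_ a d)) (P.obj a ⊗ Z) ≫
    P.obj a ◃ (hat₂₁ (μ P d a) Z ≫ hat₁₁ (P.map (ε_ a d)) Z) =
      hat₁₂ (P.map (ρ_ a).inv ≫ δ P a (𝟙_ A)) Z := by
  rw [← mapCup_μ_map_ev P (a := a) (d := d)]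
  simp only [hat₀₂, hat₁₁, hat₁₂, hat₂₁, lw, comp_whiskerRight,
    MonoidalCategory.whiskerLeft_comp, Category.assoc]
  monoidal

lemma hat_mapCup_δ_μ (n : 𝟙_ A ⟶ a ⊗ d) (Z : V) : hat₀₂ (mapCup P n) Z ≫
    hat₁₂ (P.map (ρ_ a).inv ≫ δ P a (𝟙_ A)) _ ≫
      P.obj a ◃ hat₂₁ (μ P (𝟙_ A) d ≫ P.map (λ_ d).hom) Z = hat₀₂ (mapCup P n) Z := by
  conv_rhs => rw [← mapCup_δ_μ P n]
  simp only [hat₀₂, hat₁₂, hat₂₁, lw, comp_whiskerRight,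
    MonoidalCategory.whiskerLeft_comp, Category.assoc]
  monoidal

end

section

variable {a b : A} [HasRightDual a] [HasRightDual b] (f : a ⟶ b)

lemma mapCup_mate (Z : V) : hat₀₂ (mapCup P (η_ a (aᘁ))) Z ≫ hat₁₁ (P.map f) _ =
    hat₀₂ (mapCup P (η_ b (bᘁ))) Z ≫ P.obj b ◃ hat₁₁ (P.map (fᘁ)) Z := by
  have h := congrArg P.map (coevaluation_comp_rightAdjointMate f)
  simp only [Functor.map_comp] at h
  have h₁ : mapCup P (η_ a (aᘁ)) ≫ P.map f ▷ _ = mapCup P (η_ b (bᘁ)) ≫ _ ◁ P.map (fᘁ) := by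
    simp only [mapCup, Category.assoc]
    rw [δ_natural_left, δ_natural_right, reassoc_of% h]
  have e₁ : hat₀₂ (mapCup P (η_ a (aᘁ))) Z ≫ hat₁₁ (P.map f) _ =
      hat₀₂ (mapCup P (η_ a (aᘁ)) ≫ P.map f ▷ _) Z := by
    simp only [hat₀₂, hat₁₁, comp_whiskerRight]
    monoidal
  have e₂ : hat₀₂ (mapCup P (η_ b (bᘁ))) Z ≫ P.obj b ◃ hat₁₁ (P.map (fᘁ)) Z =
      hat₀₂ (mapCup P (η_ b (bᘁ)) ≫ _ ◁ P.map (fᘁ)) Z := by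
    simp only [hat₀₂, hat₁₁, lw, comp_whiskerRight]
    monoidal
  rw [e₁, e₂, h₁]

lemma mate_mapCap (Z : V) : hat₁₁ (P.map (fᘁ)) _ ≫ hat₂₀ (mapCap P (ε_ a (aᘁ))) Z =
    P.obj (bᘁ) ◃ hat₁₁ (P.map f) Z ≫ hat₂₀ (mapCap P (ε_ b (bᘁ))) Z := by
  have h := congrArg P.map (rightAdjointMate_comp_evaluation f)
  simp only [Functor.map_comp] at h
  have h₁ : P.map (fᘁ) ▷ _ ≫ mapCap P (ε_ a (aᘁ)) = _ ◁ P.map f ≫ mapCap P (ε_ b (bᘁ)) := by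
    simp only [mapCap]
    rw [μ_natural_left_assoc, μ_natural_right_assoc, reassoc_of% h]
  have e₁ : hat₁₁ (P.map (fᘁ)) _ ≫ hat₂₀ (mapCap P (ε_ a (aᘁ))) Z =
      hat₂₀ (P.map (fᘁ) ▷ _ ≫ mapCap P (ε_ a (aᘁ))) Z := by
    simp only [hat₂₀, hat₁₁, comp_whiskerRight]
    monoidal
  have e₂ : P.obj (bᘁ) ◃ hat₁₁ (P.map f) Z ≫ hat₂₀ (mapCap P (ε_ b (bᘁ))) Z =
      hat₂₀ (_ ◁ P.map f ≫ mapCap P (ε_ b (bᘁ))) Z := by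
    simp only [hat₂₀, hat₁₁, lw, comp_whiskerRight]
    monoidal
  rw [e₁, e₂, h₁]

end

end MapDuals

namespace IsActEnd

variable {V : Type u} [Category.{v} V] [MonoidalCategory V] [BraidedCategory V]
  {A : Type u₁} [Category.{v₁} A] [MonoidalCategory A] {P : A ⥤ V} [SepFrobenius P]
  {T : V} {x : ∀ a, T ⊗ P.obj a ⟶ P.obj a}

/-- The action on `Pa` that is dual to an action on `Pd`, where `d` is dual to `a`. -/
def predualAct (a d : A) [ExactPairing a d] (y : T ⊗ P.obj d ⟶ P.obj d) :
    T ⊗ P.obj a ⟶ P.obj a :=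
  T ◁ ((λ_ _).inv ≫ mapCup P (η_ a d) ▷ P.obj a ≫ (α_ _ _ _).hom) ≫ (α_ _ _ _).inv ≫
    (β_ T (P.obj a)).hom ▷ _ ≫ (α_ _ _ _).hom ≫
      P.obj a ◁ ((α_ _ _ _).inv ≫ y ▷ P.obj a ≫ mapCap P (ε_ a d)) ≫ (ρ_ _).hom

lemma hat_predualAct (a d : A) [ExactPairing a d] (y : T ⊗ P.obj d ⟶ P.obj d) (Z : V) :
    hat₂₁ (predualAct a d y) Z = T ◃ hat₀₂ (mapCup P (η_ a d)) _ ≫ swap T (P.obj a) _ ≫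
      P.obj a ◃ (hat₂₁ y _ ≫ hat₂₀ (mapCap P (ε_ a d)) Z) := by
  simp only [predualAct, hat₂₁, hat₀₂, hat₂₀, lw, swap, MonoidalCategory.whiskerLeft_comp,
    comp_whiskerRight, Category.assoc]
  monoidal

variable [∀ a : A, HasRightDual a]

lemma predualAct_natural (E : IsActEnd P T x) {a b : A} (f : a ⟶ b) :
    predualAct a (aᘁ) (x (aᘁ)) ≫ P.map f = T ◁ P.map f ≫ predualAct b (bᘁ) (x (bᘁ)) := by
  refine hat₂₁_congr fun Z => ?_
  have h₁ := mapCup_mate P f (P.obj a ⊗ Z)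
  have h₂ := mate_mapCap P f Z
  have h₃ := E.hat_natural (fᘁ) (P.obj a ⊗ Z)
  have h₄ := lw_hat₁₁_swap T (P.obj (aᘁ) ⊗ P.obj a ⊗ Z) (P.map f)
  rw [hat₂₁_comp, hat₂₁_lw, hat_predualAct, hat_predualAct]
  calc _ = T ◃ hat₀₂ (mapCup P (η_ a (aᘁ))) _ ≫ (swap T (P.obj a) _ ≫ hat₁₁ (P.map f) _) ≫
        P.obj b ◃ (hat₂₁ (x (aᘁ)) _ ≫ hat₂₀ (mapCap P (ε_ a (aᘁ))) Z) := by simp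
    _ = T ◃ (hat₀₂ (mapCup P (η_ a (aᘁ))) _ ≫ hat₁₁ (P.map f) _) ≫ swap T (P.obj b) _ ≫
        P.obj b ◃ (hat₂₁ (x (aᘁ)) _ ≫ hat₂₀ (mapCap P (ε_ a (aᘁ))) Z) := by
        rw [← h₄]; simp
    _ = T ◃ hat₀₂ (mapCup P (η_ b (bᘁ))) _ ≫ swap T (P.obj b) _ ≫
        P.obj b ◃ ((T ◃ hat₁₁ (P.map (fᘁ)) _ ≫ hat₂₁ (x (aᘁ)) _) ≫
          hat₂₀ (mapCap P (ε_ a (aᘁ))) Z) := by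
        rw [h₁]; simp
    _ = T ◃ hat₀₂ (mapCup P (η_ b (bᘁ))) _ ≫ swap T (P.obj b) _ ≫
        P.obj b ◃ (hat₂₁ (x (bᘁ)) _ ≫ hat₁₁ (P.map (fᘁ)) _ ≫
          hat₂₀ (mapCap P (ε_ a (aᘁ))) Z) := by
        rw [← h₃]; simp
    _ = _ := by rw [h₂]; simp

lemma exists_antipode (E : IsActEnd P T x) : ∃ S : T ⟶ T,
    ∀ a, S ▷ P.obj a ≫ x a = predualAct a (aᘁ) (x (aᘁ)) :=
  E.exists_lift₁ _ fun f => E.predualAct_natural f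

variable (E : IsActEnd P T x)

/-- The antipode of the Tannaka object. -/
def antipode : T ⟶ T := E.exists_antipode.choose

lemma antipode_act (a : A) (Z : V) : hat₁₁ E.antipode (P.obj a ⊗ Z) ≫ hat₂₁ (x a) Z =
    T ◃ hat₀₂ (mapCup P (η_ a (aᘁ))) _ ≫ swap T (P.obj a) _ ≫
      P.obj a ◃ (hat₂₁ (x (aᘁ)) _ ≫ hat₂₀ (mapCap P (ε_ a (aᘁ))) Z) := by
  rw [← hat_predualAct, ← E.exists_antipode.choose_spec a, hat₂₁_rw]
  rfl

lemma hat_mapCup_μ {a d : A} (n : 𝟙_ A ⟶ a ⊗ d) (Z : V) :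
    hat₀₂ (mapCup P n) Z ≫ hat₂₁ (μ P a d) Z = hat₀₁ (ε P) Z ≫ hat₁₁ (P.map n) Z := by
  rw [hat_mapCup, Category.assoc, Category.assoc, hat_separable, Category.comp_id]

lemma hat_δ_mapCap {a d : A} (k : d ⊗ a ⟶ 𝟙_ A) (Z : V) :
    hat₁₂ (δ P d a) Z ≫ hat₂₀ (mapCap P k) Z = hat₁₁ (P.map k) Z ≫ hat₁₀ (η P) Z := by
  have h := reassoc_of% hat_separable P d a Z
  rw [hat_mapCap, h]

local notation "𝐦" => hat₂₁ E.mul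
local notation "𝐝" => hat₁₂ E.comul
local notation "𝐒" => hat₁₁ E.antipode

lemma id_conv_antipode_act (a : A) (Z : V) : 𝐝 (P.obj a ⊗ Z) ≫ T ◃ 𝐒 _ ≫ 𝐦 _ ≫ hat₂₁ (x a) Z =
    hat₁₁ E.t (P.obj a ⊗ Z) ≫ hat₂₁ (x a) Z := by
  have h₁ := E.hat_comul_act a (aᘁ) (P.obj a ⊗ Z)
  have h₂ := hat_mapCup_μ (P := P) (η_ a (aᘁ)) (P.obj a ⊗ Z)
  have h₃ := E.hat_natural (η_ a (aᘁ)) (P.obj a ⊗ Z)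
  have h₄ := hat_map_coev_δ_mapCap P (a := a) (d := aᘁ) Z
  rw [E.idemT_act, E.hat_mul_act]
  calc _ = 𝐝 _ ≫ T ◃ (𝐒 _ ≫ hat₂₁ (x a) Z) ≫ hat₂₁ (x a) Z := by simp
    _ = T ◃ hat₀₂ (mapCup P (η_ a (aᘁ))) _ ≫ (𝐝 _ ≫ T ◃ (swap T (P.obj a) _ ≫
          P.obj a ◃ hat₂₁ (x (aᘁ)) _) ≫ hat₂₁ (x a) _) ≫
            P.obj a ◃ hat₂₀ (mapCap P (ε_ a (aᘁ))) Z := by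
        rw [E.antipode_act]; simp
    _ = T ◃ (hat₀₂ (mapCup P (η_ a (aᘁ))) _ ≫ hat₂₁ (μ P a (aᘁ)) _) ≫ hat₂₁ (x _) _ ≫
          hat₁₂ (δ P a (aᘁ)) _ ≫ P.obj a ◃ hat₂₀ (mapCap P (ε_ a (aᘁ))) Z := by
        rw [h₁]; simp
    _ = T ◃ hat₀₁ (ε P) _ ≫ (T ◃ hat₁₁ (P.map (η_ a (aᘁ))) _ ≫ hat₂₁ (x _) _) ≫
          hat₁₂ (δ P a (aᘁ)) _ ≫ P.obj a ◃ hat₂₀ (mapCap P (ε_ a (aᘁ))) Z := by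
        rw [h₂]; simp
    _ = _ := by rw [← h₃]; simp only [Category.assoc]; rw [h₄]

lemma antipode_conv_id_act (a : A) (Z : V) : 𝐝 (P.obj a ⊗ Z) ≫ 𝐒 _ ≫ 𝐦 _ ≫ hat₂₁ (x a) Z =
    hat₁₁ E.r (P.obj a ⊗ Z) ≫ hat₂₁ (x a) Z := by
  have h₁ := E.hat_comul_act (aᘁ) a Z
  have h₂ := hat_δ_mapCap (P := P) (ε_ a (aᘁ)) Z
  have h₃ := E.hat_natural (ε_ a (aᘁ)) Z
  have h₄ := hat_mapCup_μ_map_ev P (a := a) (d := aᘁ) Z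
  have h₅ := lw_hat₀₂_swap T (P.obj a ⊗ Z) (mapCup P (η_ a (aᘁ)))
  have h₆ := hat₁₂_swap (P.obj a) (P.obj (aᘁ) ⊗ P.obj a ⊗ Z) E.comul
  rw [E.idemR_act, E.hat_mul_act]
  calc _ = 𝐝 _ ≫ T ◃ hat₂₁ (x a) Z ≫ 𝐒 _ ≫ hat₂₁ (x a) Z := by simp
    _ = 𝐝 _ ≫ T ◃ hat₀₂ (mapCup P (η_ a (aᘁ))) _ ≫ swap T (P.obj a) _ ≫
          P.obj a ◃ (T ◃ P.obj (aᘁ) ◃ hat₂₁ (x a) Z ≫ hat₂₁ (x (aᘁ)) _ ≫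
            hat₂₀ (mapCap P (ε_ a (aᘁ))) Z) := by
        rw [E.antipode_act]; simp
    _ = T ◃ hat₀₂ (mapCup P (η_ a (aᘁ))) _ ≫ (𝐝 _ ≫ T ◃ swap T (P.obj a) _ ≫ swap T (P.obj a) _) ≫
          P.obj a ◃ (T ◃ (swap T (P.obj (aᘁ)) _ ≫ P.obj (aᘁ) ◃ hat₂₁ (x a) Z) ≫
            hat₂₁ (x (aᘁ)) _ ≫ hat₂₀ (mapCap P (ε_ a (aᘁ))) Z) := by
        rw [← h₅]; simp
    _ = T ◃ hat₀₂ (mapCup P (η_ a (aᘁ))) _ ≫ swap T (P.obj a) _ ≫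
          P.obj a ◃ ((𝐝 _ ≫ T ◃ (swap T (P.obj (aᘁ)) _ ≫ P.obj (aᘁ) ◃ hat₂₁ (x a) Z) ≫
            hat₂₁ (x (aᘁ)) _) ≫ hat₂₀ (mapCap P (ε_ a (aᘁ))) Z) := by
        rw [h₆]; simp
    _ = T ◃ hat₀₂ (mapCup P (η_ a (aᘁ))) _ ≫ swap T (P.obj a) _ ≫
          P.obj a ◃ (T ◃ hat₂₁ (μ P (aᘁ) a) _ ≫ (hat₂₁ (x _) _ ≫ hat₁₁ (P.map (ε_ a (aᘁ))) Z) ≫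
            hat₁₀ (η P) Z) := by
        rw [h₁]; simp only [Category.assoc]; rw [h₂]
    _ = T ◃ (hat₀₂ (mapCup P (η_ a (aᘁ))) _ ≫
          P.obj a ◃ (hat₂₁ (μ P (aᘁ) a) _ ≫ hat₁₁ (P.map (ε_ a (aᘁ))) Z)) ≫ swap T (P.obj a) _ ≫
            P.obj a ◃ (hat₂₁ (x (𝟙_ A)) _ ≫ hat₁₀ (η P) Z) := by
        rw [h₃]; simp
    _ = _ := by rw [h₄]

lemma idemR_conv_antipode_act (a : A) (Z : V) :
    𝐝 (P.obj a ⊗ Z) ≫ T ◃ 𝐒 _ ≫ hat₁₁ E.r _ ≫ 𝐦 _ ≫ hat₂₁ (x a) Z =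
      𝐒 _ ≫ hat₂₁ (x a) Z := by
  have h₁ := E.hat_comul_act (𝟙_ A) (aᘁ) (P.obj a ⊗ Z)
  have h₂ := hat_δ_η' P (aᘁ) (P.obj a ⊗ Z)
  have h₃ := E.hat_natural (λ_ (aᘁ)).hom (P.obj a ⊗ Z)
  have h₄ := hat_mapCup_δ_μ P (η_ a (aᘁ)) (P.obj a ⊗ Z)
  have h₅ := lw_hat₁₂_swap T (P.obj (aᘁ) ⊗ P.obj a ⊗ Z) (P.map (ρ_ a).inv ≫ δ P a (𝟙_ A))
  have h₆ := hat₁₂_swap (P.obj a) (P.obj (𝟙_ A) ⊗ P.obj (aᘁ) ⊗ P.obj a ⊗ Z) E.comul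
  have h₇ := E.idemR_act a Z
  rw [E.hat_mul_act]
  rw [hat₂₁_comp] at h₄
  set j := P.map (ρ_ a).inv ≫ δ P a (𝟙_ A)
  calc _ = 𝐝 _ ≫ T ◃ (𝐒 _ ≫ hat₂₁ (x a) Z) ≫ hat₁₁ E.r _ ≫ hat₂₁ (x a) Z := by simp
    _ = T ◃ hat₀₂ (mapCup P (η_ a (aᘁ))) _ ≫ 𝐝 _ ≫ T ◃ ((swap T (P.obj a) _ ≫ hat₁₂ j _) ≫
          P.obj a ◃ P.obj (𝟙_ A) ◃ hat₂₁ (x (aᘁ)) _) ≫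
            swap T (P.obj a) _ ≫ P.obj a ◃ (hat₂₁ (x (𝟙_ A)) _ ≫ hat₁₀ (η P) _ ≫
              hat₂₀ (mapCap P (ε_ a (aᘁ))) Z) := by
        rw [h₇, E.antipode_act]; simp
    _ = T ◃ (hat₀₂ (mapCup P (η_ a (aᘁ))) _ ≫ hat₁₂ j _) ≫
          (𝐝 _ ≫ T ◃ swap T (P.obj a) _ ≫ swap T (P.obj a) _) ≫
            P.obj a ◃ (T ◃ (swap T (P.obj (𝟙_ A)) _ ≫ P.obj (𝟙_ A) ◃ hat₂₁ (x (aᘁ)) _) ≫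
              hat₂₁ (x (𝟙_ A)) _ ≫ hat₁₀ (η P) _ ≫ hat₂₀ (mapCap P (ε_ a (aᘁ))) Z) := by
        rw [← h₅]; simp
    _ = T ◃ (hat₀₂ (mapCup P (η_ a (aᘁ))) _ ≫ hat₁₂ j _) ≫ swap T (P.obj a) _ ≫
            P.obj a ◃ ((𝐝 _ ≫ T ◃ (swap T (P.obj (𝟙_ A)) _ ≫
              P.obj (𝟙_ A) ◃ hat₂₁ (x (aᘁ)) _) ≫ hat₂₁ (x (𝟙_ A)) _) ≫ hat₁₀ (η P) _ ≫
                hat₂₀ (mapCap P (ε_ a (aᘁ))) Z) := by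
        rw [h₆]; simp
    _ = T ◃ (hat₀₂ (mapCup P (η_ a (aᘁ))) _ ≫ hat₁₂ j _) ≫ swap T (P.obj a) _ ≫
            P.obj a ◃ (T ◃ hat₂₁ (μ P (𝟙_ A) (aᘁ)) _ ≫
              (hat₂₁ (x _) _ ≫ hat₁₁ (P.map (λ_ (aᘁ)).hom) _) ≫
                hat₂₀ (mapCap P (ε_ a (aᘁ))) Z) := by
        rw [h₁]; simp only [Category.assoc]; rw [reassoc_of% h₂]
    _ = T ◃ (hat₀₂ (mapCup P (η_ a (aᘁ))) _ ≫ hat₁₂ j _ ≫ P.obj a ◃ (hat₂₁ (μ P (𝟙_ A) (aᘁ)) _ ≫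
          hat₁₁ (P.map (λ_ (aᘁ)).hom) _)) ≫ swap T (P.obj a) _ ≫
            P.obj a ◃ (hat₂₁ (x (aᘁ)) _ ≫ hat₂₀ (mapCap P (ε_ a (aᘁ))) Z) := by
        rw [h₃]; simp
    _ = _ := by rw [h₄, E.antipode_act]

lemma antipode_conv_id : @convMul _ _ _ T E.monObj E.comonObj E.antipode (𝟙 T) = E.r := by
  let := E.monObj
  let := E.comonObj
  refine E.hat_ext₁ fun a Z => ?_
  rw [hat_convMul, ← E.antipode_conv_id_act, hat₁₁_id, lw_id, Category.id_comp]
  simp only [Category.assoc]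
  rfl

lemma id_conv_antipode : @convMul _ _ _ T E.monObj E.comonObj (𝟙 T) E.antipode = E.t := by
  let := E.monObj
  let := E.comonObj
  refine E.hat_ext₁ fun a Z => ?_
  rw [hat_convMul, ← E.id_conv_antipode_act, hat₁₁_id, Category.id_comp]
  simp only [Category.assoc]
  rfl

lemma idemR_conv_antipode :
    @convMul _ _ _ T E.monObj E.comonObj E.r E.antipode = E.antipode := by
  let := E.monObj
  let := E.comonObj
  refine E.hat_ext₁ fun a Z => ?_
  rw [hat_convMul, ← E.idemR_conv_antipode_act]
  simp only [Category.assoc]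
  rfl

/-- The Tannaka object of a functor whose domain has duals is a weak Hopf algebra. -/
abbrev weakHopfObj : WeakHopfObj T where
  __ := E.weakBimonObj
  antipode := E.antipode
  antipode_conv_id := E.antipode_conv_id
  id_conv_antipode := E.id_conv_antipode
  antipode_conv_id_conv_antipode := by
    refine Eq.trans ?_ E.idemR_conv_antipode
    exact congrArg (@convMul _ _ _ T E.monObj E.comonObj · _) E.antipode_conv_id

end IsActEnd

end Tannaka

namespace Tannaka

section Restrictions

variable {V : Type u} [Category.{v} V] [MonoidalCategory V] [BraidedCategory V]

/-- A weak morphism of bialgebras as a morphism of bialgebras. -/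
def baHomMk {B C : BA V} (f : B.toWBA ⟶ C.toWBA) : B ⟶ C :=
  BA.Hom.mk (H := B) (J := C) f.hom (strict := IsWeakHom.isBimonHom (M := B.X) (N := C.X) f.hom f.weak)

lemma ba_hom_ext {B C : BA V} {f g : B ⟶ C} (h : (baToWba V).map f = (baToWba V).map g) : f = g :=
  BA.Hom.ext (congrArg WBA.Hom.hom h)

instance : (whaToWba V).Faithful := inferInstanceAs (inducedFunctor WHA.toWBA).Faithful

instance : (haToBa V).Faithful := inferInstanceAs (inducedFunctor HA.toBA).Faithful

variable [MonoidallyComplete V]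

/-- The Tannaka object of a strong monoidal functor. -/
def StrOver.tan (F : StrOver V) : BA V where
  X := F.toSFOver.tan.X
  str := IsBialgebra.bimonObj (M := F.toSFOver.tan.X) (F.toSFOver.isActEnd.isBialgebra F.strong)

/-- The Tannaka object of a functor whose domain has duals. -/
def SFOverStar.tan (F : SFOverStar V) : WHA V where
  X := F.obj.tan.X
  str :=
    letI (a : F.obj.A) : HasRightDual a := (F.property a).some
    F.obj.isActEnd.weakHopfObj

/-- The Tannaka object of a strong monoidal functor whose domain has duals. -/
def StrOverStar.tan (F : StrOverStar V) : HA V where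
  X := F.obj.toSFOver.tan.X
  str :=
    letI (a : F.obj.toSFOver.A) : HasRightDual a := (F.property a).some
    { __ := F.obj.tan.str
      antipode := F.obj.toSFOver.isActEnd.antipode
      antipode_left := by
        refine Eq.trans ?_ (F.obj.toSFOver.isActEnd.antipode_conv_id.trans
          (idemR_of_bimonObj F.obj.tan.X))
        exact congrArg (ComonObj.comul (X := F.obj.tan.X) ≫ · ≫ MonObj.mul (X := F.obj.tan.X))
          (tensorHom_id _ _).symm
      antipode_right := by
        refine Eq.trans ?_ (F.obj.toSFOver.isActEnd.id_conv_antipode.trans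
          (idemT_of_bimonObj F.obj.tan.X))
        exact congrArg (ComonObj.comul (X := F.obj.tan.X) ≫ · ≫ MonObj.mul (X := F.obj.tan.X))
          (id_tensorHom _ _).symm }

variable (V) in
/-- The Tannaka functor on strong monoidal functors. -/
def strTannakaFunctor : StrOver V ⥤ (BA V)ᵒᵖ where
  obj F := op F.tan
  map {F G} f := (baHomMk (B := G.tan) (C := F.tan) (SFOver.tanMap f.hom)).op
  map_id F := congrArg Quiver.Hom.op (ba_hom_ext (SFOver.tanMap_id F.toSFOver))
  map_comp f g := congrArg Quiver.Hom.op (ba_hom_ext (SFOver.tanMap_comp f.hom g.hom))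

variable (V) in
/-- The Tannaka functor on functors whose domain has duals. -/
def starTannakaFunctor : SFOverStar V ⥤ (WHA V)ᵒᵖ where
  obj F := op (SFOverStar.tan F)
  map {F G} f := Quiver.Hom.op (X := SFOverStar.tan G) (Y := SFOverStar.tan F) ⟨SFOver.tanMap f.hom⟩
  map_id F := congrArg Quiver.Hom.op ((whaToWba V).map_injective (SFOver.tanMap_id F.obj))
  map_comp f g := congrArg Quiver.Hom.op
    ((whaToWba V).map_injective (SFOver.tanMap_comp f.hom g.hom))

variable (V) in
/-- The Tannaka functor on strong monoidal functors whose domain has duals. -/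
def strStarTannakaFunctor : StrOverStar V ⥤ (HA V)ᵒᵖ where
  obj F := op (StrOverStar.tan F)
  map {F G} f := Quiver.Hom.op (X := StrOverStar.tan G) (Y := StrOverStar.tan F)
    ⟨((strTannakaFunctor V).map f.hom).unop⟩
  map_id F := congrArg Quiver.Hom.op ((haToBa V).map_injective
    (congrArg Quiver.Hom.unop ((strTannakaFunctor V).map_id F.obj)))
  map_comp f g := congrArg Quiver.Hom.op ((haToBa V).map_injective
    (congrArg Quiver.Hom.unop ((strTannakaFunctor V).map_comp f.hom g.hom)))

variable [EssentiallySmall.{v} (dualizable V).FullSubcategory]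

instance (H : WBA V) : (rep H).toSFOver.F.functor.Faithful :=
  inferInstanceAs (DMod.forget H).Faithful

/-- The representations of a bialgebra. -/
def BA.rep (B : BA V) : StrOver V where
  toSFOver := (Tannaka.rep B.toWBA).toSFOver
  strong := (isBialgebra_of_bimonObj B.X).isStrong_forget (H := B.toWBA)

/-- The representations of a weak Hopf algebra. -/
def WHA.rep (H : WHA V) : SFOverStar V where
  obj := (Tannaka.rep H.toWBA).toSFOver
  property := dualizable_dmod H

/-- The representations of a Hopf algebra. -/
def HA.rep (H : HA V) : StrOverStar V where
  obj := H.toBA.rep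
  property := dualizable_dmod H.toWHA

/-- A morphism into the representations of a bialgebra is strong. -/
def strHomMk {F : StrOver V} {B : BA V} (f : F.toSFOver ⟶ (rep B.toWBA).toSFOver) : F ⟶ B.rep where
  hom := f
  strong := f.isStrong F.strong B.rep.strong

variable (V) in
/-- The representations of bialgebras. -/
def strRepFunctor : (BA V)ᵒᵖ ⥤ StrOver V where
  obj B := B.unop.rep
  map {B _} f := strHomMk (F := B.unop.rep) (restr ((baToWba V).map f.unop))
  map_id B := StrOver.Hom.ext ((repFunctor V).restr_id B.unop.toWBA)
  map_comp f g := StrOver.Hom.ext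
    ((repFunctor V).restr_comp ((baToWba V).map g.unop) ((baToWba V).map f.unop))

variable (V) in
/-- The representations of weak Hopf algebras. -/
def starRepFunctor : (WHA V)ᵒᵖ ⥤ SFOverStar V where
  obj H := H.unop.rep
  map f := ⟨restr ((whaToWba V).map f.unop)⟩
  map_id H := ObjectProperty.hom_ext _ ((repFunctor V).restr_id H.unop.toWBA)
  map_comp f g := ObjectProperty.hom_ext _
    ((repFunctor V).restr_comp ((whaToWba V).map g.unop) ((whaToWba V).map f.unop))

variable (V) in
/-- The representations of Hopf algebras. -/
def strStarRepFunctor : (HA V)ᵒᵖ ⥤ StrOverStar V where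
  obj H := H.unop.rep
  map f := ⟨(strRepFunctor V).map ((haToBa V).op.map f)⟩
  map_id H := ObjectProperty.hom_ext _ ((strRepFunctor V).map_id (op H.unop.toBA))
  map_comp f g := ObjectProperty.hom_ext _
    ((strRepFunctor V).map_comp ((haToBa V).op.map f) ((haToBa V).op.map g))

variable (V) in
/-- The Tannaka adjunction for strong monoidal functors and bialgebras. -/
def strTannakaAdjunction : strTannakaFunctor V ⊣ strRepFunctor V :=
  Adjunction.mkOfUnitCounit
    { unit :=
        { app := fun F => strHomMk (B := F.tan) F.toSFOver.toRep
          naturality := fun _ _ f => StrOver.Hom.ext (toRep_naturality f.hom) }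
      counit :=
        { app := fun B => (baHomMk (B := B.unop) (C := B.unop.rep.tan) (toTan B.unop.toWBA)).op
          naturality := fun _ _ g => congrArg Quiver.Hom.op
            (ba_hom_ext (toTan_naturality ((baToWba V).map g.unop)).symm) }
      left_triangle := by
        ext F
        refine (congrArg (_ ≫ ·) (Category.id_comp _)).trans ?_
        exact congrArg Quiver.Hom.op (ba_hom_ext (toTan_tanMap_toRep F.toSFOver))
      right_triangle := by
        ext B
        refine (congrArg (_ ≫ ·) (Category.id_comp _)).trans ?_
        exact StrOver.Hom.ext (toRep_restr_toTan B.unop.toWBA) }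

variable (V) in
/-- The Tannaka adjunction for weak Hopf algebras. -/
def starTannakaAdjunction : starTannakaFunctor V ⊣ starRepFunctor V :=
  Adjunction.mkOfUnitCounit
    { unit :=
        { app := fun F => ⟨F.obj.toRep⟩
          naturality := fun _ _ f => ObjectProperty.hom_ext _ (toRep_naturality f.hom) }
      counit :=
        { app := fun H => Quiver.Hom.op (X := H.unop) (Y := SFOverStar.tan H.unop.rep)
            ⟨toTan H.unop.toWBA⟩
          naturality := fun _ _ g => congrArg Quiver.Hom.op ((whaToWba V).map_injective
            (toTan_naturality ((whaToWba V).map g.unop)).symm) }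
      left_triangle := by
        ext F
        refine (congrArg (_ ≫ ·) (Category.id_comp _)).trans ?_
        exact congrArg Quiver.Hom.op ((whaToWba V).map_injective (toTan_tanMap_toRep F.obj))
      right_triangle := by
        refine NatTrans.ext (funext fun H => ?_)
        refine (congrArg (_ ≫ ·) (Category.id_comp _)).trans ?_
        exact ObjectProperty.hom_ext _ (toRep_restr_toTan H.unop.toWBA) }

variable (V) in
/-- The Tannaka adjunction for Hopf algebras. -/
def strStarTannakaAdjunction : strStarTannakaFunctor V ⊣ strStarRepFunctor V :=
  Adjunction.mkOfUnitCounit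
    { unit :=
        { app := fun F => ⟨strHomMk (B := F.obj.tan) F.obj.toSFOver.toRep⟩
          naturality := fun _ _ f => ObjectProperty.hom_ext _
            (StrOver.Hom.ext (toRep_naturality f.hom.hom)) }
      counit :=
        { app := fun H => Quiver.Hom.op (X := H.unop) (Y := StrOverStar.tan H.unop.rep)
            ⟨baHomMk (B := H.unop.toBA) (C := H.unop.toBA.rep.tan) (toTan H.unop.toBA.toWBA)⟩
          naturality := fun _ _ g => congrArg Quiver.Hom.op ((haToBa V).map_injective
            (ba_hom_ext (toTan_naturality ((baToWba V).map ((haToBa V).map g.unop))).symm)) }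
      left_triangle := by
        ext F
        refine (congrArg (_ ≫ ·) (Category.id_comp _)).trans ?_
        exact congrArg Quiver.Hom.op ((haToBa V).map_injective
          (ba_hom_ext (toTan_tanMap_toRep F.obj.toSFOver)))
      right_triangle := by
        refine NatTrans.ext (funext fun H => ?_)
        refine (congrArg (_ ≫ ·) (Category.id_comp _)).trans ?_
        exact ObjectProperty.hom_ext _ (StrOver.Hom.ext (toRep_restr_toTan H.unop.toBA.toWBA)) }

lemma starTannakaAdjunction_restricts :
    AdjRestricts (starTannakaAdjunction V) (tannakaAdjunction V) (SFOver.domainHasDuals V).ι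
      (whaToWba V).op where
  left := rfl
  right := rfl
  unit _ := (Category.comp_id _).symm

lemma strTannakaAdjunction_restricts :
    AdjRestricts (strTannakaAdjunction V) (tannakaAdjunction V) (StrOver.incl V)
      (baToWba V).op where
  left := rfl
  right := rfl
  unit _ := (Category.comp_id _).symm

lemma strStarTannakaAdjunction_restricts :
    AdjRestricts (strStarTannakaAdjunction V) (strTannakaAdjunction V)
      (StrOver.domainHasDuals V).ι (haToBa V).op where
  left := rfl
  right := rfl
  unit _ := (Category.comp_id _).symm

lemma strStarTannakaAdjunction_restricts_star :
    AdjRestricts (strStarTannakaAdjunction V) (starTannakaAdjunction V)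
      (StrOverStar.incl V) (haToWha V).op where
  left := rfl
  right := rfl
  unit _ := (Category.comp_id _).symm

end Restrictions

end Tannaka

end

theorem proposition6 {V : Type u} [Category.{v} V] [MonoidalCategory V] [BraidedCategory V]
    [MonoidallyComplete V] [EssentiallySmall.{v} (dualizable V).FullSubcategory] :
    ∃ (T : TannakaFunctor V) (M : RepFunctor V) (adj : T.functor ⊣ M.functor)
      (tanStar : SFOverStar V ⥤ (WHA V)ᵒᵖ) (modStar : (WHA V)ᵒᵖ ⥤ SFOverStar V)
      (adjStar : tanStar ⊣ modStar)
      (tanStr : StrOver V ⥤ (BA V)ᵒᵖ) (modStr : (BA V)ᵒᵖ ⥤ StrOver V)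
      (adjStr : tanStr ⊣ modStr)
      (tanStrStar : StrOverStar V ⥤ (HA V)ᵒᵖ) (modStrStar : (HA V)ᵒᵖ ⥤ StrOverStar V)
      (adjStrStar : tanStrStar ⊣ modStrStar),
      IsTannakaAdjunction adj ∧
      AdjRestricts adjStar adj (SFOver.domainHasDuals V).ι (whaToWba V).op ∧
      AdjRestricts adjStr adj (StrOver.incl V) (baToWba V).op ∧
      AdjRestricts adjStrStar adjStr (StrOver.domainHasDuals V).ι (haToBa V).op ∧
      AdjRestricts adjStrStar adjStar (StrOverStar.incl V) (haToWha V).op ∧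
      StrOverStar.incl V ⋙ (SFOver.domainHasDuals V).ι =
        (StrOver.domainHasDuals V).ι ⋙ StrOver.incl V ∧
      haToWha V ⋙ whaToWba V = haToBa V ⋙ baToWba V := by
  exact ⟨tannakaFunctor V, repFunctor V, tannakaAdjunction V, starTannakaFunctor V,
    starRepFunctor V, starTannakaAdjunction V, strTannakaFunctor V, strRepFunctor V,
    strTannakaAdjunction V, strStarTannakaFunctor V, strStarRepFunctor V,
    strStarTannakaAdjunction V, isTannakaAdjunction, starTannakaAdjunction_restricts,
    strTannakaAdjunction_restricts, strStarTannakaAdjunction_restricts,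
    strStarTannakaAdjunction_restricts_star, rfl, rfl⟩
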